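/- **Model.** An MR$(m,M)$-algorithm works in rounds. In round $r$ it transforms a multiset $W_r$ of key-value pairs into a multiset $W_{r+1}$ of pairs and a multiset $O_r$ of output items, by applying a reducer $\rho_r$ separately, for each key $k$, to the multiset $W_{r,k}$ of the values with key $k$; it stops when $W_{r}$ is empty. If $m_{r,k}\ge |W_{r,k}|$ is the space (input and work space, but not output) in which $\rho_r(W_{r,k})$ is computed on a RAM with $O(\log n)$-bit words (a word may also hold one element of the semiring below), then it is required that $m_{r,k}=O(m)$ for all $r,k$, that $\sum_k m_{r,k}=O(M)$ for all $r$, that $\sum_r|O_r|=O(M)$, and that every reducer runs in time polynomial in $n$. **Problem.** Let $A,B$ be $\sqrt n\times\sqrt n$ matrices over a semiring, with at most $\tilde n\le n$ nonzero entries each, where $\tilde n$ is given; let $o$ be the number of nonzero entries of $C=AB$. Assume $2\le m<2\tilde n$, $\tilde n\le M$ and $o\le M$, and assume that $c_{x,y}\ne 0$ whenever $a_{x,z}\neq 0\neq b_{z,y}$ for some $z$. The input consists of the nonzero entries of $A$ and $B$, keyed by their index in a row-major scan of the matrix; the output has to consist of the nonzero entries of $C$. **Algorithm R1.** Divide the matrices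 into $g\times g$ submatrices $A_{i,h}$, $B_{h,j}$ of side $\lfloor\sqrt m\rfloor$, $g=\lceil \sqrt n/\lfloor\sqrt m\rfloor\rceil$, and let group $G_\ell$, $0\le\ell<g$, consist of the products $A_{i,h}B_{h,j}$ with $h=(i+j+\ell)\bmod g$. *(1) Estimating $o$.* A sketch of a set of numbers $z\in[n]$ consists, for each of $\Delta=\Theta(\log n)$ hash functions drawn independently from a pairwise independent family with range $\{1,\dots,N\}$, $N=\Theta(n^3)$, of the $t$ smallest hash values ($t$ a constant). In each of $\lceil g/K'\rceil$ phases, $K'=\min\{\lfloor M/\tilde n\rfloor,g\}$ consecutive groups are handled. For each pair of nonzero submatrices $A_{i,h},B_{h,j}$ in these groups, one reducer forms the sketch of the set of all $x\sqrt n+y$ such that $a_{x,z}\ne0\ne b_{z,y}$ for entries of the two submatrices, if these have more than $H=t\Delta$ nonzero entries; otherwise it leaves the positions of the entries as they are (a pseudosketch). All sketches and pseudosketches, with the sketches from the previous phase, are assigned independently and uniformly at random to $\lceil M/m\rceil$ reducers, each of which merges what it receives into one sketch. After the last phase the sketches are merged along a tree in which each node receives at most $\max\{2,\lfloor m/H\rfloor\}$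 of them. The estimate $\widehat o$ is the median over the $\Delta$ lists of $\lfloor tN/v\rfloor$, where $v$ is the $t$-th smallest value of the list (the length of the list, if it has fewer than $t$ values). *(2) Multiplication.* With $K=\max\{1,\min\{\lfloor M/(\tilde n+2\widehat o)\rfloor,g\}\}$, the products of $K$ consecutive groups are computed in each round, one reducer for each product, and are added to $K$ partial sums for each submatrix of $C$ (one for each group index modulo $K$). Finally the $K$ partial sums for each entry of $C$ are added up along a tree of degree $m$, and the result is output. (In all these formulas $M$ is replaced by $\min\{M,n^2\}$, so that the numbers fit into words.) **Theorem.** Suppose $m=\Omega(\log^2 n)$. Then, with probability at least $1-1/n$ over the random choices of R1 (the hash functions, which are known to all reducers, and the random assignments), algorithm R1 satisfies the constraints of MR$(m,M)$ and outputs exactly the nonzero entries of $AB$ within $$O\!\left(\frac{(\tilde n+o)\sqrt n}{M\sqrt m}+\log_m M\right)$$ rounds. That is, for every $c>0$ there is a constant, depending only on $c$, that bounds all implied constants (including the exponent of the polynomial time bound), for all $n,m,M,\tilde n$ as above with $m\ge c\log^2 n$, all semirings and all $A,B$. One fixed RAM program computes all the reducers. -/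

import Mathlib

/-! ## The random access machine that runs the reducers

A word holds a number of `O(log n)` bits or one element of the semiring `S`.  Programs are given in
structured form.  They do not mention `S`, so one program serves every semiring. -/

namespace Ram

/-- A memory word: a number, or an element of the semiring of the matrix entries. -/
inductive Word (S : Type*) where
  | num (k : ℕ)
  | elt (x : S)

/-- The word fits into the word length: a number has to be smaller than `L`. -/
def Word.Fits {S : Type*} (L : ℕ) : Word S → Prop
  | .num k => k < L
  | .elt _ => True

/-- Operations on numbers. -/
inductive Op where
  | add | sub | mul | div | mod | lt | eq

def Op.eval : Op → ℕ → ℕ → ℕ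
  | .add, a, b => a + b
  | .sub, a, b => a - b
  | .mul, a, b => a * b
  | .div, a, b => a / b
  | .mod, a, b => a % b
  | .lt, a, b => if a < b then 1 else 0
  | .eq, a, b => if a = b then 1 else 0

/-- Programs.  The arguments `d`, `a`, `b` are names of registers. -/
inductive Cmd where
  | skip
  /-- `d := v`. -/
  | const (d v : ℕ)
  /-- `d := a`. -/
  | move (d a : ℕ)
  /-- `d := a o b`, on numbers. -/
  | op (o : Op) (d a b : ℕ)
  /-- `d := 0`, the zero of the semiring. -/
  | eltZero (d : ℕ)
  /-- `d := a + b` in the semiring. -/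
  | eltAdd (d a b : ℕ)
  /-- `d := a * b` in the semiring. -/
  | eltMul (d a b : ℕ)
  /-- `d := memory[a]`. -/
  | load (d a : ℕ)
  /-- `memory[a] := b`. -/
  | store (a b : ℕ)
  /-- `d := rom[a]`, where `rom` is the read-only list of parameters of the reducer. -/
  | param (d a : ℕ)
  /-- Emit the record made of the contents of the listed registers; the flag tells whether it is
  part of the final output or a key-value pair for the next round. -/
  | emit (final : Bool) (args : List ℕ)
  | seq (p₁ p₂ : Cmd)
  | ite (a : ℕ) (p₁ p₂ : Cmd)
  | loop (a : ℕ) (p : Cmd)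

/-- The number of registers of a program (one more than the largest register that it names). -/
def Cmd.width : Cmd → ℕ
  | .skip => 0
  | .const d _ => d + 1
  | .move d a => max d a + 1
  | .op _ d a b => max d (max a b) + 1
  | .eltZero d => d + 1
  | .eltAdd d a b => max d (max a b) + 1
  | .eltMul d a b => max d (max a b) + 1
  | .load d a => max d a + 1
  | .store a b => max a b + 1
  | .param d a => max d a + 1
  | .emit _ args => args.foldr (fun a s => max (a + 1) s) 0
  | .seq p₁ p₂ => max p₁.width p₂.width
  | .ite a p₁ p₂ => max (a + 1) (max p₁.width p₂.width)
  | .loop a p => max (a + 1) p.width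

/-- A configuration: registers, random access memory and the records emitted so far. -/
structure State (S : Type*) where
  reg : ℕ → Word S
  mem : ℕ → Word S
  out : List (Bool × List (Word S))

def State.set {S : Type*} (σ : State S) (d : ℕ) (w : Word S) : State S :=
  { σ with reg := Function.update σ.reg d w }

/-- `Exec L s rom p σ k σ'`: started in `σ`, the program `p` stops in `σ'` after `k` steps, all
numbers that it produces are smaller than `L` and all addresses that it uses are smaller than `s`.
A program that would leave these limits, or that applies an operation to words of the wrong kind,
has no execution. -/
inductive Exec {S : Type*} [NonUnitalSemiring S] (L s : ℕ) (rom : ℕ → ℕ) :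
    Cmd → State S → ℕ → State S → Prop
  | skip (σ : State S) : Exec L s rom .skip σ 1 σ
  | const (σ : State S) (d v : ℕ) (h : v < L) :
      Exec L s rom (.const d v) σ 1 (σ.set d (.num v))
  | move (σ : State S) (d a : ℕ) : Exec L s rom (.move d a) σ 1 (σ.set d (σ.reg a))
  | op (σ : State S) (o : Op) (d a b x y : ℕ) (ha : σ.reg a = .num x) (hb : σ.reg b = .num y)
      (h : o.eval x y < L) :
      Exec L s rom (.op o d a b) σ 1 (σ.set d (.num (o.eval x y)))
  | eltZero (σ : State S) (d : ℕ) : Exec L s rom (.eltZero d) σ 1 (σ.set d (.elt 0))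
  | eltAdd (σ : State S) (d a b : ℕ) (x y : S) (ha : σ.reg a = .elt x) (hb : σ.reg b = .elt y) :
      Exec L s rom (.eltAdd d a b) σ 1 (σ.set d (.elt (x + y)))
  | eltMul (σ : State S) (d a b : ℕ) (x y : S) (ha : σ.reg a = .elt x) (hb : σ.reg b = .elt y) :
      Exec L s rom (.eltMul d a b) σ 1 (σ.set d (.elt (x * y)))
  | load (σ : State S) (d a i : ℕ) (ha : σ.reg a = .num i) (h : i < s) :
      Exec L s rom (.load d a) σ 1 (σ.set d (σ.mem i))
  | store (σ : State S) (a b i : ℕ) (ha : σ.reg a = .num i) (h : i < s) :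
      Exec L s rom (.store a b) σ 1 { σ with mem := Function.update σ.mem i (σ.reg b) }
  | param (σ : State S) (d a i : ℕ) (ha : σ.reg a = .num i) (h : rom i < L) :
      Exec L s rom (.param d a) σ 1 (σ.set d (.num (rom i)))
  | emit (σ : State S) (final : Bool) (args : List ℕ) :
      Exec L s rom (.emit final args) σ 1 { σ with out := (final, args.map σ.reg) :: σ.out }
  | seq (σ₁ σ₂ σ₃ : State S) (p₁ p₂ : Cmd) (k₁ k₂ : ℕ)
      (h₁ : Exec L s rom p₁ σ₁ k₁ σ₂) (h₂ : Exec L s rom p₂ σ₂ k₂ σ₃) :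
      Exec L s rom (.seq p₁ p₂) σ₁ (k₁ + k₂ + 1) σ₃
  | iteTrue (σ σ' : State S) (a x : ℕ) (p₁ p₂ : Cmd) (k : ℕ) (ha : σ.reg a = .num x) (hx : x ≠ 0)
      (h : Exec L s rom p₁ σ k σ') : Exec L s rom (.ite a p₁ p₂) σ (k + 1) σ'
  | iteFalse (σ σ' : State S) (a : ℕ) (p₁ p₂ : Cmd) (k : ℕ) (ha : σ.reg a = .num 0)
      (h : Exec L s rom p₂ σ k σ') : Exec L s rom (.ite a p₁ p₂) σ (k + 1) σ'
  | loopStop (σ : State S) (a : ℕ) (p : Cmd) (ha : σ.reg a = .num 0) :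
      Exec L s rom (.loop a p) σ 1 σ
  | loopStep (σ₁ σ₂ σ₃ : State S) (a x : ℕ) (p : Cmd) (k₁ k₂ : ℕ) (ha : σ₁.reg a = .num x)
      (hx : x ≠ 0) (h₁ : Exec L s rom p σ₁ k₁ σ₂) (h₂ : Exec L s rom (.loop a p) σ₂ k₂ σ₃) :
      Exec L s rom (.loop a p) σ₁ (k₁ + k₂ + 1) σ₃

/-- All registers hold the number `0`, and the memory holds the input, followed by zeros. -/
def State.init {S : Type*} (input : List (Word S)) : State S where
  reg := fun _ => .num 0
  mem := fun i => input.getD i (.num 0)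
  out := []

/-- On the given input, the program `p` emits the given records, in some order, in at most `time`
steps and with at most `space` words, which include the input and the registers (but not the
emitted records); numbers are smaller than `L` throughout. -/
def Computes {S : Type*} [NonUnitalSemiring S] (p : Cmd) (L space time : ℕ) (rom : ℕ → ℕ)
    (input : List (Word S)) (records : Multiset (Bool × List (Word S))) : Prop :=
  ∃ s k : ℕ, ∃ σ : State S,
    s + p.width ≤ space ∧ k ≤ time ∧ input.length ≤ s ∧ (∀ w ∈ input, w.Fits L) ∧
    Exec L s rom p (State.init input) k σ ∧ (σ.out : Multiset (Bool × List (Word S))) = records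

end Ram

/-! ## The model `MR(m, M)` -/

namespace MapReduce

/-- A MapReduce algorithm with keys in `κ`, values in `ν` and output items in `ο`: in round `r` the
reducer for the key `k` turns the multiset of all values with key `k` into pairs for the next round
and into items of the final output. -/
structure Algorithm (κ ν ο : Type*) where
  reduce : ℕ → κ → Multiset ν → Multiset (κ × ν) × Multiset ο

/-- How keys, values and output items are written as words, and the read-only parameters of the
reducer for a key in a round. -/
structure Encoding (κ ν ο S : Type*) where
  key : κ → List (Ram.Word S)
  val : ν → List (Ram.Word S)
  out : ο → List (Ram.Word S)
  rom : ℕ → κ → Multiset ν → ℕ → ℕ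

variable {κ ν ο S : Type*} [DecidableEq κ]

/-- The keys that occur. -/
def keys (W : Multiset (κ × ν)) : Finset κ := (W.map Prod.fst).toFinset

/-- The values with key `k`. -/
def values (W : Multiset (κ × ν)) (k : κ) : Multiset ν :=
  (W.filter fun x => x.1 = k).map Prod.snd

/-- The multiset of pairs at the beginning of round `r`, where rounds are numbered from `0`. -/
def Algorithm.state (alg : Algorithm κ ν ο) (W₀ : Multiset (κ × ν)) : ℕ → Multiset (κ × ν)
  | 0 => W₀
  | r + 1 => (keys (alg.state W₀ r)).val.bind fun k =>
      (alg.reduce r k (values (alg.state W₀ r) k)).1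

/-- The final output produced in round `r`. -/
def Algorithm.roundOutput (alg : Algorithm κ ν ο) (W₀ : Multiset (κ × ν)) (r : ℕ) : Multiset ο :=
  (keys (alg.state W₀ r)).val.bind fun k => (alg.reduce r k (values (alg.state W₀ r) k)).2

/-- The output of the first `T` rounds. -/
def Algorithm.output (alg : Algorithm κ ν ο) (W₀ : Multiset (κ × ν)) (T : ℕ) : Multiset ο :=
  (Multiset.range T).bind fun r => alg.roundOutput W₀ r

/-- The records that the reducer for the key `k` has to emit in round `r` on the values `V`. -/
def Algorithm.records (alg : Algorithm κ ν ο) (enc : Encoding κ ν ο S) (r : ℕ) (k : κ)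
    (V : Multiset ν) : Multiset (Bool × List (Ram.Word S)) :=
  ((alg.reduce r k V).1.map fun x => (false, enc.key x.1 ++ enc.val x.2)) +
    (alg.reduce r k V).2.map fun y => (true, enc.out y)

/-- The first `T` rounds respect the constraints of `MR(m, M)`: the program `p` computes every
reducer, on its values in whatever order, in at most `time` steps on a random access machine with
numbers smaller than `L`, in a space of at most `m` words for each key, of at most `M` words for all
keys of a round together, and the final output takes at most `M` words. -/
def Algorithm.Respects [NonUnitalSemiring S] (alg : Algorithm κ ν ο) (enc : Encoding κ ν ο S)
    (p : Ram.Cmd) (W₀ : Multiset (κ × ν)) (T L time m M : ℕ) : Prop :=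
  (∃ space : ℕ → κ → ℕ, ∀ r < T,
    (∀ k ∈ keys (alg.state W₀ r),
      (∀ l : List ν, (l : Multiset ν) = values (alg.state W₀ r) k →
        Ram.Computes p L (space r k) time (enc.rom r k (values (alg.state W₀ r) k))
          (l.flatMap enc.val) (alg.records enc r k (values (alg.state W₀ r) k))) ∧
      space r k ≤ m) ∧
    ∑ k ∈ keys (alg.state W₀ r), space r k ≤ M) ∧
  ((alg.output W₀ T).map fun y => (enc.out y).length).sum ≤ M

end MapReduce

/-! ## Algorithm R1 -/

namespace R1

/-- Matrices of size `q × q`, local memory `m`, aggregate memory `M`, and the given bound `nt` on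
the number of nonzero entries of each input matrix. -/
structure Params where
  q : ℕ
  m : ℕ
  M : ℕ
  nt : ℕ

namespace Params

/-- The input size `n = q²`. -/
def n (p : Params) : ℕ := p.q ^ 2

/-- The aggregate memory that the algorithm tries to use.  More than `n²` words are of no use, and
a number above `n²` need not fit into a word. -/
def mem (p : Params) : ℕ := min p.M (p.n ^ 2)

/-- The side `⌊√m⌋` of the submatrices. -/
def b (p : Params) : ℕ := Nat.sqrt p.m

/-- The number `⌈q / b⌉` of submatrices in a row, which is also the number of groups. -/
def g (p : Params) : ℕ := (p.q + p.b - 1) / p.b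

/-- The number of values kept in each list of a sketch, `96 / ε²` for `ε = 1/2`. -/
def t (_p : Params) : ℕ := 384

/-- The number of lists of a sketch, `Θ(log (1/δ))` for `δ = 1 / (2n)`; it is odd. -/
def Δ (p : Params) : ℕ := 12 * Nat.clog 2 (2 * p.n) + 1

/-- The size of a sketch. -/
def H (p : Params) : ℕ := p.t * p.Δ

/-- The smallest prime number that is at least `n³`: the size of the range of the hash functions. -/
def prime (p : Params) : ℕ := Nat.find (Nat.exists_infinite_primes (p.n ^ 3))

/-- The number `⌈M / m⌉` of reducers to which the sketches are assigned at random. -/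
def bins (p : Params) : ℕ := (p.mem + p.m - 1) / p.m

/-- The number of sketches that are merged by one reducer at the end of the estimation. -/
def fan (p : Params) : ℕ := max 2 (p.m / p.H)

/-- The number of groups in a phase of the estimation, `min (M / nt) g`. -/
def estGroups (p : Params) : ℕ := max 1 (min (p.mem / p.nt) p.g)

/-- The number of phases of the estimation. -/
def phases (p : Params) : ℕ := (p.g + p.estGroups - 1) / p.estGroups

/-- The round in which the estimate is computed. -/
def estRound (p : Params) : ℕ := p.phases + Nat.clog p.fan p.bins + 2

/-- The number of groups multiplied in a round, given the estimate `e` of the number of nonzero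
entries of the product: `M / (nt + 2 e)`. -/
def mulGroups (p : Params) (e : ℕ) : ℕ := max 1 (min (p.mem / (p.nt + 2 * e)) p.g)

/-- The number of rounds in which products are computed, with `K` groups in each of them. -/
def mulPhases (p : Params) (K : ℕ) : ℕ := (p.g + K - 1) / K

end Params

/-- The random choices: the coefficients of the hash functions, the reducer to which the
(pseudo)sketch of the submatrices `A_{i,h}`, `B_{h,j}` in group `ℓ` is assigned, for each `i, j, ℓ`,
and the reducer to which the merged sketch of reducer `β` in round `r` is assigned, for each `r, β`.
-/
abbrev Choices (p : Params) : Type :=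
  (Fin p.Δ → Fin p.prime × Fin p.prime) × (Fin p.g × Fin p.g × Fin p.g → Fin p.bins) ×
    (Fin (p.phases + 1) × Fin p.bins → Fin p.bins)

/-- The two coefficients of the hash function with index `w`. -/
def seed {p : Params} (ω : Choices p) (w : ℕ) : ℕ × ℕ :=
  if h : w < p.Δ then ((ω.1 ⟨w, h⟩).1, (ω.1 ⟨w, h⟩).2) else (0, 0)

/-- The hash function with index `w`, from the pairwise independent family of all maps
`x ↦ (c x + d mod prime) + 1`. -/
def hash {p : Params} (ω : Choices p) (w x : ℕ) : ℕ :=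
  ((seed ω w).1 * x + (seed ω w).2) % p.prime + 1

/-- Keys.  The flag is `true` for the matrix `A` and `false` for `B`. -/
inductive Key where
  /-- The place where the `k`-th nonzero entry of a matrix is stored. -/
  | home (isA : Bool) (k : ℕ)
  /-- Estimation: the submatrices `A_{i,h}` and `B_{h,j}` of group `ℓ`. -/
  | pair (i j ℓ : ℕ)
  /-- Estimation: one of the `M / m` reducers that collect sketches. -/
  | bin (β : ℕ)
  /-- Estimation: a node of the tree that combines the sketches. -/
  | node (β : ℕ)
  /-- Multiplication with `K` groups in a round: submatrix `(i, j)` of the partial sum number `s`. -/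
  | prod (K i j s : ℕ)
  /-- Final summation: a node of the tree that adds up the `K` partial sums for entry `(x, y)`. -/
  | cell (K x y s : ℕ)
  deriving DecidableEq

/-- Values. -/
inductive Msg (S : Type*) where
  /-- Entry `(x, y)` of a matrix. -/
  | entry (isA : Bool) (x y : ℕ) (a : S)
  /-- The position of a nonzero entry, as part of the pseudosketch of submatrices `(i, j, ℓ)`. -/
  | pseudo (i j ℓ : ℕ) (isA : Bool) (x y : ℕ)
  /-- The value `v` in list `w` of a sketch. -/
  | sketch (w v : ℕ)
  /-- The estimate of the number of nonzero entries of the product. -/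
  | est (e : ℕ)
  /-- A contribution to entry `(x, y)` of the product. -/
  | part (x y : ℕ) (a : S)

section Reducers

variable {S : Type*}

/-- The entries of one of the matrices among the values. -/
def entries (isA : Bool) (V : Multiset (Msg S)) : Multiset (ℕ × ℕ × S) :=
  V.filterMap fun
    | .entry c x y a => if c = isA then some (x, y, a) else none
    | _ => none

def pseudos (isA : Bool) (V : Multiset (Msg S)) : Multiset ((ℕ × ℕ × ℕ) × ℕ × ℕ) :=
  V.filterMap fun
    | .pseudo i j l c x y => if c = isA then some ((i, j, l), x, y) else none
    | _ => none

def sketchValues (V : Multiset (Msg S)) (w : ℕ) : Finset ℕ :=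
  (V.filterMap fun
    | .sketch w' v => if w' = w then some v else none
    | _ => none).toFinset

def ests (V : Multiset (Msg S)) : Multiset ℕ :=
  V.filterMap fun
    | .est e => some e
    | _ => none

def parts (V : Multiset (Msg S)) (x y : ℕ) : Multiset S :=
  V.filterMap fun
    | .part x' y' a => if x' = x ∧ y' = y then some a else none
    | _ => none

/-- The `t` smallest elements. -/
def smallest (t : ℕ) (X : Finset ℕ) : Finset ℕ := X.filter fun v => (X.filter (· < v)).card < t

/-- The sketch that has the `t` smallest elements of `X w` in list `w`. -/
def sketchOf (p : Params) (X : ℕ → Finset ℕ) : Multiset (Msg S) :=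
  (Multiset.range p.Δ).bind fun w => (smallest p.t (X w)).val.map fun v => Msg.sketch w v

/-- The elements `x q + y` of the stream contributed by the entries `(x, z)` of `A` and `(z, y)` of
`B` that occur in the values. -/
def pairStream (p : Params) (V : Multiset (Msg S)) : Finset ℕ :=
  (((entries true V ×ˢ entries false V).filter fun u => u.1.2.1 = u.2.1).map fun u =>
    u.1.1 * p.q + u.2.2.1).toFinset

/-- The elements of the stream contributed by the pseudosketches among the values. -/
def pseudoStream (p : Params) (V : Multiset (Msg S)) : Finset ℕ :=
  (((pseudos true V ×ˢ pseudos false V).filter fun u =>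
    u.1.1 = u.2.1 ∧ u.1.2.2 = u.2.2.1).map fun u => u.1.2.1 * p.q + u.2.2.2).toFinset

/-- The single sketch made of all sketches and pseudosketches among the values. -/
def merge {p : Params} (ω : Choices p) (V : Multiset (Msg S)) : Multiset (Msg S) :=
  sketchOf p fun w => sketchValues V w ∪ (pseudoStream p V).image (hash ω w)

/-- The number of distinct elements as estimated from a list of a sketch: `t N / v` for the `t`-th
smallest value `v` and the range `{1, …, N}`, or the length of the list if it is not full. -/
def listEstimate (p : Params) (X : Finset ℕ) : ℕ :=
  if X.card < p.t then X.card else p.t * p.prime / X.sup id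

/-- The median of the estimates from all lists. -/
def estimate (p : Params) (V : Multiset (Msg S)) : ℕ :=
  (((Multiset.range p.Δ).map fun w =>
    listEstimate p (smallest p.t (sketchValues V w))).sort (· ≤ ·)).getD (p.Δ / 2) 0

/-- The reducer to which a (pseudo)sketch is assigned at random. -/
def coin {p : Params} (ω : Choices p) (r : ℕ) : Key → ℕ
  | .pair i j l =>
      if h : i < p.g ∧ j < p.g ∧ l < p.g then ω.2.1 (⟨i, h.1⟩, ⟨j, h.2.1⟩, ⟨l, h.2.2⟩) else 0
  | .bin β => if h : r < p.phases + 1 ∧ β < p.bins then ω.2.2 (⟨r, h.1⟩, ⟨β, h.2⟩) else 0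
  | _ => 0

/-- The pairs `(i, j)` such that the product `A_{i,h} B_{h,j}` of group `ℓ`, for which
`h = (i + j + ℓ) mod g`, involves the submatrix of the entry `(x, y)` of the given matrix. -/
def places (p : Params) (isA : Bool) (x y l : ℕ) : Multiset (ℕ × ℕ) :=
  (Multiset.range p.g ×ˢ Multiset.range p.g).filter fun u =>
    if isA then u.1 = x / p.b ∧ (u.1 + u.2 + l) % p.g = y / p.b
    else u.2 = y / p.b ∧ (u.1 + u.2 + l) % p.g = x / p.b

/-- Copies of all entries among the values for the groups `c K + s`, where `s < K`, each sent to
its `places`. -/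
def copies (p : Params) (K c : ℕ) (key : ℕ → ℕ → ℕ → Key) (V : Multiset (Msg S)) :
    Multiset (Key × Msg S) :=
  ((Multiset.range K).filter fun s => c * K + s < p.g).bind fun s =>
    ({true, false} : Multiset Bool).bind fun isA =>
      (entries isA V).bind fun u =>
        (places p isA u.1 u.2.1 (c * K + s)).map fun ij =>
          (key ij.1 ij.2 s, Msg.entry isA u.1 u.2.1 u.2.2)

/-- Storage of an entry.  Up to `estRound` the entry is kept and, in round `r < phases`, copied to
the submatrix pairs of phase `r` of the estimation.  Afterwards, once the estimate has arrived, one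
phase of the multiplication is started in each round. -/
def homeStep (p : Params) (r : ℕ) (k : Key) (V : Multiset (Msg S)) : Multiset (Key × Msg S) :=
  if r ≤ p.estRound then
    V.map (fun v => (k, v)) +
      if r < p.phases then
        copies p p.estGroups r (fun i j s => .pair i j (r * p.estGroups + s)) V
      else 0
  else
    (ests V).bind fun e =>
      if r - (p.estRound + 1) < p.mulPhases (p.mulGroups e) then
        V.map (fun v => (k, v)) +
          copies p (p.mulGroups e) (r - (p.estRound + 1)) (fun i j s => .prod (p.mulGroups e) i j s) V
      else 0

/-- A pair of nonzero submatrices is replaced by its sketch if it has more than `H` nonzero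
entries, and is left untouched, as a pseudosketch, otherwise. -/
def pairStep {p : Params} (ω : Choices p) (r i j l : ℕ) (V : Multiset (Msg S)) :
    Multiset (Key × Msg S) :=
  (if (entries true V).card = 0 ∨ (entries false V).card = 0 then 0
    else if p.H < (entries true V).card + (entries false V).card then
      sketchOf p fun w => (pairStream p V).image (hash ω w)
    else
      (entries true V).map (fun u => Msg.pseudo i j l true u.1 u.2.1) +
        (entries false V).map (fun u => Msg.pseudo i j l false u.1 u.2.1)).map
    fun v => (Key.bin (coin ω r (.pair i j l)), v)

/-- The sketches are merged, and assigned at random to the reducers of the next phase or, after the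
last phase, to the nodes of a tree. -/
def binStep {p : Params} (ω : Choices p) (r β : ℕ) (V : Multiset (Msg S)) :
    Multiset (Key × Msg S) :=
  (merge ω V).map fun v =>
    (if r ≤ p.phases then Key.bin (coin ω r (.bin β)) else Key.node (β / p.fan), v)

/-- The sketches are merged along a tree; the root sends the estimate to all entries. -/
def nodeStep {p : Params} (ω : Choices p) (r β : ℕ) (V : Multiset (Msg S)) :
    Multiset (Key × Msg S) :=
  if r < p.estRound then (merge ω V).map fun v => (Key.node (β / p.fan), v)
  else
    (Multiset.range p.nt).bind fun k =>
      {(Key.home true k, Msg.est (estimate p V)), (Key.home false k, Msg.est (estimate p V))}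

/-- The contributions to entry `(x, y)` among the values: partial sums and products `a b` for
entries `a = (x, z)` of `A` and `b = (z, y)` of `B`. -/
def contributions [NonUnitalSemiring S] (V : Multiset (Msg S)) (x y : ℕ) : Multiset S :=
  parts V x y +
    ((entries true V ×ˢ entries false V).filter fun u =>
      u.1.1 = x ∧ u.2.2.1 = y ∧ u.1.2.1 = u.2.1).map fun u => u.1.2.2 * u.2.2.2

/-- The product of two submatrices is added to the partial sum with the same `(i, j, s)`.  After the
last group, the partial sums go to the trees that add them up. -/
def prodStep [NonUnitalSemiring S] (p : Params) (r K i j s : ℕ) (V : Multiset (Msg S)) :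
    Multiset (Key × Msg S) :=
  ((Multiset.range p.b ×ˢ Multiset.range p.b).map fun u =>
      (i * p.b + u.1, j * p.b + u.2)).bind fun xy =>
    if (contributions V xy.1 xy.2).card = 0 then 0
    else
      {(if r - (p.estRound + 2) + 1 < p.mulPhases K then Key.prod K i j s
          else Key.cell K xy.1 xy.2 (s / p.m),
        Msg.part xy.1 xy.2 (contributions V xy.1 xy.2).sum)}

/-- The partial sums for entry `(x, y)` are added up along a tree with at most `m` children for each
node; the root outputs the entry. -/
def cellStep [NonUnitalSemiring S] (p : Params) (r K x y s : ℕ) (V : Multiset (Msg S)) :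
    Multiset (Key × Msg S) × Multiset (ℕ × ℕ × S) :=
  if r - (p.estRound + p.mulPhases K + 2) + 1 < Nat.clog p.m K then
    ({(Key.cell K x y (s / p.m), Msg.part x y (parts V x y).sum)}, 0)
  else (0, {(x, y, (parts V x y).sum)})

end Reducers

/-- Algorithm R1 with random choices `ω`. -/
def algorithm {p : Params} (S : Type*) [NonUnitalSemiring S] (ω : Choices p) :
    MapReduce.Algorithm Key (Msg S) (ℕ × ℕ × S) where
  reduce := fun r k V =>
    match k with
    | .home isA k => (homeStep p r (.home isA k) V, 0)
    | .pair i j l => (pairStep ω r i j l V, 0)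
    | .bin β => (binStep ω r β V, 0)
    | .node β => (nodeStep ω r β V, 0)
    | .prod K i j s => (prodStep p r K i j s V, 0)
    | .cell K x y s => cellStep p r K x y s V

def flag (isA : Bool) : ℕ := if isA then 1 else 0

/-- The numbers that make up a key. -/
def Key.code : Key → List ℕ
  | .home isA k => [0, flag isA, k, 0, 0]
  | .pair i j l => [1, i, j, l, 0]
  | .bin β => [2, β, 0, 0, 0]
  | .node β => [3, β, 0, 0, 0]
  | .prod K i j s => [4, K, i, j, s]
  | .cell K x y s => [5, K, x, y, s]

/-- The words that make up a value. -/
def Msg.code {S : Type*} : Msg S → List (Ram.Word S)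
  | .entry isA x y a =>
      [.num 0, .num (flag isA), .num x, .num y, .num 0, .num 0, .num 0, .elt a]
  | .pseudo i j l isA x y =>
      [.num 1, .num (flag isA), .num x, .num y, .num i, .num j, .num l, .num 0]
  | .sketch w v => [.num 2, .num w, .num v, .num 0, .num 0, .num 0, .num 0, .num 0]
  | .est e => [.num 3, .num e, .num 0, .num 0, .num 0, .num 0, .num 0, .num 0]
  | .part x y a => [.num 4, .num x, .num y, .num 0, .num 0, .num 0, .num 0, .elt a]

/-- The read-only parameters of a reducer are `q`, `m`, `M`, `nt`, the round, the random assignment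
of its own (pseudo)sketch, the number of its values, its key, and the shared hash functions. -/
def encoding {p : Params} (S : Type*) (ω : Choices p) :
    MapReduce.Encoding Key (Msg S) (ℕ × ℕ × S) S where
  key := fun k => k.code.map Ram.Word.num
  val := Msg.code
  out := fun y => [.num y.1, .num y.2.1, .elt y.2.2]
  rom := fun r k V i =>
    ([p.q, p.m, p.mem, p.nt, r, coin ω r k, V.card] ++ k.code ++
      (List.range p.Δ).flatMap fun w => [(seed ω w).1, (seed ω w).2]).getD i 0

section Matrices

variable {S : Type*} [NonUnitalSemiring S] {q : ℕ}

open Classical in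
/-- The positions of the nonzero entries. -/
noncomputable def support (X : Matrix (Fin q) (Fin q) S) : Finset (Fin q × Fin q) :=
  Finset.univ.filter fun u => X u.1 u.2 ≠ 0

/-- The number of nonzero entries. -/
noncomputable def nnz (X : Matrix (Fin q) (Fin q) S) : ℕ := (support X).card

/-- The number of nonzero entries that precede `(i, j)` in the row-major scan of the matrix. -/
noncomputable def progressiveIndex (X : Matrix (Fin q) (Fin q) S) (i j : Fin q) : ℕ :=
  ((support X).filter fun u => u.1 < i ∨ u.1 = i ∧ u.2 < j).card

/-- The key-value pairs for one input matrix. -/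
noncomputable def inputPairs (isA : Bool) (X : Matrix (Fin q) (Fin q) S) :
    Multiset (Key × Msg S) :=
  (support X).val.map fun u =>
    (Key.home isA (progressiveIndex X u.1 u.2), Msg.entry isA u.1 u.2 (X u.1 u.2))

/-- The nonzero entries of a matrix, as output items. -/
noncomputable def outputItems (X : Matrix (Fin q) (Fin q) S) : Multiset (ℕ × ℕ × S) :=
  (support X).val.map fun u => ((u.1 : ℕ), (u.2 : ℕ), X u.1 u.2)

/-- Inner products of rows of `A` and columns of `B` with overlapping nonzero entries never cancel
to zero. -/
def NoCancellation (A B : Matrix (Fin q) (Fin q) S) : Prop :=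
  ∀ i j, (∃ h, A i h ≠ 0 ∧ B h j ≠ 0) → (A * B) i j ≠ 0

/-- With the random choices `ω`, algorithm R1 stops after at most `bound` rounds with the nonzero
entries of `A B` as its output, and satisfies the constraints of the model, where each `O(·)` has
the constant `C`: reducers, computed by the program `prog`, take time at most `n ^ C` on a machine
whose numbers are smaller than `n ^ C`, and the memory is at most `C m` for each reducer and at most
`C M` in total. -/
def Multiplies (prog : Ram.Cmd) (C : ℕ) (bound : ℝ) {p : Params} (A B : Matrix (Fin q) (Fin q) S)
    (ω : Choices p) : Prop :=
  ∃ T : ℕ, (T : ℝ) ≤ bound ∧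
    (algorithm S ω).state (inputPairs true A + inputPairs false B) T = 0 ∧
    (algorithm S ω).output (inputPairs true A + inputPairs false B) T = outputItems (A * B) ∧
    (algorithm S ω).Respects (encoding S ω) prog (inputPairs true A + inputPairs false B) T
      (p.n ^ C) (p.n ^ C) (C * p.m) (C * p.M)

end Matrices

end R1

/-!
The proof has a deterministic part and a probabilistic one, which meet in the notion of favourable
random choices (`Favourable`): the estimate of the number `o` of nonzero entries of the product is
right up to a constant factor, and no reducer that collects sketches receives more than `O(m)`
words. For favourable choices everything that is claimed of the algorithm is deterministic
(`multiplies`), and choices are favourable with probability at least `1 - 1 / n`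
(`le_pr_favourable`).

*One program.* Every reducer can be written with bounded sums, case distinctions and arithmetic on
the numbers of its input. Functions of this kind are computed by programs that never write to the
memory and that need polynomial time and polynomially large numbers (`Comp`, `EComp`, `OComp`). The
median, the smallest elements of a set, logarithms and the prime are obtained by counting. So one
program computes all reducers in a space proportional to their input (`exists_program`), and what
remains to be bounded are the numbers of values and the sizes of the numbers in them.

*The estimate does not depend on the assignments.* An element that is among the `t` smallest of a
set is among the `t` smallest of each subset that contains it. Hence the values of the sketch of the
set of all positions of the product survive every merging (`exists_bin_carries`, `mem_root`), and as
no other values ever arise (`sound`), the root of the tree computes the estimate of that sketch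
(`estimate_root`). The absence of cancellation makes the positions suggested by the entries those of
the nonzero entries of the product. For one list of the sketch, Markov's inequality, Chebyshev's
inequality for a pairwise independent family and the rarity of collisions show that the estimate is
wrong with probability at most `1 / 8` (`pr_badList_le`); the median over `Δ = Θ(log n)` independent
lists is wrong with probability at most `1 / (2 n)` (`pr_badLists_le`).

*The loads.* The words that a collecting reducer receives are a sum of independent contributions of
at most `H` words each, with a mean of `O(m)`. The exponential moment of the load (`pr_load_le`) and
`H log n = O(m)`, which is where `m = Ω(log² n)` enters (`Params.SmallSketches`), leave a failure
probability of `O(n⁻⁴)` for each of at most `n³` loads.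

*The multiplication.* Each pair of blocks with a common middle index occurs in exactly one group,
and each entry is used at most once in a group. The first fact says that the contents of the
reducers, which are determined exactly round by round (`vals_prod`, `vals_cell`), add up to the
product (`sum_groupProducts`, `sum_nodeSum`); this gives termination and output (`state_rounds`,
`output_rounds`). The second fact bounds the memory: a round takes `O(K ñ)` words for the blocks of
`K` groups, and `O(K o)` words for the partial sums, which is `O(M)` because the estimate is not too
small (`width_mul_card_le`).

*The number of rounds.* There are `g = O(√n / √m)` groups, and `K` is about `M / (ñ + 2 ê)`, where
the estimate `ê` is not too large; so there are `O(g (ñ + o) / M + 1)` rounds for each of the two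
stages. The tree of sketches has degree `m ^ Ω(1)`, since `H² = O(m)`, and the trees of partial sums
have degree `m`; their depth is `O(log_m M)` (`rounds_le`).
-/

set_option linter.unusedSectionVars false

/-! ### Polynomially bounded functions -/

namespace Ram

/-- A bound that is polynomial in `B ≥ 2`; constants are absorbed by the exponent. -/
def PolyB (β : ℕ → ℕ) : Prop := ∃ D : ℕ, ∀ B, 2 ≤ B → β B ≤ B ^ D

namespace PolyB

theorem const (k : ℕ) : PolyB fun _ => k :=
  ⟨k, fun _ hB => (Nat.lt_two_pow_self).le.trans (Nat.pow_le_pow_left hB k)⟩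

theorem id : PolyB fun B => B := ⟨1, fun B _ => by simp⟩

theorem mul {β γ : ℕ → ℕ} (hβ : PolyB β) (hγ : PolyB γ) : PolyB fun B => β B * γ B := by
  obtain ⟨D, h⟩ := hβ
  obtain ⟨D', h'⟩ := hγ
  exact ⟨D + D', fun B hB => by rw [pow_add]; exact Nat.mul_le_mul (h B hB) (h' B hB)⟩

theorem add {β γ : ℕ → ℕ} (hβ : PolyB β) (hγ : PolyB γ) : PolyB fun B => β B + γ B := by
  obtain ⟨D, h⟩ := hβ
  obtain ⟨D', h'⟩ := hγ
  refine ⟨D + D' + 1, fun B hB => ?_⟩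
  have h1 : B ^ D ≤ B ^ (D + D') := Nat.pow_le_pow_right (by omega) (by omega)
  have h2 : B ^ D' ≤ B ^ (D + D') := Nat.pow_le_pow_right (by omega) (by omega)
  calc β B + γ B ≤ B ^ (D + D') * 2 := by have := h B hB; have := h' B hB; omega
    _ ≤ B ^ (D + D' + 1) := by rw [pow_succ]; exact Nat.mul_le_mul_left _ hB

/-- Composition, where `B + γ B` in place of `γ B` keeps the argument at least `2`. -/
theorem comp {β γ : ℕ → ℕ} (hβ : PolyB β) (hγ : PolyB γ) : PolyB fun B => β (B + γ B) := by
  obtain ⟨D, h⟩ := hβ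
  obtain ⟨D', h'⟩ := id.add hγ
  refine ⟨D' * D, fun B hB => (h _ (by omega)).trans ?_⟩
  rw [pow_mul]
  exact Nat.pow_le_pow_left (h' B hB) D

end PolyB

/-! ### Functions computed by the random access machine -/

/-- The numbers that a program can read: the parameters `rom`, the number `len` of input records
and field `f` of the `i`-th record. -/
structure Inp where
  rom : ℕ → ℕ
  len : ℕ
  num : ℕ → ℕ → ℕ

/-- All readable numbers are at most `B`. -/
structure Inp.Bdd (I : Inp) (B : ℕ) : Prop where
  two : 2 ≤ B
  rom : ∀ i, I.rom i ≤ B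
  len : I.len ≤ B
  num : ∀ i f, I.num i f ≤ B

/-- The memory holds the records of `I`, eight words each.  The last word is the semiring element
`E i` if the tag of the record, its first word, is `0` or `4`.  Parameter `6` is the number of
records. -/
structure Inp.Stored {S : Type*} (I : Inp) (s : ℕ) (mem : ℕ → Word S) (E : ℕ → S) : Prop where
  rom : I.rom 6 = I.len
  size : 8 * I.len ≤ s
  num : ∀ i < I.len, ∀ f < 7, mem (8 * i + f) = .num (I.num i f)
  elt : ∀ i < I.len, I.num i 0 = 0 ∨ I.num i 0 = 4 → mem (8 * i + 7) = .elt (E i)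
  outside : ∀ i f, I.len ≤ i → I.num i f = 0

/-- Contexts: an input together with the values of some loop variables. -/
class Ctx (α : Type) where
  inp : α → Inp
  vars : α → List ℕ

instance : Ctx Inp := ⟨fun I => I, fun _ => []⟩
instance {α : Type} [Ctx α] : Ctx (α × ℕ) := ⟨fun p => Ctx.inp p.1, fun p => p.2 :: Ctx.vars p.1⟩

open Ctx

/-- All numbers in the context are at most `B`. -/
structure CBdd {α : Type} [Ctx α] (a : α) (B : ℕ) : Prop where
  inp : (inp a).Bdd B
  vars : ∀ x ∈ vars a, x ≤ B

/-- The registers below `d` and the memory are the same in both states. A piece of code that owns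
the registers from `d` on may change nothing else, apart from the output. -/
structure Frame {S : Type*} (d : ℕ) (σ σ' : State S) : Prop where
  reg : ∀ r < d, σ'.reg r = σ.reg r
  mem : σ'.mem = σ.mem

theorem Frame.refl {S : Type*} (d : ℕ) (σ : State S) : Frame d σ σ := ⟨fun _ _ => rfl, rfl⟩

theorem Frame.trans {S : Type*} {d d' : ℕ} {σ σ' σ'' : State S} (h : Frame d σ σ')
    (h' : Frame d' σ' σ'') (hd : d ≤ d') : Frame d σ σ'' :=
  ⟨fun r hr => (h'.reg r (by omega)).trans (h.reg r hr), h'.mem.trans h.mem⟩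

theorem Frame.set {S : Type*} {d r : ℕ} (σ : State S) (w : Word S) (h : d ≤ r) :
    Frame d σ (σ.set r w) :=
  ⟨fun r' hr' => by simp [State.set, Function.update, show r' ≠ r by omega], rfl⟩

@[simp] theorem State.set_reg_self {S : Type*} (σ : State S) (d : ℕ) (w : Word S) :
    (σ.set d w).reg d = w := by simp [State.set]

@[simp] theorem State.set_out {S : Type*} (σ : State S) (d : ℕ) (w : Word S) :
    (σ.set d w).out = σ.out := rfl

theorem State.set_reg_ne {S : Type*} (σ : State S) {d r : ℕ} (w : Word S) (h : r ≠ d) :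
    (σ.set d w).reg r = σ.reg r := by simp [State.set, Function.update, h]

/-- The input is in memory and the loop variables are in the registers `γ`, which are below `d`. -/
structure Ready {S : Type*} {α : Type} [Ctx α] (a : α) (s : ℕ) (E : ℕ → S) (γ : List ℕ) (d : ℕ)
    (σ : State S) : Prop where
  stored : (inp a).Stored s σ.mem E
  vars : List.Forall₂ (fun r x => r < d ∧ σ.reg r = .num x) γ (vars a)

section

variable {S : Type*} {α : Type} [Ctx α] {a : α} {s : ℕ} {E : ℕ → S} {γ : List ℕ} {d d' : ℕ}
  {σ σ' : State S}

theorem Ready.mono (h : Ready a s E γ d σ) (hf : Frame d σ σ') (hd : d ≤ d') :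
    Ready a s E γ d' σ' :=
  ⟨by rw [hf.mem]; exact h.stored,
    h.vars.imp fun r x hr => ⟨by omega, by rw [hf.reg r hr.1]; exact hr.2⟩⟩

theorem Ready.push (h : Ready a s E γ d σ) {r x : ℕ} (hr : r < d) (hx : σ.reg r = .num x) :
    Ready (a, x) s E (r :: γ) d σ :=
  ⟨h.stored, List.Forall₂.cons ⟨hr, hx⟩ h.vars⟩

end

section

variable {S : Type*} [NonUnitalSemiring S] {L s : ℕ} {rom : ℕ → ℕ}

/-- The body of a counting loop: register `d` counts down and register `d + 1` counts up. -/
def forBody (d : ℕ) (c : Cmd) : Cmd :=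
  .seq c (.seq (.const (d + 2) 1) (.seq (.op .add (d + 1) (d + 1) (d + 2)) (.op .sub d d (d + 2))))

/-- Counting loops, with an invariant that depends on nothing but memory, output and the registers
below `d`. -/
theorem exec_for {d τ k : ℕ} {c : Cmd} (Inv : ℕ → State S → Prop) (hL : k < L) (h1L : 1 < L)
    (hInv : ∀ i σ σ', Inv i σ → Frame d σ σ' → σ'.out = σ.out → Inv i σ')
    (hc : ∀ i < k, ∀ σ : State S, Inv i σ → σ.reg d = .num (k - i) → σ.reg (d + 1) = .num i →
      ∃ t σ', t ≤ τ ∧ Exec L s rom c σ t σ' ∧ Inv (i + 1) σ' ∧ σ'.reg d = .num (k - i) ∧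
        σ'.reg (d + 1) = .num i) (σ : State S) (h0 : Inv 0 σ) (hd : σ.reg d = .num k)
    (hd1 : σ.reg (d + 1) = .num 0) :
    ∃ t σ', t ≤ k * (τ + 10) + 1 ∧ Exec L s rom (.loop d (forBody d c)) σ t σ' ∧ Inv k σ' := by
  have key : ∀ j i, i + j = k → ∀ σ : State S, Inv i σ → σ.reg d = .num (k - i) →
      σ.reg (d + 1) = .num i → ∃ t σ', t ≤ j * (τ + 10) + 1 ∧
        Exec L s rom (.loop d (forBody d c)) σ t σ' ∧ Inv k σ' := by
    intro j
    induction j with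
    | zero =>
      intro i hi σ hσ hd _
      refine ⟨1, σ, by omega, .loopStop _ _ _ (by rw [hd]; congr; omega), ?_⟩
      rwa [← hi]
    | succ j ih =>
      intro i hi σ hσ hd hd1
      obtain ⟨t, σ₁, ht, hex, hI, hd', hd1'⟩ := hc i (by omega) σ hσ hd hd1
      have e1 := Exec.const (rom := rom) (s := s) σ₁ (d + 2) 1 h1L
      set σ₂ := σ₁.set (d + 2) (.num 1) with hσ₂
      have e2 := Exec.op (rom := rom) (s := s) (L := L) σ₂ .add (d + 1) (d + 1) (d + 2) i 1
        (by rw [hσ₂, State.set_reg_ne _ _ (by omega), hd1'])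
        (by simp [hσ₂]) (by simp only [Op.eval]; omega)
      set σ₃ := σ₂.set (d + 1) (.num (Op.add.eval i 1)) with hσ₃
      have e3 := Exec.op (rom := rom) (s := s) (L := L) σ₃ .sub d d (d + 2) (k - i) 1
        (by rw [hσ₃, State.set_reg_ne _ _ (by omega), hσ₂, State.set_reg_ne _ _ (by omega), hd'])
        (by rw [hσ₃, State.set_reg_ne _ _ (by omega)]; simp [hσ₂])
        (by simp only [Op.eval]; omega)
      set σ₄ := σ₃.set d (.num (Op.sub.eval (k - i) 1)) with hσ₄
      have hF : Frame d σ₁ σ₄ :=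
        ((Frame.set _ _ (by omega)).trans (Frame.set _ _ (by omega)) le_rfl).trans
          (Frame.set _ _ le_rfl) le_rfl
      obtain ⟨t', σ', ht', hex', hI'⟩ := ih (i + 1) (by omega) σ₄ (hInv _ _ _ hI hF rfl)
        (by simp only [hσ₄, State.set_reg_self, Op.eval]; congr 1)
        (by rw [hσ₄, State.set_reg_ne _ _ (by omega), hσ₃]; simp [Op.eval])
      refine ⟨_, σ', ?_, .loopStep _ _ _ _ (k - i) _ _ _ hd (by omega)
        (.seq _ _ _ _ _ _ _ hex (.seq _ _ _ _ _ _ _ e1 (.seq _ _ _ _ _ _ _ e2 e3))) hex', hI'⟩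
      rw [Nat.succ_mul]
      omega
  exact key k 0 (by omega) σ h0 (by simpa using hd) hd1

end

universe u

/-- `f` is computed, for every input and every choice of the loop variables, by code that uses the
registers from `d` on, leaves the result in register `d` and never writes to the memory. The
arguments of the code are the registers that hold the loop variables, and `d`. If all numbers in the
context are at most `B`, then the result, the number of steps and the word length that is needed are
bounded by `β B`, a polynomial in `B`. The code depends neither on the context nor on the semiring.
-/
def Comp {α : Type} [Ctx α] (f : α → ℕ) : Prop :=
  ∃ (code : List ℕ → ℕ → Cmd) (β : ℕ → ℕ), PolyB β ∧ ∀ a B, CBdd a B → f a ≤ β B ∧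
    ∀ (S : Type u) [NonUnitalSemiring S] (L s : ℕ) (γ : List ℕ) (d : ℕ) (σ : State S) (E : ℕ → S),
      β B < L → Ready a s E γ d σ → ∃ k σ', k ≤ β B ∧ Exec L s (inp a).rom (code γ d) σ k σ' ∧
        Frame d σ σ' ∧ σ'.out = σ.out ∧ σ'.reg d = .num (f a)

/-- The analogue of `Comp` for semiring elements. -/
def EComp {α : Type} [Ctx α] (f : ∀ (S : Type u) [NonUnitalSemiring S], (ℕ → S) → α → S) : Prop :=
  ∃ (code : List ℕ → ℕ → Cmd) (β : ℕ → ℕ), PolyB β ∧ ∀ a B, CBdd a B →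
    ∀ (S : Type u) [NonUnitalSemiring S] (L s : ℕ) (γ : List ℕ) (d : ℕ) (σ : State S) (E : ℕ → S),
      β B < L → Ready a s E γ d σ → ∃ k σ', k ≤ β B ∧ Exec L s (inp a).rom (code γ d) σ k σ' ∧
        Frame d σ σ' ∧ σ'.out = σ.out ∧ σ'.reg d = .elt (f S E a)

/-- The records emitted by a program. -/
abbrev Records (S : Type*) := Multiset (Bool × List (Word S))

/-- The analogue of `Comp` for the emission of a multiset of records. -/
def OComp {α : Type} [Ctx α]
    (f : ∀ (S : Type u) [NonUnitalSemiring S], (ℕ → S) → α → Records S) : Prop :=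
  ∃ (code : List ℕ → ℕ → Cmd) (β : ℕ → ℕ), PolyB β ∧ ∀ a B, CBdd a B →
    ∀ (S : Type u) [NonUnitalSemiring S] (L s : ℕ) (γ : List ℕ) (d : ℕ) (σ : State S) (E : ℕ → S),
      β B < L → Ready a s E γ d σ → ∃ k σ', k ≤ β B ∧ Exec L s (inp a).rom (code γ d) σ k σ' ∧
        Frame d σ σ' ∧ (σ'.out : Records S) = f S E a + (σ.out : Records S)

variable {α : Type} [Ctx α]

theorem CBdd.push {a : α} {B B' x : ℕ} (h : CBdd a B) (hB : B ≤ B') (hx : x ≤ B') :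
    CBdd (a, x) B' :=
  ⟨⟨h.inp.two.trans hB, fun i => (h.inp.rom i).trans hB, h.inp.len.trans hB,
    fun i f => (h.inp.num i f).trans hB⟩, fun y hy => by
      rcases List.mem_cons.1 hy with rfl | hy
      · exact hx
      · exact (h.vars y hy).trans hB⟩

namespace Comp

theorem const (v : ℕ) : Comp.{u} fun _ : α => v := by
  refine ⟨fun _ d => .const d v, fun _ => v + 1, .const _, fun a B _ => ?_⟩
  beta_reduce
  refine ⟨by omega, fun S _ L s γ d σ E hL _ => ?_⟩
  exact ⟨1, _, by omega, .const _ _ _ (by omega), .set _ _ le_rfl, rfl, by simp⟩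

theorem var : Comp.{u} fun p : α × ℕ => p.2 := by
  refine ⟨fun γ d => .move d (γ.headD 0), fun B => B + 1, PolyB.id.add (.const 1),
    fun a B h => ?_⟩
  beta_reduce
  refine ⟨(h.vars a.2 (by simp [vars])).trans (by omega), fun S _ L s γ d σ E hL hR => ?_⟩
  refine ⟨1, _, by omega, .move _ _ _, .set _ _ le_rfl, rfl, ?_⟩
  obtain ⟨_, hv⟩ := hR
  cases hv with
  | cons h _ => simpa using h.2

theorem weaken {f : α → ℕ} (h : Comp.{u} f) : Comp.{u} fun p : α × ℕ => f p.1 := by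
  obtain ⟨code, β, hβ, h⟩ := h
  refine ⟨fun γ d => code γ.tail d, β, hβ, fun a B hB => ?_⟩
  beta_reduce
  obtain ⟨h1, h2⟩ := h a.1 B ⟨hB.inp, fun x hx => hB.vars x (List.mem_cons_of_mem _ hx)⟩
  refine ⟨h1, fun S _ L s γ d σ E hL hR => ?_⟩
  refine h2 S L s γ.tail d σ E hL ⟨hR.stored, ?_⟩
  obtain ⟨_, hv⟩ := hR
  cases hv with
  | cons _ h => exact h

/-- A sequence of two number computations, with results in registers `d` and `d + 1`. -/
theorem pair {f g : α → ℕ} (hf : Comp.{u} f) (hg : Comp.{u} g) :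
    ∃ (code : List ℕ → ℕ → Cmd) (β : ℕ → ℕ), PolyB β ∧ ∀ a B, CBdd a B → f a ≤ β B ∧ g a ≤ β B ∧
    ∀ (S : Type u) [NonUnitalSemiring S] (L s : ℕ) (γ : List ℕ) (d : ℕ) (σ : State S) (E : ℕ → S),
      β B < L → Ready a s E γ d σ → ∃ k σ', k ≤ β B ∧ Exec L s (inp a).rom (code γ d) σ k σ' ∧
        Frame d σ σ' ∧ σ'.out = σ.out ∧ σ'.reg d = .num (f a) ∧ σ'.reg (d + 1) = .num (g a) := by
  obtain ⟨c₁, β₁, hβ₁, h₁⟩ := hf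
  obtain ⟨c₂, β₂, hβ₂, h₂⟩ := hg
  refine ⟨fun γ d => .seq (c₁ γ d) (c₂ γ (d + 1)), fun B => β₁ B + β₂ B + 1,
    (hβ₁.add hβ₂).add (.const 1), fun a B hB => ?_⟩
  beta_reduce
  obtain ⟨b₁, h₁⟩ := h₁ a B hB
  obtain ⟨b₂, h₂⟩ := h₂ a B hB
  refine ⟨by omega, by omega, fun S _ L s γ d σ E hL hR => ?_⟩
  obtain ⟨k₁, σ₁, hk₁, e₁, F₁, o₁, r₁⟩ := h₁ S L s γ d σ E (by omega) hR
  obtain ⟨k₂, σ₂, hk₂, e₂, F₂, o₂, r₂⟩ := h₂ S L s γ (d + 1) σ₁ E (by omega)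
    (hR.mono F₁ (by omega))
  exact ⟨_, σ₂, by omega, .seq _ _ _ _ _ _ _ e₁ e₂, F₁.trans F₂ (by omega), o₂.trans o₁,
    by rw [F₂.reg d (by omega), r₁], r₂⟩

/-- Any machine operation on two computed numbers. -/
theorem op (o : Op) {f g : α → ℕ} (hf : Comp.{u} f) (hg : Comp.{u} g) :
    Comp.{u} fun a => o.eval (f a) (g a) := by
  obtain ⟨c, β, hβ, h⟩ := hf.pair hg
  have hval : ∀ x y b, x ≤ b → y ≤ b → o.eval x y ≤ b + b + b * b + 2 := by
    intro x y b hx hy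
    have := Nat.mul_le_mul hx hy
    have := Nat.div_le_self x y
    have := Nat.mod_le x y
    cases o <;> simp only [Op.eval] <;> (try split_ifs) <;> omega
  refine ⟨fun γ d => .seq (c γ d) (.op o d d (d + 1)), fun B => β B + β B + β B * β B + 2,
    ((hβ.add hβ).add (hβ.mul hβ)).add (.const 2), fun a B hB => ?_⟩
  beta_reduce
  obtain ⟨b₁, b₂, h⟩ := h a B hB
  refine ⟨hval _ _ _ b₁ b₂, fun S _ L s γ d σ E hL hR => ?_⟩
  obtain ⟨k₁, σ₁, hk₁, e₁, F₁, o₁, r₁, r₂⟩ := h S L s γ d σ E (by omega) hR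
  exact ⟨_, _, by omega, .seq _ _ _ _ _ _ _ e₁ (.op _ o d d (d + 1) _ _ r₁ r₂
    ((hval _ _ _ b₁ b₂).trans_lt hL)), F₁.trans (.set _ _ le_rfl) le_rfl, o₁, by simp⟩

/-- Reading a parameter at a computed index. -/
theorem rom {f : α → ℕ} (hf : Comp.{u} f) : Comp.{u} fun a => (inp a).rom (f a) := by
  obtain ⟨c, β, hβ, h⟩ := hf
  refine ⟨fun γ d => .seq (c γ d) (.param d d), fun B => β B + B + 2, (hβ.add .id).add (.const 2),
    fun a B hB => ?_⟩
  beta_reduce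
  obtain ⟨b, h⟩ := h a B hB
  have hr := hB.inp.rom (f a)
  refine ⟨by omega, fun S _ L s γ d σ E hL hR => ?_⟩
  obtain ⟨k₁, σ₁, hk₁, e₁, F₁, o₁, r₁⟩ := h S L s γ d σ E (by omega) hR
  exact ⟨_, _, by omega, .seq _ _ _ _ _ _ _ e₁ (.param _ _ _ _ r₁ (by omega)),
    F₁.trans (.set _ _ le_rfl) le_rfl, o₁, by simp⟩

section

variable {f g : α → ℕ}

theorem add (hf : Comp.{u} f) (hg : Comp.{u} g) : Comp.{u} fun a => f a + g a := hf.op .add hg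
theorem sub (hf : Comp.{u} f) (hg : Comp.{u} g) : Comp.{u} fun a => f a - g a := hf.op .sub hg
theorem mul (hf : Comp.{u} f) (hg : Comp.{u} g) : Comp.{u} fun a => f a * g a := hf.op .mul hg
theorem div (hf : Comp.{u} f) (hg : Comp.{u} g) : Comp.{u} fun a => f a / g a := hf.op .div hg
theorem mod (hf : Comp.{u} f) (hg : Comp.{u} g) : Comp.{u} fun a => f a % g a := hf.op .mod hg

theorem congr (hf : Comp.{u} f) (h : ∀ a, g a = f a) : Comp.{u} g := by
  rwa [show g = f from funext h]

end

end Comp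

open Classical in
/-- Conditions that can be tested. Using the classical truth value frees the closure properties from
decidability assumptions. -/
def CompP (P : α → Prop) : Prop := Comp.{u} fun a => if P a then 1 else 0

namespace CompP

variable {f g : α → ℕ} {P Q : α → Prop}

theorem toComp [DecidablePred P] (hP : CompP.{u} P) : Comp.{u} fun a => if P a then 1 else 0 :=
  Comp.congr hP fun a => by congr

theorem of_comp [DecidablePred P] (hP : Comp.{u} fun a => if P a then 1 else 0) : CompP.{u} P :=
  Comp.congr hP fun a => by congr

theorem lt (hf : Comp.{u} f) (hg : Comp.{u} g) : CompP.{u} fun a => f a < g a :=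
  of_comp (hf.op .lt hg)

theorem eq (hf : Comp.{u} f) (hg : Comp.{u} g) : CompP.{u} fun a => f a = g a :=
  of_comp (hf.op .eq hg)

theorem congr (hP : CompP.{u} P) (h : ∀ a, Q a ↔ P a) : CompP.{u} Q := by
  rwa [show Q = P from funext fun a => propext (h a)]

theorem and (hP : CompP.{u} P) (hQ : CompP.{u} Q) : CompP.{u} fun a => P a ∧ Q a :=
  Comp.congr (Comp.mul hP hQ) fun a => by by_cases P a <;> by_cases Q a <;> simp [*]

theorem not (hP : CompP.{u} P) : CompP.{u} fun a => ¬ P a :=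
  Comp.congr ((Comp.const 1).sub hP) fun a => by by_cases P a <;> simp [*]

theorem or (hP : CompP.{u} P) (hQ : CompP.{u} Q) : CompP.{u} fun a => P a ∨ Q a :=
  (hP.not.and hQ.not).not.congr fun a => by tauto

theorem le (hf : Comp.{u} f) (hg : Comp.{u} g) : CompP.{u} fun a => f a ≤ g a :=
  (lt hg hf).not.congr fun a => by omega

end CompP

/-- A case distinction, at the level of executions. -/
theorem exec_ite {S : Type*} [NonUnitalSemiring S] {L s : ℕ} {rom : ℕ → ℕ} {P : Prop} [Decidable P]
    {d : ℕ} {c₁ c₂ : Cmd} {σ : State S} (hd : σ.reg d = .num (if P then 1 else 0)) {τ : ℕ}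
    {R : State S → Prop}
    (h : ∃ k σ', k ≤ τ ∧ Exec L s rom (if P then c₁ else c₂) σ k σ' ∧ R σ') :
    ∃ k σ', k ≤ τ + 1 ∧ Exec L s rom (.ite d c₁ c₂) σ k σ' ∧ R σ' := by
  obtain ⟨k, σ', hk, he, hR⟩ := h
  by_cases hP : P
  · rw [if_pos hP] at hd he
    exact ⟨_, σ', by omega, .iteTrue _ _ _ 1 _ _ _ hd one_ne_zero he, hR⟩
  · rw [if_neg hP] at hd he
    exact ⟨_, σ', by omega, .iteFalse _ _ _ _ _ _ hd he, hR⟩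

namespace Comp

variable {f g b : α → ℕ} {P : α → Prop} [DecidablePred P]

theorem ite (hP : CompP.{u} P) (hf : Comp.{u} f) (hg : Comp.{u} g) :
    Comp.{u} fun a => if P a then f a else g a := by
  obtain ⟨c₀, β₀, hβ₀, h₀⟩ := hP.toComp
  obtain ⟨c₁, β₁, hβ₁, h₁⟩ := hf
  obtain ⟨c₂, β₂, hβ₂, h₂⟩ := hg
  refine ⟨fun γ d => .seq (c₀ γ d) (.ite d (c₁ γ d) (c₂ γ d)), fun B => β₀ B + β₁ B + β₂ B + 2,
    ((hβ₀.add hβ₁).add hβ₂).add (.const 2), fun a B hB => ?_⟩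
  beta_reduce
  obtain ⟨b₀, h₀⟩ := h₀ a B hB
  obtain ⟨b₁, h₁⟩ := h₁ a B hB
  obtain ⟨b₂, h₂⟩ := h₂ a B hB
  beta_reduce at b₀ h₀
  refine ⟨by split_ifs <;> omega, fun S _ L s γ d σ E hL hR => ?_⟩
  obtain ⟨k₀, σ₀, hk₀, e₀, F₀, o₀, r₀⟩ := h₀ S L s γ d σ E (by omega) hR
  have hR' := hR.mono F₀ le_rfl
  obtain ⟨k, σ', hk, e, F, o, r⟩ := exec_ite (L := L) (s := s) (rom := (inp a).rom)
      (τ := β₁ B + β₂ B)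
    (c₁ := c₁ γ d) (c₂ := c₂ γ d)
    (R := fun σ' => Frame d σ₀ σ' ∧ σ'.out = σ₀.out ∧ σ'.reg d = .num (if P a then f a else g a))
    r₀ (by
      by_cases hP : P a
      · simp only [if_pos hP]
        obtain ⟨k, σ', hk, h⟩ := h₁ S L s γ d σ₀ E (by omega) hR'
        exact ⟨k, σ', by omega, h⟩
      · simp only [if_neg hP]
        obtain ⟨k, σ', hk, h⟩ := h₂ S L s γ d σ₀ E (by omega) hR'
        exact ⟨k, σ', by omega, h⟩)
  exact ⟨_, σ', by omega, .seq _ _ _ _ _ _ _ e₀ e, F₀.trans F le_rfl, o.trans o₀, r⟩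

/-- The number of input records is parameter `6`. -/
theorem len : Comp.{u} fun a : α => (inp a).len := by
  obtain ⟨c, β, hβ, h⟩ := (Comp.const (α := α) 6).rom
  refine ⟨c, fun B => β B + B, hβ.add .id, fun a B hB => ?_⟩
  beta_reduce
  obtain ⟨b₀, h⟩ := h a B hB
  beta_reduce at b₀ h
  refine ⟨hB.inp.len.trans (by omega), fun S _ L s γ d σ E hL hR => ?_⟩
  obtain ⟨k, σ', hk, e, F, o, r⟩ := h S L s γ d σ E (by omega) hR
  exact ⟨k, σ', by omega, e, F, o, by rw [r, hR.stored.rom]⟩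

/-- Reading a number of the input; records past the end count as zeros. -/
theorem get (hf : Comp.{u} f) {i : ℕ} (hi : i < 7) : Comp.{u} fun a => (inp a).num (f a) i := by
  obtain ⟨c₀, β₀, hβ₀, h₀⟩ := (CompP.lt hf len).toComp
  obtain ⟨c₁, β₁, hβ₁, h₁⟩ := ((const 8).mul hf).add (const i)
  refine ⟨fun γ d => .seq (c₀ γ d) (.ite d (.seq (c₁ γ d) (.load d d)) (.const d 0)),
    fun B => β₀ B + β₁ B + B + 10, ((hβ₀.add hβ₁).add .id).add (.const 10), fun a B hB => ?_⟩
  beta_reduce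
  obtain ⟨b₀, h₀⟩ := h₀ a B hB
  obtain ⟨b₁, h₁⟩ := h₁ a B hB
  beta_reduce at b₀ h₀ b₁ h₁
  refine ⟨(hB.inp.num _ _).trans (by omega), fun S _ L s γ d σ E hL hR => ?_⟩
  obtain ⟨k₀, σ₀, hk₀, e₀, F₀, o₀, r₀⟩ := h₀ S L s γ d σ E (by omega) hR
  have hR' := hR.mono F₀ le_rfl
  obtain ⟨k, σ', hk, e, F, o, r⟩ := exec_ite (L := L) (s := s) (rom := (inp a).rom) (τ := β₁ B + 2)
    (c₁ := .seq (c₁ γ d) (.load d d)) (c₂ := .const d 0)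
    (R := fun σ' => Frame d σ₀ σ' ∧ σ'.out = σ₀.out ∧ σ'.reg d = .num ((inp a).num (f a) i))
    r₀ (by
      by_cases hP : f a < (inp a).len
      · simp only [if_pos hP]
        obtain ⟨k, σ', hk, e, F, o, r⟩ := h₁ S L s γ d σ₀ E (by omega) hR'
        refine ⟨_, _, ?_, .seq _ _ _ _ _ _ _ e (.load _ _ _ _ r ?_),
          F.trans (.set _ _ le_rfl) le_rfl, o, ?_⟩
        · omega
        · have := hR'.stored.size
          omega
        · rw [State.set_reg_self, F.mem, hR'.stored.num _ hP _ hi]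
      · simp only [if_neg hP]
        exact ⟨1, _, by omega, .const _ _ _ (by omega), .set _ _ le_rfl, rfl,
          by simp [hR.stored.outside _ i (not_lt.1 hP)]⟩)
  exact ⟨_, σ', by omega, .seq _ _ _ _ _ _ _ e₀ e, F₀.trans F le_rfl, o.trans o₀, r⟩

/-- Bounded sums: the sum is accumulated in register `d`, while registers `d + 1` and `d + 2`
control the loop and `d + 2` holds the index. -/
theorem sum {f : α → ℕ → ℕ} (hb : Comp.{u} b) (hf : Comp.{u} fun p : α × ℕ => f p.1 p.2) :
    Comp.{u} fun a => ∑ i ∈ Finset.range (b a), f a i := by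
  obtain ⟨c₀, β₀, hβ₀, h₀⟩ := hb
  obtain ⟨c₁, β₁, hβ₁, h₁⟩ := hf
  set β₂ : ℕ → ℕ := fun B => β₁ (B + β₀ B) with hβ₂
  refine ⟨fun γ d => .seq (.const d 0) (.seq (c₀ γ (d + 1)) (.seq (.const (d + 2) 0)
      (.loop (d + 1) (forBody (d + 1) (.seq (c₁ ((d + 2) :: γ) (d + 3)) (.op .add d d (d + 3))))))),
    fun B => β₀ B + β₀ B * (β₂ B + 12) + β₀ B * β₂ B + β₂ B + 10,
    ((((hβ₀.add (hβ₀.mul ((hβ₁.comp hβ₀).add (.const 12)))).add (hβ₀.mul (hβ₁.comp hβ₀))).add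
      (hβ₁.comp hβ₀))).add (.const 10), fun a B hB => ?_⟩
  beta_reduce
  obtain ⟨b₀, h₀⟩ := h₀ a B hB
  have hB' : ∀ i < b a, CBdd (a, i) (B + β₀ B) := fun i hi =>
    hB.push (by omega) (by omega)
  have hsum : ∀ j ≤ b a, ∑ i ∈ Finset.range j, f a i ≤ β₀ B * β₂ B := by
    intro j hj
    refine (Finset.sum_le_card_nsmul _ _ (β₂ B) fun i hi => ?_).trans ?_
    · exact (h₁ (a, i) _ (hB' i (by simp at hi; omega))).1
    · rw [Finset.card_range, smul_eq_mul]
      exact Nat.mul_le_mul_right _ (by omega)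
  refine ⟨(hsum _ le_rfl).trans (by omega), fun S _ L s γ d σ E hL hR => ?_⟩
  set σ₀ := σ.set d (.num 0) with hσ₀
  have F₀ : Frame d σ σ₀ := .set _ _ le_rfl
  obtain ⟨k₁, σ₁, hk₁, e₁, F₁, o₁, r₁⟩ := h₀ S L s γ (d + 1) σ₀ E (by omega)
    (hR.mono F₀ (by omega))
  set σ₂ := σ₁.set (d + 2) (.num 0) with hσ₂
  have F₂ : Frame (d + 1) σ₁ σ₂ := .set _ _ (by omega)
  have hmul : β₀ B * (β₂ B + 12) = β₀ B * β₂ B + β₀ B * 12 := by ring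
  have hmono : b a * (β₂ B + 2 + 10) ≤ β₀ B * (β₂ B + 12) := Nat.mul_le_mul_right _ b₀
  obtain ⟨k, σ', hk, e, F, o, r⟩ := exec_for (L := L) (s := s) (rom := (inp a).rom) (d := d + 1)
    (τ := β₂ B + 2) (k := b a) (c := .seq (c₁ ((d + 2) :: γ) (d + 3)) (.op .add d d (d + 3)))
    (fun i σ' => Frame d σ σ' ∧ σ'.out = σ.out ∧ σ'.reg d = .num (∑ i ∈ Finset.range i, f a i))
    (by omega) (by omega)
    (fun i τ τ' hτ hF ho => ⟨hτ.1.trans hF (by omega), ho.trans hτ.2.1,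
      by rw [hF.reg d (by omega), hτ.2.2]⟩)
    (fun i hi τ hτ hd hd1 => by
      obtain ⟨F, o, r⟩ := hτ
      obtain ⟨k, τ₁, hk, e, F', o', r'⟩ := (h₁ (a, i) _ (hB' i hi)).2 S L s ((d + 2) :: γ)
          (d + 3) τ E
        (by simp only [hβ₂] at hL ⊢; omega) ((hR.mono F (by omega)).push (by omega) hd1)
      refine ⟨_, _, ?_, .seq _ _ _ _ _ _ _ e (.op _ .add d d (d + 3) _ _
        (by rw [F'.reg d (by omega), r]) r' ?_), ⟨(F.trans F' (by omega)).trans (.set _ _ le_rfl)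
          le_rfl, o'.trans o, ?_⟩, ?_, ?_⟩
      · simp only [hβ₂]; omega
      · have := hsum (i + 1) (by omega)
        rw [Finset.sum_range_succ] at this
        simp only [Op.eval]
        omega
      · rw [State.set_reg_self, Finset.sum_range_succ]; rfl
      · rw [State.set_reg_ne _ _ (by omega), F'.reg _ (by omega), hd]
      · rw [State.set_reg_ne _ _ (by omega), F'.reg _ (by omega), hd1])
    σ₂ ⟨(F₀.trans F₁ (by omega)).trans F₂ (by omega), by simp [hσ₂, o₁, hσ₀],
      by rw [F₂.reg d (by omega), F₁.reg d (by omega)]; simp [hσ₀]⟩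
    (by rw [hσ₂, State.set_reg_ne _ _ (by omega), r₁]) (by simp [hσ₂])
  refine ⟨_, σ', ?_, .seq _ _ _ _ _ _ _ (.const _ _ _ (by omega)) (.seq _ _ _ _ _ _ _ e₁
    (.seq _ _ _ _ _ _ _ (.const _ _ _ (by omega)) e)), F, o, r⟩
  omega

/-- Bounded recursion: the values are cut off at `g`, which keeps them polynomial. -/
theorem iterate {f : α → ℕ → ℕ} {x : α → ℕ} (hb : Comp.{u} b) (hx : Comp.{u} x) (hg : Comp.{u} g)
    (hf : Comp.{u} fun p : α × ℕ => f p.1 p.2) :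
    Comp.{u} fun a => (fun y => min (f a y) (g a))^[b a] (x a) := by
  have hf' : Comp.{u} fun p : α × ℕ => min (f p.1 p.2) (g p.1) :=
    (Comp.ite (CompP.le hf hg.weaken) hf hg.weaken).congr fun p => by
      rw [min_def]
  obtain ⟨c₀, β₀, hβ₀, h₀⟩ := hb
  obtain ⟨c₁, β₁, hβ₁, h₁⟩ := hf'
  obtain ⟨c₂, β₂, hβ₂, h₂⟩ := hx
  obtain ⟨_, β₃, hβ₃, h₃⟩ := hg
  set β₄ : ℕ → ℕ := fun B => β₁ (B + (β₂ B + β₃ B)) with hβ₄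
  have hβ₄' : PolyB β₄ := hβ₁.comp (hβ₂.add hβ₃)
  refine ⟨fun γ d => .seq (c₂ γ d) (.seq (c₀ γ (d + 1)) (.seq (.const (d + 2) 0)
      (.loop (d + 1) (forBody (d + 1) (.seq (c₁ (d :: γ) (d + 3)) (.move d (d + 3))))))),
    fun B => β₀ B + β₂ B + β₃ B + β₀ B * (β₄ B + 12) + β₄ B + 10,
    (((((hβ₀.add hβ₂).add hβ₃).add (hβ₀.mul (hβ₄'.add (.const 12)))).add hβ₄')).add (.const 10),
    fun a B hB => ?_⟩
  beta_reduce
  obtain ⟨b₀, h₀⟩ := h₀ a B hB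
  obtain ⟨b₂, h₂⟩ := h₂ a B hB
  have b₃ := (h₃ a B hB).1
  set y : ℕ → ℕ := fun i => (fun y => min (f a y) (g a))^[i] (x a) with hy
  have hyB : ∀ i, y i ≤ β₂ B + β₃ B := by
    rintro (_ | i)
    · simp only [hy, Function.iterate_zero, _root_.id]; omega
    · simp only [hy, Function.iterate_succ_apply']
      exact (min_le_right _ _).trans (by omega)
  have hB' : ∀ i, CBdd (a, y i) (B + (β₂ B + β₃ B)) := fun i =>
    hB.push (by omega) ((hyB i).trans (by omega))
  refine ⟨(hyB _).trans (by omega), fun S _ L s γ d σ E hL hR => ?_⟩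
  obtain ⟨k₀, σ₀, hk₀, e₀, F₀, o₀, r₀⟩ := h₂ S L s γ d σ E (by omega) hR
  obtain ⟨k₁, σ₁, hk₁, e₁, F₁, o₁, r₁⟩ := h₀ S L s γ (d + 1) σ₀ E (by omega)
    (hR.mono F₀ (by omega))
  set σ₂ := σ₁.set (d + 2) (.num 0) with hσ₂
  have F₂ : Frame (d + 1) σ₁ σ₂ := .set _ _ (by omega)
  have hmul : β₀ B * (β₄ B + 12) = β₀ B * β₄ B + β₀ B * 12 := by ring
  have hmono : b a * (β₄ B + 2 + 10) ≤ β₀ B * (β₄ B + 12) := Nat.mul_le_mul_right _ b₀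
  obtain ⟨k, σ', hk, e, F, o, r⟩ := exec_for (L := L) (s := s) (rom := (inp a).rom) (d := d + 1)
    (τ := β₄ B + 2) (k := b a) (c := .seq (c₁ (d :: γ) (d + 3)) (.move d (d + 3)))
    (fun i σ' => Frame d σ σ' ∧ σ'.out = σ.out ∧ σ'.reg d = .num (y i))
    (by omega) (by omega)
    (fun i τ τ' hτ hF ho => ⟨hτ.1.trans hF (by omega), ho.trans hτ.2.1,
      by rw [hF.reg d (by omega), hτ.2.2]⟩)
    (fun i hi τ hτ hd hd1 => by
      obtain ⟨F, o, r⟩ := hτ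
      obtain ⟨k, τ₁, hk, e, F', o', r'⟩ := (h₁ (a, y i) _ (hB' i)).2 S L s (d :: γ) (d + 3) τ E
        (by simp only [hβ₄] at hL ⊢; omega) ((hR.mono F (by omega)).push (by omega) r)
      refine ⟨_, _, ?_, .seq _ _ _ _ _ _ _ e (.move _ d (d + 3)),
        ⟨(F.trans F' (by omega)).trans (.set _ _ le_rfl) le_rfl, o'.trans o, ?_⟩, ?_, ?_⟩
      · simp only [hβ₄]; omega
      · rw [State.set_reg_self, r']
        simp only [hy, Function.iterate_succ_apply']
      · rw [State.set_reg_ne _ _ (by omega), F'.reg _ (by omega), hd]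
      · rw [State.set_reg_ne _ _ (by omega), F'.reg _ (by omega), hd1])
    σ₂ ⟨(F₀.trans F₁ (by omega)).trans F₂ (by omega), by simp [hσ₂, o₁, o₀],
      by rw [F₂.reg d (by omega), F₁.reg d (by omega), r₀]; simp [hy]⟩
    (by rw [hσ₂, State.set_reg_ne _ _ (by omega), r₁]) (by simp [hσ₂])
  refine ⟨_, σ', ?_, .seq _ _ _ _ _ _ _ e₀ (.seq _ _ _ _ _ _ _ e₁
    (.seq _ _ _ _ _ _ _ (.const _ _ _ (by omega)) e)), F, o, r⟩
  omega

end Comp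

/-! ### Computed semiring elements and emitted records -/

namespace EComp

variable {f g : ∀ (S : Type u) [NonUnitalSemiring S], (ℕ → S) → α → S} {b : α → ℕ}
  {P : α → Prop} [DecidablePred P]

theorem zero : EComp.{u} fun _ [NonUnitalSemiring _] _ (_ : α) => 0 := by
  refine ⟨fun _ d => .eltZero d, fun _ => 1, .const _, fun a B hB => ?_⟩
  intro S _ L s γ d σ E hL hR
  exact ⟨1, _, le_rfl, .eltZero _ _, .set _ _ le_rfl, rfl, by simp⟩

theorem ite (hP : CompP.{u} P) (hf : EComp.{u} f) (hg : EComp.{u} g) :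
    EComp.{u} fun S _ E a => if P a then f S E a else g S E a := by
  obtain ⟨c₀, β₀, hβ₀, h₀⟩ := hP.toComp
  obtain ⟨c₁, β₁, hβ₁, h₁⟩ := hf
  obtain ⟨c₂, β₂, hβ₂, h₂⟩ := hg
  refine ⟨fun γ d => .seq (c₀ γ d) (.ite d (c₁ γ d) (c₂ γ d)), fun B => β₀ B + β₁ B + β₂ B + 2,
    ((hβ₀.add hβ₁).add hβ₂).add (.const 2), fun a B hB => ?_⟩
  beta_reduce
  obtain ⟨b₀, h₀⟩ := h₀ a B hB
  have h₁ := h₁ a B hB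
  have h₂ := h₂ a B hB
  beta_reduce at b₀ h₀
  intro S _ L s γ d σ E hL hR
  obtain ⟨k₀, σ₀, hk₀, e₀, F₀, o₀, r₀⟩ := h₀ S L s γ d σ E (by omega) hR
  have hR' := hR.mono F₀ le_rfl
  obtain ⟨k, σ', hk, e, F, o, r⟩ := exec_ite (L := L) (s := s) (rom := (inp a).rom)
      (τ := β₁ B + β₂ B)
    (c₁ := c₁ γ d) (c₂ := c₂ γ d)
    (R := fun σ' => Frame d σ₀ σ' ∧ σ'.out = σ₀.out ∧
      σ'.reg d = .elt (if P a then f S E a else g S E a))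
    r₀ (by
      by_cases hP : P a
      · simp only [if_pos hP]
        obtain ⟨k, σ', hk, h⟩ := h₁ S L s γ d σ₀ E (by omega) hR'
        exact ⟨k, σ', by omega, h⟩
      · simp only [if_neg hP]
        obtain ⟨k, σ', hk, h⟩ := h₂ S L s γ d σ₀ E (by omega) hR'
        exact ⟨k, σ', by omega, h⟩)
  exact ⟨_, σ', by omega, .seq _ _ _ _ _ _ _ e₀ e, F₀.trans F le_rfl, o.trans o₀, r⟩

/-- The semiring element of an input record; zero if the record holds none. -/
theorem get {i : α → ℕ} (hi : Comp.{u} i) :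
    EComp.{u} fun _ [NonUnitalSemiring _] E a =>
      if i a < (inp a).len ∧ ((inp a).num (i a) 0 = 0 ∨ (inp a).num (i a) 0 = 4) then E (i a)
      else 0 := by
  obtain ⟨c₀, β₀, hβ₀, h₀⟩ := (CompP.lt hi Comp.len).and
    ((CompP.eq (hi.get (i := 0) (by norm_num)) (.const 0)).or
      (CompP.eq (hi.get (i := 0) (by norm_num)) (.const 4))) |>.toComp
  obtain ⟨c₁, β₁, hβ₁, h₁⟩ := ((Comp.const 8).mul hi).add (Comp.const 7)
  refine ⟨fun γ d => .seq (c₀ γ d) (.ite d (.seq (c₁ γ d) (.load d d)) (.eltZero d)),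
    fun B => β₀ B + β₁ B + 10, (hβ₀.add hβ₁).add (.const 10), fun a B hB => ?_⟩
  beta_reduce
  obtain ⟨b₀, h₀⟩ := h₀ a B hB
  obtain ⟨b₁, h₁⟩ := h₁ a B hB
  beta_reduce at b₀ h₀ b₁ h₁
  intro S _ L s γ d σ E hL hR
  obtain ⟨k₀, σ₀, hk₀, e₀, F₀, o₀, r₀⟩ := h₀ S L s γ d σ E (by omega) hR
  have hR' := hR.mono F₀ le_rfl
  obtain ⟨k, σ', hk, e, F, o, r⟩ := exec_ite (L := L) (s := s) (rom := (inp a).rom) (τ := β₁ B + 2)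
    (c₁ := .seq (c₁ γ d) (.load d d)) (c₂ := .eltZero d)
    (R := fun σ' => Frame d σ₀ σ' ∧ σ'.out = σ₀.out ∧ σ'.reg d = .elt
      (if i a < (inp a).len ∧ ((inp a).num (i a) 0 = 0 ∨ (inp a).num (i a) 0 = 4) then E (i a)
      else 0))
    r₀ (by
      by_cases hP : i a < (inp a).len ∧ ((inp a).num (i a) 0 = 0 ∨ (inp a).num (i a) 0 = 4)
      · simp only [if_pos hP]
        obtain ⟨k, σ', hk, e, F, o, r⟩ := h₁ S L s γ d σ₀ E (by omega) hR'
        refine ⟨_, _, ?_, .seq _ _ _ _ _ _ _ e (.load _ _ _ _ r ?_),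
          F.trans (.set _ _ le_rfl) le_rfl, o, ?_⟩
        · omega
        · have := hR'.stored.size
          omega
        · rw [State.set_reg_self, F.mem, hR'.stored.elt _ hP.1 hP.2]
      · simp only [if_neg hP]
        exact ⟨1, _, by omega, .eltZero _ _, .set _ _ le_rfl, rfl, by simp⟩)
  exact ⟨_, σ', by omega, .seq _ _ _ _ _ _ _ e₀ e, F₀.trans F le_rfl, o.trans o₀, r⟩

/-- A machine operation on two computed semiring elements. -/
theorem binary {o : ∀ (S : Type u) [NonUnitalSemiring S], S → S → S} {cmd : ℕ → ℕ → ℕ → Cmd}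
    (ho : ∀ (S : Type u) [NonUnitalSemiring S] (L s : ℕ) (rom : ℕ → ℕ) (σ : State S) (d a b : ℕ)
      (x y : S), σ.reg a = .elt x → σ.reg b = .elt y →
        Exec L s rom (cmd d a b) σ 1 (σ.set d (.elt (o S x y))))
    (hf : EComp.{u} f) (hg : EComp.{u} g) :
    EComp.{u} fun S _ E a => o S (f S E a) (g S E a) := by
  obtain ⟨c₁, β₁, hβ₁, h₁⟩ := hf
  obtain ⟨c₂, β₂, hβ₂, h₂⟩ := hg
  refine ⟨fun γ d => .seq (c₁ γ d) (.seq (c₂ γ (d + 1)) (cmd d d (d + 1))),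
    fun B => β₁ B + β₂ B + 5, (hβ₁.add hβ₂).add (.const 5), fun a B hB => ?_⟩
  beta_reduce
  have h₁ := h₁ a B hB
  have h₂ := h₂ a B hB
  intro S _ L s γ d σ E hL hR
  obtain ⟨k₁, σ₁, hk₁, e₁, F₁, o₁, r₁⟩ := h₁ S L s γ d σ E (by omega) hR
  obtain ⟨k₂, σ₂, hk₂, e₂, F₂, o₂, r₂⟩ := h₂ S L s γ (d + 1) σ₁ E (by omega)
    (hR.mono F₁ (by omega))
  exact ⟨_, _, by omega, .seq _ _ _ _ _ _ _ e₁ (.seq _ _ _ _ _ _ _ e₂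
    (ho S _ _ _ _ d d (d + 1) _ _ (by rw [F₂.reg d (by omega), r₁]) r₂)),
    (F₁.trans F₂ (by omega)).trans (.set _ _ le_rfl) le_rfl, o₂.trans o₁, by simp⟩

theorem add (hf : EComp.{u} f) (hg : EComp.{u} g) :
    EComp.{u} fun S _ E a => f S E a + g S E a :=
  binary (o := fun _ _ x y => x + y) (fun _ _ _ _ _ _ _ _ _ _ _ => .eltAdd _ _ _ _ _ _) hf hg

theorem mul (hf : EComp.{u} f) (hg : EComp.{u} g) :
    EComp.{u} fun S _ E a => f S E a * g S E a :=
  binary (o := fun _ _ x y => x * y) (fun _ _ _ _ _ _ _ _ _ _ _ => .eltMul _ _ _ _ _ _) hf hg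

theorem sum {f : ∀ (S : Type u) [NonUnitalSemiring S], (ℕ → S) → α → ℕ → S} (hb : Comp.{u} b)
    (hf : EComp.{u} fun S _ E (p : α × ℕ) => f S E p.1 p.2) :
    EComp.{u} fun S _ E a => ∑ i ∈ Finset.range (b a), f S E a i := by
  obtain ⟨c₀, β₀, hβ₀, h₀⟩ := hb
  obtain ⟨c₁, β₁, hβ₁, h₁⟩ := hf
  set β₂ : ℕ → ℕ := fun B => β₁ (B + β₀ B) with hβ₂
  refine ⟨fun γ d => .seq (.eltZero d) (.seq (c₀ γ (d + 1)) (.seq (.const (d + 2) 0)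
      (.loop (d + 1) (forBody (d + 1) (.seq (c₁ ((d + 2) :: γ) (d + 3)) (.eltAdd d d (d + 3))))))),
    fun B => β₀ B + β₀ B * (β₂ B + 12) + β₂ B + 10,
    (((hβ₀.add (hβ₀.mul ((hβ₁.comp hβ₀).add (.const 12)))).add
      (hβ₁.comp hβ₀))).add (.const 10), fun a B hB => ?_⟩
  beta_reduce
  obtain ⟨b₀, h₀⟩ := h₀ a B hB
  have hB' : ∀ i < b a, CBdd (a, i) (B + β₀ B) := fun i hi =>
    hB.push (by omega) (by omega)
  intro S _ L s γ d σ E hL hR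
  set σ₀ := σ.set d (.elt 0) with hσ₀
  have F₀ : Frame d σ σ₀ := .set _ _ le_rfl
  obtain ⟨k₁, σ₁, hk₁, e₁, F₁, o₁, r₁⟩ := h₀ S L s γ (d + 1) σ₀ E (by omega)
    (hR.mono F₀ (by omega))
  set σ₂ := σ₁.set (d + 2) (.num 0) with hσ₂
  have F₂ : Frame (d + 1) σ₁ σ₂ := .set _ _ (by omega)
  have hmul : β₀ B * (β₂ B + 12) = β₀ B * β₂ B + β₀ B * 12 := by ring
  have hmono : b a * (β₂ B + 2 + 10) ≤ β₀ B * (β₂ B + 12) := Nat.mul_le_mul_right _ b₀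
  obtain ⟨k, σ', hk, e, F, o, r⟩ := exec_for (L := L) (s := s) (rom := (inp a).rom) (d := d + 1)
    (τ := β₂ B + 2) (k := b a) (c := .seq (c₁ ((d + 2) :: γ) (d + 3)) (.eltAdd d d (d + 3)))
    (fun i σ' => Frame d σ σ' ∧ σ'.out = σ.out ∧
      σ'.reg d = .elt (∑ i ∈ Finset.range i, f S E a i))
    (by omega) (by omega)
    (fun i τ τ' hτ hF ho => ⟨hτ.1.trans hF (by omega), ho.trans hτ.2.1,
      by rw [hF.reg d (by omega), hτ.2.2]⟩)
    (fun i hi τ hτ hd hd1 => by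
      obtain ⟨F, o, r⟩ := hτ
      obtain ⟨k, τ₁, hk, e, F', o', r'⟩ := (h₁ (a, i) _ (hB' i hi)) S L s ((d + 2) :: γ) (d + 3) τ E
        (by simp only [hβ₂] at hL ⊢; omega) ((hR.mono F (by omega)).push (by omega) hd1)
      refine ⟨_, _, ?_, .seq _ _ _ _ _ _ _ e (.eltAdd _ d d (d + 3) _ _
        (by rw [F'.reg d (by omega), r]) r'), ⟨(F.trans F' (by omega)).trans (.set _ _ le_rfl)
          le_rfl, o'.trans o, ?_⟩, ?_, ?_⟩
      · simp only [hβ₂]; omega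
      · rw [State.set_reg_self, Finset.sum_range_succ]
      · rw [State.set_reg_ne _ _ (by omega), F'.reg _ (by omega), hd]
      · rw [State.set_reg_ne _ _ (by omega), F'.reg _ (by omega), hd1])
    σ₂ ⟨(F₀.trans F₁ (by omega)).trans F₂ (by omega), by simp [hσ₂, o₁, hσ₀],
      by rw [F₂.reg d (by omega), F₁.reg d (by omega)]; simp [hσ₀]⟩
    (by rw [hσ₂, State.set_reg_ne _ _ (by omega), r₁]) (by simp [hσ₂])
  refine ⟨_, σ', ?_, .seq _ _ _ _ _ _ _ (.eltZero _ _) (.seq _ _ _ _ _ _ _ e₁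
    (.seq _ _ _ _ _ _ _ (.const _ _ _ (by omega)) e)), F, o, r⟩
  omega

end EComp

namespace OComp

variable {f g : ∀ (S : Type u) [NonUnitalSemiring S], (ℕ → S) → α → Records S} {b : α → ℕ}
  {P : α → Prop} [DecidablePred P]

theorem zero : OComp.{u} fun _ [NonUnitalSemiring _] _ (_ : α) => 0 := by
  refine ⟨fun _ _ => .skip, fun _ => 1, .const _, fun a B hB => ?_⟩
  intro S _ L s γ d σ E hL hR
  exact ⟨1, σ, le_rfl, .skip _, .refl _ _, by simp⟩

theorem ite (hP : CompP.{u} P) (hf : OComp.{u} f) (hg : OComp.{u} g) :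
    OComp.{u} fun S _ E a => if P a then f S E a else g S E a := by
  obtain ⟨c₀, β₀, hβ₀, h₀⟩ := hP.toComp
  obtain ⟨c₁, β₁, hβ₁, h₁⟩ := hf
  obtain ⟨c₂, β₂, hβ₂, h₂⟩ := hg
  refine ⟨fun γ d => .seq (c₀ γ d) (.ite d (c₁ γ d) (c₂ γ d)), fun B => β₀ B + β₁ B + β₂ B + 2,
    ((hβ₀.add hβ₁).add hβ₂).add (.const 2), fun a B hB => ?_⟩
  beta_reduce
  obtain ⟨b₀, h₀⟩ := h₀ a B hB
  have h₁ := h₁ a B hB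
  have h₂ := h₂ a B hB
  beta_reduce at b₀ h₀
  intro S _ L s γ d σ E hL hR
  obtain ⟨k₀, σ₀, hk₀, e₀, F₀, o₀, r₀⟩ := h₀ S L s γ d σ E (by omega) hR
  have hR' := hR.mono F₀ le_rfl
  obtain ⟨k, σ', hk, e, F, o⟩ := exec_ite (L := L) (s := s) (rom := (inp a).rom) (τ := β₁ B + β₂ B)
    (c₁ := c₁ γ d) (c₂ := c₂ γ d)
    (R := fun σ' => Frame d σ₀ σ' ∧ (σ'.out : Records S) =
      (if P a then f S E a else g S E a) + (σ₀.out : Records S))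
    r₀ (by
      by_cases hP : P a
      · simp only [if_pos hP]
        obtain ⟨k, σ', hk, h⟩ := h₁ S L s γ d σ₀ E (by omega) hR'
        exact ⟨k, σ', by omega, h⟩
      · simp only [if_neg hP]
        obtain ⟨k, σ', hk, h⟩ := h₂ S L s γ d σ₀ E (by omega) hR'
        exact ⟨k, σ', by omega, h⟩)
  exact ⟨_, σ', by omega, .seq _ _ _ _ _ _ _ e₀ e, F₀.trans F le_rfl, by rw [o, o₀]⟩

theorem add (hf : OComp.{u} f) (hg : OComp.{u} g) :
    OComp.{u} fun S _ E a => f S E a + g S E a := by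
  obtain ⟨c₁, β₁, hβ₁, h₁⟩ := hf
  obtain ⟨c₂, β₂, hβ₂, h₂⟩ := hg
  refine ⟨fun γ d => .seq (c₁ γ d) (c₂ γ d), fun B => β₁ B + β₂ B + 1,
    (hβ₁.add hβ₂).add (.const 1), fun a B hB => ?_⟩
  beta_reduce
  have h₁ := h₁ a B hB
  have h₂ := h₂ a B hB
  intro S _ L s γ d σ E hL hR
  obtain ⟨k₁, σ₁, hk₁, e₁, F₁, o₁⟩ := h₁ S L s γ d σ E (by omega) hR
  obtain ⟨k₂, σ₂, hk₂, e₂, F₂, o₂⟩ := h₂ S L s γ d σ₁ E (by omega) (hR.mono F₁ (by omega))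
  exact ⟨_, _, by omega, .seq _ _ _ _ _ _ _ e₁ e₂, F₁.trans F₂ (by omega), by
    rw [o₂, o₁]; abel⟩

theorem sum {f : ∀ (S : Type u) [NonUnitalSemiring S], (ℕ → S) → α → ℕ → Records S}
    (hb : Comp.{u} b) (hf : OComp.{u} fun S _ E (p : α × ℕ) => f S E p.1 p.2) :
    OComp.{u} fun S _ E a => ∑ i ∈ Finset.range (b a), f S E a i := by
  obtain ⟨c₀, β₀, hβ₀, h₀⟩ := hb
  obtain ⟨c₁, β₁, hβ₁, h₁⟩ := hf
  set β₂ : ℕ → ℕ := fun B => β₁ (B + β₀ B) with hβ₂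
  refine ⟨fun γ d => .seq (c₀ γ d) (.seq (.const (d + 1) 0)
      (.loop d (forBody d (c₁ ((d + 1) :: γ) (d + 2))))),
    fun B => β₀ B + β₀ B * (β₂ B + 12) + β₂ B + 10,
    (((hβ₀.add (hβ₀.mul ((hβ₁.comp hβ₀).add (.const 12)))).add
      (hβ₁.comp hβ₀))).add (.const 10), fun a B hB => ?_⟩
  beta_reduce
  obtain ⟨b₀, h₀⟩ := h₀ a B hB
  have hB' : ∀ i < b a, CBdd (a, i) (B + β₀ B) := fun i hi =>
    hB.push (by omega) (by omega)
  intro S _ L s γ d σ E hL hR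
  obtain ⟨k₁, σ₁, hk₁, e₁, F₁, o₁, r₁⟩ := h₀ S L s γ d σ E (by omega) hR
  set σ₂ := σ₁.set (d + 1) (.num 0) with hσ₂
  have F₂ : Frame d σ₁ σ₂ := .set _ _ (by omega)
  have hmul : β₀ B * (β₂ B + 12) = β₀ B * β₂ B + β₀ B * 12 := by ring
  have hmono : b a * (β₂ B + 2 + 10) ≤ β₀ B * (β₂ B + 12) := Nat.mul_le_mul_right _ b₀
  obtain ⟨k, σ', hk, e, F, o⟩ := exec_for (L := L) (s := s) (rom := (inp a).rom) (d := d)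
    (τ := β₂ B + 2) (k := b a) (c := c₁ ((d + 1) :: γ) (d + 2))
    (fun i σ' => Frame d σ σ' ∧ (σ'.out : Records S) =
      (∑ i ∈ Finset.range i, f S E a i) + (σ.out : Records S))
    (by omega) (by omega)
    (fun i τ τ' hτ hF ho => ⟨hτ.1.trans hF le_rfl, by rw [ho, hτ.2]⟩)
    (fun i hi τ hτ hd hd1 => by
      obtain ⟨F, o⟩ := hτ
      obtain ⟨k, τ₁, hk, e, F', o'⟩ := (h₁ (a, i) _ (hB' i hi)) S L s ((d + 1) :: γ) (d + 2) τ E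
        (by simp only [hβ₂] at hL ⊢; omega) ((hR.mono F (by omega)).push (by omega) hd1)
      refine ⟨_, _, ?_, e, ⟨F.trans F' (by omega), ?_⟩, ?_, ?_⟩
      · simp only [hβ₂]; omega
      · rw [o', o, Finset.sum_range_succ]; abel
      · rw [F'.reg _ (by omega), hd]
      · rw [F'.reg _ (by omega), hd1])
    σ₂ ⟨F₁.trans F₂ le_rfl, by simp [hσ₂, o₁]⟩
    (by rw [hσ₂, State.set_reg_ne _ _ (by omega), r₁]) (by simp [hσ₂])
  refine ⟨_, σ', ?_, .seq _ _ _ _ _ _ _ e₁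
    (.seq _ _ _ _ _ _ _ (.const _ _ _ (by omega)) e), F, o⟩
  omega

theorem congr (hf : OComp.{u} f) (h : ∀ (S : Type u) [NonUnitalSemiring S] E a,
    g S E a = f S E a) : OComp.{u} g := by
  have : g = f := by
    funext S _ E a
    exact h S E a
  rwa [this]

/-- Evaluation of a list of numbers into consecutive registers. -/
theorem eval_list (fs : List (α → ℕ)) (hfs : ∀ f ∈ fs, Comp.{u} f) :
    ∃ (code : List ℕ → ℕ → Cmd) (β : ℕ → ℕ), PolyB β ∧ ∀ a B, CBdd a B →
    ∀ (S : Type u) [NonUnitalSemiring S] (L s : ℕ) (γ : List ℕ) (d : ℕ) (σ : State S) (E : ℕ → S),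
      β B < L → Ready a s E γ d σ → ∃ k σ', k ≤ β B ∧ Exec L s (inp a).rom (code γ d) σ k σ' ∧
        Frame d σ σ' ∧ σ'.out = σ.out ∧
        (List.range' d fs.length).map σ'.reg = fs.map fun f => .num (f a) := by
  induction fs with
  | nil =>
    refine ⟨fun _ _ => .skip, fun _ => 1, .const _, fun a B hB => ?_⟩
    intro S _ L s γ d σ E hL hR
    exact ⟨1, σ, le_rfl, .skip _, .refl _ _, rfl, rfl⟩
  | cons f fs ih =>
    obtain ⟨c₁, β₁, hβ₁, h₁⟩ := hfs f (by simp)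
    obtain ⟨c₂, β₂, hβ₂, h₂⟩ := ih fun g hg => hfs g (by simp [hg])
    refine ⟨fun γ d => .seq (c₁ γ d) (c₂ γ (d + 1)), fun B => β₁ B + β₂ B + 1,
      (hβ₁.add hβ₂).add (.const 1), fun a B hB => ?_⟩
    beta_reduce
    obtain ⟨b₁, h₁⟩ := h₁ a B hB
    have h₂ := h₂ a B hB
    intro S _ L s γ d σ E hL hR
    obtain ⟨k₁, σ₁, hk₁, e₁, F₁, o₁, r₁⟩ := h₁ S L s γ d σ E (by omega) hR
    obtain ⟨k₂, σ₂, hk₂, e₂, F₂, o₂, r₂⟩ := h₂ S L s γ (d + 1) σ₁ E (by omega)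
      (hR.mono F₁ (by omega))
    refine ⟨_, σ₂, by omega, .seq _ _ _ _ _ _ _ e₁ e₂, F₁.trans F₂ (by omega), o₂.trans o₁, ?_⟩
    rw [List.length_cons, List.range'_succ, List.map_cons, List.map_cons, r₂,
      F₂.reg d (by omega), r₁]

/-- Emission of a record made of numbers. -/
theorem emit (final : Bool) (fs : List (α → ℕ)) (hfs : ∀ f ∈ fs, Comp.{u} f) :
    OComp.{u} fun _ [NonUnitalSemiring _] _ a => {(final, fs.map fun f => .num (f a))} := by
  obtain ⟨c, β, hβ, h⟩ := eval_list fs hfs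
  refine ⟨fun γ d => .seq (c γ d) (.emit final (List.range' d fs.length)), fun B => β B + 2,
    hβ.add (.const 2), fun a B hB => ?_⟩
  beta_reduce
  intro S _ L s γ d σ E hL hR
  obtain ⟨k₁, σ₁, hk₁, e₁, F₁, o₁, r₁⟩ := h a B hB S L s γ d σ E (by omega) hR
  refine ⟨_, _, by omega, .seq _ _ _ _ _ _ _ e₁ (.emit _ _ _),
      F₁.trans ⟨fun _ _ => rfl, rfl⟩ le_rfl,
    ?_⟩
  simp only [r₁, o₁, Multiset.singleton_add]
  rfl

/-- Emission of a record made of numbers and one semiring element at its end. -/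
theorem emitElt (final : Bool) (fs : List (α → ℕ)) (hfs : ∀ f ∈ fs, Comp.{u} f)
    {e : ∀ (S : Type u) [NonUnitalSemiring S], (ℕ → S) → α → S} (he : EComp.{u} e) :
    OComp.{u} fun S _ E a => {(final, (fs.map fun f => .num (f a)) ++ [.elt (e S E a)])} := by
  obtain ⟨c, β, hβ, h⟩ := eval_list fs hfs
  obtain ⟨c₂, β₂, hβ₂, h₂⟩ := he
  refine ⟨fun γ d => .seq (c₂ γ d) (.seq (c γ (d + 1))
      (.emit final (List.range' (d + 1) fs.length ++ [d]))),
    fun B => β B + β₂ B + 5, (hβ.add hβ₂).add (.const 5), fun a B hB => ?_⟩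
  beta_reduce
  intro S _ L s γ d σ E hL hR
  obtain ⟨k₂, σ₂, hk₂, e₂, F₂, o₂, r₂⟩ := h₂ a B hB S L s γ d σ E (by omega) hR
  obtain ⟨k₁, σ₁, hk₁, e₁, F₁, o₁, r₁⟩ := h a B hB S L s γ (d + 1) σ₂ E (by omega)
    (hR.mono F₂ (by omega))
  refine ⟨_, _, by omega, .seq _ _ _ _ _ _ _ e₂ (.seq _ _ _ _ _ _ _ e₁ (.emit _ _ _)),
    (F₂.trans F₁ (by omega)).trans ⟨fun _ _ => rfl, rfl⟩ le_rfl, ?_⟩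
  simp only [List.map_append, r₁, o₁, o₂, Multiset.singleton_add, List.map_cons, List.map_nil,
    F₁.reg d (by omega), r₂]
  rfl

end OComp

/-- A program for an emission, with exponent `D` for time and word length. Since the code does not
write to the memory, the space consists of the input and of the registers of the program. -/
theorem OComp.computes {f : ∀ (S : Type u) [NonUnitalSemiring S], (ℕ → S) → Inp → Records S}
    (hf : OComp.{u} f) : ∃ (p : Cmd) (D : ℕ), ∀ (S : Type u) [NonUnitalSemiring S] (I : Inp) (B : ℕ)
      (E : ℕ → S) (input : List (Word S)) (space L time : ℕ), I.Bdd B → input.length = 8 * I.len →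
      I.Stored (8 * I.len) (fun i => input.getD i (.num 0)) E → (∀ w ∈ input, w.Fits L) →
      8 * I.len + p.width ≤ space → B ^ D < L → B ^ D ≤ time →
      Computes p L space time I.rom input (f S E I) := by
  obtain ⟨c, β, ⟨D, hD⟩, h⟩ := hf
  refine ⟨c [] 0, D, fun S _ I B E input space L time hI hlen hst hfit hsp hL ht => ?_⟩
  have hβ := hD B hI.two
  obtain ⟨k, σ, hk, e, -, o⟩ := h I B ⟨hI, by simp [Ctx.vars]⟩ S L (8 * I.len) [] 0
    (State.init input) E (by omega) ⟨hst, List.Forall₂.nil⟩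
  exact ⟨8 * I.len, k, σ, hsp, by omega, by omega, hfit, e, by simpa [State.init] using o⟩

/-! ### The parameters of the algorithm can be computed -/

/-- Counting the numbers below a threshold. -/
theorem sum_range_ite_of_iff_lt {N k : ℕ} {P : ℕ → Prop} [DecidablePred P]
    (h : ∀ i < N, (P i ↔ i < k)) (hk : k ≤ N) :
    (∑ i ∈ Finset.range N, if P i then 1 else 0) = k := by
  rw [Finset.sum_congr rfl (g := fun i => if i < k then 1 else 0) fun i hi => by
    simp only [h i (Finset.mem_range.1 hi)], ← Finset.card_filter]
  rw [show (Finset.range N).filter (· < k) = Finset.range k by ext; simp; omega,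
    Finset.card_range]

/-- Square roots are computed by counting the positive numbers whose square is small enough. -/
theorem Comp.sqrt {f : α → ℕ} (hf : Comp.{u} f) : Comp.{u} fun a => Nat.sqrt (f a) := by
  have h1 : Comp.{u} fun p : α × ℕ => p.2 + 1 := Comp.var.add (.const 1)
  refine (hf.sum (f := fun a i => if (i + 1) * (i + 1) ≤ f a then 1 else 0)
    (CompP.le (h1.mul h1) hf.weaken).toComp).congr fun a => ?_
  rw [sum_range_ite_of_iff_lt (k := Nat.sqrt (f a))]
  · intro i _
    rw [← Nat.le_sqrt]
    omega
  · exact Nat.sqrt_le_self _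

theorem min_iterate_mul {b N : ℕ} (hb : 1 ≤ b) (i : ℕ) :
    (fun y => min (y * b) N)^[i] (min 1 N) = min (b ^ i) N := by
  induction i with
  | zero => simp
  | succ i ih =>
    rw [Function.iterate_succ_apply', ih, pow_succ]
    rcases le_total (b ^ i) N with h | h
    · rw [min_eq_left h]
    · rw [min_eq_right h, min_eq_right (Nat.le_mul_of_pos_right _ hb),
        min_eq_right (h.trans (Nat.le_mul_of_pos_right _ hb))]

theorem Comp.min {f g : α → ℕ} (hf : Comp.{u} f) (hg : Comp.{u} g) :
    Comp.{u} fun a => min (f a) (g a) :=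
  (Comp.ite (CompP.le hf hg) hf hg).congr fun a => by rw [min_def]

theorem Comp.max {f g : α → ℕ} (hf : Comp.{u} f) (hg : Comp.{u} g) :
    Comp.{u} fun a => max (f a) (g a) :=
  (Comp.ite (CompP.le hf hg) hg hf).congr fun a => by rw [max_def]

/-- Logarithms are computed by counting powers, which are cut off to keep the numbers small. -/
theorem Comp.clog {b N : α → ℕ} (hb : Comp.{u} b) (hN : Comp.{u} N) :
    Comp.{u} fun a => Nat.clog (b a) (N a) := by
  have hp : Comp.{u} fun p : α × ℕ =>
      (fun y => Min.min (y * b p.1) (N p.1))^[p.2] (Min.min 1 (N p.1)) :=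
    Comp.iterate (f := fun p y => y * b p.1) Comp.var ((Comp.const 1).min hN.weaken) hN.weaken
      (Comp.var.mul hb.weaken.weaken)
  refine (Comp.ite (CompP.lt (.const 1) hb)
    (hN.sum (f := fun a i => if (fun y => Min.min (y * b a) (N a))^[i] (Min.min 1 (N a)) < N a
      then 1 else 0) (CompP.lt hp hN.weaken).toComp) (.const 0)).congr fun a => ?_
  split_ifs with h
  · rw [sum_range_ite_of_iff_lt]
    · intro i hi
      rw [min_iterate_mul h.le, min_lt_iff]
      simp only [lt_irrefl, or_false]
      rw [← not_iff_not, not_lt, not_lt, Nat.clog_le_iff_le_pow h]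
    · exact (Nat.clog_le_iff_le_pow h).2 (Nat.lt_pow_self h).le
  · exact Nat.clog_of_left_le_one (by omega) _

/-- Bounded search for a divisor decides primality. -/
theorem CompP.prime {f : α → ℕ} (hf : Comp.{u} f) : CompP.{u} fun a => (f a).Prime := by
  have h : Comp.{u} fun a =>
      ∑ d ∈ Finset.range (f a), if 2 ≤ d ∧ f a % d = 0 then 1 else 0 :=
    hf.sum (f := fun a d => if 2 ≤ d ∧ f a % d = 0 then 1 else 0)
      ((CompP.le (.const 2) .var).and (CompP.eq (hf.weaken.mod .var) (.const 0))).toComp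
  refine ((CompP.le (.const 2) hf).and (CompP.eq h (.const 0))).congr fun a => ?_
  rw [Finset.sum_eq_zero_iff, Nat.prime_def_lt]
  refine and_congr_right fun h2 => forall_congr' fun d => ?_
  simp only [Finset.mem_range, ite_eq_right_iff, one_ne_zero, imp_false, not_and]
  constructor
  · intro h hd h2' h3
    have := h hd (Nat.dvd_of_mod_eq_zero h3)
    omega
  · intro h hd h3
    by_contra h4
    have : d ≠ 0 := by rintro rfl; simp at h3; omega
    exact h hd (by omega) (Nat.mod_eq_zero_of_dvd h3)

/-- The smallest prime that is at least `N`, found below `2 N` by Bertrand's postulate. -/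
theorem Comp.nextPrime {f : α → ℕ} (hf : Comp.{u} f) :
    Comp.{u} fun a => Nat.find (Nat.exists_infinite_primes (f a)) := by
  have hin : Comp.{u} fun p : α × ℕ =>
      ∑ j ∈ Finset.range (p.2 + 1), if (f p.1 + j).Prime then 1 else 0 :=
    (Comp.var.add (.const 1)).sum (f := fun p j => if (f p.1 + j).Prime then 1 else 0)
      (CompP.prime (hf.weaken.weaken.add .var)).toComp
  refine (hf.add ((hf.add (.const 3)).sum
    (f := fun a i => if (∑ j ∈ Finset.range (i + 1), if (f a + j).Prime then 1 else 0) = 0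
      then 1 else 0) (CompP.eq hin (.const 0)).toComp)).congr fun a => ?_
  obtain ⟨h1, h2⟩ := Nat.find_spec (Nat.exists_infinite_primes (f a))
  set q := Nat.find (Nat.exists_infinite_primes (f a)) with hq
  have hmin : ∀ x, f a ≤ x → x.Prime → q ≤ x := fun x hx hp => Nat.find_min' _ ⟨hx, hp⟩
  rw [sum_range_ite_of_iff_lt (k := q - f a)]
  · omega
  · intro i _
    rw [Finset.sum_eq_zero_iff]
    simp only [Finset.mem_range, ite_eq_right_iff, one_ne_zero, imp_false]
    constructor
    · intro h
      by_contra h3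
      exact h (q - f a) (by omega) (by rwa [Nat.add_sub_cancel' h1])
    · intro h j hj hp
      have := hmin _ (by omega) hp
      omega
  · rcases Nat.eq_zero_or_pos (f a) with h0 | h0
    · have := hmin 2 (by omega) Nat.prime_two
      omega
    · obtain ⟨x, hx, h3, h4⟩ := Nat.exists_prime_lt_and_le_two_mul (f a) (by omega)
      have := hmin x (by omega) hx
      omega

end Ram

namespace R1
open Ram Ctx
universe u
variable {α : Type} [Ctx α]

/-- The parameters of the algorithm, as read by a reducer. -/
def parm (I : Inp) : Params := ⟨I.rom 0, I.rom 1, I.rom 2, I.rom 3⟩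

namespace Params

theorem comp_q : Comp.{u} fun a : α => (parm (inp a)).q := (Comp.const 0).rom
theorem comp_m : Comp.{u} fun a : α => (parm (inp a)).m := (Comp.const 1).rom
theorem comp_nt : Comp.{u} fun a : α => (parm (inp a)).nt := (Comp.const 3).rom

theorem comp_n : Comp.{u} fun a : α => (parm (inp a)).n :=
  (comp_q.mul comp_q).congr fun _ => pow_two _

theorem comp_mem : Comp.{u} fun a : α => (parm (inp a)).mem :=
  ((Comp.const 2).rom.min (comp_n.mul comp_n)).congr fun a => by rw [mem, pow_two]; rfl

theorem comp_b : Comp.{u} fun a : α => (parm (inp a)).b := comp_m.sqrt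

theorem comp_g : Comp.{u} fun a : α => (parm (inp a)).g :=
  ((comp_q.add comp_b).sub (.const 1)).div comp_b

theorem comp_t : Comp.{u} fun a : α => (parm (inp a)).t := Comp.const 384

theorem comp_Δ : Comp.{u} fun a : α => (parm (inp a)).Δ :=
  ((Comp.const 12).mul (.clog (.const 2) ((Comp.const 2).mul comp_n))).add (.const 1)

theorem comp_H : Comp.{u} fun a : α => (parm (inp a)).H := comp_t.mul comp_Δ

theorem comp_prime : Comp.{u} fun a : α => (parm (inp a)).prime :=
  ((comp_n.mul (comp_n.mul comp_n)).nextPrime).congr fun a => by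
    unfold prime
    congr! 1
    ext x
    rw [show (parm (inp a)).n ^ 3 = (parm (inp a)).n *
        ((parm (inp a)).n * (parm (inp a)).n) by ring]

theorem comp_bins : Comp.{u} fun a : α => (parm (inp a)).bins :=
  ((comp_mem.add comp_m).sub (.const 1)).div comp_m

theorem comp_fan : Comp.{u} fun a : α => (parm (inp a)).fan :=
  (Comp.const 2).max (comp_m.div comp_H)

theorem comp_estGroups : Comp.{u} fun a : α => (parm (inp a)).estGroups :=
  (Comp.const 1).max ((comp_mem.div comp_nt).min comp_g)

theorem comp_phases : Comp.{u} fun a : α => (parm (inp a)).phases :=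
  ((comp_g.add comp_estGroups).sub (.const 1)).div comp_estGroups

theorem comp_estRound : Comp.{u} fun a : α => (parm (inp a)).estRound :=
  (comp_phases.add (.clog comp_fan comp_bins)).add (.const 2)

theorem comp_mulGroups {e : α → ℕ} (he : Comp.{u} e) :
    Comp.{u} fun a : α => (parm (inp a)).mulGroups (e a) :=
  (Comp.const 1).max ((comp_mem.div (comp_nt.add ((Comp.const 2).mul he))).min comp_g)

theorem comp_mulPhases {K : α → ℕ} (hK : Comp.{u} K) :
    Comp.{u} fun a : α => (parm (inp a)).mulPhases (K a) :=
  ((comp_g.add hK).sub (.const 1)).div hK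

end Params
end R1

namespace Ram
open Ctx
universe u
variable {α : Type} [Ctx α]

theorem sum_ite_pos_iff {N : ℕ} {P : ℕ → Prop} [DecidablePred P] :
    (0 < ∑ i ∈ Finset.range N, if P i then 1 else 0) ↔ ∃ i < N, P i := by
  rw [← Finset.card_filter, Finset.card_pos]
  simp [Finset.Nonempty]

theorem CompP.exists {b : α → ℕ} {P : α → ℕ → Prop}
    (hb : Comp.{u} b)
    (hP : CompP.{u} fun p : α × ℕ => P p.1 p.2) : CompP.{u} fun a => ∃ i < b a, P a i := by
  classical
  exact (CompP.lt (.const 0) (hb.sum (f := fun a i => if P a i then 1 else 0) hP.toComp)).congr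
    fun _ => sum_ite_pos_iff.symm

/-- Lists of computable numbers. -/
def CompL (fs : List (α → ℕ)) : Prop := ∀ f ∈ fs, Comp.{u} f

theorem CompL.nil : CompL.{u} ([] : List (α → ℕ)) := fun _ h => absurd h (by simp)

theorem CompL.cons {f : α → ℕ} {fs : List (α → ℕ)} (hf : Comp.{u} f) (hfs : CompL.{u} fs) :
    CompL.{u} (f :: fs) := List.forall_mem_cons.2 ⟨hf, hfs⟩

theorem CompL.append {fs gs : List (α → ℕ)} (hf : CompL.{u} fs) (hg : CompL.{u} gs) :
    CompL.{u} (fs ++ gs) := List.forall_mem_append.2 ⟨hf, hg⟩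

end Ram

namespace R1
open Ram Ctx
universe u
variable {α : Type} [Ctx α]

/-! ### The reducers as sums over their input -/

section

variable {S : Type u} [NonUnitalSemiring S]

/-- The semiring element of the `i`-th value. -/
def eltAt (I : Inp) (E : ℕ → S) (i : ℕ) : S :=
  if i < I.len ∧ (I.num i 0 = 0 ∨ I.num i 0 = 4) then E i else 0

/-- The words of the `i`-th value. -/
def msgWords (I : Inp) (E : ℕ → S) (i : ℕ) : List (Word S) :=
  [.num (I.num i 0), .num (I.num i 1), .num (I.num i 2), .num (I.num i 3), .num (I.num i 4),
    .num (I.num i 5), .num (I.num i 6),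
    if I.num i 0 = 0 ∨ I.num i 0 = 4 then .elt (eltAt I E i) else .num 0]

/-- The `i`-th value is an entry of the matrix with flag `c`. -/
abbrev IsEntry (I : Inp) (c i : ℕ) : Prop := I.num i 0 = 0 ∧ I.num i 1 = c

/-- The `i`-th value belongs to a pseudosketch and comes from the matrix with flag `c`. -/
abbrev IsPseudo (I : Inp) (c i : ℕ) : Prop := I.num i 0 = 1 ∧ I.num i 1 = c

/-- The hash function with index `w`, evaluated with the coefficients among the parameters. -/
def hashI (I : Inp) (w x : ℕ) : ℕ :=
  (I.rom (12 + 2 * w) * x + I.rom (13 + 2 * w)) % (parm I).prime + 1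

/-- The number of entries of the matrix with flag `c` among the values. -/
def countI (I : Inp) (c : ℕ) : ℕ := ∑ i ∈ Finset.range I.len, if IsEntry I c i then 1 else 0

/-- Membership in the set of hash values of the stream of a pair of submatrices. -/
abbrev MemPair (I : Inp) (w v : ℕ) : Prop :=
  ∃ i < I.len, ∃ j < I.len, IsEntry I 1 i ∧ IsEntry I 0 j ∧ I.num i 3 = I.num j 2 ∧
    hashI I w (I.num i 2 * (parm I).q + I.num j 3) = v

/-- Membership in list `w` of the union of the sketches among the values. -/
abbrev MemSketch (I : Inp) (w v : ℕ) : Prop :=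
  ∃ i < I.len, I.num i 0 = 2 ∧ I.num i 1 = w ∧ I.num i 2 = v

/-- Membership in the set of hash values of the stream that the pseudosketches among the values
describe. -/
abbrev MemPseudo (I : Inp) (w v : ℕ) : Prop :=
  ∃ i < I.len, ∃ j < I.len, IsPseudo I 1 i ∧ IsPseudo I 0 j ∧
    (I.num i 4 = I.num j 4 ∧ I.num i 5 = I.num j 5 ∧ I.num i 6 = I.num j 6) ∧
    I.num i 3 = I.num j 2 ∧ hashI I w (I.num i 2 * (parm I).q + I.num j 3) = v

/-- Membership in the set of values from which a merging reducer selects the smallest ones. -/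
abbrev MemMerge (I : Inp) (w v : ℕ) : Prop := MemSketch I w v ∨ MemPseudo I w v

/-- Membership among the `t` smallest elements. Counting the smaller members replaces sorting, so
that no work space is needed. -/
abbrev Small (mem : Inp → ℕ → ℕ → Prop) [∀ I w v, Decidable (mem I w v)] (I : Inp) (w v : ℕ) :
    Prop :=
  mem I w v ∧ (∑ u ∈ Finset.range v, if mem I w u then 1 else 0) < (parm I).t

/-- A strict upper bound on all hash values that can occur. -/
def hashBound (I : Inp) : ℕ := (parm I).prime + 2 + ∑ i ∈ Finset.range I.len, I.num i 2

/-- The records of the sketch of the sets given by `mem`, sent to the key with the given code. -/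
def sketchRec (mem : Inp → ℕ → ℕ → Prop) [∀ I w v, Decidable (mem I w v)] (key : List ℕ)
    (I : Inp) : Records S :=
  ∑ w ∈ Finset.range (parm I).Δ, ∑ v ∈ Finset.range (hashBound I),
    if Small mem I w v then {(false, (key ++ [2, w, v, 0, 0, 0, 0, 0]).map .num)} else 0

/-- The length of list `w` of the sketch. -/
def listCard (I : Inp) (w : ℕ) : ℕ :=
  ∑ v ∈ Finset.range (hashBound I), if Small MemSketch I w v then 1 else 0

/-- The largest value of list `w` of the sketch, as the number of all smaller numbers. -/
def listSup (I : Inp) (w : ℕ) : ℕ :=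
  ∑ u ∈ Finset.range (hashBound I),
    if ∃ v < hashBound I, u < v ∧ Small MemSketch I w v then 1 else 0

/-- The estimate that list `w` yields. -/
def listEst (I : Inp) (w : ℕ) : ℕ :=
  if listCard I w < (parm I).t then listCard I w else (parm I).t * (parm I).prime / listSup I w

/-- The median, as the number of `e` such that at most half of the estimates are at most `e`. -/
def estI (I : Inp) : ℕ :=
  ∑ e ∈ Finset.range ((parm I).t + (parm I).t * (parm I).prime + 1),
    if (∑ w ∈ Finset.range (parm I).Δ, if listEst I w ≤ e then 1 else 0) ≤ (parm I).Δ / 2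
      then 1 else 0

/-- The `i`-th value is an entry in submatrix pair `(u, v)` of group `l`. -/
abbrev PlaceI (I : Inp) (i u v l : ℕ) : Prop :=
  I.num i 1 = 1 ∧ u = I.num i 2 / (parm I).b ∧ (u + v + l) % (parm I).g = I.num i 3 / (parm I).b ∨
    ¬ I.num i 1 = 1 ∧ v = I.num i 3 / (parm I).b ∧
      (u + v + l) % (parm I).g = I.num i 2 / (parm I).b

/-- The records of the copies of all entries for the groups `c K + s`, `s < K`. -/
def copiesRec (key : ℕ → ℕ → ℕ → List ℕ) (K c : ℕ) (I : Inp) (E : ℕ → S) : Records S :=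
  ∑ s ∈ Finset.range K, if c * K + s < (parm I).g then
    ∑ i ∈ Finset.range I.len, if I.num i 0 = 0 then
      ∑ u ∈ Finset.range (parm I).g, ∑ v ∈ Finset.range (parm I).g,
        if PlaceI I i u v (c * K + s) then {(false, (key u v s).map .num ++ msgWords I E i)} else 0
      else 0
    else 0

/-- All values are sent to the reducer's own key. -/
def keepRec (I : Inp) (E : ℕ → S) : Records S :=
  ∑ i ∈ Finset.range I.len,
    {(false, ([I.rom 7, I.rom 8, I.rom 9, I.rom 10, I.rom 11].map .num) ++ msgWords I E i)}

/-- The records of a reducer that stores an entry. -/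
def homeRec (I : Inp) (E : ℕ → S) : Records S :=
  if I.rom 4 ≤ (parm I).estRound then
    keepRec I E + if I.rom 4 < (parm I).phases then
      copiesRec (fun i j s => [1, i, j, I.rom 4 * (parm I).estGroups + s, 0])
        (parm I).estGroups (I.rom 4) I E
    else 0
  else ∑ i ∈ Finset.range I.len, if I.num i 0 = 3 then
    if I.rom 4 - ((parm I).estRound + 1) < (parm I).mulPhases ((parm I).mulGroups (I.num i 1)) then
      keepRec I E + copiesRec (fun i' j s => [4, (parm I).mulGroups (I.num i 1), i', j, s])
        ((parm I).mulGroups (I.num i 1)) (I.rom 4 - ((parm I).estRound + 1)) I E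
    else 0
  else 0

/-- The records of the reducer for a pair of submatrices in the estimation. -/
def pairRec (I : Inp) (_E : ℕ → S) : Records S :=
  if countI I 1 = 0 ∨ countI I 0 = 0 then 0
  else if (parm I).H < countI I 1 + countI I 0 then sketchRec MemPair [2, I.rom 5, 0, 0, 0] I
  else ∑ i ∈ Finset.range I.len, if I.num i 0 = 0 then
    {(false, [2, I.rom 5, 0, 0, 0, 1, I.num i 1, I.num i 2, I.num i 3, I.rom 8, I.rom 9, I.rom 10,
      0].map .num)}
  else 0

/-- The records of a reducer to which sketches are assigned at random. -/
def binRec (I : Inp) (_E : ℕ → S) : Records S :=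
  if I.rom 4 ≤ (parm I).phases then sketchRec MemMerge [2, I.rom 5, 0, 0, 0] I
  else sketchRec MemMerge [3, I.rom 8 / (parm I).fan, 0, 0, 0] I

/-- The records of a node of the tree that combines the sketches. -/
def nodeRec (I : Inp) (_E : ℕ → S) : Records S :=
  if I.rom 4 < (parm I).estRound then sketchRec MemMerge [3, I.rom 8 / (parm I).fan, 0, 0, 0] I
  else ∑ k ∈ Finset.range (parm I).nt,
    ({(false, [0, 1, k, 0, 0, 3, estI I, 0, 0, 0, 0, 0, 0].map .num)} +
      {(false, [0, 0, k, 0, 0, 3, estI I, 0, 0, 0, 0, 0, 0].map .num)})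

/-- The `i`-th value is a contribution to entry `(x, y)`. -/
abbrev IsPart (I : Inp) (x y i : ℕ) : Prop := I.num i 0 = 4 ∧ I.num i 1 = x ∧ I.num i 2 = y

/-- The `i`-th and the `j`-th value are entries whose product contributes to entry `(x, y)`. -/
abbrev IsProduct (I : Inp) (x y i j : ℕ) : Prop :=
  (IsEntry I 1 i ∧ IsEntry I 0 j) ∧ I.num i 2 = x ∧ I.num j 3 = y ∧ I.num i 3 = I.num j 2

/-- The number of contributions to entry `(x, y)`. -/
def countContr (I : Inp) (x y : ℕ) : ℕ :=
  (∑ i ∈ Finset.range I.len, if IsPart I x y i then 1 else 0) +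
    ∑ i ∈ Finset.range I.len, ∑ j ∈ Finset.range I.len, if IsProduct I x y i j then 1 else 0

/-- The sum of the partial sums for entry `(x, y)`. -/
def sumParts (I : Inp) (E : ℕ → S) (x y : ℕ) : S :=
  ∑ i ∈ Finset.range I.len, if IsPart I x y i then eltAt I E i else 0

/-- The sum of all contributions to entry `(x, y)`. -/
def sumContr (I : Inp) (E : ℕ → S) (x y : ℕ) : S :=
  sumParts I E x y + ∑ i ∈ Finset.range I.len, ∑ j ∈ Finset.range I.len,
    if IsProduct I x y i j then eltAt I E i * eltAt I E j else 0

/-- The records of a reducer that multiplies two submatrices. -/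
def prodRec (I : Inp) (E : ℕ → S) : Records S :=
  ∑ u ∈ Finset.range (parm I).b, ∑ v ∈ Finset.range (parm I).b,
    if countContr I (I.rom 9 * (parm I).b + u) (I.rom 10 * (parm I).b + v) = 0 then 0
    else if I.rom 4 - ((parm I).estRound + 2) + 1 < (parm I).mulPhases (I.rom 8) then
      {(false, [4, I.rom 8, I.rom 9, I.rom 10, I.rom 11, 4, I.rom 9 * (parm I).b + u,
        I.rom 10 * (parm I).b + v, 0, 0, 0, 0].map .num ++
          [.elt (sumContr I E (I.rom 9 * (parm I).b + u) (I.rom 10 * (parm I).b + v))])}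
    else
      {(false, [5, I.rom 8, I.rom 9 * (parm I).b + u, I.rom 10 * (parm I).b + v,
        I.rom 11 / (parm I).m, 4, I.rom 9 * (parm I).b + u,
        I.rom 10 * (parm I).b + v, 0, 0, 0, 0].map .num ++
          [.elt (sumContr I E (I.rom 9 * (parm I).b + u) (I.rom 10 * (parm I).b + v))])}

/-- The records of a node of a tree that adds up partial sums. -/
def cellRec (I : Inp) (E : ℕ → S) : Records S :=
  if I.rom 4 - ((parm I).estRound + (parm I).mulPhases (I.rom 8) + 2) + 1 <
      Nat.clog (parm I).m (I.rom 8) then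
    {(false, [5, I.rom 8, I.rom 9, I.rom 10, I.rom 11 / (parm I).m, 4, I.rom 9, I.rom 10, 0, 0, 0,
      0].map .num ++ [.elt (sumParts I E (I.rom 9) (I.rom 10))])}
  else {(true, [I.rom 9, I.rom 10].map .num ++ [.elt (sumParts I E (I.rom 9) (I.rom 10))])}

/-- The records of all reducers, by the tag of the key. Every reducer is a sum over ranges that uses
nothing but the numbers and the elements of its input, so that no work space beyond a constant
number of registers is needed. -/
def allRec (I : Inp) (E : ℕ → S) : Records S :=
  if I.rom 7 = 0 then homeRec I E else if I.rom 7 = 1 then pairRec I E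
  else if I.rom 7 = 2 then binRec I E else if I.rom 7 = 3 then nodeRec I E
  else if I.rom 7 = 4 then prodRec I E else cellRec I E

end

section Computability

theorem comp_rom (k : ℕ) : Comp.{u} fun a : α => (inp a).rom k := (Comp.const k).rom

variable {w v x i j : α → ℕ}

theorem comp_hashI (hw : Comp.{u} w) (hx : Comp.{u} x) :
    Comp.{u} fun a => hashI (inp a) (w a) (x a) :=
  (((((Comp.const 12).add ((Comp.const 2).mul hw)).rom.mul hx).add
    ((Comp.const 13).add ((Comp.const 2).mul hw)).rom).mod Params.comp_prime).add (.const 1)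

theorem comp_field (hi : Comp.{u} i) (f : ℕ) (hf : f < 7 := by norm_num) :
    Comp.{u} fun a => (inp a).num (i a) f := hi.get hf

theorem comp_isEntry (c : ℕ) (hi : Comp.{u} i) : CompP.{u} fun a => IsEntry (inp a) c (i a) :=
  (CompP.eq (comp_field hi 0) (.const 0)).and (CompP.eq (comp_field hi 1) (.const c))

theorem comp_isPseudo (c : ℕ) (hi : Comp.{u} i) : CompP.{u} fun a => IsPseudo (inp a) c (i a) :=
  (CompP.eq (comp_field hi 0) (.const 1)).and (CompP.eq (comp_field hi 1) (.const c))

theorem comp_countI (c : ℕ) : Comp.{u} fun a : α => countI (inp a) c :=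
  Comp.len.sum (f := fun a i => if IsEntry (inp a) c i then 1 else 0) (comp_isEntry c .var).toComp

theorem comp_memPair (hw : Comp.{u} w) (hv : Comp.{u} v) :
    CompP.{u} fun a => MemPair (inp a) (w a) (v a) := by
  refine CompP.exists Comp.len (CompP.exists Comp.len ?_)
  exact (comp_isEntry 1 Comp.var.weaken).and ((comp_isEntry 0 Comp.var).and
    ((CompP.eq (comp_field Comp.var.weaken 3) (comp_field Comp.var 2)).and
      (CompP.eq (comp_hashI hw.weaken.weaken (((comp_field Comp.var.weaken 2).mul
        Params.comp_q).add (comp_field Comp.var 3))) hv.weaken.weaken)))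

theorem comp_memSketch (hw : Comp.{u} w) (hv : Comp.{u} v) :
    CompP.{u} fun a => MemSketch (inp a) (w a) (v a) := by
  refine CompP.exists Comp.len ?_
  exact (CompP.eq (comp_field Comp.var 0) (.const 2)).and
    ((CompP.eq (comp_field Comp.var 1) hw.weaken).and
      (CompP.eq (comp_field Comp.var 2) hv.weaken))

theorem comp_memPseudo (hw : Comp.{u} w) (hv : Comp.{u} v) :
    CompP.{u} fun a => MemPseudo (inp a) (w a) (v a) := by
  refine CompP.exists Comp.len (CompP.exists Comp.len ?_)
  have h : ∀ f g (_ : f < 7) (_ : g < 7), CompP.{u} fun p : (α × ℕ) × ℕ =>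
      (inp p).num p.1.2 f = (inp p).num p.2 g := fun f g hf hg =>
    CompP.eq (comp_field Comp.var.weaken f hf) (comp_field Comp.var g hg)
  exact (comp_isPseudo 1 Comp.var.weaken).and ((comp_isPseudo 0 Comp.var).and
    (((h 4 4 (by norm_num) (by norm_num)).and ((h 5 5 (by norm_num) (by norm_num)).and
      (h 6 6 (by norm_num) (by norm_num)))).and
    ((h 3 2 (by norm_num) (by norm_num)).and
      (CompP.eq (comp_hashI hw.weaken.weaken (((comp_field Comp.var.weaken 2).mul
        Params.comp_q).add (comp_field Comp.var 3))) hv.weaken.weaken))))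

theorem comp_memMerge (hw : Comp.{u} w) (hv : Comp.{u} v) :
    CompP.{u} fun a => MemMerge (inp a) (w a) (v a) :=
  (comp_memSketch hw hv).or (comp_memPseudo hw hv)

/-- Computability of a set of numbers for each list of a sketch, in all contexts. -/
def CompMem (mem : Inp → ℕ → ℕ → Prop) : Prop :=
  ∀ {β : Type} [Ctx β] {w v : β → ℕ}, Comp.{u} w → Comp.{u} v →
    CompP.{u} fun a => mem (inp a) (w a) (v a)

theorem compMem_memPair : CompMem.{u} fun I w v => MemPair I w v := comp_memPair
theorem compMem_memSketch : CompMem.{u} fun I w v => MemSketch I w v := comp_memSketch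
theorem compMem_memMerge : CompMem.{u} fun I w v => MemMerge I w v := comp_memMerge

variable {mem : Inp → ℕ → ℕ → Prop} [∀ I w v, Decidable (mem I w v)]

theorem comp_small (hm : CompMem.{u} mem) (hw : Comp.{u} w) (hv : Comp.{u} v) :
    CompP.{u} fun a => Small mem (inp a) (w a) (v a) :=
  (hm hw hv).and (CompP.lt (hv.sum (f := fun a u => if mem (inp a) (w a) u then 1 else 0)
    (hm hw.weaken .var).toComp) Params.comp_t)

theorem comp_hashBound : Comp.{u} fun a : α => hashBound (inp a) :=
  (Params.comp_prime.add (.const 2)).add (Comp.len.sum (f := fun a i => (inp a).num i 2)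
    (comp_field .var 2))

theorem ocomp_sketchRec (hm : CompMem.{u} mem) (ks : List (α → ℕ)) (hks : CompL.{u} ks) :
    OComp.{u} fun S _ _ a => sketchRec (S := S) mem (ks.map fun f => f a) (inp a) := by
  have hks' : CompL.{u} (ks.map fun (f : α → ℕ) (p : (α × ℕ) × ℕ) => f p.1.1) := by
    intro f hf
    obtain ⟨g, hg, rfl⟩ := List.mem_map.1 hf
    exact (hks g hg).weaken.weaken
  have hem := OComp.emit false ((ks.map fun (f : α → ℕ) (p : (α × ℕ) × ℕ) => f p.1.1) ++
    [fun _ => 2, fun p => p.1.2, fun p => p.2, fun _ => 0, fun _ => 0, fun _ => 0, fun _ => 0,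
      fun _ => 0]) (hks'.append
      (.cons (.const _) (.cons Comp.var.weaken (.cons .var (.cons (.const _) (.cons (.const _)
        (.cons (.const _) (.cons (.const _) (.cons (.const _) .nil)))))))))
  unfold sketchRec
  refine OComp.sum Params.comp_Δ (OComp.sum comp_hashBound ?_)
  refine OComp.ite (comp_small hm Comp.var.weaken .var) ?_ .zero
  refine hem.congr fun S _ E a => ?_
  simp [Function.comp_def]

theorem comp_listCard (hw : Comp.{u} w) : Comp.{u} fun a => listCard (inp a) (w a) :=
  comp_hashBound.sum (f := fun a v => if Small MemSketch (inp a) (w a) v then 1 else 0)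
    (comp_small compMem_memSketch hw.weaken .var).toComp

theorem comp_listSup (hw : Comp.{u} w) : Comp.{u} fun a => listSup (inp a) (w a) := by
  unfold listSup
  exact comp_hashBound.sum (CompP.exists comp_hashBound ((CompP.lt Comp.var.weaken .var).and
    (comp_small compMem_memSketch hw.weaken.weaken .var))).toComp

theorem comp_listEst (hw : Comp.{u} w) : Comp.{u} fun a => listEst (inp a) (w a) :=
  Comp.ite (CompP.lt (comp_listCard hw) Params.comp_t) (comp_listCard hw)
    ((Params.comp_t.mul Params.comp_prime).div (comp_listSup hw))

theorem comp_estI : Comp.{u} fun a : α => estI (inp a) := by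
  refine ((Params.comp_t.add (Params.comp_t.mul Params.comp_prime)).add (.const 1)).sum
    (f := fun a e => if (∑ w ∈ Finset.range (parm (inp a)).Δ, if listEst (inp a) w ≤ e
      then 1 else 0) ≤ (parm (inp a)).Δ / 2 then 1 else 0) ?_
  refine CompP.toComp <| CompP.le (Params.comp_Δ.sum (α := α × ℕ)
    (f := fun p w => if listEst (inp p) w ≤ p.2 then 1 else 0) ?_)
    (Params.comp_Δ.div (.const 2))
  exact (CompP.le (comp_listEst .var) Comp.var.weaken).toComp

theorem ecomp_eltAt (hi : Comp.{u} i) :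
    EComp.{u} fun _ _ E a => eltAt (inp a) E (i a) := EComp.get hi

theorem ocomp_emit_msgWords (ks : List (α → ℕ)) (hks : CompL.{u} ks) (hi : Comp.{u} i) :
    OComp.{u} fun S _ E a => {(false, (ks.map fun f => f a).map .num ++
      msgWords (S := S) (inp a) E (i a))} := by
  have h7 : CompL.{u} ([fun a => (inp a).num (i a) 0, fun a => (inp a).num (i a) 1,
      fun a => (inp a).num (i a) 2, fun a => (inp a).num (i a) 3, fun a => (inp a).num (i a) 4,
      fun a => (inp a).num (i a) 5, fun a => (inp a).num (i a) 6] : List (α → ℕ)) :=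
    .cons (comp_field hi 0) (.cons (comp_field hi 1) (.cons (comp_field hi 2)
      (.cons (comp_field hi 3) (.cons (comp_field hi 4) (.cons (comp_field hi 5)
        (.cons (comp_field hi 6) .nil))))))
  have h1 := OComp.emitElt false _ (hks.append h7) (ecomp_eltAt hi)
  have h2 := OComp.emit false _ ((hks.append h7).append (.cons (.const 0) .nil))
  refine (OComp.ite ((CompP.eq (comp_field hi 0) (.const 0)).or
    (CompP.eq (comp_field hi 0) (.const 4))) h1 h2).congr fun S _ E a => ?_
  split_ifs with h <;> simp [msgWords, h]

theorem ocomp_keepRec : OComp.{u} fun S _ E (a : α) => keepRec (S := S) (inp a) E := by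
  unfold keepRec
  refine OComp.sum Comp.len ?_
  exact ocomp_emit_msgWords (α := α × ℕ) (i := fun p => p.2) [fun p => (inp p).rom 7,
    fun p => (inp p).rom 8, fun p => (inp p).rom 9, fun p => (inp p).rom 10,
    fun p => (inp p).rom 11]
    (.cons (comp_rom 7) (.cons (comp_rom 8) (.cons (comp_rom 9) (.cons (comp_rom 10)
      (.cons (comp_rom 11) .nil))))) .var

/-- The key of a copy is given by its words, as functions of `(((a, s), i), u), v`. -/
theorem ocomp_copiesRec {key : α → ℕ → ℕ → ℕ → List ℕ}
    (ks : List (((((α × ℕ) × ℕ) × ℕ) × ℕ) → ℕ)) (hks : CompL.{u} ks)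
    (hkey : ∀ a s i u v, key a u v s = ks.map fun f => f ((((a, s), i), u), v)) {K c : α → ℕ}
    (hK : Comp.{u} K) (hc : Comp.{u} c) :
    OComp.{u} fun S _ E a => copiesRec (S := S) (key a) (K a) (c a) (inp a) E := by
  have hl : Comp.{u} fun p : α × ℕ => c p.1 * K p.1 + p.2 :=
    (hc.weaken.mul hK.weaken).add .var
  have hx : ∀ f (_ : f < 7), Comp.{u} fun p : (((α × ℕ) × ℕ) × ℕ) × ℕ => (inp p).num p.1.1.2 f :=
    fun f hf => comp_field Comp.var.weaken.weaken f hf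
  have hmod : Comp.{u} fun p : (((α × ℕ) × ℕ) × ℕ) × ℕ =>
      (p.1.2 + p.2 + (c p.1.1.1.1 * K p.1.1.1.1 + p.1.1.1.2)) % (parm (inp p)).g :=
    (((Comp.var.weaken).add .var).add hl.weaken.weaken.weaken).mod Params.comp_g
  unfold copiesRec
  refine OComp.sum hK (OComp.ite (CompP.lt hl Params.comp_g) ?_ .zero)
  refine OComp.sum Comp.len (OComp.ite (CompP.eq (comp_field .var 0) (.const 0)) ?_ .zero)
  refine OComp.sum Params.comp_g (OComp.sum Params.comp_g ?_)
  refine OComp.ite ?_ ?_ .zero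
  · have h1 := CompP.eq (hx 1 (by norm_num)) (.const 1)
    exact (h1.and ((CompP.eq Comp.var.weaken ((hx 2 (by norm_num)).div Params.comp_b)).and
      (CompP.eq hmod ((hx 3 (by norm_num)).div Params.comp_b)))).or
      (h1.not.and ((CompP.eq Comp.var ((hx 3 (by norm_num)).div Params.comp_b)).and
      (CompP.eq hmod ((hx 2 (by norm_num)).div Params.comp_b))))
  · refine (ocomp_emit_msgWords ks hks (i := fun p => p.1.1.2) Comp.var.weaken.weaken).congr
      fun S _ E p => ?_
    rw [hkey p.1.1.1.1 p.1.1.1.2 p.1.1.2 p.1.2 p.2]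
    rfl

theorem ocomp_homeRec : OComp.{u} fun S _ E (a : α) => homeRec (S := S) (inp a) E := by
  unfold homeRec
  refine OComp.ite (CompP.le (comp_rom 4) Params.comp_estRound)
    (ocomp_keepRec.add (OComp.ite (CompP.lt (comp_rom 4) Params.comp_phases) ?_ .zero)) ?_
  · exact ocomp_copiesRec (key := fun a i j s => [1, i, j, (inp a).rom 4 *
      (parm (inp a)).estGroups + s, 0]) [fun _ => 1, fun p => p.1.2, fun p => p.2,
        fun p => (inp p).rom 4 * (parm (inp p)).estGroups + p.1.1.1.2, fun _ => 0]
      (.cons (.const _) (.cons Comp.var.weaken (.cons .var (.cons (((comp_rom 4).mul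
        Params.comp_estGroups).add Comp.var.weaken.weaken.weaken) (.cons (.const _) .nil)))))
      (fun _ _ _ _ _ => rfl) Params.comp_estGroups (comp_rom 4)
  · refine OComp.sum Comp.len ?_
    have hK : Comp.{u} fun p : α × ℕ => (parm (inp p)).mulGroups ((inp p).num p.2 1) :=
      Params.comp_mulGroups (comp_field .var 1)
    have hc : Comp.{u} fun p : α × ℕ => (inp p).rom 4 - ((parm (inp p)).estRound + 1) :=
      (comp_rom 4).sub (Params.comp_estRound.add (.const 1))
    refine OComp.ite (CompP.eq (comp_field .var 0) (.const 3)) (OComp.ite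
      (CompP.lt hc (Params.comp_mulPhases hK)) (ocomp_keepRec.add ?_) .zero) .zero
    exact ocomp_copiesRec (α := α × ℕ) (key := fun p i' j s =>
      [4, (parm (inp p)).mulGroups ((inp p).num p.2 1), i', j, s])
      [fun _ => 4, fun p => (parm (inp p)).mulGroups ((inp p).num p.1.1.1.1.2 1), fun p => p.1.2,
        fun p => p.2, fun p => p.1.1.1.2]
      (.cons (.const _) (.cons hK.weaken.weaken.weaken.weaken (.cons Comp.var.weaken
        (.cons .var (.cons Comp.var.weaken.weaken.weaken .nil)))))
      (fun _ _ _ _ _ => rfl) hK hc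

theorem ocomp_pairRec : OComp.{u} fun S _ E (a : α) => pairRec (S := S) (inp a) E := by
  unfold pairRec
  refine OComp.ite ((CompP.eq (comp_countI 1) (.const 0)).or (CompP.eq (comp_countI 0) (.const 0)))
    .zero (OComp.ite (CompP.lt Params.comp_H ((comp_countI 1).add (comp_countI 0))) ?_ ?_)
  · exact ocomp_sketchRec compMem_memPair [fun _ => 2, fun a => (inp a).rom 5, fun _ => 0,
      fun _ => 0,
      fun _ => 0] (.cons (.const _) (.cons (comp_rom 5) (.cons (.const _) (.cons (.const _)
        (.cons (.const _) .nil)))))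
  · refine OComp.sum Comp.len
      (OComp.ite (CompP.eq (comp_field .var 0) (.const 0)) ?_ .zero)
    exact OComp.emit (α := α × ℕ) false [fun _ => 2, fun p => (inp p).rom 5, fun _ => 0,
      fun _ => 0, fun _ => 0, fun _ => 1, fun p => (inp p).num p.2 1, fun p => (inp p).num p.2 2,
      fun p => (inp p).num p.2 3, fun p => (inp p).rom 8, fun p => (inp p).rom 9,
      fun p => (inp p).rom 10, fun _ => 0]
      (CompL.cons (.const _) (.cons (comp_rom 5) (.cons (.const _) (.cons (.const _)
        (.cons (.const _) (.cons (.const _) (.cons (comp_field .var 1) (.cons (comp_field .var 2)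
          (.cons (comp_field .var 3) (.cons (comp_rom 8) (.cons (comp_rom 9) (.cons (comp_rom 10)
            (.cons (.const _) .nil)))))))))))))

theorem ocomp_mergeRec (k : ℕ) {f : α → ℕ} (hf : Comp.{u} f) : OComp.{u} fun S _ _ a =>
    sketchRec (S := S) MemMerge [k, f a, 0, 0, 0] (inp a) :=
  ocomp_sketchRec compMem_memMerge [fun _ => k, f, fun _ => 0, fun _ => 0, fun _ => 0]
    (.cons (.const _) (.cons hf (.cons (.const _) (.cons (.const _) (.cons (.const _) .nil)))))

theorem ocomp_binRec : OComp.{u} fun S _ E (a : α) => binRec (S := S) (inp a) E :=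
  OComp.ite (CompP.le (comp_rom 4) Params.comp_phases) (ocomp_mergeRec 2 (comp_rom 5))
    (ocomp_mergeRec 3 ((comp_rom 8).div Params.comp_fan))

theorem ocomp_nodeRec : OComp.{u} fun S _ E (a : α) => nodeRec (S := S) (inp a) E := by
  unfold nodeRec
  refine OComp.ite (CompP.lt (comp_rom 4) Params.comp_estRound)
    (ocomp_mergeRec 3 ((comp_rom 8).div Params.comp_fan)) ?_
  have h : ∀ c, OComp.{u} fun S _ _ (p : α × ℕ) =>
      ({(false, [0, c, p.2, 0, 0, 3, estI (inp p), 0, 0, 0, 0, 0, 0].map .num)} : Records S) :=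
    fun c => OComp.emit (α := α × ℕ) false [fun _ => 0, fun _ => c, fun p => p.2, fun _ => 0,
      fun _ => 0, fun _ => 3, fun p => estI (inp p), fun _ => 0, fun _ => 0, fun _ => 0, fun _ => 0,
      fun _ => 0, fun _ => 0] (CompL.cons (.const _) (.cons (.const _) (.cons .var (.cons (.const _)
        (.cons (.const _) (.cons (.const _) (.cons comp_estI (.cons (.const _) (.cons (.const _)
          (.cons (.const _) (.cons (.const _) (.cons (.const _) (.cons (.const _) .nil)))))))))))))
  exact OComp.sum Params.comp_nt ((h 1).add (h 0))

variable {y : α → ℕ}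

theorem comp_isPart (hx : Comp.{u} x) (hy : Comp.{u} y) (hi : Comp.{u} i) :
    CompP.{u} fun a => IsPart (inp a) (x a) (y a) (i a) :=
  (CompP.eq (comp_field hi 0) (.const 4)).and ((CompP.eq (comp_field hi 1) hx).and
    (CompP.eq (comp_field hi 2) hy))

theorem comp_isProduct (hx : Comp.{u} x) (hy : Comp.{u} y) (hi : Comp.{u} i) (hj : Comp.{u} j) :
    CompP.{u} fun a => IsProduct (inp a) (x a) (y a) (i a) (j a) :=
  ((comp_isEntry 1 hi).and (comp_isEntry 0 hj)).and ((CompP.eq (comp_field hi 2) hx).and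
    ((CompP.eq (comp_field hj 3) hy).and (CompP.eq (comp_field hi 3) (comp_field hj 2))))

theorem comp_countContr (hx : Comp.{u} x) (hy : Comp.{u} y) :
    Comp.{u} fun a => countContr (inp a) (x a) (y a) := by
  unfold countContr
  exact (Comp.len.sum (comp_isPart hx.weaken hy.weaken .var).toComp).add
    (Comp.len.sum (Comp.len.sum (comp_isProduct hx.weaken.weaken hy.weaken.weaken
      Comp.var.weaken .var).toComp))

theorem ecomp_sumParts (hx : Comp.{u} x) (hy : Comp.{u} y) :
    EComp.{u} fun S _ E a => sumParts (S := S) (inp a) E (x a) (y a) := by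
  unfold sumParts
  exact EComp.sum Comp.len (EComp.ite (comp_isPart hx.weaken hy.weaken .var) (ecomp_eltAt .var)
    .zero)

theorem ecomp_sumContr (hx : Comp.{u} x) (hy : Comp.{u} y) :
    EComp.{u} fun S _ E a => sumContr (S := S) (inp a) E (x a) (y a) := by
  unfold sumContr
  exact (ecomp_sumParts hx hy).add (EComp.sum Comp.len (EComp.sum Comp.len
    (EComp.ite (comp_isProduct hx.weaken.weaken hy.weaken.weaken Comp.var.weaken .var)
      ((ecomp_eltAt Comp.var.weaken).mul (ecomp_eltAt .var)) .zero)))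

theorem ocomp_prodRec : OComp.{u} fun S _ E (a : α) => prodRec (S := S) (inp a) E := by
  unfold prodRec
  refine OComp.sum Params.comp_b (OComp.sum Params.comp_b ?_)
  have hx : Comp.{u} fun p : (α × ℕ) × ℕ => (inp p).rom 9 * (parm (inp p)).b + p.1.2 :=
    ((comp_rom 9).mul Params.comp_b).add Comp.var.weaken
  have hy : Comp.{u} fun p : (α × ℕ) × ℕ => (inp p).rom 10 * (parm (inp p)).b + p.2 :=
    ((comp_rom 10).mul Params.comp_b).add .var
  refine OComp.ite (CompP.eq (comp_countContr hx hy) (.const 0)) .zero (OComp.ite (CompP.lt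
    (((comp_rom 4).sub (Params.comp_estRound.add (.const 2))).add (.const 1))
    (Params.comp_mulPhases (comp_rom 8))) ?_ ?_)
  · exact OComp.emitElt false [fun _ => 4, fun p : (α × ℕ) × ℕ => (inp p).rom 8,
      fun p => (inp p).rom 9, fun p => (inp p).rom 10, fun p => (inp p).rom 11, fun _ => 4,
      fun p => (inp p).rom 9 * (parm (inp p)).b + p.1.2,
      fun p => (inp p).rom 10 * (parm (inp p)).b + p.2, fun _ => 0, fun _ => 0, fun _ => 0,
      fun _ => 0] (CompL.cons (.const _) (.cons (comp_rom 8) (.cons (comp_rom 9) (.cons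
        (comp_rom 10) (.cons (comp_rom 11) (.cons (.const _) (.cons hx (.cons hy (.cons (.const _)
          (.cons (.const _) (.cons (.const _) (.cons (.const _) .nil))))))))))))
              (ecomp_sumContr hx hy)
  · exact OComp.emitElt false [fun _ => 5, fun p : (α × ℕ) × ℕ => (inp p).rom 8,
      fun p => (inp p).rom 9 * (parm (inp p)).b + p.1.2,
      fun p => (inp p).rom 10 * (parm (inp p)).b + p.2,
      fun p => (inp p).rom 11 / (parm (inp p)).m, fun _ => 4,
      fun p => (inp p).rom 9 * (parm (inp p)).b + p.1.2,
      fun p => (inp p).rom 10 * (parm (inp p)).b + p.2, fun _ => 0, fun _ => 0, fun _ => 0,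
      fun _ => 0] (CompL.cons (.const _) (.cons (comp_rom 8) (.cons hx (.cons hy (.cons
        ((comp_rom 11).div Params.comp_m) (.cons (.const _) (.cons hx (.cons hy (.cons (.const _)
          (.cons (.const _) (.cons (.const _) (.cons (.const _) .nil))))))))))))
              (ecomp_sumContr hx hy)

theorem ocomp_cellRec : OComp.{u} fun S _ E (a : α) => cellRec (S := S) (inp a) E := by
  unfold cellRec
  refine OComp.ite (CompP.lt (((comp_rom 4).sub ((Params.comp_estRound.add
    (Params.comp_mulPhases (comp_rom 8))).add (.const 2))).add (.const 1))
      (Comp.clog Params.comp_m (comp_rom 8))) ?_ ?_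
  · exact OComp.emitElt false [fun _ => 5, fun a : α => (inp a).rom 8, fun a => (inp a).rom 9,
      fun a => (inp a).rom 10, fun a => (inp a).rom 11 / (parm (inp a)).m, fun _ => 4,
      fun a => (inp a).rom 9, fun a => (inp a).rom 10, fun _ => 0, fun _ => 0, fun _ => 0,
      fun _ => 0] (CompL.cons (.const _) (.cons (comp_rom 8) (.cons (comp_rom 9) (.cons
        (comp_rom 10) (.cons ((comp_rom 11).div Params.comp_m) (.cons (.const _) (.cons
          (comp_rom 9) (.cons (comp_rom 10) (.cons (.const _) (.cons (.const _) (.cons (.const _)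
            (.cons (.const _) .nil)))))))))))) (ecomp_sumParts (comp_rom 9) (comp_rom 10))
  · exact OComp.emitElt true [fun a : α => (inp a).rom 9, fun a => (inp a).rom 10]
      (CompL.cons (comp_rom 9) (.cons (comp_rom 10) .nil))
      (ecomp_sumParts (comp_rom 9) (comp_rom 10))

theorem ocomp_allRec : OComp.{u} fun S _ E (a : α) => allRec (S := S) (inp a) E := by
  have h : ∀ k, CompP.{u} fun a : α => (inp a).rom 7 = k := fun k =>
    CompP.eq (comp_rom 7) (.const k)
  exact .ite (h 0) ocomp_homeRec (.ite (h 1) ocomp_pairRec (.ite (h 2) ocomp_binRec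
    (.ite (h 3) ocomp_nodeRec (.ite (h 4) ocomp_prodRec ocomp_cellRec))))

end Computability

/-! ### The programs emit the records of the reducers -/

section

variable {S : Type*}

/-- The first seven words of a value. -/
def Msg.num : Msg S → ℕ → ℕ
  | .entry isA x y _ => fun f => [0, flag isA, x, y].getD f 0
  | .pseudo i j l isA x y => fun f => [1, flag isA, x, y, i, j, l].getD f 0
  | .sketch w v => fun f => [2, w, v].getD f 0
  | .est e => fun f => [3, e].getD f 0
  | .part x y _ => fun f => [4, x, y].getD f 0

/-- The semiring element of a value, or zero. -/
def Msg.elt [Zero S] : Msg S → S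
  | .entry _ _ _ a => a
  | .part _ _ a => a
  | _ => 0

/-- The input of a reducer with parameters `rom` and values `l`. -/
def inpOf (rom : ℕ → ℕ) (l : List (Msg S)) : Inp where
  rom := rom
  len := l.length
  num := fun i f => (l[i]?.map fun v => v.num f).getD 0

/-- The semiring elements of the values, by their position. -/
def eltsOf [Zero S] (l : List (Msg S)) (i : ℕ) : S := (l[i]?.map Msg.elt).getD 0

theorem inpOf_num {rom : ℕ → ℕ} {l : List (Msg S)} {i : ℕ} (h : i < l.length) (f : ℕ) :
    (inpOf rom l).num i f = l[i].num f := by simp [inpOf, h]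

/-- A sum over the positions in the input does not depend on the order of the values. This is how
every reducer, as a function of a multiset, is matched with a program that reads a list. -/
theorem sum_inpOf {X : Type*} [AddCommMonoid X] {rom : ℕ → ℕ} {l : List (Msg S)} {F : ℕ → X}
    {G : Msg S → X} (h : ∀ i (hi : i < l.length), F i = G l[i]) :
    ∑ i ∈ Finset.range (inpOf rom l).len, F i = ((l : Multiset (Msg S)).map G).sum := by
  rw [show (inpOf rom l).len = l.length from rfl, Finset.sum_range, Multiset.map_coe,
    Multiset.sum_coe, ← List.sum_ofFn]
  congr 1
  apply List.ext_getElem <;> simp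
  intro i hi
  exact h i hi

theorem exists_inpOf {rom : ℕ → ℕ} {l : List (Msg S)} {P : ℕ → Prop} {Q : Msg S → Prop}
    (h : ∀ i (hi : i < l.length), P i ↔ Q l[i]) :
    (∃ i < (inpOf rom l).len, P i) ↔ ∃ v ∈ (l : Multiset (Msg S)), Q v := by
  constructor
  · rintro ⟨i, hi, hP⟩
    exact ⟨l[i]'hi, List.getElem_mem _, (h i hi).1 hP⟩
  · rintro ⟨v, hv, hQ⟩
    obtain ⟨i, hi, rfl⟩ := List.getElem_of_mem (Multiset.mem_coe.1 hv)
    exact ⟨i, hi, (h i hi).2 hQ⟩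

theorem Msg.code_eq [Zero S] (v : Msg S) : v.code = [.num (v.num 0), .num (v.num 1), .num (v.num 2),
    .num (v.num 3), .num (v.num 4), .num (v.num 5), .num (v.num 6),
    if v.num 0 = 0 ∨ v.num 0 = 4 then .elt v.elt else .num 0] := by
  cases v <;> simp [Msg.code, Msg.num, Msg.elt]

variable [NonUnitalSemiring S]

theorem eltAt_inpOf {rom : ℕ → ℕ} {l : List (Msg S)} {i : ℕ} (h : i < l.length) :
    eltAt (inpOf rom l) (eltsOf l) i = l[i].elt := by
  rw [eltAt, inpOf_num h]
  simp only [inpOf, h, true_and, eltsOf, List.getElem?_eq_getElem, Option.map_some,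
    Option.getD_some, ite_eq_left_iff]
  intro h'
  generalize l[i] = v at h'
  cases v <;> simp_all [Msg.num, Msg.elt]

theorem msgWords_inpOf {rom : ℕ → ℕ} {l : List (Msg S)} {i : ℕ} (h : i < l.length) :
    msgWords (inpOf rom l) (eltsOf l) i = l[i].code := by
  simp only [msgWords, inpOf_num h, eltAt_inpOf h, Msg.code_eq]

end

section

variable {S X Y Z : Type*} [AddCommMonoid X]

theorem map_filterMap_sum (f : Y → Option Z) (G : Z → X) (V : Multiset Y) :
    ((V.filterMap f).map G).sum = (V.map fun v => (f v).elim 0 G).sum := by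
  induction V using Multiset.induction with
  | empty => simp
  | cons v V ih =>
    rcases h : f v with _ | z
    · simp [Multiset.filterMap_cons_none _ _ h, ih, h]
    · simp [Multiset.filterMap_cons_some f v V h, ih, h]

theorem flag_inj {c c' : Bool} : flag c = flag c' ↔ c = c' := by
  cases c <;> cases c' <;> simp [flag]

theorem entries_sum [Zero S] (c : Bool) (V : Multiset (Msg S)) (G : ℕ × ℕ × S → X) :
    ((entries c V).map G).sum = (V.map fun v =>
      if v.num 0 = 0 ∧ v.num 1 = flag c then G (v.num 2, v.num 3, v.elt) else 0).sum := by
  rw [entries, map_filterMap_sum]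
  congr 1
  refine Multiset.map_congr rfl fun v _ => ?_
  cases v <;> simp [Msg.num, Msg.elt, flag_inj, apply_ite (fun o : Option _ => o.elim 0 G)]

theorem ests_sum (V : Multiset (Msg S)) (G : ℕ → X) :
    ((ests V).map G).sum = (V.map fun v => if v.num 0 = 3 then G (v.num 1) else 0).sum := by
  rw [ests, map_filterMap_sum]
  congr 1
  refine Multiset.map_congr rfl fun v _ => ?_
  cases v <;> simp [Msg.num]

theorem parts_sum [Zero S] (V : Multiset (Msg S)) (x y : ℕ) (G : S → X) :
    ((parts V x y).map G).sum = (V.map fun v =>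
      if v.num 0 = 4 ∧ v.num 1 = x ∧ v.num 2 = y then G v.elt else 0).sum := by
  rw [parts, map_filterMap_sum]
  congr 1
  refine Multiset.map_congr rfl fun v _ => ?_
  cases v <;> simp [Msg.num, Msg.elt, apply_ite (fun o : Option _ => o.elim 0 G)]

theorem card_map_sum (V : Multiset Y) : (V.map fun _ => 1).sum = V.card := by simp

theorem sum_singleton_eq_map (s : Finset Y) (f : Y → Z) :
    ∑ y ∈ s, ({f y} : Multiset Z) = s.val.map f := by
  change (s.val.map ((fun z => ({z} : Multiset Z)) ∘ f)).sum = _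
  rw [← Multiset.map_map, Multiset.sum_map_singleton]

theorem product_filter_map_sum {P : Y × Z → Prop} [DecidablePred P] (G : Y × Z → X)
    (s : Multiset Y) (t : Multiset Z) :
    (((s ×ˢ t).filter P).map G).sum =
      (s.map fun a => (t.map fun b => if P (a, b) then G (a, b) else 0).sum).sum := by
  have h : ∀ r : Multiset (Y × Z), ((r.filter P).map G).sum =
      (r.map fun u => if P u then G u else 0).sum := by
    intro r
    induction r using Multiset.induction with
    | empty => simp
    | cons u r ih => by_cases hu : P u <;> simp [hu, ih]
  rw [h]
  induction s using Multiset.induction with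
  | empty => simp
  | cons a s ih =>
    rw [Multiset.cons_product, Multiset.map_add, Multiset.sum_add, ih]
    simp

theorem mem_entries {c : Bool} {V : Multiset (Msg S)} {x y : ℕ} {a : S} :
    (x, y, a) ∈ entries c V ↔ Msg.entry c x y a ∈ V := by
  rw [entries, Multiset.mem_filterMap]
  constructor
  · rintro ⟨v, hv, h⟩
    cases v <;> simp_all
  · intro h
    exact ⟨_, h, by simp⟩

theorem mem_pseudos {c : Bool} {V : Multiset (Msg S)} {i j l x y : ℕ} :
    ((i, j, l), x, y) ∈ pseudos c V ↔ Msg.pseudo i j l c x y ∈ V := by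
  rw [pseudos, Multiset.mem_filterMap]
  constructor
  · rintro ⟨v, hv, h⟩
    cases v <;> simp_all
  · intro h
    exact ⟨_, h, by simp⟩

theorem mem_sketchValues {V : Multiset (Msg S)} {w v : ℕ} :
    v ∈ sketchValues V w ↔ Msg.sketch w v ∈ V := by
  rw [sketchValues, Multiset.mem_toFinset, Multiset.mem_filterMap]
  constructor
  · rintro ⟨v, hv, h⟩
    cases v <;> simp_all
  · intro h
    exact ⟨_, h, by simp⟩

theorem mem_ests {V : Multiset (Msg S)} {e : ℕ} : e ∈ ests V ↔ Msg.est e ∈ V := by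
  rw [ests, Multiset.mem_filterMap]
  constructor
  · rintro ⟨v, hv, h⟩
    cases v <;> simp_all
  · intro h
    exact ⟨_, h, by simp⟩

theorem mem_parts {V : Multiset (Msg S)} {x y : ℕ} {a : S} :
    a ∈ parts V x y ↔ Msg.part x y a ∈ V := by
  rw [parts, Multiset.mem_filterMap]
  constructor
  · rintro ⟨v, hv, h⟩
    cases v <;> simp_all
  · intro h
    exact ⟨_, h, by simp⟩

theorem mem_pairStream {p : Params} {V : Multiset (Msg S)} {z : ℕ} :
    z ∈ pairStream p V ↔ ∃ x y k a b, Msg.entry true x k a ∈ V ∧ Msg.entry false k y b ∈ V ∧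
      x * p.q + y = z := by
  simp only [pairStream, Multiset.mem_toFinset, Multiset.mem_map, Multiset.mem_filter,
    Multiset.mem_product, Prod.exists, mem_entries]
  constructor
  · rintro ⟨x, k, a, k', y, b, ⟨⟨h1, h2⟩, rfl⟩, h⟩
    exact ⟨x, y, k, a, b, h1, h2, h⟩
  · rintro ⟨x, y, k, a, b, h1, h2, h⟩
    exact ⟨x, k, a, k, y, b, ⟨⟨h1, h2⟩, rfl⟩, h⟩

theorem mem_pseudoStream {p : Params} {V : Multiset (Msg S)} {z : ℕ} :
    z ∈ pseudoStream p V ↔ ∃ i j l x y k, Msg.pseudo i j l true x k ∈ V ∧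
      Msg.pseudo i j l false k y ∈ V ∧ x * p.q + y = z := by
  simp only [pseudoStream, Multiset.mem_toFinset, Multiset.mem_map, Multiset.mem_filter,
    Multiset.mem_product, Prod.exists, mem_pseudos, Prod.mk.injEq]
  constructor
  · rintro ⟨i, j, l, x, k, i', j', l', k', y, ⟨⟨h1, h2⟩, ⟨rfl, rfl, rfl⟩, rfl⟩, h⟩
    exact ⟨i, j, l, x, y, k, h1, h2, h⟩
  · rintro ⟨i, j, l, x, y, k, h1, h2, h⟩
    exact ⟨i, j, l, x, k, i, j, l, k, y, ⟨⟨h1, h2⟩, ⟨rfl, rfl, rfl⟩, rfl⟩, h⟩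

end

/-- The parameters as a reducer knows them: the aggregate memory is cut off. -/
def Params.trim (p : Params) : Params := { p with M := p.mem }

namespace Params

variable (p : Params)

theorem trim_mem : p.trim.mem = p.mem := by
  simp only [mem, trim, n]
  omega

theorem trim_bins : p.trim.bins = p.bins := by simp only [bins, trim_mem]; rfl
theorem trim_estGroups : p.trim.estGroups = p.estGroups := by simp only [estGroups, trim_mem]; rfl
theorem trim_phases : p.trim.phases = p.phases := by simp only [phases, trim_estGroups]; rfl
theorem trim_estRound : p.trim.estRound = p.estRound := by
  simp only [estRound, trim_phases, trim_bins]; rfl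
theorem trim_mulGroups (e : ℕ) : p.trim.mulGroups e = p.mulGroups e := by
  simp only [mulGroups, trim_mem]; rfl
theorem trim_mulPhases (K : ℕ) : p.trim.mulPhases K = p.mulPhases K := rfl

end Params

section

variable {S : Type u} [NonUnitalSemiring S] {p : Params} (ω : Choices p) (r : ℕ) (k : Key)

/-- A key-value pair as a record. -/
def recOf (x : Key × Msg S) : Bool × List (Word S) := (false, x.1.code.map .num ++ x.2.code)

/-- The input that the reducer for the key `k` sees in round `r`. -/
abbrev inpAt (l : List (Msg S)) : Inp := inpOf ((encoding S ω).rom r k (l : Multiset (Msg S))) l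

variable {l : List (Msg S)}

theorem parm_inpAt : parm (inpAt ω r k l) = p.trim := rfl

theorem rom_seed {w : ℕ} (hw : w < p.Δ) : (inpAt ω r k l).rom (12 + 2 * w) = (seed ω w).1 ∧
    (inpAt ω r k l).rom (13 + 2 * w) = (seed ω w).2 := by
  have key : ∀ N w (f : ℕ → ℕ × ℕ), w < N → ((List.range N).flatMap
      fun w => [(f w).1, (f w).2]).getD
      (2 * w) 0 = (f w).1 ∧ ((List.range N).flatMap fun w => [(f w).1, (f w).2]).getD
      (2 * w + 1) 0 = (f w).2 := by
    intro N
    induction N with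
    | zero => intro w f h; omega
    | succ N ih =>
      intro w f h
      rw [List.range_succ_eq_map, List.flatMap_cons, List.flatMap_map]
      rcases w with _ | w
      · simp
      · have := ih w (fun w => f (w + 1)) (by omega)
        simpa [Nat.mul_add] using this
  have hlen : k.code.length = 5 := by cases k <;> rfl
  have := key p.Δ w (seed ω) hw
  constructor
  · simp only [inpOf, encoding, List.append_assoc]
    rw [List.getD_append_right _ _ _ _ (by simp; omega), List.getD_append_right _ _ _ _
      (by simp [hlen]; omega)]
    rw [← this.1]
    congr 1
    simp [hlen]; omega
  · simp only [inpOf, encoding, List.append_assoc]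
    rw [List.getD_append_right _ _ _ _ (by simp; omega), List.getD_append_right _ _ _ _
      (by simp [hlen]; omega)]
    rw [← this.2]
    congr 1
    simp [hlen]; omega

theorem hashI_inpAt {w : ℕ} (hw : w < p.Δ) (x : ℕ) : hashI (inpAt ω r k l) w x = hash ω w x := by
  obtain ⟨h1, h2⟩ := rom_seed ω r k (l := l) hw
  rw [hashI, h1, h2]
  rfl

theorem countI_inpAt (c : Bool) :
    countI (inpAt ω r k l) (flag c) = (entries c (l : Multiset (Msg S))).card := by
  rw [← card_map_sum, entries_sum]
  refine sum_inpOf fun i hi => ?_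
  simp only [IsEntry, inpOf_num hi]

theorem memPair_inpAt {w v : ℕ} (hw : w < p.Δ) : MemPair (inpAt ω r k l) w v ↔
    v ∈ (pairStream p (l : Multiset (Msg S))).image (hash ω w) := by
  have h1 : MemPair (inpAt ω r k l) w v ↔ ∃ u ∈ (l : Multiset (Msg S)),
      ∃ u' ∈ (l : Multiset (Msg S)),
      (u.num 0 = 0 ∧ u.num 1 = 1) ∧ (u'.num 0 = 0 ∧ u'.num 1 = 0) ∧ u.num 3 = u'.num 2 ∧
        hash ω w (u.num 2 * p.q + u'.num 3) = v := by
    refine exists_inpOf fun i hi => exists_inpOf fun j hj => ?_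
    simp only [IsEntry, inpOf_num hi, inpOf_num hj, hashI_inpAt ω r k hw]
    rfl
  rw [h1]
  simp only [Finset.mem_image, mem_pairStream]
  constructor
  · rintro ⟨u, hu, u', hu', h⟩
    cases u <;> simp [Msg.num] at h
    cases u' <;> simp at h
    obtain ⟨h1, h2, rfl, h⟩ := h
    rename_i c x y a c' y' b
    obtain rfl : c = true := by cases c <;> simp_all [flag]
    obtain rfl : c' = false := by cases c' <;> simp_all [flag]
    exact ⟨_, ⟨x, y', y, a, b, hu, hu', rfl⟩, h⟩
  · rintro ⟨z, ⟨x, y, k, a, b, h1, h2, rfl⟩, h⟩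
    exact ⟨_, h1, _, h2, by simpa [Msg.num, flag] using h⟩

theorem memMerge_inpAt {w v : ℕ} (hw : w < p.Δ) : MemMerge (inpAt ω r k l) w v ↔
    v ∈ sketchValues (l : Multiset (Msg S)) w ∪
      (pseudoStream p (l : Multiset (Msg S))).image (hash ω w) := by
  rw [Finset.mem_union]
  refine or_congr ?_ ?_
  · rw [mem_sketchValues]
    have h1 : MemSketch (inpAt ω r k l) w v ↔ ∃ u ∈ (l : Multiset (Msg S)),
        u.num 0 = 2 ∧ u.num 1 = w ∧ u.num 2 = v := by
      refine exists_inpOf fun i hi => ?_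
      simp only [inpOf_num hi]
    rw [h1]
    constructor
    · rintro ⟨u, hu, h⟩
      cases u <;> simp [Msg.num] at h
      obtain ⟨rfl, rfl⟩ := h
      exact hu
    · intro h
      exact ⟨_, h, by simp [Msg.num]⟩
  · have h1 : MemPseudo (inpAt ω r k l) w v ↔ ∃ u ∈ (l : Multiset (Msg S)),
        ∃ u' ∈ (l : Multiset (Msg S)),
        (u.num 0 = 1 ∧ u.num 1 = 1) ∧ (u'.num 0 = 1 ∧ u'.num 1 = 0) ∧
        (u.num 4 = u'.num 4 ∧ u.num 5 = u'.num 5 ∧ u.num 6 = u'.num 6) ∧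
        u.num 3 = u'.num 2 ∧ hash ω w (u.num 2 * p.q + u'.num 3) = v := by
      refine exists_inpOf fun i hi => exists_inpOf fun j hj => ?_
      simp only [IsPseudo, inpOf_num hi, inpOf_num hj, hashI_inpAt ω r k hw]
      rfl
    rw [h1]
    simp only [Finset.mem_image, mem_pseudoStream]
    constructor
    · rintro ⟨u, hu, u', hu', h⟩
      cases u <;> simp [Msg.num] at h
      cases u' <;> simp at h
      rename_i i j l c x y i' j' l' c' x' y'
      obtain ⟨h1, h2, ⟨rfl, rfl, rfl⟩, rfl, h⟩ := h
      obtain rfl : c = true := by cases c <;> simp_all [flag]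
      obtain rfl : c' = false := by cases c' <;> simp_all [flag]
      exact ⟨_, ⟨i, j, l, x, y', y, hu, hu', rfl⟩, h⟩
    · rintro ⟨z, ⟨i, j, l, x, y, k, h1, h2, rfl⟩, h⟩
      exact ⟨_, h1, _, h2, by simpa [Msg.num, flag] using h⟩

theorem hash_le (w x : ℕ) : hash ω w x ≤ p.prime := by
  have h : 0 < p.prime := (Nat.find_spec (Nat.exists_infinite_primes (p.n ^ 3))).2.pos
  exact Nat.mod_lt _ h

theorem prime_lt_hashBound : p.prime + 1 < hashBound (inpAt ω r k l) := by
  have : (parm (inpAt ω r k l)).prime = p.prime := rfl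
  rw [hashBound, this]
  omega

theorem sketchValues_lt_hashBound {w v : ℕ} (h : v ∈ sketchValues (l : Multiset (Msg S)) w) :
    v < hashBound (inpAt ω r k l) := by
  rw [mem_sketchValues] at h
  obtain ⟨i, hi, h⟩ := List.getElem_of_mem (Multiset.mem_coe.1 h)
  have h2 : (inpAt ω r k l).num i 2 = v := by rw [inpOf_num hi, h]; rfl
  have h3 := Finset.single_le_sum (f := fun i => (inpAt ω r k l).num i 2) (fun _ _ => Nat.zero_le _)
    (Finset.mem_range.2 (show i < (inpAt ω r k l).len from hi))
  rw [hashBound]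
  omega

theorem merge_lt_hashBound {w v : ℕ} (h : v ∈ sketchValues (l : Multiset (Msg S)) w ∪
    (pseudoStream p (l : Multiset (Msg S))).image (hash ω w)) : v < hashBound (inpAt ω r k l) := by
  rcases Finset.mem_union.1 h with h | h
  · exact sketchValues_lt_hashBound ω r k h
  · obtain ⟨x, -, rfl⟩ := Finset.mem_image.1 h
    have := hash_le ω w x
    have := prime_lt_hashBound ω r k (l := l)
    omega

theorem small_iff {mem : Inp → ℕ → ℕ → Prop} [∀ I w v, Decidable (mem I w v)] {w : ℕ}
    {X : Finset ℕ} (h : ∀ v, mem (inpAt ω r k l) w v ↔ v ∈ X) (v : ℕ) :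
    Small mem (inpAt ω r k l) w v ↔ v ∈ smallest p.t X := by
  rw [smallest, Finset.mem_filter, Small, h v]
  refine and_congr_right fun _ => ?_
  rw [← Finset.card_filter, show (parm (inpAt ω r k l)).t = p.t from rfl]
  rw [show (Finset.range v).filter (fun u => mem (inpAt ω r k l) w u) = X.filter (· < v) by
    ext u; simp [h u, and_comm]]

theorem sum_range_ite_mem {X : Type*} [AddCommMonoid X] {N : ℕ} {A : Finset ℕ} {P : ℕ → Prop}
    [DecidablePred P] (hP : ∀ v, P v ↔ v ∈ A) (hA : ∀ v ∈ A, v < N) (G : ℕ → X) :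
    (∑ v ∈ Finset.range N, if P v then G v else 0) = ∑ v ∈ A, G v := by
  rw [← Finset.sum_filter]
  congr 1
  ext v
  rw [Finset.mem_filter, Finset.mem_range, hP v]
  exact ⟨fun h => h.2, fun h => ⟨hA v h, h⟩⟩

theorem sketchRec_eq {mem : Inp → ℕ → ℕ → Prop} [∀ I w v, Decidable (mem I w v)]
    {X : ℕ → Finset ℕ} (h : ∀ w < p.Δ, ∀ v, mem (inpAt ω r k l) w v ↔ v ∈ X w)
    (hX : ∀ w < p.Δ, ∀ v ∈ X w, v < hashBound (inpAt ω r k l)) (key : Key) :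
    sketchRec mem key.code (inpAt ω r k l) =
      (((sketchOf p X).map fun v => (key, v)).map recOf : Records S) := by
  rw [sketchRec, sketchOf, Multiset.map_bind, Multiset.map_bind]
  change _ = ∑ w ∈ Finset.range p.Δ, _
  refine Finset.sum_congr rfl fun w hw => ?_
  have hw' : w < p.Δ := Finset.mem_range.1 hw
  rw [sum_range_ite_mem (small_iff ω r k (h w hw')) (fun v hv => hX w hw' v
    (Finset.mem_filter.1 hv).1), Multiset.map_map, Multiset.map_map, sum_singleton_eq_map]
  simp only [List.map_append]
  rfl

end

theorem filter_range_bind {X : Type*} (N : ℕ) (P : ℕ → Prop) [DecidablePred P]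
    (f : ℕ → Multiset X) : ((Multiset.range N).filter P).bind f =
      ∑ s ∈ Finset.range N, if P s then f s else 0 := by
  rw [← Finset.sum_filter]
  rfl

theorem map_eq_sum_singleton {X Y : Type*} (V : Multiset X) (f : X → Y) :
    V.map f = (V.map fun v => ({f v} : Multiset Y)).sum := by
  change _ = (V.map ((fun z => ({z} : Multiset Y)) ∘ f)).sum
  rw [← Multiset.map_map, Multiset.sum_map_singleton]

theorem map_range_sum {X : Type*} [AddCommMonoid X] (N : ℕ) (f : ℕ → X) :
    ((Multiset.range N).map f).sum = ∑ i ∈ Finset.range N, f i := rfl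

theorem map_multiset_sum {X Y Z : Type*} (f : Y → Z) (V : Multiset X) (g : X → Multiset Y) :
    (V.map g).sum.map f = (V.map fun v => (g v).map f).sum := Multiset.map_bind _ _ _

theorem map_finset_sum {X Y Z : Type*} (f : Y → Z) (V : Finset X) (g : X → Multiset Y) :
    (∑ v ∈ V, g v).map f = ∑ v ∈ V, (g v).map f := Multiset.map_bind _ _ _

section

variable {S : Type u} [NonUnitalSemiring S] {p : Params} (ω : Choices p) (r : ℕ) (k : Key)
  {l : List (Msg S)}

theorem keepRec_eq : keepRec (inpAt ω r k l) (eltsOf l) =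
    (((l : Multiset (Msg S)).map fun v => (k, v)).map recOf : Records S) := by
  rw [Multiset.map_map, map_eq_sum_singleton]
  refine sum_inpOf fun i hi => ?_
  rw [msgWords_inpOf hi]
  cases k <;> rfl

theorem map_places (K : Bool) (x y s : ℕ) {X : Type*} (G : ℕ × ℕ → X) :
    (places p K x y s).map G = ∑ u ∈ Finset.range p.g, ∑ v ∈ Finset.range p.g,
      if (if K then u = x / p.b ∧ (u + v + s) % p.g = y / p.b
        else v = y / p.b ∧ (u + v + s) % p.g = x / p.b) then {G (u, v)} else 0 := by
  rw [map_eq_sum_singleton, places, product_filter_map_sum]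
  rfl

/-- The copies made from a set of entries, in terms of the single values. -/
theorem copies_eq_sum (K c : ℕ) (key : ℕ → ℕ → ℕ → Key) (V : Multiset (Msg S)) :
    copies p K c key V = ∑ s ∈ Finset.range K, if c * K + s < p.g then
      (V.map fun v => if v.num 0 = 0 then ∑ i ∈ Finset.range p.g, ∑ j ∈ Finset.range p.g,
        if (v.num 1 = 1 ∧ i = v.num 2 / p.b ∧ (i + j + (c * K + s)) % p.g = v.num 3 / p.b ∨
            ¬ v.num 1 = 1 ∧ j = v.num 3 / p.b ∧ (i + j + (c * K + s)) % p.g = v.num 2 / p.b)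
          then {(key i j s, v)} else 0
        else 0).sum
      else 0 := by
  rw [copies, filter_range_bind]
  refine Finset.sum_congr rfl fun s _ => ?_
  split_ifs
  swap
  · rfl
  simp only [Multiset.insert_eq_cons, Multiset.cons_bind, Multiset.singleton_bind]
  change ((entries true V).map _).sum + ((entries false V).map _).sum = _
  rw [entries_sum, entries_sum, ← Multiset.sum_map_add]
  congr 1
  refine Multiset.map_congr rfl fun v _ => ?_
  simp only [map_places]
  rcases v with ⟨_ | _, x, y, a⟩ | _ | _ | _ | _ <;> simp [Msg.num, flag, Msg.elt]

theorem copiesRec_eq (K c : ℕ) (key : ℕ → ℕ → ℕ → Key) :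
    copiesRec (fun i j s => (key i j s).code) K c (inpAt ω r k l) (eltsOf l) =
      ((copies p K c key (l : Multiset (Msg S))).map recOf : Records S) := by
  rw [copies_eq_sum, map_finset_sum]
  refine Finset.sum_congr rfl fun s _ => ?_
  change (if c * K + s < p.g then _ else 0) = _
  split_ifs
  swap
  · rfl
  rw [map_multiset_sum]
  refine sum_inpOf fun i hi => ?_
  have hg : (parm (inpAt ω r k l)).g = p.g := rfl
  have hb : (parm (inpAt ω r k l)).b = p.b := rfl
  simp only [PlaceI, inpOf_num hi, msgWords_inpOf hi, hg, hb]
  split_ifs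
  swap
  · rfl
  rw [map_finset_sum]
  refine Finset.sum_congr rfl fun u _ => ?_
  rw [map_finset_sum]
  refine Finset.sum_congr rfl fun v _ => ?_
  split_ifs
  · rfl
  · rfl

theorem rom_round : (inpAt ω r k l).rom 4 = r := rfl
theorem parm_trim : (parm (inpAt ω r k l)).estRound = p.estRound ∧
    (parm (inpAt ω r k l)).phases = p.phases ∧ (parm (inpAt ω r k l)).estGroups = p.estGroups ∧
    (∀ e, (parm (inpAt ω r k l)).mulGroups e = p.mulGroups e) ∧
    ∀ K, (parm (inpAt ω r k l)).mulPhases K = p.mulPhases K := by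
  rw [parm_inpAt]
  exact ⟨p.trim_estRound, p.trim_phases, p.trim_estGroups, p.trim_mulGroups, p.trim_mulPhases⟩

theorem homeRec_eq (c : Bool) (i : ℕ) :
    homeRec (inpAt ω r (.home c i) l) (eltsOf l) =
      ((homeStep p r (.home c i) (l : Multiset (Msg S))).map recOf : Records S) := by
  obtain ⟨h1, h2, h3, h4, h5⟩ := parm_trim ω r (.home c i) (l := l)
  rw [homeRec, homeStep, rom_round, h1, h2, h3]
  simp only [h4, h5]
  by_cases hr : r ≤ p.estRound
  · rw [if_pos hr, if_pos hr, Multiset.map_add, keepRec_eq]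
    congr 1
    split_ifs
    · exact copiesRec_eq ω r (.home c i) p.estGroups r
        (fun i j s => .pair i j (r * p.estGroups + s))
    · rfl
  · rw [if_neg hr, if_neg hr]
    rw [Multiset.bind, Multiset.join]
    rw [map_multiset_sum, ests_sum]
    refine sum_inpOf fun j hj => ?_
    simp only [inpOf_num hj]
    split_ifs
    · rw [Multiset.map_add, keepRec_eq]
      congr 1
      exact copiesRec_eq ω r (.home c i) _ _ (fun i j s => .prod _ i j s)
    · rfl
    · rfl

theorem pairRec_eq (i j g : ℕ) :
    pairRec (inpAt ω r (.pair i j g) l) (eltsOf l) =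
      ((pairStep ω r i j g (l : Multiset (Msg S))).map recOf : Records S) := by
  have h1 := countI_inpAt ω r (.pair i j g) (l := l) true
  have h0 := countI_inpAt ω r (.pair i j g) (l := l) false
  simp only [flag, if_true, Bool.false_eq_true, if_false] at h1 h0
  rw [pairRec, pairStep, h1, h0, show (parm (inpAt ω r (.pair i j g) l)).H = p.H from rfl]
  split_ifs
  · rfl
  · exact sketchRec_eq ω r _ (fun w hw v => memPair_inpAt ω r _ hw) (fun w hw v hv => by
      obtain ⟨x, -, rfl⟩ := Finset.mem_image.1 hv
      have := hash_le ω w x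
      have := prime_lt_hashBound ω r (.pair i j g) (l := l)
      omega) (.bin _)
  · rw [Multiset.map_map, Multiset.map_add, Multiset.map_map, Multiset.map_map,
      map_eq_sum_singleton (entries true _), map_eq_sum_singleton (entries false _), entries_sum,
          entries_sum, ← Multiset.sum_map_add]
    refine sum_inpOf fun i hi => ?_
    simp only [inpOf_num hi]
    generalize l[i] = v
    rcases v with ⟨_ | _, x, y, a⟩ | _ | _ | _ | _ <;> simp [Msg.num, flag, Msg.elt] <;> rfl

theorem binRec_eq (β : ℕ) :
    binRec (inpAt ω r (.bin β) l) (eltsOf l) =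
      ((binStep ω r β (l : Multiset (Msg S))).map recOf : Records S) := by
  obtain ⟨h1, h2, h3, h4, h5⟩ := parm_trim ω r (.bin β) (l := l)
  rw [binRec, binStep, rom_round, h2]
  split_ifs
  · exact sketchRec_eq ω r _ (fun w hw v => memMerge_inpAt ω r _ hw)
      (fun w hw v hv => merge_lt_hashBound ω r _ hv) (.bin _)
  · exact sketchRec_eq ω r _ (fun w hw v => memMerge_inpAt ω r _ hw)
      (fun w hw v hv => merge_lt_hashBound ω r _ hv) (.node _)

theorem listEst_inpAt {w : ℕ} : listEst (inpAt ω r k l) w =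
    listEstimate p (smallest p.t (sketchValues (l : Multiset (Msg S)) w)) := by
  have hm : ∀ v, MemSketch (inpAt ω r k l) w v ↔ v ∈ sketchValues (l : Multiset (Msg S)) w := by
    intro v
    rw [mem_sketchValues]
    have h1 : MemSketch (inpAt ω r k l) w v ↔ ∃ u ∈ (l : Multiset (Msg S)),
        u.num 0 = 2 ∧ u.num 1 = w ∧ u.num 2 = v := by
      refine exists_inpOf fun i hi => ?_
      simp only [inpOf_num hi]
    rw [h1]
    constructor
    · rintro ⟨u, hu, h⟩
      cases u <;> simp [Msg.num] at h
      obtain ⟨rfl, rfl⟩ := h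
      exact hu
    · intro h
      exact ⟨_, h, by simp [Msg.num]⟩
  have hs := small_iff ω r k hm
  set X := smallest p.t (sketchValues (l : Multiset (Msg S)) w) with hX
  have hb : ∀ v ∈ X, v < hashBound (inpAt ω r k l) := fun v hv =>
    sketchValues_lt_hashBound ω r k (Finset.mem_filter.1 hv).1
  have hc : listCard (inpAt ω r k l) w = X.card := by
    rw [listCard, sum_range_ite_mem hs hb, Finset.card_eq_sum_ones]
  have hsup : listSup (inpAt ω r k l) w = X.sup id := by
    refine Ram.sum_range_ite_of_iff_lt (fun u _ => ?_) (Finset.sup_le fun v hv => (hb v hv).le)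
    rw [Finset.lt_sup_iff]
    constructor
    · rintro ⟨v, _, h1, h2⟩
      exact ⟨v, (hs v).1 h2, h1⟩
    · rintro ⟨v, h1, h2⟩
      exact ⟨v, hb v h1, h2, (hs v).2 h1⟩
  rw [listEst, listEstimate, hc, hsup]
  rfl

/-- The element number `i` of a sorted list exceeds `e` exactly if at most `i` elements do not. -/
theorem lt_sort_getD_iff (s : Multiset ℕ) {i : ℕ} (hi : i < s.card) (e : ℕ) :
    e < (s.sort (· ≤ ·)).getD i 0 ↔ (s.filter (· ≤ e)).card ≤ i := by
  set L := s.sort (· ≤ ·) with hL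
  have hlen : L.length = s.card := Multiset.length_sort ..
  have hs : (L : Multiset ℕ) = s := Multiset.sort_eq ..
  have hsorted : L.Pairwise (· ≤ ·) := Multiset.pairwise_sort ..
  rw [← hs, Multiset.filter_coe, Multiset.coe_card, List.getD_eq_getElem _ _ (by omega)]
  have hmono : ∀ a b (ha : a < L.length) (hb : b < L.length), a ≤ b → L[a] ≤ L[b] := by
    intro a b ha hb hab
    rcases hab.eq_or_lt with rfl | hab
    · rfl
    · exact List.pairwise_iff_getElem.1 hsorted a b ha hb hab
  constructor
  · intro h
    have h2 : (L.drop i).filter (fun b => decide (b ≤ e)) = [] := by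
      rw [List.filter_eq_nil_iff]
      intro a ha
      obtain ⟨j, hj, rfl⟩ := List.getElem_of_mem ha
      rw [List.getElem_drop]
      have := hmono i (i + j) (by omega) (by simp at hj; omega) (by omega)
      simp
      omega
    have h1 := List.length_filter_le (fun b => decide (b ≤ e)) (L.take i)
    have h3 : L.filter (fun b => decide (b ≤ e)) =
        (L.take i).filter (fun b => decide (b ≤ e)) := by
      conv_lhs => rw [← List.take_append_drop i L, List.filter_append, h2, List.append_nil]
    rw [h3]
    refine h1.trans ?_
    simp
  · intro h
    by_contra hlt
    have h2 : (L.take (i + 1)).filter (fun b => decide (b ≤ e)) = L.take (i + 1) := by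
      rw [List.filter_eq_self]
      intro a ha
      obtain ⟨j, hj, rfl⟩ := List.getElem_of_mem ha
      rw [List.getElem_take]
      have := hmono j i (by simp at hj; omega) (by omega) (by simp at hj; omega)
      simp
      omega
    have h3 := (List.Sublist.filter (fun b => decide (b ≤ e))
        (List.take_sublist (i + 1) L)).length_le
    rw [h2, List.length_take] at h3
    omega

theorem listEstimate_le (X : Finset ℕ) : listEstimate p X ≤ p.t + p.t * p.prime := by
  rw [listEstimate]
  split_ifs with h
  · omega
  · exact (Nat.div_le_self _ _).trans (by omega)

/-- Counting the numbers that too few estimates reach yields the median without sorting. -/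
theorem estI_inpAt : estI (inpAt ω r k l) = estimate p (l : Multiset (Msg S)) := by
  have hΔ : p.Δ / 2 < p.Δ := Nat.div_lt_self (by simp [Params.Δ]) (by norm_num)
  refine Ram.sum_range_ite_of_iff_lt (fun e _ => ?_) ?_
  · rw [estimate, lt_sort_getD_iff _ (by simpa using hΔ)]
    rw [show (parm (inpAt ω r k l)).Δ = p.Δ from rfl, Multiset.filter_map, Multiset.card_map]
    simp only [listEst_inpAt]
    rw [← Finset.card_filter]
    rfl
  · rw [estimate]
    set s := (Multiset.range p.Δ).map fun w =>
      listEstimate p (smallest p.t (sketchValues (l : Multiset (Msg S)) w)) with hs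
    have hmem : (s.sort (· ≤ ·)).getD (p.Δ / 2) 0 ∈ s.sort (· ≤ ·) := by
      rw [List.getD_eq_getElem _ _ (by rw [Multiset.length_sort, hs]; simpa using hΔ)]
      exact List.getElem_mem _
    rw [Multiset.mem_sort, hs, Multiset.mem_map] at hmem
    obtain ⟨w, _, hw⟩ := hmem
    rw [← hw]
    exact (listEstimate_le _).trans (Nat.le_succ _)

theorem nodeRec_eq (β : ℕ) :
    nodeRec (inpAt ω r (.node β) l) (eltsOf l) =
      ((nodeStep ω r β (l : Multiset (Msg S))).map recOf : Records S) := by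
  obtain ⟨h1, h2, h3, h4, h5⟩ := parm_trim ω r (.node β) (l := l)
  rw [nodeRec, nodeStep, rom_round, h1]
  split_ifs
  · exact sketchRec_eq ω r _ (fun w hw v => memMerge_inpAt ω r _ hw)
      (fun w hw v hv => merge_lt_hashBound ω r _ hv) (.node _)
  · rw [Multiset.map_bind, estI_inpAt]
    refine Finset.sum_congr rfl fun i _ => ?_
    rfl

theorem countContr_inpAt (x y : ℕ) : countContr (inpAt ω r k l) x y =
    (contributions (l : Multiset (Msg S)) x y).card := by
  rw [countContr, ← card_map_sum, contributions, Multiset.map_add, Multiset.sum_add, parts_sum,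
    Multiset.map_map, product_filter_map_sum]
  congr 1
  · refine sum_inpOf fun i hi => ?_
    simp only [IsPart, inpOf_num hi]
  · rw [entries_sum]
    refine sum_inpOf fun i hi => ?_
    rw [entries_sum]
    trans ((l : Multiset (Msg S)).map fun v => if (l[i].num 0 = 0 ∧ l[i].num 1 = 1) ∧
      (v.num 0 = 0 ∧ v.num 1 = 0) ∧ l[i].num 2 = x ∧ v.num 3 = y ∧ l[i].num 3 = v.num 2
        then 1 else 0).sum
    · refine sum_inpOf fun j hj => ?_
      simp only [IsProduct, inpOf_num hi, inpOf_num hj, IsEntry, and_assoc]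
    · simp only [ite_and, flag]
      split_ifs <;> simp_all

theorem sumParts_inpAt (x y : ℕ) : sumParts (inpAt ω r k l) (eltsOf l) x y =
    (parts (l : Multiset (Msg S)) x y).sum := by
  have := parts_sum (X := S) (l : Multiset (Msg S)) x y (fun a => a)
  rw [Multiset.map_id'] at this
  rw [this]
  refine sum_inpOf fun i hi => ?_
  simp only [IsPart, inpOf_num hi, eltAt_inpOf hi]

theorem sumContr_inpAt (x y : ℕ) : sumContr (inpAt ω r k l) (eltsOf l) x y =
    (contributions (l : Multiset (Msg S)) x y).sum := by
  rw [contributions, Multiset.sum_add, product_filter_map_sum, sumContr, sumParts_inpAt]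
  congr 1
  rw [entries_sum]
  refine sum_inpOf fun i hi => ?_
  rw [entries_sum]
  trans ((l : Multiset (Msg S)).map fun v => if (l[i].num 0 = 0 ∧ l[i].num 1 = 1) ∧
      (v.num 0 = 0 ∧ v.num 1 = 0) ∧ l[i].num 2 = x ∧ v.num 3 = y ∧ l[i].num 3 = v.num 2
        then l[i].elt * v.elt else 0).sum
  · refine sum_inpOf fun j hj => ?_
    simp only [IsProduct, inpOf_num hi, inpOf_num hj, IsEntry, and_assoc, eltAt_inpOf hi,
      eltAt_inpOf hj]
  · simp only [ite_and, flag]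
    split_ifs <;> simp_all

theorem prodRec_eq (K i j s : ℕ) :
    prodRec (inpAt ω r (.prod K i j s) l) (eltsOf l) =
      ((prodStep p r K i j s (l : Multiset (Msg S))).map recOf : Records S) := by
  obtain ⟨h1, h2, h3, h4, h5⟩ := parm_trim ω r (.prod K i j s) (l := l)
  rw [prodRec, prodStep, Multiset.map_bind, Multiset.bind_map, Multiset.bind, Multiset.join,
    ← Multiset.filter_true (Multiset.range p.b ×ˢ Multiset.range p.b),
    product_filter_map_sum]
  simp only [h1, h5, rom_round, countContr_inpAt, sumContr_inpAt, if_true]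
  refine Finset.sum_congr rfl fun u _ => Finset.sum_congr rfl fun v _ => ?_
  rw [show (parm (inpAt ω r (.prod K i j s) l)).b = p.b from rfl,
    show (inpAt ω r (.prod K i j s) l).rom 8 = K from rfl,
    show (inpAt ω r (.prod K i j s) l).rom 9 = i from rfl,
    show (inpAt ω r (.prod K i j s) l).rom 10 = j from rfl,
    show (inpAt ω r (.prod K i j s) l).rom 11 = s from rfl]
  split_ifs
  · rfl
  · rfl
  · rfl

theorem cellRec_eq (K x y s : ℕ) :
    cellRec (inpAt ω r (.cell K x y s) l) (eltsOf l) =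
      ((cellStep p r K x y s (l : Multiset (Msg S))).1.map recOf +
        (cellStep p r K x y s (l : Multiset (Msg S))).2.map
          fun y => (true, (encoding S ω).out y) : Records S) := by
  obtain ⟨h1, h2, h3, h4, h5⟩ := parm_trim ω r (.cell K x y s) (l := l)
  rw [cellRec, cellStep, h1, h5, rom_round, sumParts_inpAt,
    show (parm (inpAt ω r (.cell K x y s) l)).m = p.m from rfl,
    show (inpAt ω r (.cell K x y s) l).rom 8 = K from rfl,
    show (inpAt ω r (.cell K x y s) l).rom 9 = x from rfl,
    show (inpAt ω r (.cell K x y s) l).rom 10 = y from rfl,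
    show (inpAt ω r (.cell K x y s) l).rom 11 = s from rfl]
  split_ifs
  · rfl
  · rfl

/-- The sums over ranges of positions that the programs evaluate are the reducers of the algorithm.
-/
theorem allRec_eq : allRec (inpAt ω r k l) (eltsOf l) =
    (algorithm S ω).records (encoding S ω) r k (l : Multiset (Msg S)) := by
  have h0 : ∀ k, (inpAt ω r k l).rom 7 = k.code.headD 0 := fun k => by cases k <;> rfl
  cases k with
  | home c i =>
    rw [allRec, h0, if_pos (show (Key.home c i).code.headD 0 = 0 from rfl), homeRec_eq]
    exact (add_zero _).symm
  | pair i j g =>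
    rw [allRec, h0, if_neg (by simp [Key.code]), if_pos
        (show (Key.pair i j g).code.headD 0 = 1 from rfl), pairRec_eq]
    exact (add_zero _).symm
  | bin β =>
    rw [allRec, h0, if_neg (by simp [Key.code]), if_neg (by simp [Key.code]),
        if_pos (show (Key.bin β).code.headD 0 = 2 from rfl), binRec_eq]
    exact (add_zero _).symm
  | node β =>
    rw [allRec, h0, if_neg (by simp [Key.code]), if_neg (by simp [Key.code]),
      if_neg (by simp [Key.code]), if_pos (show (Key.node β).code.headD 0 = 3 from rfl), nodeRec_eq]
    exact (add_zero _).symm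
  | prod K i j s =>
    rw [allRec, h0, if_neg (by simp [Key.code]), if_neg (by simp [Key.code]),
      if_neg (by simp [Key.code]), if_neg (by simp [Key.code]),
          if_pos (show (Key.prod K i j s).code.headD 0 = 4 from rfl), prodRec_eq]
    exact (add_zero _).symm
  | cell K x y s =>
    rw [allRec, h0, if_neg (by simp [Key.code]), if_neg (by simp [Key.code]),
      if_neg (by simp [Key.code]), if_neg (by simp [Key.code]), if_neg (by simp [Key.code]),
      cellRec_eq]
    rfl

end

/-! ### One program for all reducers -/

section

variable {S : Type u}

theorem Msg.length_code (v : Msg S) : v.code.length = 8 := by cases v <;> rfl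

theorem getD_flatMap_code {l : List (Msg S)} {i f : ℕ} (hi : i < l.length) (hf : f < 8)
    (d : Word S) : (l.flatMap Msg.code).getD (8 * i + f) d = l[i].code.getD f d := by
  induction l generalizing i with
  | nil => simp at hi
  | cons v l ih =>
    rw [List.flatMap_cons]
    rcases i with _ | i
    · rw [List.getD_append _ _ _ _ (by rw [v.length_code]; omega)]
      simp
    · rw [List.getD_append_right _ _ _ _ (by rw [v.length_code]; omega), v.length_code,
        show 8 * (i + 1) + f - 8 = 8 * i + f by omega, ih (by simpa using hi)]
      simp

theorem length_flatMap_code (l : List (Msg S)) : (l.flatMap Msg.code).length = 8 * l.length := by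
  induction l with
  | nil => rfl
  | cons v l ih =>
    rw [List.flatMap_cons, List.length_append, ih, v.length_code, List.length_cons]
    ring

theorem stored_inpOf [NonUnitalSemiring S] {rom : ℕ → ℕ} {l : List (Msg S)}
    (h : rom 6 = l.length) : (inpOf rom l).Stored (8 * l.length)
      (fun i => (l.flatMap Msg.code).getD i (.num 0)) (eltsOf l) where
  rom := h
  size := le_rfl
  num := by
    intro i hi f hf
    rw [getD_flatMap_code hi (by omega), Msg.code_eq, inpOf_num hi]
    interval_cases f <;> rfl
  elt := by
    intro i hi h0
    rw [inpOf_num hi] at h0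
    rw [getD_flatMap_code hi (by omega), Msg.code_eq]
    simp [h0, eltsOf, show i < l.length from hi]
    rfl
  outside := by
    intro i f hi
    have : l.length ≤ i := hi
    simp [inpOf, this]

end

/-- The program computes all reducers. If all numbers in sight are at most `B`, then `B ^ D` bounds
the time and all numbers that it produces. The space consists of the eight words of each value and
of a constant number of registers. -/
def ComputesReducers (prog : Cmd) (D : ℕ) : Prop :=
  ∀ (S : Type u) [NonUnitalSemiring S] {p : Params} (ω : Choices p) (r : ℕ) (k : Key)
    (l : List (Msg S)) (B space L time : ℕ), 2 ≤ B →
    (∀ i, (encoding S ω).rom r k (l : Multiset (Msg S)) i ≤ B) → l.length ≤ B →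
    (∀ v ∈ l, ∀ f, v.num f ≤ B) → 8 * l.length + prog.width ≤ space → B ^ D < L → B ^ D ≤ time →
    Computes prog L space time ((encoding S ω).rom r k (l : Multiset (Msg S)))
      (l.flatMap (encoding S ω).val)
      ((algorithm S ω).records (encoding S ω) r k (l : Multiset (Msg S)))

/-- One program computes all reducers: it branches on the tag of the key. -/
theorem exists_program : ∃ (prog : Cmd) (D : ℕ), ComputesReducers.{u} prog D := by
  obtain ⟨prog, D, h⟩ := OComp.computes (ocomp_allRec.{u} (α := Inp))
  refine ⟨prog, D + 1, fun S _ p ω r k l B space L time hB hrom hlen hnum hsp hL ht => ?_⟩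
  have hBD : B ^ D ≤ B ^ (D + 1) := Nat.pow_le_pow_right (by omega) (by omega)
  have hBB : B ≤ B ^ (D + 1) := Nat.le_self_pow (by omega) B
  have h1 := h S (inpAt ω r k l) B (eltsOf l) (l.flatMap Msg.code) space L time
    ⟨hB, hrom, hlen, fun i f => ?_⟩ (length_flatMap_code l) (stored_inpOf rfl) ?_ hsp (by omega)
    (by omega)
  · have h2 := allRec_eq ω r k (l := l)
    rw [← h2]
    exact h1
  · rcases lt_or_ge i l.length with hi | hi
    · rw [inpOf_num hi]
      exact hnum _ (List.getElem_mem _) _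
    · simp [inpOf, hi]
  · intro w hw
    obtain ⟨v, hv, hw⟩ := List.mem_flatMap.1 hw
    have h3 := hnum v hv
    have h4 : ∀ f, v.num f < L := fun f => by have := h3 f; omega
    rw [Msg.code_eq] at hw
    simp only [List.mem_cons, List.not_mem_nil, or_false] at hw
    rcases hw with rfl | rfl | rfl | rfl | rfl | rfl | rfl | rfl
    any_goals exact h4 _
    split_ifs
    · trivial
    · exact (Nat.zero_le _).trans_lt (h4 0)

/-! ### Averages over finite probability spaces -/

section Average

variable {Ω Ω' : Type*} [Fintype Ω] [Fintype Ω']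

/-- The average of a function on a finite type. -/
noncomputable def avg (f : Ω → ℝ) : ℝ := (∑ ω, f ω) / Fintype.card Ω

open Classical in
/-- The probability of an event under the uniform distribution. -/
noncomputable def pr (P : Ω → Prop) : ℝ := avg fun ω => if P ω then 1 else 0

theorem avg_mono {f g : Ω → ℝ} (h : ∀ ω, f ω ≤ g ω) : avg f ≤ avg g :=
  div_le_div_of_nonneg_right (Finset.sum_le_sum fun ω _ => h ω) (by positivity)

theorem avg_add (f g : Ω → ℝ) : avg (fun ω => f ω + g ω) = avg f + avg g := by
  rw [avg, Finset.sum_add_distrib, add_div]; rfl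

theorem avg_sum {ι : Type*} (s : Finset ι) (f : ι → Ω → ℝ) :
    avg (fun ω => ∑ i ∈ s, f i ω) = ∑ i ∈ s, avg (f i) := by
  rw [avg, Finset.sum_comm, Finset.sum_div]; rfl

theorem avg_mul_left (c : ℝ) (f : Ω → ℝ) : avg (fun ω => c * f ω) = c * avg f := by
  rw [avg, ← Finset.mul_sum, mul_div_assoc]; rfl

theorem avg_const [Nonempty Ω] (c : ℝ) : avg (fun _ : Ω => c) = c := by
  rw [avg, Finset.sum_const, nsmul_eq_mul, Finset.card_univ, mul_div_cancel_left₀]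
  exact_mod_cast Fintype.card_ne_zero

theorem avg_prod (f : Ω → ℝ) (g : Ω' → ℝ) :
    avg (fun u : Ω × Ω' => f u.1 * g u.2) = avg f * avg g := by
  rw [avg, avg, avg, div_mul_div_comm, Finset.sum_mul_sum, Fintype.sum_prod_type,
    Fintype.card_prod]
  push_cast
  rfl

theorem avg_fst [Nonempty Ω'] (f : Ω → ℝ) : avg (fun u : Ω × Ω' => f u.1) = avg f := by
  have := avg_prod f (fun _ : Ω' => 1)
  simpa [avg_const] using this

theorem avg_snd [Nonempty Ω] (f : Ω' → ℝ) : avg (fun u : Ω × Ω' => f u.2) = avg f := by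
  have := avg_prod (fun _ : Ω => 1) f
  simpa [avg_const] using this

/-- Independence of the coordinates of a uniformly random function. -/
theorem avg_pi {ι : Type*} [Fintype ι] [DecidableEq ι] (φ : ι → Ω → ℝ) :
    avg (fun f : ι → Ω => ∏ i, φ i (f i)) = ∏ i, avg (φ i) := by
  simp only [avg]
  rw [Finset.prod_div_distrib, Finset.prod_univ_sum, Fintype.piFinset_univ, Finset.prod_const,
    Finset.card_univ, Fintype.card_fun]
  push_cast
  rfl

theorem avg_equiv (e : Ω ≃ Ω') (f : Ω' → ℝ) : avg (fun ω => f (e ω)) = avg f := by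
  rw [avg, avg, Fintype.card_congr e, Equiv.sum_comp e f]

theorem pr_mono {P Q : Ω → Prop} (h : ∀ ω, P ω → Q ω) : pr P ≤ pr Q := by
  refine avg_mono fun ω => ?_
  by_cases hP : P ω
  · simp [hP, h ω hP]
  · rw [if_neg hP]
    split_ifs <;> simp

theorem pr_or (P Q : Ω → Prop) : pr (fun ω => P ω ∨ Q ω) ≤ pr P + pr Q := by
  rw [pr, pr, pr, ← avg_add]
  refine avg_mono fun ω => ?_
  by_cases hP : P ω <;> by_cases hQ : Q ω <;> simp [hP, hQ]

theorem pr_exists {ι : Type*} (s : Finset ι) (P : ι → Ω → Prop) :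
    pr (fun ω => ∃ i ∈ s, P i ω) ≤ ∑ i ∈ s, pr (P i) := by
  classical
  simp only [pr]
  rw [← avg_sum]
  refine avg_mono fun ω => ?_
  split_ifs with h
  · obtain ⟨i, hi, hP⟩ := h
    refine le_trans ?_ (Finset.single_le_sum (f := fun i => if P i ω then (1 : ℝ) else 0)
      (fun i _ => by positivity) hi)
    simp [hP]
  · exact Finset.sum_nonneg fun i _ => by positivity

/-- Markov's inequality. -/
theorem pr_le_avg {P : Ω → Prop} {f : Ω → ℝ} (h0 : ∀ ω, 0 ≤ f ω) (h : ∀ ω, P ω → 1 ≤ f ω) :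
    pr P ≤ avg f := by
  refine avg_mono fun ω => ?_
  split_ifs with hP
  · exact h ω hP
  · exact h0 ω

theorem pr_fst [Nonempty Ω'] (P : Ω → Prop) : pr (fun u : Ω × Ω' => P u.1) = pr P := by
  classical exact avg_fst fun ω => if P ω then 1 else 0

theorem pr_false : pr (fun _ : Ω => False) = 0 := by simp [pr, avg]

theorem pr_not [Nonempty Ω] (P : Ω → Prop) : pr (fun ω => ¬ P ω) = 1 - pr P := by
  rw [eq_sub_iff_add_eq, pr, pr, ← avg_add]
  refine (congrArg avg (funext fun ω => ?_)).trans (avg_const 1)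
  by_cases hP : P ω <;> simp [hP]

theorem uniformOn_univ_eq_pr [MeasurableSpace Ω] [MeasurableSingletonClass Ω] [Nonempty Ω]
    (P : Ω → Prop) : ProbabilityTheory.uniformOn Set.univ {ω | P ω} = ENNReal.ofReal (pr P) := by
  classical
  rw [ProbabilityTheory.uniformOn_univ, MeasureTheory.Measure.count_apply
      (Set.toFinite _).measurableSet,
    Set.encard_eq_coe_toFinset_card, pr, avg, ENNReal.ofReal_div_of_pos
      (by exact_mod_cast Fintype.card_pos), ENNReal.ofReal_natCast, Finset.sum_boole,
    ENNReal.ofReal_natCast]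
  congr 2
  simp only [Set.toFinset_ofPred]
  norm_cast

/-- When balls of weights `w i ∈ [0, 1]` are thrown at random into `N` bins, the load of a bin has
an exponential moment like that of a Poisson variable. The factor `2` comes from `exp w ≤ 1 + 2 w`.
-/
theorem avg_exp_load_le {ι : Type*} [Fintype ι] [DecidableEq ι] {N : ℕ} (β : Fin N) (w : ι → ℝ)
    (h0 : ∀ i, 0 ≤ w i) (h1 : ∀ i, w i ≤ 1) :
    avg (fun f : ι → Fin N => Real.exp (∑ i, if f i = β then w i else 0)) ≤
      Real.exp (2 * (∑ i, w i) / N) := by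
  have hN : (0 : ℝ) < N := by exact_mod_cast β.pos
  simp only [Real.exp_sum]
  rw [avg_pi (fun i x => Real.exp (if x = β then w i else 0)), mul_div_assoc, Finset.sum_div,
    Finset.mul_sum, Real.exp_sum]
  refine Finset.prod_le_prod (fun i _ => div_nonneg (Finset.sum_nonneg fun _ _ =>
    (Real.exp_pos _).le) (Nat.cast_nonneg _)) fun i _ => ?_
  have hexp : Real.exp (w i) ≤ 1 + 2 * w i := by
    have := Real.abs_exp_sub_one_le (x := w i) (by rw [abs_of_nonneg (h0 i)]; exact h1 i)
    rw [abs_of_nonneg (h0 i)] at this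
    have := (abs_le.1 this).2
    linarith
  calc avg (fun x : Fin N => Real.exp (if x = β then w i else 0))
      ≤ avg (fun x : Fin N => 1 + 2 * w i * (if x = β then 1 else 0)) := by
        refine avg_mono fun x => ?_
        split_ifs
        · linarith
        · simp
    _ = 1 + 2 * (w i / N) := by
        have : Nonempty (Fin N) := ⟨β⟩
        rw [avg_add, avg_const, avg_mul_left, avg]
        simp
        ring
    _ ≤ _ := by
        have := Real.add_one_le_exp (2 * (w i / N))
        linarith

end Average

/-! ### The smallest elements of a set -/

section Smallest

variable {t : ℕ} {X Y : Finset ℕ} {v : ℕ}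

theorem mem_smallest : v ∈ smallest t X ↔ v ∈ X ∧ (X.filter (· < v)).card < t := by
  rw [smallest, Finset.mem_filter]

theorem smallest_subset : smallest t X ⊆ X := Finset.filter_subset _ _

/-- An element that is among the `t` smallest of a set stays so in every subset that contains it.
Hence no merging of sketches of subsets loses a value of the sketch of the whole set. -/
theorem mem_smallest_of_subset (h : v ∈ smallest t X) (hYX : Y ⊆ X) (hv : v ∈ Y) :
    v ∈ smallest t Y :=
  mem_smallest.2 ⟨hv, (Finset.card_le_card (Finset.filter_subset_filter _ hYX)).trans_lt
    (mem_smallest.1 h).2⟩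

/-- Sketches may be merged in any order: all that matters is that the `t` smallest elements have not
been lost. -/
theorem smallest_eq_of_subset (h : smallest t X ⊆ Y) (hYX : Y ⊆ X) :
    smallest t Y = smallest t X := by
  ext v
  constructor
  · intro hv
    obtain ⟨hvY, hc⟩ := mem_smallest.1 hv
    by_contra hn
    -- the least element of `X` below `v` that is missing from `Y` would be among the smallest
    have hex : ∃ u, u ∈ X ∧ u ≤ v ∧ u ∉ smallest t X := ⟨v, hYX hvY, le_rfl, hn⟩
    classical
    obtain ⟨hu, huv, hus⟩ := Nat.find_spec hex
    set u := Nat.find hex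
    have hsub : X.filter (· < u) ⊆ Y.filter (· < v) := by
      intro z hz
      rw [Finset.mem_filter] at hz ⊢
      refine ⟨h ?_, hz.2.trans_le huv⟩
      by_contra hzs
      exact Nat.find_min hex hz.2 ⟨hz.1, (hz.2.trans_le huv).le, hzs⟩
    exact hus (mem_smallest.2 ⟨hu, (Finset.card_le_card hsub).trans_lt hc⟩)
  · intro hv
    exact mem_smallest_of_subset hv hYX (h hv)

theorem card_smallest_le : (smallest t X).card ≤ t := by
  rcases (smallest t X).eq_empty_or_nonempty with h | h
  · simp [h]
  · have hm := (smallest t X).max'_mem h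
    set z := (smallest t X).max' h
    have hsub : (smallest t X).erase z ⊆ X.filter (· < z) := by
      intro u hu
      rw [Finset.mem_erase] at hu
      exact Finset.mem_filter.2 ⟨smallest_subset hu.2,
        lt_of_le_of_ne ((smallest t X).le_max' u hu.2) hu.1⟩
    have h1 := Finset.card_le_card hsub
    rw [Finset.card_erase_of_mem hm] at h1
    have := (mem_smallest.1 hm).2
    omega

theorem card_smallest (h : t ≤ X.card) : (smallest t X).card = t := by
  refine le_antisymm card_smallest_le ?_
  by_contra hlt
  have hne : (X \ smallest t X).Nonempty := by
    rw [← Finset.card_pos, Finset.card_sdiff_of_subset smallest_subset]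
    omega
  have hz := (X \ smallest t X).min'_mem hne
  set z := (X \ smallest t X).min' hne
  rw [Finset.mem_sdiff] at hz
  refine hz.2 (mem_smallest.2 ⟨hz.1, (Finset.card_le_card ?_).trans_lt (not_le.1 hlt)⟩)
  intro u hu
  rw [Finset.mem_filter] at hu
  by_contra hus
  have := (X \ smallest t X).min'_le u (Finset.mem_sdiff.2 ⟨hu.1, hus⟩)
  omega

theorem smallest_nonempty (ht : 0 < t) (h : X.Nonempty) : (smallest t X).Nonempty := by
  refine ⟨X.min' h, mem_smallest.2 ⟨X.min'_mem h, ?_⟩⟩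
  rw [Finset.card_eq_zero.2]
  · exact ht
  · refine Finset.filter_eq_empty_iff.2 fun u hu => not_lt.2 (X.min'_le u hu)

/-- If at least `t` elements are at most `b`, then so are the `t` smallest ones. -/
theorem le_of_mem_smallest {b : ℕ} (h : t ≤ (X.filter (· ≤ b)).card) (hv : v ∈ smallest t X) :
    v ≤ b := by
  by_contra hb
  have hsub : X.filter (· ≤ b) ⊆ X.filter (· < v) := by
    intro u hu
    rw [Finset.mem_filter] at hu ⊢
    exact ⟨hu.1, hu.2.trans_lt (not_le.1 hb)⟩
  have := Finset.card_le_card hsub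
  have := (mem_smallest.1 hv).2
  omega

end Smallest

/-! ### The estimate of the number of distinct elements -/

section Hash

/-- The value at `x` of the hash function with coefficients `u`. -/
def hashVal {P : ℕ} (u : Fin P × Fin P) (x : ℕ) : ℕ := (u.1 * x + u.2) % P + 1

variable {P : ℕ}

theorem hashVal_le (u : Fin P × Fin P) (x : ℕ) : hashVal u x ≤ P :=
  Nat.mod_lt _ u.1.pos

/-- The values of a random hash function at two points are independent and uniformly distributed,
because the coefficients can be recovered from them by solving a linear system modulo the prime. -/
theorem avg_hash_pair (hP : P.Prime) {x y : ℕ} (hx : x < P) (hy : y < P) (hxy : x ≠ y)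
    (f : ℕ → ℕ → ℝ) : avg (fun u : Fin P × Fin P => f (hashVal u x) (hashVal u y)) =
      avg (fun u : Fin P × Fin P => f (u.1 + 1) (u.2 + 1)) := by
  have : Fact P.Prime := ⟨hP⟩
  let e : Fin P × Fin P → Fin P × Fin P := fun u =>
    (⟨(u.1 * x + u.2) % P, Nat.mod_lt _ hP.pos⟩, ⟨(u.1 * y + u.2) % P, Nat.mod_lt _ hP.pos⟩)
  have hinj : Function.Injective e := by
    rintro ⟨a, b⟩ ⟨a', b'⟩ h
    simp only [e, Prod.mk.injEq, Fin.mk.injEq] at h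
    have h1 := (ZMod.natCast_eq_natCast_iff' _ _ P).2 h.1
    have h2 := (ZMod.natCast_eq_natCast_iff' _ _ P).2 h.2
    push_cast at h1 h2
    have hne : (x : ZMod P) - y ≠ 0 := by
      rw [sub_ne_zero, Ne, ZMod.natCast_eq_natCast_iff', Nat.mod_eq_of_lt hx, Nat.mod_eq_of_lt hy]
      exact hxy
    have ha : (a : ZMod P) = a' := mul_right_cancel₀ hne (by linear_combination h1 - h2)
    have hb : ((b : ℕ) : ZMod P) = (b' : ℕ) := by rw [ha] at h1; linear_combination h1
    have key : ∀ a b : Fin P, ((a : ℕ) : ZMod P) = (b : ℕ) → a = b := fun a b h => by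
      rw [ZMod.natCast_eq_natCast_iff', Nat.mod_eq_of_lt a.2, Nat.mod_eq_of_lt b.2] at h
      exact Fin.ext h
    exact Prod.ext (key _ _ ha) (key _ _ hb)
  exact avg_equiv (Equiv.ofBijective e (Finite.injective_iff_bijective.1 hinj))
    fun u : Fin P × Fin P => f (u.1 + 1) (u.2 + 1)

theorem avg_hash (hP : P.Prime) {x : ℕ} (hx : x < P) (f : ℕ → ℝ) :
    avg (fun u : Fin P × Fin P => f (hashVal u x)) = avg (fun i : Fin P => f (i + 1)) := by
  have : Nonempty (Fin P) := ⟨⟨x, hx⟩⟩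
  obtain ⟨y, hy, hxy⟩ : ∃ y < P, x ≠ y := by
    rcases Nat.eq_zero_or_pos x with rfl | h
    · exact ⟨1, hP.one_lt, by omega⟩
    · exact ⟨0, hP.pos, by omega⟩
  rw [avg_hash_pair hP hx hy hxy fun a _ => f a]
  exact avg_fst fun i : Fin P => f (i + 1)

theorem avg_le_indicator {v : ℕ} (hv : v ≤ P) :
    avg (fun i : Fin P => if (i : ℕ) + 1 ≤ v then (1 : ℝ) else 0) = v / P := by
  rw [avg, Fintype.card_fin, Fin.sum_univ_eq_sum_range (fun i => if i + 1 ≤ v then (1 : ℝ) else 0),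
    Finset.sum_boole]
  congr 2
  rw [show (Finset.range P).filter (fun i => i + 1 ≤ v) = Finset.range v by
    ext i; simp; omega, Finset.card_range]

/-- The number of elements of `F` with a hash value of at most `v`. -/
def below (F : Finset ℕ) (v : ℕ) (u : Fin P × Fin P) : ℕ := (F.filter fun x => hashVal u x ≤ v).card

theorem below_eq_sum (F : Finset ℕ) (v : ℕ) (u : Fin P × Fin P) :
    (below F v u : ℝ) = ∑ x ∈ F, if hashVal u x ≤ v then 1 else 0 := by
  rw [below, Finset.sum_boole]

variable {F : Finset ℕ} {v : ℕ}

theorem avg_below (hP : P.Prime) (hF : ∀ x ∈ F, x < P) (hv : v ≤ P) :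
    avg (fun u : Fin P × Fin P => (below F v u : ℝ)) = F.card * (v / P) := by
  simp only [below_eq_sum]
  rw [avg_sum, Finset.sum_congr rfl fun x hx =>
    (avg_hash hP (hF x hx) fun a => if a ≤ v then (1 : ℝ) else 0).trans (avg_le_indicator hv),
    Finset.sum_const, nsmul_eq_mul]

/-- The variance of `below` is at most its mean. -/
theorem avg_below_sub_sq_le (hP : P.Prime) (hF : ∀ x ∈ F, x < P) (hv : v ≤ P) :
    avg (fun u : Fin P × Fin P => ((below F v u : ℝ) - F.card * (v / P)) ^ 2) ≤
      F.card * (v / P) := by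
  have : Nonempty (Fin P) := ⟨⟨0, hP.pos⟩⟩
  set a : ℝ := v / P
  have ha : 0 ≤ a := by positivity
  have hsq : avg (fun u : Fin P × Fin P => (below F v u : ℝ) ^ 2) ≤
      F.card * a + (F.card * a) ^ 2 := by
    have h : ∀ u : Fin P × Fin P, (below F v u : ℝ) ^ 2 = ∑ x ∈ F, ∑ y ∈ F,
        (if hashVal u x ≤ v then 1 else 0) * (if hashVal u y ≤ v then 1 else 0) := fun u => by
      rw [below_eq_sum, sq, Finset.sum_mul_sum]
    simp only [h]
    rw [avg_sum]
    simp only [avg_sum]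
    calc _ ≤ ∑ x ∈ F, ∑ y ∈ F, (a ^ 2 + if x = y then a else 0) := by
          refine Finset.sum_le_sum fun x hx => Finset.sum_le_sum fun y hy => ?_
          by_cases hxy : x = y
          · subst hxy
            have h1 : avg (fun u : Fin P × Fin P => if hashVal u x ≤ v then (1 : ℝ) else 0) = a :=
              (avg_hash hP (hF x hx) fun a => if a ≤ v then (1 : ℝ) else 0).trans
                (avg_le_indicator hv)
            rw [if_pos rfl]
            refine le_trans (avg_mono fun u => ?_)
                (h1.le.trans (le_add_of_nonneg_left (sq_nonneg _)))
            split_ifs <;> simp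
          · rw [if_neg hxy, add_zero, avg_hash_pair hP (hF x hx) (hF y hy) hxy
              (fun a b => (if a ≤ v then (1 : ℝ) else 0) * (if b ≤ v then 1 else 0)),
              avg_prod (fun i : Fin P => if (i : ℕ) + 1 ≤ v then (1 : ℝ) else 0)
                (fun i : Fin P => if (i : ℕ) + 1 ≤ v then (1 : ℝ) else 0), avg_le_indicator hv, sq]
      _ = _ := by
          simp only [Finset.sum_add_distrib, Finset.sum_const, nsmul_eq_mul, Finset.sum_ite_eq,
            Finset.sum_ite_mem, Finset.inter_self]
          ring
  have hexp : ∀ u : Fin P × Fin P, ((below F v u : ℝ) - F.card * a) ^ 2 =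
      below F v u ^ 2 + (-(2 * (F.card * a)) * below F v u + (F.card * a) ^ 2) := fun u => by ring
  simp only [hexp]
  rw [avg_add, avg_add, avg_mul_left, avg_const, avg_below hP hF hv]
  nlinarith

/-- Two elements of `F` collide with probability at most `|F|² / P`. -/
theorem pr_collision_le (hP : P.Prime) (hF : ∀ x ∈ F, x < P) :
    pr (fun u : Fin P × Fin P => ¬ Set.InjOn (hashVal u) F) ≤ F.card ^ 2 / P := by
  have hne : Nonempty (Fin P) := ⟨⟨0, hP.pos⟩⟩
  have hP0 : (0 : ℝ) < P := by exact_mod_cast hP.pos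
  calc pr (fun u : Fin P × Fin P => ¬ Set.InjOn (hashVal u) F)
      ≤ pr (fun u : Fin P × Fin P => ∃ z ∈ F ×ˢ F, z.1 ≠ z.2 ∧ hashVal u z.1 = hashVal u z.2) := by
        refine pr_mono fun u hu => ?_
        simp only [Set.InjOn, not_forall] at hu
        obtain ⟨x, hx, y, hy, h, hxy⟩ := hu
        exact ⟨(x, y), Finset.mem_product.2 ⟨hx, hy⟩, hxy, h⟩
    _ ≤ ∑ z ∈ F ×ˢ F, (1 / P : ℝ) := by
        refine (pr_exists _ _).trans (Finset.sum_le_sum fun z hz => ?_)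
        rw [Finset.mem_product] at hz
        by_cases hxy : z.1 = z.2
        · simp only [hxy, ne_eq, not_true_eq_false, false_and, pr_false]
          positivity
        · refine (pr_mono (Q := fun u => hashVal u z.1 = hashVal u z.2) fun u hu => hu.2).trans ?_
          rw [pr, avg_hash_pair hP (hF _ hz.1) (hF _ hz.2) hxy
            (fun a b => @ite ℝ (a = b) (Classical.propDecidable _) 1 0), avg, Fintype.sum_prod_type]
          simp only [Nat.add_right_cancel_iff, Fin.val_inj, Finset.sum_ite_eq, Finset.mem_univ,
            if_true, Finset.sum_const, Finset.card_univ, Fintype.card_fin, Fintype.card_prod,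
            nsmul_eq_mul, mul_one]
          push_cast
          rw [div_le_div_iff₀ (by positivity) hP0]
          ring_nf
          exact le_rfl
    _ = _ := by rw [Finset.sum_const, Finset.card_product, nsmul_eq_mul]; push_cast; ring

end Hash

section Estimate

variable {p : Params}

theorem Params.prime_spec (p : Params) : p.n ^ 3 ≤ p.prime ∧ p.prime.Prime :=
  Nat.find_spec (Nat.exists_infinite_primes (p.n ^ 3))

/-- A list of a sketch is bad for `F` if its estimate is off by more than a constant factor. The
factors are generous: `16` leaves room for Markov, and `768 = 2 t` for Chebyshev. -/
def BadList (p : Params) (F : Finset ℕ) (u : Fin p.prime × Fin p.prime) : Prop :=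
  768 * listEstimate p (smallest p.t (F.image (hashVal u))) < F.card ∨
    16 * F.card < listEstimate p (smallest p.t (F.image (hashVal u)))

variable {F : Finset ℕ}

theorem card_filter_image_le (u : Fin p.prime × Fin p.prime) (v : ℕ) :
    ((F.image (hashVal u)).filter (· ≤ v)).card ≤ below F v u := by
  rw [Finset.filter_image, below]
  exact Finset.card_image_le

/-- An overestimate means that too many hash values are small. -/
theorem le_below_of_lt_listEstimate (hF : F.Nonempty) {u : Fin p.prime × Fin p.prime}
    (h : 16 * F.card < listEstimate p (smallest p.t (F.image (hashVal u)))) :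
    384 ≤ below F (384 * p.prime / (16 * F.card)) u := by
  have hc : (smallest p.t (F.image (hashVal u))).card ≤ F.card :=
    (Finset.card_le_card smallest_subset).trans Finset.card_image_le
  rw [listEstimate] at h
  split_ifs at h with h1
  · omega
  set v := (smallest p.t (F.image (hashVal u))).sup id
  have hv : 0 < v := by
    by_contra h0
    rw [Nat.le_zero.1 (not_lt.1 h0), Nat.div_zero] at h
    omega
  have h2 : v ≤ 384 * p.prime / (16 * F.card) := by
    have := (Nat.le_div_iff_mul_le hv).1 h.le
    rw [Nat.le_div_iff_mul_le (by have := hF.card_pos; omega), mul_comm]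
    exact this
  refine le_trans (not_lt.1 h1) (le_trans (Finset.card_le_card ?_)
    (card_filter_image_le u (384 * p.prime / (16 * F.card))))
  intro w hw
  exact Finset.mem_filter.2 ⟨smallest_subset hw, le_trans (Finset.le_sup (f := id) hw) h2⟩

theorem listEstimate_pos (hF : F.Nonempty) (u : Fin p.prime × Fin p.prime) :
    0 < listEstimate p (smallest p.t (F.image (hashVal u))) := by
  have hne : (smallest p.t (F.image (hashVal u))).Nonempty :=
    smallest_nonempty (by norm_num [Params.t]) (hF.image _)
  rw [listEstimate]
  split_ifs with h
  · exact hne.card_pos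
  · have hle : (smallest p.t (F.image (hashVal u))).sup id ≤ p.prime := by
      refine Finset.sup_le fun v hv => ?_
      obtain ⟨x, -, rfl⟩ := Finset.mem_image.1 (smallest_subset hv)
      exact hashVal_le u x
    obtain ⟨v, hv⟩ := hne
    have h0 : 0 < (smallest p.t (F.image (hashVal u))).sup id := by
      refine lt_of_lt_of_le ?_ (Finset.le_sup (f := id) hv)
      obtain ⟨x, -, rfl⟩ := Finset.mem_image.1 (smallest_subset hv)
      exact Nat.succ_pos _
    refine Nat.div_pos (hle.trans ?_) h0
    simp only [Params.t]
    omega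

/-- An underestimate means that two hash values collide or that too few of them are small. -/
theorem below_lt_of_listEstimate_lt {u : Fin p.prime × Fin p.prime}
    (ho : 768 < F.card) (hinj : Set.InjOn (hashVal u) F)
    (h : 768 * listEstimate p (smallest p.t (F.image (hashVal u))) < F.card) :
    below F (768 * p.prime / F.card) u < 384 := by
  by_contra hb
  rw [not_lt, below] at hb
  have hcard : (F.image (hashVal u)).card = F.card := Finset.card_image_of_injOn hinj
  have ht : p.t ≤ (F.image (hashVal u)).card := by rw [hcard, Params.t]; omega
  have hsup : (smallest p.t (F.image (hashVal u))).sup id ≤ 768 * p.prime / F.card := by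
    refine Finset.sup_le fun v hv => le_of_mem_smallest ?_ hv
    rw [Finset.filter_image, Finset.card_image_of_injOn
        (hinj.mono (Finset.coe_subset.2 (Finset.filter_subset _ _)))]
    exact hb
  rw [listEstimate, if_neg (by rw [card_smallest ht]; omega)] at h
  have hs0 : 0 < (smallest p.t (F.image (hashVal u))).sup id := by
    obtain ⟨v, hv⟩ := smallest_nonempty (t := p.t) (by norm_num [Params.t])
      (Finset.card_pos.1 (by rw [hcard]; omega : 0 < (F.image (hashVal u)).card))
    refine lt_of_lt_of_le ?_ (Finset.le_sup (f := id) hv)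
    obtain ⟨x, -, rfl⟩ := Finset.mem_image.1 (smallest_subset hv)
    exact Nat.succ_pos _
  have h1 : F.card / 2 ≤ p.t * p.prime / (smallest p.t (F.image (hashVal u))).sup id := by
    rw [Nat.le_div_iff_mul_le hs0]
    have h2 := (Nat.le_div_iff_mul_le (by omega)).1 hsup
    have h3 : F.card / 2 * 2 ≤ F.card := by omega
    simp only [Params.t] at h2 ⊢
    have h4 := Nat.mul_le_mul_right
      ((smallest 384 (F.image (hashVal u))).sup id) h3
    have h5 : F.card / 2 * 2 * (smallest 384 (F.image (hashVal u))).sup id =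
      2 * (F.card / 2 * (smallest 384 (F.image (hashVal u))).sup id) := by ring
    rw [mul_comm _ F.card] at h2
    omega
  omega

/-- A list is bad with probability at most `1 / 8`: `1 / 16` for an overestimate, by Markov, and
`1 / 16` for an underestimate, by Chebyshev and the rarity of collisions. -/
theorem pr_badList_le (hF : F.Nonempty) (hn : ∀ x ∈ F, x < p.n) :
    pr (BadList p F) ≤ 1 / 8 := by
  obtain ⟨hP3, hP⟩ := p.prime_spec
  have hcn : F.card ≤ p.n := by
    have : F ⊆ Finset.range p.n := fun x hx => Finset.mem_range.2 (hn x hx)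
    simpa using Finset.card_le_card this
  have hpos := hF.card_pos
  have hn1 : 1 ≤ p.n := by omega
  have hFP : ∀ x ∈ F, x < p.prime := fun x hx =>
    (hn x hx).trans_le ((Nat.le_self_pow (by norm_num) _).trans hP3)
  have hP0 : (0 : ℝ) < p.prime := by exact_mod_cast hP.pos
  have ho0 : (0 : ℝ) < F.card := by exact_mod_cast hpos
  have hne : Nonempty (Fin p.prime) := ⟨⟨0, hP.pos⟩⟩
  -- Markov: the mean of `below` is at most `384 / 16`
  have hup : pr (fun u : Fin p.prime × Fin p.prime =>
      384 ≤ below F (384 * p.prime / (16 * F.card)) u) ≤ 1 / 16 := by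
    set v := 384 * p.prime / (16 * F.card)
    have hvo : v * (16 * F.card) ≤ 384 * p.prime := Nat.div_mul_le_self _ _
    have hub : pr (fun u : Fin p.prime × Fin p.prime => 384 ≤ below F v u) ≤
        avg fun u : Fin p.prime × Fin p.prime => (1 / 384 : ℝ) * below F v u :=
      pr_le_avg (fun u => by positivity) fun u hu => by
        have : (384 : ℝ) ≤ below F v u := by exact_mod_cast hu
        linarith
    refine hub.trans ?_
    rw [avg_mul_left]
    -- a threshold above the range occurs only for a small set, all of which it exceeds
    have hmean : avg (fun u : Fin p.prime × Fin p.prime => (below F v u : ℝ)) ≤ 24 := by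
      by_cases hv : v ≤ p.prime
      · rw [avg_below hP hFP hv, ← mul_div_assoc, div_le_iff₀ hP0]
        have : v * (16 * F.card) ≤ 384 * p.prime := hvo
        have : (v : ℝ) * (16 * F.card) ≤ 384 * p.prime := by exact_mod_cast this
        linarith
      · have hc : F.card ≤ 24 := by
          by_contra hc
          have h1 : p.prime * 24 < v * F.card :=
            Nat.mul_lt_mul_of_lt_of_le (not_le.1 hv) (by omega) (by omega)
          have h2 : v * (16 * F.card) = 16 * (v * F.card) := by ring
          omega
        refine (avg_mono (g := fun _ => 24) fun u => ?_).trans (avg_const _).le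
        have : below F v u ≤ F.card := Finset.card_filter_le _ _
        exact_mod_cast this.trans hc
    linarith
  refine (pr_or _ _).trans ?_
  have hup' := (pr_mono fun u => le_below_of_lt_listEstimate (p := p) hF (u := u)).trans hup
  suffices hlow : pr (fun u => 768 * listEstimate p (smallest p.t (F.image (hashVal u))) < F.card) ≤
      1 / 16 from (add_le_add hlow hup').trans (by norm_num)
  -- for a small set, every positive estimate is large enough
  by_cases ho : F.card ≤ 768
  · refine le_trans (pr_mono (Q := fun _ => False) fun u hu => ?_) (by rw [pr_false]; norm_num)
    have := listEstimate_pos (p := p) hF u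
    omega
  · rw [not_le] at ho
    set v := 768 * p.prime / F.card
    refine (pr_mono (Q := fun u => ¬ Set.InjOn (hashVal u) F ∨ below F v u < 384)
      fun u hu => ?_).trans ((pr_or _ _).trans ?_)
    · by_cases hinj : Set.InjOn (hashVal u) F
      · exact Or.inr (below_lt_of_listEstimate_lt ho hinj hu)
      · exact Or.inl hinj
    have hv : v ≤ p.prime := by
      refine Nat.div_le_of_le_mul ?_
      exact Nat.mul_le_mul_right _ ho.le
    have hcol : pr (fun u : Fin p.prime × Fin p.prime => ¬ Set.InjOn (hashVal u) F) ≤ 1 / 768 := by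
      refine (pr_collision_le hP hFP).trans ?_
      rw [div_le_div_iff₀ hP0 (by norm_num)]
      have : F.card ^ 2 * 768 ≤ p.prime := by
        refine le_trans ?_ hP3
        rw [pow_succ p.n 2]
        exact Nat.mul_le_mul (Nat.pow_le_pow_left hcn 2) (by omega)
      rw [one_mul]
      exact_mod_cast this
    -- the mean is between `767` and `768`, so `below < 384` is a deviation by at least `383`
    have hlo : pr (fun u : Fin p.prime × Fin p.prime => below F v u < 384) ≤ 768 / 383 ^ 2 := by
      set μ : ℝ := F.card * (v / p.prime)
      have hμ1 : μ ≤ 768 := by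
        rw [show μ = F.card * v / p.prime from (mul_div_assoc _ _ _).symm, div_le_iff₀ hP0]
        have := Nat.div_mul_le_self (768 * p.prime) F.card
        rw [mul_comm]
        exact_mod_cast this
      have hμ2 : 767 ≤ μ := by
        rw [show μ = F.card * v / p.prime from (mul_div_assoc _ _ _).symm, le_div_iff₀ hP0]
        have h1 := Nat.lt_div_mul_add (a := 768 * p.prime) hpos
        have h2 : F.card ≤ p.prime := hcn.trans ((Nat.le_self_pow (by norm_num) _).trans hP3)
        have : 767 * p.prime ≤ F.card * v := by
          rw [mul_comm F.card v]
          change _ ≤ 768 * p.prime / F.card * F.card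
          omega
        exact_mod_cast this
      refine (pr_le_avg (f := fun u => (1 / 383 ^ 2) * ((below F v u : ℝ) - μ) ^ 2)
        (fun u => by positivity) fun u hu => ?_).trans ?_
      · have : (below F v u : ℝ) ≤ 384 := by exact_mod_cast hu.le
        nlinarith
      · rw [avg_mul_left]
        have := avg_below_sub_sq_le hP hFP hv
        change avg (fun u => ((below F v u : ℝ) - μ) ^ 2) ≤ μ at this
        linarith
    norm_num at hlo ⊢
    linarith

end Estimate

/-! ### The median of the estimates -/

section Median

variable {p : Params}

/-- The estimate that the sketch of the whole set `F` yields, the median over all lists. -/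
def trueEstimate (ω : Choices p) (F : Finset ℕ) : ℕ :=
  (((Multiset.range p.Δ).map fun w =>
    listEstimate p (smallest p.t (F.image (hash ω w)))).sort (· ≤ ·)).getD (p.Δ / 2) 0

open Classical in
/-- The number of lists with a bad estimate. -/
noncomputable def badLists (F : Finset ℕ) (f : Fin p.Δ → Fin p.prime × Fin p.prime) : ℕ :=
  (Finset.univ.filter fun w => BadList p F (f w)).card

theorem hash_eq_hashVal (ω : Choices p) (w : Fin p.Δ) (x : ℕ) : hash ω w x = hashVal (ω.1 w) x := by
  rw [hash, seed, dif_pos w.2]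
  rfl

/-- At most as many lists have a property that only bad lists can have as there are bad lists. -/
theorem card_filter_range_le_badLists {F : Finset ℕ} {ω : Choices p} {Q : ℕ → Prop}
    [DecidablePred Q] (h : ∀ u, Q (listEstimate p (smallest p.t (F.image (hashVal u)))) →
      BadList p F u) :
    (((Multiset.range p.Δ).map fun w =>
      listEstimate p (smallest p.t (F.image (hash ω w)))).filter Q).card ≤ badLists F ω.1 := by
  classical
  rw [Multiset.filter_map, Multiset.card_map, badLists]
  change ((Finset.range p.Δ).filter fun w =>
    Q (listEstimate p (smallest p.t (F.image (hash ω w))))).card ≤ _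
  refine Finset.card_le_card_of_injOn (fun w => if h : w < p.Δ then ⟨w, h⟩ else ⟨0, by
    simp [Params.Δ]⟩) ?_ ?_
  · intro w hw
    simp only [Finset.coe_filter, Finset.mem_range, Set.mem_ofPred_eq] at hw
    simp only [Finset.coe_filter, Finset.mem_univ, true_and, Set.mem_ofPred_eq, hw.1, dif_pos]
    refine h _ ?_
    have : (F.image (hash ω w)) = F.image (hashVal (ω.1 ⟨w, hw.1⟩)) :=
      congrArg F.image (funext fun x => hash_eq_hashVal ω ⟨w, hw.1⟩ x)
    rw [← this]
    exact hw.2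
  · intro w hw w' hw' h
    simp only [Finset.coe_filter, Finset.mem_range, Set.mem_ofPred_eq] at hw hw'
    simpa [hw.1, hw'.1] using h

/-- The median is good if fewer than half of the lists are bad. -/
theorem trueEstimate_good {F : Finset ℕ} {ω : Choices p} (h : 2 * badLists F ω.1 < p.Δ) :
    F.card ≤ 768 * trueEstimate ω F ∧ trueEstimate ω F ≤ 16 * F.card := by
  have hΔ : p.Δ % 2 = 1 := by
    rw [Params.Δ]
    omega
  set s := (Multiset.range p.Δ).map fun w =>
    listEstimate p (smallest p.t (F.image (hash ω w))) with hs
  have hcard : s.card = p.Δ := by simp [hs]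
  have hi : p.Δ / 2 < s.card := by omega
  constructor
  · by_contra hlt
    have h1 := (lt_sort_getD_iff s hi (trueEstimate ω F)).not.1 (lt_irrefl _)
    have h2 := card_filter_range_le_badLists (F := F) (ω := ω) (Q := (· ≤ trueEstimate ω F))
      fun u hu => Or.inl (by have : _ ≤ _ := hu; omega)
    rw [← hs] at h2
    omega
  · by_contra hlt
    have h1 := (lt_sort_getD_iff s hi (16 * F.card)).1 (not_le.1 hlt)
    have h2 := card_filter_range_le_badLists (F := F) (ω := ω) (Q := (¬ · ≤ 16 * F.card))
      fun u hu => Or.inr (not_le.1 hu)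
    rw [← hs] at h2
    have h3 := congrArg Multiset.card (Multiset.filter_add_not (· ≤ 16 * F.card) s)
    rw [Multiset.card_add] at h3
    omega

/-- Half of the lists are bad only with a probability exponentially small in their number, by the
exponential moment of the number of bad lists. -/
theorem pr_badLists_le {F : Finset ℕ} (hF : F.Nonempty) (hn : ∀ x ∈ F, x < p.n) :
    pr (fun f : Fin p.Δ → Fin p.prime × Fin p.prime => p.Δ ≤ 2 * badLists F f) ≤
      (2 / 3) ^ p.Δ := by
  classical
  have : Nonempty (Fin p.prime) := ⟨⟨0, p.prime_spec.2.pos⟩⟩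
  -- Markov for `9 ^ badLists`: the event makes it at least `3 ^ Δ`, and its mean is at most `2 ^ Δ`
  calc pr (fun f : Fin p.Δ → Fin p.prime × Fin p.prime => p.Δ ≤ 2 * badLists F f)
      ≤ avg (fun f : Fin p.Δ → Fin p.prime × Fin p.prime =>
          (1 / 3) ^ p.Δ * ∏ w, (if BadList p F (f w) then (9 : ℝ) else 1)) := by
        refine pr_le_avg (fun f => mul_nonneg (by positivity) (Finset.prod_nonneg fun w _ => by
          split_ifs <;> norm_num)) fun f hf => ?_
        have h1 : ∏ w, (if BadList p F (f w) then (9 : ℝ) else 1) = 3 ^ (2 * badLists F f) := by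
          rw [Finset.prod_ite, Finset.prod_const, Finset.prod_const, one_pow, mul_one, pow_mul,
            badLists]
          norm_num
        rw [h1, one_div, inv_pow, inv_mul_eq_div, one_le_div (by positivity)]
        exact pow_le_pow_right₀ (by norm_num) hf
    _ = (1 / 3) ^ p.Δ * avg (fun u => if BadList p F u then (9 : ℝ) else 1) ^ p.Δ := by
        rw [avg_mul_left, avg_pi (fun _ u => if BadList p F u then (9 : ℝ) else 1),
          Finset.prod_const, Finset.card_univ, Fintype.card_fin]
    _ ≤ (1 / 3) ^ p.Δ * 2 ^ p.Δ := by
        refine mul_le_mul_of_nonneg_left (pow_le_pow_left₀ (div_nonneg (Finset.sum_nonneg fun u _ =>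
          by split_ifs <;> norm_num) (by positivity)) ?_ _) (by positivity)
        have h2 : ∀ u, (if BadList p F u then (9 : ℝ) else 1) =
            1 + 8 * (if BadList p F u then 1 else 0) := fun u => by split_ifs <;> norm_num
        have h3 : avg (fun u => if BadList p F u then (9 : ℝ) else 1) =
            1 + 8 * pr (BadList p F) := by
          simp only [h2]
          rw [avg_add, avg_const, avg_mul_left]
          rfl
        rw [← avg, h3]
        have := pr_badList_le hF hn
        linarith
    _ = _ := by rw [← mul_pow]; norm_num

theorem two_thirds_pow_le (hn : 0 < p.n) : (2 / 3 : ℝ) ^ p.Δ ≤ 1 / (2 * p.n) := by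
  calc (2 / 3 : ℝ) ^ p.Δ ≤ (2 / 3) ^ (12 * Nat.clog 2 (2 * p.n)) :=
        pow_le_pow_of_le_one (by norm_num) (by norm_num) (by rw [Params.Δ]; omega)
    _ = ((2 / 3) ^ 12) ^ Nat.clog 2 (2 * p.n) := pow_mul _ _ _
    _ ≤ (1 / 2) ^ Nat.clog 2 (2 * p.n) := pow_le_pow_left₀ (by norm_num) (by norm_num) _
    _ = 1 / 2 ^ Nat.clog 2 (2 * p.n) := by rw [one_div_pow]
    _ ≤ 1 / (2 * p.n) := by
        refine one_div_le_one_div_of_le (by positivity) ?_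
        exact_mod_cast Nat.le_pow_clog (by norm_num) (2 * p.n)

end Median

/-! ### The load of a random reducer -/

section Load

variable {p : Params}

theorem Params.H_pos (p : Params) : 0 < p.H := by simp [Params.H, Params.t, Params.Δ]

/-- The number of words of sketches and pseudosketches that are assigned to the reducer `β` in round
`ρ`, when `wt` bounds the sizes of those of the pairs of submatrices. The pairs of group `l` are
active in round `l / estGroups + 1`, and the merged sketches have at most `H` words. -/
def load (ω : Choices p) (wt : Fin p.g × Fin p.g × Fin p.g → ℕ) (ρ : ℕ) (β : Fin p.bins) : ℕ :=
  (∑ u, if ω.2.1 u = β then (if (u.2.2 : ℕ) / p.estGroups + 1 = ρ then wt u else 0) else 0) +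
    ∑ v, if ω.2.2 v = β then (if (v.1 : ℕ) = ρ then p.H else 0) else 0

/-- The Chernoff bound for the load of a reducer. All weights are divided by the size `H` of a
sketch, so that they are at most `1`; the summand `2` accounts for the merged sketches of the
previous phase, one for each of the reducers. -/
theorem pr_load_le [Nonempty (Fin p.prime)] {wt : Fin p.g × Fin p.g × Fin p.g → ℕ}
    (hw : ∀ u, wt u ≤ p.H) (ρ : ℕ) (β : Fin p.bins) (X W : ℝ)
    (hW : ∑ u, (if (u.2.2 : ℕ) / p.estGroups + 1 = ρ then wt u else 0 : ℕ) ≤ W) :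
    pr (fun ω : Choices p => X ≤ load ω wt ρ β) ≤
      Real.exp (2 * W / (p.H * p.bins) + 2 - X / p.H) := by
  classical
  have hne : Nonempty (Fin p.bins) := ⟨β⟩
  have hH : (0 : ℝ) < p.H := by exact_mod_cast p.H_pos
  have hN : (0 : ℝ) < p.bins := by exact_mod_cast β.pos
  let a : Fin p.g × Fin p.g × Fin p.g → ℝ := fun u =>
    ((if (u.2.2 : ℕ) / p.estGroups + 1 = ρ then wt u else 0 : ℕ) : ℝ) / p.H
  let b : Fin (p.phases + 1) × Fin p.bins → ℝ := fun v => if (v.1 : ℕ) = ρ then 1 else 0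
  have ha0 : ∀ u, 0 ≤ a u := fun u => by positivity
  have hb0 : ∀ u, 0 ≤ b u := fun u => by simp only [b]; positivity
  have ha1 : ∀ u, a u ≤ 1 := fun u => by
    rw [div_le_one hH]
    split_ifs
    · exact_mod_cast hw u
    · simp
  have hb1 : ∀ u, b u ≤ 1 := fun u => by simp only [b]; split_ifs <;> norm_num
  have hload : ∀ ω : Choices p, (load ω wt ρ β : ℝ) / p.H =
      (∑ u, if ω.2.1 u = β then a u else 0) + ∑ v, if ω.2.2 v = β then b v else 0 := by
    intro ω
    rw [load]
    push_cast
    rw [add_div, Finset.sum_div, Finset.sum_div]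
    congr 1
    · refine Finset.sum_congr rfl fun u _ => ?_
      split_ifs <;> simp_all [a]
    · refine Finset.sum_congr rfl fun u _ => ?_
      split_ifs <;> simp_all [b, hH.ne']
  have hsb : ∑ v, b v ≤ p.bins := by
    rw [Fintype.sum_prod_type]
    simp only [b]
    rw [Finset.sum_comm]
    refine (Finset.sum_le_card_nsmul _ _ 1 fun y _ => ?_).trans (by simp)
    rw [Finset.sum_boole]
    have : (Finset.univ.filter fun i : Fin (p.phases + 1) => (i : ℕ) = ρ).card ≤ 1 :=
      Finset.card_le_one.2 fun i hi j hj => Fin.ext (by simp_all)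
    exact_mod_cast this
  have hsa : ∑ u, a u ≤ W / p.H := by
    rw [← Finset.sum_div]
    refine div_le_div_of_nonneg_right (le_trans (le_of_eq ?_) hW) hH.le
    push_cast
    rfl
  calc pr (fun ω : Choices p => X ≤ load ω wt ρ β)
      ≤ avg (fun ω : Choices p => Real.exp (-(X / p.H)) *
          (Real.exp (∑ u, if ω.2.1 u = β then a u else 0) *
            Real.exp (∑ v, if ω.2.2 v = β then b v else 0))) := by
        refine pr_le_avg (fun ω => by positivity) fun ω h => ?_
        rw [← Real.exp_add, ← hload, ← Real.exp_add]
        refine Real.one_le_exp ?_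
        have := div_le_div_of_nonneg_right h hH.le
        linarith
    _ = Real.exp (-(X / p.H)) *
          (avg (fun f : Fin p.g × Fin p.g × Fin p.g → Fin p.bins =>
            Real.exp (∑ u, if f u = β then a u else 0)) *
          avg (fun f : Fin (p.phases + 1) × Fin p.bins → Fin p.bins =>
            Real.exp (∑ v, if f v = β then b v else 0))) := by
        rw [avg_mul_left, ← avg_prod]
        congr 1
        exact avg_snd (Ω := Fin p.Δ → Fin p.prime × Fin p.prime)
          fun u : (Fin p.g × Fin p.g × Fin p.g → Fin p.bins) ×
            (Fin (p.phases + 1) × Fin p.bins → Fin p.bins) =>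
            Real.exp (∑ v, if u.1 v = β then a v else 0) *
            Real.exp (∑ v, if u.2 v = β then b v else 0)
    _ ≤ Real.exp (-(X / p.H)) *
          (Real.exp (2 * (W / p.H) / p.bins) * Real.exp (2 * p.bins / p.bins)) := by
        refine mul_le_mul_of_nonneg_left (mul_le_mul ?_ ?_ ?_ (Real.exp_pos _).le)
          (Real.exp_pos _).le
        · refine (avg_exp_load_le β a ha0 ha1).trans (Real.exp_le_exp.2 ?_)
          gcongr
        · refine (avg_exp_load_le β b hb0 hb1).trans (Real.exp_le_exp.2 ?_)
          gcongr
        · exact div_nonneg (Finset.sum_nonneg fun f _ => (Real.exp_pos _).le) (by positivity)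
    _ = _ := by
        rw [← Real.exp_add, ← Real.exp_add]
        congr 1
        field_simp
        ring

end Load

end R1

namespace MapReduce

/-! ### Rounds of a MapReduce algorithm -/

section

variable {κ ν ο : Type*} [DecidableEq κ]

/-- The values with a given key, as an additive function of the multiset of pairs. -/
def valuesHom (k : κ) : Multiset (κ × ν) →+ Multiset ν where
  toFun W := values W k
  map_zero' := rfl
  map_add' W W' := by simp [values, Multiset.filter_add]

theorem values_add (W W' : Multiset (κ × ν)) (k : κ) :
    values (W + W') k = values W k + values W' k := (valuesHom k).map_add W W'

theorem values_zero (k : κ) : values (0 : Multiset (κ × ν)) k = 0 := rfl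

theorem values_finset_sum {ι : Type*} (s : Finset ι) (f : ι → Multiset (κ × ν)) (k : κ) :
    values (∑ i ∈ s, f i) k = ∑ i ∈ s, values (f i) k := map_sum (valuesHom k) f s

theorem values_multiset_sum {ι : Type*} (s : Multiset ι) (f : ι → Multiset (κ × ν)) (k : κ) :
    values (s.map f).sum k = (s.map fun i => values (f i) k).sum := by
  have := map_multiset_sum (valuesHom k) (s.map f)
  rw [Multiset.map_map] at this
  exact this

theorem values_singleton (x : κ × ν) (k : κ) : values {x} k = if x.1 = k then {x.2} else 0 := by
  rw [values, Multiset.filter_singleton]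
  split_ifs <;> simp

theorem values_map_const {ι : Type*} (V : Multiset ι) (k k' : κ) (f : ι → ν) :
    values (V.map fun v => (k, f v)) k' = if k = k' then V.map f else 0 := by
  rw [values]
  split_ifs with h
  · rw [Multiset.filter_eq_self.2 (by simp [h]), Multiset.map_map]
    rfl
  · rw [Multiset.filter_eq_nil.2 (by simp [h])]
    rfl

theorem mem_values {W : Multiset (κ × ν)} {k : κ} {v : ν} : v ∈ values W k ↔ (k, v) ∈ W := by
  simp [values]

theorem mem_keys {W : Multiset (κ × ν)} {k : κ} : k ∈ keys W ↔ ∃ v, (k, v) ∈ W := by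
  simp [keys]

theorem mem_keys_iff {W : Multiset (κ × ν)} {k : κ} : k ∈ keys W ↔ values W k ≠ 0 := by
  rw [mem_keys, Ne, Multiset.eq_zero_iff_forall_notMem, not_forall_not]
  simp only [mem_values]

theorem values_eq_zero {W : Multiset (κ × ν)} {k : κ} (h : k ∉ keys W) : values W k = 0 := by
  by_contra h'
  exact h (mem_keys_iff.2 h')

/-- Summing over all keys and over the values of each of them is the same as summing over all pairs.
-/
theorem sum_map_values {X : Type*} [AddCommMonoid X] (W : Multiset (κ × ν)) {T : Finset κ}
    (hT : keys W ⊆ T) (f : κ → ν → X) :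
    ∑ k ∈ T, ((values W k).map (f k)).sum = (W.map fun x => f x.1 x.2).sum := by
  have hT' : ∀ x ∈ W, x.1 ∈ T := fun x hx => hT (mem_keys.2 ⟨x.2, hx⟩)
  clear hT
  induction W using Multiset.induction with
  | empty => simp [values_zero]
  | cons x W ih =>
    rw [← Multiset.singleton_add, Multiset.map_add, Multiset.sum_add,
      ← ih fun y hy => hT' y (Multiset.mem_cons_of_mem hy)]
    simp only [values_add, Multiset.map_add, Multiset.sum_add, Finset.sum_add_distrib,
      values_singleton]
    congr 1
    rw [Finset.sum_eq_single x.1]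
    · simp
    · intro k _ hk
      simp [Ne.symm hk]
    · intro h
      exact absurd (hT' x (Multiset.mem_cons_self _ _)) h

theorem sum_card_values (W : Multiset (κ × ν)) : ∑ k ∈ keys W, (values W k).card = W.card := by
  have := sum_map_values W subset_rfl fun _ _ => (1 : ℕ)
  simpa using this

variable (alg : Algorithm κ ν ο) (W₀ : Multiset (κ × ν)) (r : ℕ)

theorem state_succ : alg.state W₀ (r + 1) =
    ∑ k ∈ keys (alg.state W₀ r), (alg.reduce r k (values (alg.state W₀ r) k)).1 := rfl

theorem values_state_succ (k' : κ) : values (alg.state W₀ (r + 1)) k' =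
    ∑ k ∈ keys (alg.state W₀ r), values (alg.reduce r k (values (alg.state W₀ r) k)).1 k' := by
  rw [state_succ, values_finset_sum]

theorem mem_state_succ {x : κ × ν} : x ∈ alg.state W₀ (r + 1) ↔
    ∃ k ∈ keys (alg.state W₀ r), x ∈ (alg.reduce r k (values (alg.state W₀ r) k)).1 := by
  rw [state_succ, Multiset.mem_sum]

end

end MapReduce

namespace R1
open MapReduce
universe u

/-! ### The arrangement of submatrices in groups -/

/-- The map `l ↦ (a + l) mod g` permutes the residues, so each pair `(i, j)` meets every middle
index `h` in exactly one group. -/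
theorem sum_range_shift {X : Type*} [AddCommMonoid X] (g a : ℕ) (f : ℕ → X) :
    ∑ l ∈ Finset.range g, f ((a + l) % g) = ∑ h ∈ Finset.range g, f h := by
  have hinj : Set.InjOn (fun l => (a + l) % g) (Finset.range g : Finset ℕ) := by
    intro l hl l' hl' h
    simp only [Finset.coe_range, Set.mem_Iio] at hl hl'
    have : l % g = l' % g := Nat.ModEq.add_left_cancel' a h
    rwa [Nat.mod_eq_of_lt hl, Nat.mod_eq_of_lt hl'] at this
  have himg : (Finset.range g).image (fun l => (a + l) % g) = Finset.range g := by
    refine Finset.eq_of_subset_of_card_le ?_ (Finset.card_image_of_injOn hinj).ge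
    intro h hh
    obtain ⟨l, hl, rfl⟩ := Finset.mem_image.1 hh
    rw [Finset.mem_range] at hl ⊢
    exact Nat.mod_lt _ (by omega)
  conv_rhs => rw [← himg, Finset.sum_image hinj]

theorem exists_shift {g h : ℕ} (a : ℕ) (hh : h < g) : ∃ l < g, (a + l) % g = h := by
  refine ⟨(h + (g - a % g)) % g, Nat.mod_lt _ (by omega), ?_⟩
  have h1 := Nat.mod_lt a (by omega : 0 < g)
  rw [Nat.add_mod, Nat.mod_mod, ← Nat.add_mod, ← Nat.div_add_mod a g,
    show g * (a / g) + a % g + (h + (g - (g * (a / g) + a % g) % g)) =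
      h + g * (a / g + 1) by
        rw [Nat.mul_add_mod, Nat.mod_mod]
        rw [Nat.mul_add]
        omega, Nat.add_mul_mod_self_left, Nat.mod_eq_of_lt hh]

section

variable {S : Type u} (p : Params)

/-- The message is an entry of a submatrix that takes part in the product `A_{i,h} B_{h,j}` of group
`l`. -/
def AtPlace (i j l : ℕ) (v : Msg S) : Prop :=
  v.num 0 = 0 ∧ (v.num 1 = 1 ∧ i = v.num 2 / p.b ∧ (i + j + l) % p.g = v.num 3 / p.b ∨
    ¬ v.num 1 = 1 ∧ j = v.num 3 / p.b ∧ (i + j + l) % p.g = v.num 2 / p.b)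

instance (i j l : ℕ) : DecidablePred (AtPlace (S := S) p i j l) := fun v => by
  unfold AtPlace; infer_instance

variable {p}

/-- Within a group, an entry belongs to a single product, since two of the indices `i`, `j`, `h` and
the group determine the third. -/
theorem AtPlace.unique {i j i' j' l : ℕ} {v : Msg S} (h : AtPlace p i j l v)
    (h' : AtPlace p i' j' l v) (hi : i < p.g) (hi' : i' < p.g) (hj : j < p.g) (hj' : j' < p.g) :
    i = i' ∧ j = j' := by
  obtain ⟨-, ⟨h1, rfl, h2⟩ | ⟨h1, rfl, h2⟩⟩ := h <;>
      obtain ⟨-, ⟨h1', rfl, h2'⟩ | ⟨h1', rfl, h2'⟩⟩ := h'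
  · refine ⟨rfl, ?_⟩
    have h3 := Nat.ModEq.add_right_cancel' l (h2.trans h2'.symm)
    have h4 : j % p.g = j' % p.g := Nat.ModEq.add_left_cancel' _ h3
    rwa [Nat.mod_eq_of_lt hj, Nat.mod_eq_of_lt hj'] at h4
  · exact absurd h1 h1'
  · exact absurd h1' h1
  · refine ⟨?_, rfl⟩
    have h3 := Nat.ModEq.add_right_cancel' l (h2.trans h2'.symm)
    have h4 : i % p.g = i' % p.g := Nat.ModEq.add_right_cancel' _ h3
    rwa [Nat.mod_eq_of_lt hi, Nat.mod_eq_of_lt hi'] at h4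

/-- Every entry goes to at most one of the products of a group. -/
theorem sum_card_filter_atPlace_le (V : Multiset (Msg S)) (l : ℕ) :
    ∑ i ∈ Finset.range p.g, ∑ j ∈ Finset.range p.g, (V.filter (AtPlace p i j l)).card ≤ V.card := by
  induction V using Multiset.induction with
  | empty => simp
  | cons v V ih =>
    rw [Multiset.card_cons]
    have h : ∀ i j, ((v ::ₘ V).filter (AtPlace p i j l)).card =
        (V.filter (AtPlace p i j l)).card + if AtPlace p i j l v then 1 else 0 := by
      intro i j
      rw [Multiset.filter_cons]
      split_ifs <;> simp [add_comm]
    simp only [h, Finset.sum_add_distrib]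
    refine Nat.add_le_add ih ?_
    rw [← Finset.sum_product' (f := fun i j => if AtPlace p i j l v then 1 else 0),
      ← Finset.card_filter]
    refine Finset.card_le_one.2 fun x hx y hy => ?_
    simp only [Finset.mem_filter, Finset.mem_product, Finset.mem_range] at hx hy
    obtain ⟨h1, h2⟩ := hx.2.unique hy.2 hx.1.1 hy.1.1 hx.1.2 hy.1.2
    exact Prod.ext h1 h2

/-- What the reducer for the product `(i, j, s)` receives from the copies of the entries `V`. -/
theorem values_copies [NonUnitalSemiring S] {K c : ℕ} {key : ℕ → ℕ → ℕ → Key}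
    (hkey : ∀ i j s i' j' s', key i j s = key i' j' s' ↔ i = i' ∧ j = j' ∧ s = s')
    (V : Multiset (Msg S)) (i j s : ℕ) : values (copies p K c key V) (key i j s) =
      if i < p.g ∧ j < p.g ∧ s < K ∧ c * K + s < p.g then V.filter (AtPlace p i j (c * K + s))
      else 0 := by
  rw [copies_eq_sum, values_finset_sum]
  have h1 : ∀ s' v, (if v.num 0 = 0 then ∑ i ∈ Finset.range p.g, ∑ j ∈ Finset.range p.g,
        if (v.num 1 = 1 ∧ i = v.num 2 / p.b ∧ (i + j + (c * K + s')) % p.g = v.num 3 / p.b ∨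
            ¬ v.num 1 = 1 ∧ j = v.num 3 / p.b ∧ (i + j + (c * K + s')) % p.g = v.num 2 / p.b)
          then ({(key i j s', v)} : Multiset (Key × Msg S)) else 0
        else 0) = ∑ i ∈ Finset.range p.g, ∑ j ∈ Finset.range p.g,
          if AtPlace p i j (c * K + s') v then {(key i j s', v)} else 0 := by
    intro s' v
    by_cases hv : v.num 0 = 0 <;> simp [AtPlace, hv]
  have h2 : ∀ s' v, values (∑ i ∈ Finset.range p.g, ∑ j ∈ Finset.range p.g,
      if AtPlace p i j (c * K + s') v then ({(key i j s', v)} : Multiset (Key × Msg S)) else 0)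
        (key i j s) = if s' = s ∧ i < p.g ∧ j < p.g ∧ AtPlace p i j (c * K + s') v then {v}
          else 0 := by
    intro s' v
    have h3 : ∀ i' j', values (if AtPlace p i' j' (c * K + s') v then
        ({(key i' j' s', v)} : Multiset (Key × Msg S)) else 0) (key i j s) =
        if i' = i then (if j' = j then (if s' = s ∧ AtPlace p i j (c * K + s') v then {v} else 0)
          else 0) else 0 := by
      intro i' j'
      simp only [apply_ite (fun W => values W (key i j s)), values_singleton, hkey, values_zero]
      by_cases hi : i' = i <;> by_cases hj : j' = j <;> by_cases hs : s' = s <;>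
        simp [hi, hj, hs]
    simp only [values_finset_sum, h3]
    by_cases hi : i < p.g
    · by_cases hj : j < p.g
      · rw [Finset.sum_eq_single_of_mem i (Finset.mem_range.2 hi)
          (fun i' _ h => Finset.sum_eq_zero fun j' _ => if_neg h),
          Finset.sum_eq_single_of_mem j (Finset.mem_range.2 hj) (fun j' _ h => by simp [h])]
        simp [hi, hj]
      · rw [if_neg (c := s' = s ∧ i < p.g ∧ j < p.g ∧ AtPlace p i j (c * K + s') v) (by tauto)]
        refine Finset.sum_eq_zero fun i' _ => Finset.sum_eq_zero fun j' hj' => ?_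
        rw [if_neg (c := j' = j) (by rintro rfl; exact hj (Finset.mem_range.1 hj')), ite_self]
    · rw [if_neg (c := s' = s ∧ i < p.g ∧ j < p.g ∧ AtPlace p i j (c * K + s') v) (by tauto)]
      refine Finset.sum_eq_zero fun i' hi' => Finset.sum_eq_zero fun j' _ => ?_
      rw [if_neg (by rintro rfl; exact hi (Finset.mem_range.1 hi'))]
  simp only [h1, apply_ite (fun W => values W (key i j s)), values_multiset_sum, h2, values_zero]
  by_cases hc : i < p.g ∧ j < p.g ∧ s < K ∧ c * K + s < p.g
  · obtain ⟨hi, hj, hs, hg⟩ := hc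
    rw [if_pos ⟨hi, hj, hs, hg⟩, Finset.sum_eq_single_of_mem s (Finset.mem_range.2 hs), if_pos hg,
      Multiset.filter_eq_bind, Multiset.bind, Multiset.join]
    · simp [hi, hj]
    · intro s' _ hs'
      simp [hs']
  · rw [if_neg hc]
    refine Finset.sum_eq_zero fun s' hs' => ?_
    rw [Finset.mem_range] at hs'
    split_ifs with hg
    · refine Multiset.sum_eq_zero fun X hX => ?_
      obtain ⟨v, -, rfl⟩ := Multiset.mem_map.1 hX
      refine if_neg ?_
      rintro ⟨rfl, hi, hj, -⟩
      exact hc ⟨hi, hj, hs', hg⟩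
    · rfl

theorem mem_copies {K c : ℕ} {key : ℕ → ℕ → ℕ → Key} {V : Multiset (Msg S)} {x : Key × Msg S}
    (h : x ∈ copies p K c key V) : ∃ i j s, x.1 = key i j s := by
  rw [copies, Multiset.mem_bind] at h
  obtain ⟨s, -, h⟩ := h
  rw [Multiset.mem_bind] at h
  obtain ⟨isA, -, h⟩ := h
  rw [Multiset.mem_bind] at h
  obtain ⟨u, -, h⟩ := h
  rw [Multiset.mem_map] at h
  obtain ⟨ij, -, rfl⟩ := h
  exact ⟨_, _, _, rfl⟩

theorem values_copies_eq_zero {K c : ℕ} {key : ℕ → ℕ → ℕ → Key} {V : Multiset (Msg S)} {k : Key}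
    (h : ∀ i j s, key i j s ≠ k) : values (copies p K c key V) k = 0 := by
  by_contra hne
  obtain ⟨v, hv⟩ := Multiset.exists_mem_of_ne_zero hne
  obtain ⟨i, j, s, hk⟩ := mem_copies (mem_values.1 hv)
  exact h i j s hk.symm

end

/-! ### The input -/

section

variable {S : Type u} [NonUnitalSemiring S] {q : ℕ}

theorem mem_support {X : Matrix (Fin q) (Fin q) S} {u : Fin q × Fin q} :
    u ∈ support X ↔ X u.1 u.2 ≠ 0 := by
  simp [support]

theorem progressiveIndex_lt {X : Matrix (Fin q) (Fin q) S} {u : Fin q × Fin q} (h : u ∈ support X) :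
    progressiveIndex X u.1 u.2 < nnz X := by
  rw [progressiveIndex, nnz]
  refine Finset.card_lt_card ⟨Finset.filter_subset _ _, fun hsub => ?_⟩
  have h1 := hsub h
  rw [Finset.mem_filter] at h1
  rcases h1.2 with h | ⟨-, h⟩ <;> exact lt_irrefl _ h

theorem progressiveIndex_injOn (X : Matrix (Fin q) (Fin q) S) :
    Set.InjOn (fun u : Fin q × Fin q => progressiveIndex X u.1 u.2) (support X) := by
  have hlt : ∀ u ∈ support X, ∀ v : Fin q × Fin q, (u.1 < v.1 ∨ u.1 = v.1 ∧ u.2 < v.2) →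
      progressiveIndex X u.1 u.2 < progressiveIndex X v.1 v.2 := by
    intro u hu v huv
    refine Finset.card_lt_card ⟨fun w hw => ?_, fun hsub => ?_⟩
    · rw [Finset.mem_filter] at hw ⊢
      exact ⟨hw.1, by have := hw.2; omega⟩
    · have h := hsub (Finset.mem_filter.2 ⟨hu, huv⟩)
      rw [Finset.mem_filter] at h
      have := h.2
      omega
  intro u hu v hv h
  by_contra hne
  simp only at h
  have hne' : ¬ (u.1 = v.1 ∧ u.2 = v.2) := fun h => hne (Prod.ext h.1 h.2)
  have h1 := hlt u hu v
  have h2 := hlt v hv u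
  by_cases h3 : u.1 < v.1 ∨ u.1 = v.1 ∧ u.2 < v.2
  · exact absurd (h1 h3) (by omega)
  · exact absurd (h2 (by omega)) (by omega)

end

section

variable {S : Type u} [NonUnitalSemiring S] {p : Params} (A B : Matrix (Fin p.q) (Fin p.q) S)

/-- The input of the algorithm. -/
noncomputable def inputs : Multiset (Key × Msg S) := inputPairs true A + inputPairs false B

/-- All entries, without their keys. -/
noncomputable def allEntries : Multiset (Msg S) :=
  ((support A).val.map fun u => Msg.entry true u.1 u.2 (A u.1 u.2)) +
    (support B).val.map fun u => Msg.entry false u.1 u.2 (B u.1 u.2)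

theorem map_snd_inputs : (inputs A B).map Prod.snd = allEntries A B := by
  rw [inputs, inputPairs, inputPairs, Multiset.map_add, Multiset.map_map, Multiset.map_map]
  rfl

theorem card_allEntries : (allEntries A B).card = nnz A + nnz B := by
  rw [allEntries, Multiset.card_add, Multiset.card_map, Multiset.card_map]
  rfl

theorem card_inputs : (inputs A B).card = nnz A + nnz B := by
  rw [← card_allEntries, ← map_snd_inputs, Multiset.card_map]

/-- The matrix `A` or `B`, by the flag that the keys and the values carry. -/
def side : Bool → Matrix (Fin p.q) (Fin p.q) S
  | true => A
  | false => B

variable {A B}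

theorem mem_inputs {k : Key} {v : Msg S} (h : (k, v) ∈ inputs A B) :
    ∃ c, ∃ u ∈ support (side A B c), k = .home c (progressiveIndex (side A B c) u.1 u.2) ∧
      v = .entry c u.1 u.2 (side A B c u.1 u.2) := by
  rw [inputs, Multiset.mem_add] at h
  rcases h with h | h <;> rw [inputPairs, Multiset.mem_map] at h <;> obtain ⟨u, hu, h⟩ := h <;>
    rw [Prod.mk.injEq] at h <;> obtain ⟨rfl, rfl⟩ := h
  · exact ⟨true, u, hu, rfl, rfl⟩
  · exact ⟨false, u, hu, rfl, rfl⟩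

theorem mem_allEntries {v : Msg S} : v ∈ allEntries A B ↔
    ∃ c, ∃ u ∈ support (side A B c), v = .entry c u.1 u.2 (side A B c u.1 u.2) := by
  rw [allEntries, Multiset.mem_add, Multiset.mem_map, Multiset.mem_map]
  constructor
  · rintro (⟨u, hu, rfl⟩ | ⟨u, hu, rfl⟩)
    · exact ⟨true, u, hu, rfl⟩
    · exact ⟨false, u, hu, rfl⟩
  · rintro ⟨_ | _, u, hu, rfl⟩
    · exact Or.inr ⟨u, hu, rfl⟩
    · exact Or.inl ⟨u, hu, rfl⟩

theorem entry_mem_allEntries {c : Bool} {x y : ℕ} {a : S} : Msg.entry c x y a ∈ allEntries A B ↔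
    ∃ u : Fin p.q × Fin p.q, side A B c u.1 u.2 ≠ 0 ∧ x = u.1 ∧ y = u.2 ∧
      a = side A B c u.1 u.2 := by
  rw [mem_allEntries]
  constructor
  · rintro ⟨c', u, hu, h⟩
    rw [Msg.entry.injEq] at h
    obtain ⟨rfl, rfl, rfl, rfl⟩ := h
    exact ⟨u, mem_support.1 hu, rfl, rfl, rfl⟩
  · rintro ⟨u, hu, rfl, rfl, rfl⟩
    exact ⟨c, u, mem_support.2 hu, rfl⟩

/-- Every entry has a reducer of its own, since progressive indices are distinct. -/
theorem card_values_inputs_le (k : Key) : (values (inputs A B) k).card ≤ 1 := by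
  have key : ∀ (c : Bool) (X : Matrix (Fin p.q) (Fin p.q) S) (k : Key),
      (values (inputPairs c X) k).card ≤ 1 := by
    intro c X k
    have hnd : ((inputPairs c X).map Prod.fst).Nodup := by
      rw [inputPairs, Multiset.map_map]
      refine Multiset.Nodup.map_on ?_ (support X).nodup
      intro u hu v hv h
      simp only [Function.comp_apply, Key.home.injEq, true_and] at h
      exact progressiveIndex_injOn X hu hv h
    have h1 := Multiset.nodup_iff_count_le_one.1 hnd k
    rw [values, Multiset.card_map]
    rw [Multiset.count_map] at h1
    refine le_trans (le_of_eq ?_) h1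
    congr 1
    exact Multiset.filter_congr fun x _ => eq_comm
  have hz : ∀ (c : Bool) (X : Matrix (Fin p.q) (Fin p.q) S) (k : Key), (∀ i, k ≠ .home c i) →
      values (inputPairs c X) k = 0 := by
    intro c X k hk
    rw [Multiset.eq_zero_iff_forall_notMem]
    intro v hv
    rw [mem_values, inputPairs, Multiset.mem_map] at hv
    obtain ⟨u, -, h⟩ := hv
    exact hk _ (Prod.ext_iff.1 h).1.symm
  rw [inputs, values_add, Multiset.card_add]
  by_cases hk : ∀ i, k ≠ .home true i
  · rw [hz true A k hk, Multiset.card_zero, zero_add]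
    exact key _ _ _
  · simp only [not_forall, ne_eq, not_not] at hk
    obtain ⟨i, rfl⟩ := hk
    rw [hz false B _ (by simp)]
    exact key _ _ _

theorem values_inputs_eq_zero {k : Key} (h : ∀ c i, k ≠ .home c i) : values (inputs A B) k = 0 := by
  rw [Multiset.eq_zero_iff_forall_notMem]
  intro v hv
  obtain ⟨c, u, -, rfl, -⟩ := mem_inputs (mem_values.1 hv)
  exact h _ _ rfl

/-- The sum over all home reducers of an additive function of their entries. -/
theorem sum_values_inputs {T : Finset Key} (hT : keys (inputs A B) ⊆ T) (Q : Msg S → Prop)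
    [DecidablePred Q] :
    ∑ k ∈ T, (values (inputs A B) k).filter Q = (allEntries A B).filter Q := by
  simp only [Multiset.filter_eq_bind, Multiset.bind, Multiset.join]
  rw [sum_map_values _ hT fun _ v => (if Q v then {v} else 0 : Multiset (Msg S)), ← map_snd_inputs,
      Multiset.map_map]
  rfl

theorem entries_allEntries_sum {X : Type*} [AddCommMonoid X] (c : Bool) (Q : Msg S → Prop)
    [DecidablePred Q] (G : ℕ × ℕ × S → X) :
    ((entries c ((allEntries A B).filter Q)).map G).sum =
      ∑ u ∈ support (side A B c), if Q (.entry c u.1 u.2 (side A B c u.1 u.2)) then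
        G (u.1, u.2, side A B c u.1 u.2) else 0 := by
  have h : ∀ (f : Msg S → X) (W : Multiset (Msg S)), ((W.filter Q).map f).sum =
      (W.map fun v => if Q v then f v else 0).sum := by
    intro f W
    induction W using Multiset.induction with
    | empty => simp
    | cons v W ih =>
      by_cases hv : Q v <;> simp [hv, ih]
  rw [entries_sum, h, allEntries, Multiset.map_add, Multiset.sum_add, Multiset.map_map,
    Multiset.map_map]
  cases c
  · simp [Msg.num, Msg.elt, flag, side]
    rfl
  · simp [Msg.num, Msg.elt, flag, side]
    rfl

theorem card_contributions_ne_zero {V : Multiset (Msg S)} {x y : ℕ} :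
    (contributions V x y).card ≠ 0 ↔ parts V x y ≠ 0 ∨
      ∃ z a b, Msg.entry true x z a ∈ V ∧ Msg.entry false z y b ∈ V := by
  rw [contributions, Multiset.card_add, Multiset.card_map, Ne, Nat.add_eq_zero_iff, not_and_or,
    Multiset.card_eq_zero, Multiset.card_eq_zero]
  refine or_congr Iff.rfl ?_
  rw [Multiset.eq_zero_iff_forall_notMem, not_forall]
  simp only [not_not, Multiset.mem_filter, Multiset.mem_product, Prod.exists, mem_entries]
  constructor
  · rintro ⟨x', z, a, z', y', b, ⟨h1, h2⟩, h3⟩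
    obtain ⟨rfl, rfl, rfl⟩ := h3
    exact ⟨z, a, b, h1, h2⟩
  · rintro ⟨z, a, b, h1, h2⟩
    exact ⟨x, z, a, z, y, b, ⟨h1, h2⟩, rfl, rfl, rfl⟩

variable (A B)

/-- The entries that take part in the product `A_{i,h} B_{h,j}` of group `l`. -/
noncomputable def blockEntries (i j l : ℕ) : Multiset (Msg S) :=
  (allEntries A B).filter (AtPlace p i j l)

/-- The products that group `l` contributes to entry `(x, y)`. -/
noncomputable def groupProducts (l x y : ℕ) : Multiset S :=
  contributions (blockEntries A B (x / p.b) (y / p.b) l) x y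

variable {A B}

theorem parts_blockEntries (i j l x y : ℕ) : parts (blockEntries A B i j l) x y = 0 := by
  rw [Multiset.eq_zero_iff_forall_notMem]
  intro a ha
  rw [mem_parts, blockEntries, Multiset.mem_filter, mem_allEntries] at ha
  obtain ⟨⟨c, u, -, h⟩, -⟩ := ha
  cases h

theorem entry_mem_blockEntries {c : Bool} {i j l x y : ℕ} {a : S} :
    Msg.entry c x y a ∈ blockEntries A B i j l ↔ Msg.entry c x y a ∈ allEntries A B ∧
      (c = true ∧ i = x / p.b ∧ (i + j + l) % p.g = y / p.b ∨
        c = false ∧ j = y / p.b ∧ (i + j + l) % p.g = x / p.b) := by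
  rw [blockEntries, Multiset.mem_filter, AtPlace]
  cases c <;> simp [Msg.num, flag]

/-- Group `l` contributes those terms of the inner product whose middle index lies in one block. -/
theorem groupProducts_sum (l : ℕ) (x y : Fin p.q) : (groupProducts A B l x y).sum =
    ∑ z : Fin p.q, if ((x : ℕ) / p.b + (y : ℕ) / p.b + l) % p.g = (z : ℕ) / p.b then
      A x z * B z y else 0 := by
  have h : ∀ V : Multiset (Msg S), parts V x y = 0 → (contributions V x y).sum =
      ((entries true V).map fun a => ((entries false V).map fun b =>
        if a.1 = (x : ℕ) ∧ b.2.1 = (y : ℕ) ∧ a.2.1 = b.1 then a.2.2 * b.2.2 else 0).sum).sum := by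
    intro V hV
    rw [contributions, hV, zero_add, product_filter_map_sum]
  rw [groupProducts, h _ (parts_blockEntries _ _ _ _ _), blockEntries, entries_allEntries_sum]
  simp only [entries_allEntries_sum, side]
  have hA : ∀ u : Fin p.q × Fin p.q, AtPlace p ((x : ℕ) / p.b) ((y : ℕ) / p.b) l
      (.entry true u.1 u.2 (A u.1 u.2)) ↔ (x : ℕ) / p.b = u.1 / p.b ∧
        ((x : ℕ) / p.b + (y : ℕ) / p.b + l) % p.g = (u.2 : ℕ) / p.b := fun u => by
    simp [AtPlace, Msg.num, flag]
  have hB : ∀ u : Fin p.q × Fin p.q, AtPlace p ((x : ℕ) / p.b) ((y : ℕ) / p.b) l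
      (.entry false u.1 u.2 (B u.1 u.2)) ↔ (y : ℕ) / p.b = u.2 / p.b ∧
        ((x : ℕ) / p.b + (y : ℕ) / p.b + l) % p.g = (u.1 : ℕ) / p.b := fun u => by
    simp [AtPlace, Msg.num, flag]
  simp only [hA, hB, Fin.val_inj]
  rw [support, Finset.sum_filter, Fintype.sum_prod_type, Finset.sum_eq_single_of_mem x
    (Finset.mem_univ _)]
  swap
  · intro x' _ hx'
    refine Finset.sum_eq_zero fun z _ => ?_
    simp [hx']
  refine Finset.sum_congr rfl fun z _ => ?_
  simp only [true_and]
  by_cases hz : ((x : ℕ) / p.b + (y : ℕ) / p.b + l) % p.g = (z : ℕ) / p.b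
  swap
  · simp [hz]
  simp only [hz, if_true]
  rw [support, Finset.sum_filter, Fintype.sum_prod_type, Finset.sum_eq_single_of_mem z
    (Finset.mem_univ _)]
  swap
  · intro z' _ hz'
    refine Finset.sum_eq_zero fun y' _ => ?_
    simp [Ne.symm hz']
  rw [Finset.sum_eq_single_of_mem y (Finset.mem_univ _)]
  swap
  · intro y' _ hy'
    simp [hy']
  by_cases ha : A x z = 0 <;> by_cases hb : B z y = 0 <;> simp [ha, hb]

/-- Every product is formed in exactly one group. -/
theorem sum_groupProducts (hb : 0 < p.b) (hg : p.q ≤ p.g * p.b) (x y : Fin p.q) :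
    ∑ l ∈ Finset.range p.g, (groupProducts A B l x y).sum = (A * B) x y := by
  simp only [groupProducts_sum]
  rw [Finset.sum_comm, Matrix.mul_apply]
  refine Finset.sum_congr rfl fun z _ => ?_
  rw [sum_range_shift p.g ((x : ℕ) / p.b + (y : ℕ) / p.b) fun h =>
      if h = (z : ℕ) / p.b then A x z * B z y else 0,
    Finset.sum_ite_eq', if_pos]
  rw [Finset.mem_range, Nat.div_lt_iff_lt_mul hb]
  exact z.2.trans_le hg

theorem exists_of_groupProducts {l x y : ℕ} (h : (groupProducts A B l x y).card ≠ 0) :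
    ∃ x' z y' : Fin p.q, x = x' ∧ y = y' ∧ A x' z ≠ 0 ∧ B z y' ≠ 0 := by
  rw [groupProducts, card_contributions_ne_zero, parts_blockEntries] at h
  obtain ⟨z, a, b, h1, h2⟩ := h.resolve_left (by simp)
  obtain ⟨u, hu, rfl, rfl, rfl⟩ := entry_mem_allEntries.1 (entry_mem_blockEntries.1 h1).1
  obtain ⟨w, hw, h3, rfl, rfl⟩ := entry_mem_allEntries.1 (entry_mem_blockEntries.1 h2).1
  have h4 : u.2 = w.1 := Fin.ext h3
  exact ⟨u.1, u.2, w.2, rfl, rfl, hu, by rw [h4]; exact hw⟩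

theorem card_filter_div_le {b : ℕ} (hb : 0 < b) (X : Finset (Fin p.q × Fin p.q)) (i j : ℕ) :
    (X.filter fun u => (u.1 : ℕ) / b = i ∧ (u.2 : ℕ) / b = j).card ≤ b ^ 2 := by
  have : (Finset.range b ×ˢ Finset.range b).card = b ^ 2 := by simp [sq]
  rw [← this]
  refine Finset.card_le_card_of_injOn (fun u => ((u.1 : ℕ) % b, (u.2 : ℕ) % b)) ?_ ?_
  · intro u _
    simp [Nat.mod_lt _ hb]
  · intro u hu v hv h
    simp only [Finset.coe_filter, Set.mem_ofPred_eq, Prod.mk.injEq] at hu hv h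
    refine Prod.ext (Fin.ext ?_) (Fin.ext ?_)
    · rw [← Nat.div_add_mod u.1 b, ← Nat.div_add_mod v.1 b, hu.2.1, hv.2.1, h.1]
    · rw [← Nat.div_add_mod u.2 b, ← Nat.div_add_mod v.2 b, hu.2.2, hv.2.2, h.2]

theorem card_blockEntries_le (hb : 0 < p.b) (i j l : ℕ) :
    (blockEntries A B i j l).card ≤ 2 * p.b ^ 2 := by
  rw [blockEntries, allEntries, Multiset.filter_add, Multiset.card_add, Multiset.filter_map,
    Multiset.filter_map, Multiset.card_map, Multiset.card_map, two_mul]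
  refine Nat.add_le_add ?_ ?_
  · refine le_trans (Multiset.card_le_card ?_)
        (card_filter_div_le hb (support A) i ((i + j + l) % p.g))
    refine Multiset.monotone_filter_right _ fun u hu => ?_
    simp only [Function.comp_apply, AtPlace, Msg.num, flag] at hu
    simp at hu
    exact ⟨hu.1.symm, hu.2.symm⟩
  · refine le_trans (Multiset.card_le_card ?_)
        (card_filter_div_le hb (support B) ((i + j + l) % p.g) j)
    refine Multiset.monotone_filter_right _ fun u hu => ?_
    simp only [Function.comp_apply, AtPlace, Msg.num, flag] at hu
    simp at hu
    exact ⟨hu.2.symm, hu.1.symm⟩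

/-! ### The stream of positions -/

variable (A B)

/-- The distinct elements of the stream: the positions of the nonzero entries of the product. -/
noncomputable def positions : Finset ℕ := (support (A * B)).image fun u => (u.1 : ℕ) * p.q + u.2

variable {A B}

theorem card_positions : (positions A B).card = nnz (A * B) := by
  refine Finset.card_image_of_injOn fun u _ v _ h => ?_
  have h1 : (u.1 : ℕ) = v.1 := by
    have : ((u.1 : ℕ) * p.q + u.2) / p.q = (v.1 * p.q + v.2) / p.q := congrArg (· / p.q) h
    rwa [mul_comm, Nat.mul_add_div u.1.pos, mul_comm, Nat.mul_add_div u.1.pos,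
      Nat.div_eq_of_lt u.2.2, Nat.div_eq_of_lt v.2.2, add_zero, add_zero] at this
  have h : (u.1 : ℕ) * p.q + u.2 = v.1 * p.q + v.2 := h
  rw [h1] at h
  exact Prod.ext (Fin.ext h1) (Fin.ext (by omega))

theorem positions_lt {z : ℕ} (h : z ∈ positions A B) : z < p.n := by
  obtain ⟨u, -, rfl⟩ := Finset.mem_image.1 h
  have h1 := u.1.2
  have h2 := u.2.2
  rw [Params.n, sq]
  have := Nat.mul_le_mul_right p.q (Nat.succ_le_of_lt h1)
  rw [Nat.succ_mul] at this
  omega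

/-- Without cancellation, a pair of nonzero entries that can be multiplied always points to a
nonzero entry of the product. -/
theorem mem_positions (hAB : NoCancellation A B) {x z y : Fin p.q} (ha : A x z ≠ 0)
    (hb : B z y ≠ 0) : (x : ℕ) * p.q + y ∈ positions A B :=
  Finset.mem_image.2 ⟨(x, y), mem_support.2 (hAB x y ⟨z, ha, hb⟩), rfl⟩

theorem exists_of_mem_positions {v : ℕ} (h : v ∈ positions A B) :
    ∃ x z y : Fin p.q, A x z ≠ 0 ∧ B z y ≠ 0 ∧ v = (x : ℕ) * p.q + y := by
  obtain ⟨u, hu, rfl⟩ := Finset.mem_image.1 h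
  have h1 := mem_support.1 hu
  rw [Matrix.mul_apply] at h1
  obtain ⟨z, -, hz⟩ := Finset.exists_ne_zero_of_sum_ne_zero h1
  exact ⟨u.1, z, u.2, left_ne_zero_of_mul hz, right_ne_zero_of_mul hz, rfl⟩

end

/-! ### Arithmetic of the parameters -/

/-- The assumptions on the parameters that do not involve the matrices. -/
structure Params.Valid (p : Params) : Prop where
  two_le_m : 2 ≤ p.m
  m_lt : p.m < 2 * p.nt
  nt_le : p.nt ≤ p.n
  nt_le_M : p.nt ≤ p.M

namespace Params

variable {p : Params}

theorem ceilDiv_mul_le (x : ℕ) {y : ℕ} (hy : 0 < y) : x ≤ (x + y - 1) / y * y := by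
  have := Nat.div_add_mod (x + y - 1) y
  have := Nat.mod_lt (x + y - 1) hy
  rw [mul_comm]
  omega

theorem ceilDiv_le {x y : ℕ} (hx : 0 < x) (hy : 0 < y) : (x + y - 1) / y ≤ x := by
  refine Nat.div_le_of_le_mul ?_
  obtain ⟨x, rfl⟩ := Nat.exists_eq_succ_of_ne_zero hx.ne'
  obtain ⟨y, rfl⟩ := Nat.exists_eq_succ_of_ne_zero hy.ne'
  simp only [Nat.succ_eq_add_one]
  have : (y + 1) * (x + 1) = y * x + (x + y + 1) := by ring
  omega

namespace Valid

variable (hp : p.Valid)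
include hp

theorem two_le_nt : 2 ≤ p.nt := by have := hp.two_le_m; have := hp.m_lt; omega

theorem two_le_q : 2 ≤ p.q := by
  have h1 := hp.two_le_nt.trans hp.nt_le
  by_contra h
  have h2 : p.q ≤ 1 := by omega
  have := Nat.pow_le_pow_left h2 2
  rw [Params.n] at h1
  omega

theorem four_le_n : 4 ≤ p.n := Nat.pow_le_pow_left hp.two_le_q 2

theorem b_pos : 0 < p.b := Nat.sqrt_pos.2 (by have := hp.two_le_m; omega)

theorem q_le : p.q ≤ p.g * p.b := ceilDiv_mul_le _ hp.b_pos

theorem g_le : p.g ≤ p.q := ceilDiv_le (by have := hp.two_le_q; omega) hp.b_pos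

theorem div_lt {x : ℕ} (hx : x < p.q) : x / p.b < p.g :=
  (Nat.div_lt_iff_lt_mul hp.b_pos).2 (hx.trans_le hp.q_le)

theorem g_pos : 0 < p.g :=
  lt_of_le_of_lt (Nat.zero_le _) (hp.div_lt (x := 0) (by have := hp.two_le_q; omega))

theorem nt_le_mem : p.nt ≤ p.mem :=
  le_min hp.nt_le_M (hp.nt_le.trans (Nat.le_self_pow (by norm_num) _))

theorem mem_le_bins_mul : p.mem ≤ p.bins * p.m := ceilDiv_mul_le _ (by have := hp.two_le_m; omega)

theorem bins_pos : 0 < p.bins := by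
  by_contra h
  have h1 := hp.mem_le_bins_mul
  rw [Nat.le_zero.1 (not_lt.1 h)] at h1
  have := hp.nt_le_mem
  have := hp.two_le_nt
  omega

theorem bins_le : p.bins ≤ p.mem :=
  ceilDiv_le (by have := hp.nt_le_mem; have := hp.two_le_nt; omega) (by have := hp.two_le_m; omega)

omit hp in
theorem estGroups_pos : 0 < p.estGroups := lt_of_lt_of_le Nat.one_pos (le_max_left _ _)

theorem nt_mul_estGroups_le : p.nt * p.estGroups ≤ p.mem := by
  rw [estGroups]
  have h1 := Nat.mul_div_le p.mem p.nt
  rcases max_cases 1 (min (p.mem / p.nt) p.g) with ⟨h, -⟩ | ⟨h, -⟩ <;> rw [h]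
  · rw [mul_one]
    exact hp.nt_le_mem
  · exact le_trans (Nat.mul_le_mul_left _ (min_le_left _ _)) h1

theorem g_le_phases_mul : p.g ≤ p.phases * p.estGroups := ceilDiv_mul_le _ estGroups_pos

theorem phases_le : p.phases ≤ p.g := ceilDiv_le hp.g_pos estGroups_pos

theorem div_estGroups_lt {l : ℕ} (hl : l < p.g) : l / p.estGroups < p.phases :=
  (Nat.div_lt_iff_lt_mul estGroups_pos).2 (hl.trans_le hp.g_le_phases_mul)

omit hp in
theorem two_le_fan : 2 ≤ p.fan := le_max_left _ _

omit hp in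
theorem mulGroups_pos (e : ℕ) : 0 < p.mulGroups e := lt_of_lt_of_le Nat.one_pos (le_max_left _ _)

theorem mulGroups_le (e : ℕ) : p.mulGroups e ≤ p.g :=
  max_le hp.g_pos (min_le_right _ _)

theorem nt_mul_mulGroups_le (e : ℕ) : p.nt * p.mulGroups e ≤ p.mem := by
  rw [mulGroups]
  have h1 := Nat.mul_div_le p.mem (p.nt + 2 * e)
  rcases max_cases 1 (min (p.mem / (p.nt + 2 * e)) p.g) with ⟨h, -⟩ | ⟨h, -⟩ <;> rw [h]
  · rw [mul_one]
    exact hp.nt_le_mem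
  · exact le_trans (Nat.mul_le_mul (by omega) (min_le_left _ _)) h1

omit hp in
theorem g_le_mulPhases_mul {K : ℕ} (hK : 0 < K) : p.g ≤ p.mulPhases K * K := ceilDiv_mul_le _ hK

theorem mulPhases_pos {K : ℕ} (hK : 0 < K) : 0 < p.mulPhases K := by
  by_contra h
  have h1 := g_le_mulPhases_mul (p := p) hK
  rw [Nat.le_zero.1 (not_lt.1 h)] at h1
  have := hp.g_pos
  omega

end Valid

end Params

/-! ### Rounds of the estimation -/

section

variable {S : Type u} [NonUnitalSemiring S] {p : Params} (A B : Matrix (Fin p.q) (Fin p.q) S)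
  (ω : Choices p)

/-- The values with key `k` at the beginning of round `r`. -/
noncomputable abbrev vals (r : ℕ) (k : Key) : Multiset (Msg S) :=
  values ((algorithm S ω).state (inputs A B) r) k

/-- The keys at the beginning of round `r`. -/
noncomputable abbrev keysAt (r : ℕ) : Finset Key := keys ((algorithm S ω).state (inputs A B) r)

variable {A B ω}

theorem values_eq_zero_of_forall {X : Multiset (Key × Msg S)} {k : Key} (h : ∀ v, (k, v) ∉ X) :
    values X k = 0 :=
  Multiset.eq_zero_iff_forall_notMem.2 fun v hv => h v (mem_values.1 hv)

theorem mem_sketchOf {X : ℕ → Finset ℕ} {v : Msg S} : v ∈ sketchOf p X ↔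
    ∃ w < p.Δ, ∃ x ∈ smallest p.t (X w), v = .sketch w x := by
  simp only [sketchOf, Multiset.mem_bind, Multiset.mem_range, Multiset.mem_map, Finset.mem_val]
  constructor
  · rintro ⟨w, hw, x, hx, rfl⟩
    exact ⟨w, hw, x, hx, rfl⟩
  · rintro ⟨w, hw, x, hx, rfl⟩
    exact ⟨w, hw, x, hx, rfl⟩

theorem card_sketchOf_le (X : ℕ → Finset ℕ) : (sketchOf (S := S) p X).card ≤ p.H := by
  rw [sketchOf, Multiset.card_bind]
  refine (Multiset.sum_le_card_nsmul _ p.t ?_).trans ?_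
  · intro x hx
    obtain ⟨w, -, rfl⟩ := Multiset.mem_map.1 hx
    simp only [Function.comp_apply, Multiset.card_map]
    exact card_smallest_le
  · simp [Params.H, mul_comm]

theorem coin_pair_lt {r i j l : ℕ} (hi : i < p.g) (hj : j < p.g) (hl : l < p.g) :
    coin ω r (.pair i j l) < p.bins := by
  rw [coin, dif_pos ⟨hi, hj, hl⟩]
  exact Fin.is_lt _

theorem coin_bin_lt {r β : ℕ} (hr : r ≤ p.phases) (hβ : β < p.bins) :
    coin ω r (.bin β) < p.bins := by
  rw [coin, dif_pos ⟨by omega, hβ⟩]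
  exact Fin.is_lt _

theorem mem_homeStep {r : ℕ} {k : Key} {V : Multiset (Msg S)} (hr : r ≤ p.estRound)
    {x : Key × Msg S} (h : x ∈ homeStep p r k V) : x.1 = k ∧ x.2 ∈ V ∨
      ∃ i j s, x.1 = .pair i j (r * p.estGroups + s) ∧ i < p.g ∧ j < p.g ∧ s < p.estGroups ∧
        r * p.estGroups + s < p.g ∧ x.2 ∈ V.filter (AtPlace p i j (r * p.estGroups + s)) := by
  rw [homeStep, if_pos hr, Multiset.mem_add] at h
  rcases h with h | h
  · obtain ⟨v, hv, rfl⟩ := Multiset.mem_map.1 h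
    exact Or.inl ⟨rfl, hv⟩
  · right
    split_ifs at h
    swap
    · simp at h
    obtain ⟨i, j, s, hk⟩ := mem_copies h
    have h1 : x.2 ∈ values (copies p p.estGroups r (fun i j s => .pair i j (r * p.estGroups + s)) V)
        (Key.pair i j (r * p.estGroups + s)) := mem_values.2 (by rw [← hk]; exact h)
    rw [values_copies (key := fun i j s => .pair i j (r * p.estGroups + s)) (by simp)] at h1
    split_ifs at h1 with h2
    · exact ⟨i, j, s, hk, h2.1, h2.2.1, h2.2.2.1, h2.2.2.2, h1⟩
    · simp at h1

theorem mem_pairStep {r i j l : ℕ} {V : Multiset (Msg S)} {x : Key × Msg S}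
    (h : x ∈ pairStep ω r i j l V) : x.1 = .bin (coin ω r (.pair i j l)) ∧
      ((∃ w < p.Δ, ∃ z ∈ pairStream p V, x.2 = .sketch w (hash ω w z)) ∨
        ∃ c y z a, Msg.entry c y z a ∈ V ∧ x.2 = .pseudo i j l c y z) := by
  rw [pairStep, Multiset.mem_map] at h
  obtain ⟨v, hv, rfl⟩ := h
  refine ⟨rfl, ?_⟩
  split_ifs at hv
  · simp at hv
  · obtain ⟨w, hw, y, hy, rfl⟩ := mem_sketchOf.1 hv
    obtain ⟨z, hz, rfl⟩ := Finset.mem_image.1 (smallest_subset hy)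
    exact Or.inl ⟨w, hw, z, hz, rfl⟩
  · right
    rw [Multiset.mem_add, Multiset.mem_map, Multiset.mem_map] at hv
    rcases hv with ⟨⟨y, z, a⟩, hu, rfl⟩ | ⟨⟨y, z, a⟩, hu, rfl⟩
    · exact ⟨_, _, _, a, mem_entries.1 hu, rfl⟩
    · exact ⟨_, _, _, a, mem_entries.1 hu, rfl⟩

theorem mem_prodStep {r K i j s : ℕ} {V : Multiset (Msg S)} {x : Key × Msg S}
    (h : x ∈ prodStep p r K i j s V) :
    ∃ x' y a, (r - (p.estRound + 2) + 1 < p.mulPhases K ∧ x.1 = .prod K i j s ∨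
      ¬ r - (p.estRound + 2) + 1 < p.mulPhases K ∧ x.1 = .cell K x' y (s / p.m)) ∧
        x.2 = .part x' y a := by
  rw [prodStep, Multiset.mem_bind] at h
  obtain ⟨xy, -, h⟩ := h
  split_ifs at h with h1 h2
  · simp at h
  · rw [Multiset.mem_singleton] at h
    exact ⟨xy.1, xy.2, _, Or.inl ⟨h2, by rw [h]⟩, by rw [h]⟩
  · rw [Multiset.mem_singleton] at h
    exact ⟨xy.1, xy.2, _, Or.inr ⟨h2, by rw [h]⟩, by rw [h]⟩

theorem mem_cellStep {r K x y s : ℕ} {V : Multiset (Msg S)} {u : Key × Msg S}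
    (h : u ∈ (cellStep p r K x y s V).1) : ∃ x y s, u.1 = .cell K x y s := by
  rw [cellStep] at h
  split_ifs at h
  · rw [Multiset.mem_singleton] at h
    exact ⟨_, _, _, by rw [h]⟩
  · simp at h

variable (A B ω)

/-- A message that carries the value of a hash function at a position of the product. -/
def IsSketch (v : Msg S) : Prop :=
  ∃ w < p.Δ, ∃ z ∈ positions A B, v = .sketch w (hash ω w z)

/-- A message that is part of the pseudosketch of a pair of submatrices. -/
def IsPseudoValue (v : Msg S) : Prop :=
  ∃ i j l c, ∃ u : Fin p.q × Fin p.q, i < p.g ∧ j < p.g ∧ l < p.g ∧ side A B c u.1 u.2 ≠ 0 ∧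
    v = .pseudo i j l c u.1 u.2

/-- The key-value pairs that may occur in round `r` of the estimation: entries stay at home and are
copied to the pairs of the current phase, sketches move among the random reducers up to round
`phases + 1` and along the tree from round `phases + 2` on. In the tree, the number of possible
nodes shrinks by the factor `fan` in each round. -/
def Sound (r : ℕ) : Key → Msg S → Prop
  | .home c i, v => (Key.home c i, v) ∈ inputs A B
  | .pair i j l, v => l / p.estGroups + 1 = r ∧ i < p.g ∧ j < p.g ∧ l < p.g ∧
      v ∈ blockEntries A B i j l
  | .bin β, v => 2 ≤ r ∧ r ≤ p.phases + 1 ∧ β < p.bins ∧ (IsSketch A B ω v ∨ IsPseudoValue A B v)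
  | .node β, v => p.phases + 2 ≤ r ∧ r ≤ p.estRound ∧
      β ≤ (p.bins - 1) / p.fan ^ (r - p.phases - 1) ∧ IsSketch A B ω v
  | _, _ => False

variable {A B ω}

theorem mem_allEntries_of_mem_inputs {k : Key} {v : Msg S} (h : (k, v) ∈ inputs A B) :
    v ∈ allEntries A B := by
  rw [← map_snd_inputs]
  exact Multiset.mem_map_of_mem Prod.snd h

theorem pairStream_subset (hAB : NoCancellation A B) {V : Multiset (Msg S)}
    (hV : ∀ v ∈ V, v ∈ allEntries A B) : pairStream p V ⊆ positions A B := by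
  intro z hz
  obtain ⟨x, y, k, a, b, h1, h2, rfl⟩ := mem_pairStream.1 hz
  obtain ⟨u, hu, rfl, rfl, rfl⟩ := entry_mem_allEntries.1 (hV _ h1)
  obtain ⟨w, hw, h3, rfl, rfl⟩ := entry_mem_allEntries.1 (hV _ h2)
  exact mem_positions hAB hu (by rw [Fin.ext h3]; exact hw)

/-- Merging invents nothing: all values are hash values of positions of the product. -/
theorem merge_sets_subset (hAB : NoCancellation A B) {V : Multiset (Msg S)}
    (hV : ∀ v ∈ V, IsSketch A B ω v ∨ IsPseudoValue A B v) (w : ℕ) :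
    sketchValues V w ∪ (pseudoStream p V).image (hash ω w) ⊆ (positions A B).image (hash ω w) := by
  intro x hx
  rcases Finset.mem_union.1 hx with hx | hx
  · rcases hV _ (mem_sketchValues.1 hx) with ⟨w', -, z, hz, h⟩ | ⟨_, _, _, _, _, _, _, _, _, h⟩
    · rw [Msg.sketch.injEq] at h
      obtain ⟨rfl, rfl⟩ := h
      exact Finset.mem_image_of_mem _ hz
    · cases h
  · refine Finset.image_subset_image ?_ hx
    intro z hz
    obtain ⟨i, j, l, x, y, k, h1, h2, rfl⟩ := mem_pseudoStream.1 hz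
    rcases hV _ h1 with ⟨w', -, z, hz, h⟩ | ⟨_, _, _, c, u, _, _, _, hu, h⟩
    · cases h
    rcases hV _ h2 with ⟨w', -, z, hz, h'⟩ | ⟨_, _, _, c', u', _, _, _, hu', h'⟩
    · cases h'
    rw [Msg.pseudo.injEq] at h h'
    obtain ⟨rfl, rfl, rfl, rfl, rfl, rfl⟩ := h
    obtain ⟨-, -, -, rfl, h3, rfl⟩ := h'
    exact mem_positions hAB hu (by rw [Fin.ext h3]; exact hu')

theorem isSketch_of_mem_merge (hAB : NoCancellation A B) {V : Multiset (Msg S)}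
    (hV : ∀ v ∈ V, IsSketch A B ω v ∨ IsPseudoValue A B v) {v : Msg S} (h : v ∈ merge ω V) :
    IsSketch A B ω v := by
  obtain ⟨w, hw, x, hx, rfl⟩ := mem_sketchOf.1 h
  obtain ⟨z, hz, rfl⟩ := Finset.mem_image.1 (merge_sets_subset hAB hV w (smallest_subset hx))
  exact ⟨w, hw, z, hz, rfl⟩

/-- No other key-value pairs occur in the estimation. In particular, sketches hold nothing but hash
values of positions of the product. -/
theorem sound (hp : p.Valid) (hAB : NoCancellation A B) : ∀ r ≤ p.estRound, ∀ k v,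
    v ∈ vals A B ω r k → Sound A B ω r k v := by
  intro r
  induction r with
  | zero =>
    intro _ k v hv
    have hv' := mem_values.1 hv
    obtain ⟨c, u, -, rfl, -⟩ := mem_inputs hv'
    exact hv'
  | succ r ih =>
    intro hr k v hv
    have ih := ih (by omega)
    obtain ⟨k₀, hk₀, h⟩ := (mem_state_succ _ _ _).1 (mem_values.1 hv)
    obtain ⟨v₀, hv₀⟩ := mem_keys.1 hk₀
    have hs₀ := ih k₀ v₀ (mem_values.2 hv₀)
    rcases k₀ with ⟨c, i⟩ | ⟨i, j, l⟩ | β | β | ⟨K, i, j, s⟩ | ⟨K, x, y, s⟩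
    · rcases mem_homeStep (by omega) h with ⟨hk, h⟩ | ⟨i', j', s, hk, hi, hj, hs, hg, h⟩
      · obtain rfl : k = .home c i := hk
        exact ih _ _ h
      · obtain rfl : k = .pair i' j' (r * p.estGroups + s) := hk
        rw [Multiset.mem_filter] at h
        refine ⟨?_, hi, hj, hg, Multiset.mem_filter.2
          ⟨mem_allEntries_of_mem_inputs (ih _ _ h.1), h.2⟩⟩
        rw [mul_comm, Nat.mul_add_div (by omega), Nat.div_eq_of_lt hs, add_zero]
    · obtain ⟨hk, h1⟩ := mem_pairStep h
      obtain rfl : k = _ := hk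
      obtain ⟨h2, hi, hj, hl, -⟩ := hs₀
      have h3 := hp.div_estGroups_lt hl
      generalize l / p.estGroups = d at h2 h3
      refine ⟨by omega, by omega, coin_pair_lt hi hj hl, ?_⟩
      rcases h1 with ⟨w, hw, z, hz, h1⟩ | ⟨c, y, z, a, h1, h4⟩
      · exact Or.inl ⟨w, hw, z, pairStream_subset hAB (fun v hv =>
          (Multiset.mem_filter.1 (ih (.pair i j l) v hv).2.2.2.2).1) hz, h1⟩
      · obtain ⟨u, hu, rfl, rfl, rfl⟩ := entry_mem_allEntries.1
          (Multiset.mem_filter.1 (ih (.pair i j l) _ h1).2.2.2.2).1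
        exact Or.inr ⟨i, j, l, c, u, hi, hj, hl, hu, h4⟩
    · obtain ⟨v', hv', h⟩ := Multiset.mem_map.1 h
      rw [Prod.mk.injEq] at h
      obtain ⟨rfl, rfl⟩ := h
      have hsk := isSketch_of_mem_merge hAB (fun v hv => (ih (.bin β) v hv).2.2.2) hv'
      obtain ⟨h1, h2, h3, -⟩ := hs₀
      split_ifs with h4
      · exact ⟨by omega, by omega, coin_bin_lt h4 h3, Or.inl hsk⟩
      · refine ⟨by omega, hr, ?_, hsk⟩
        rw [show r + 1 - p.phases - 1 = 1 by omega, pow_one]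
        exact Nat.div_le_div_right (by omega)
    · change (k, v) ∈ nodeStep ω r β _ at h
      rw [nodeStep, if_pos (by omega)] at h
      obtain ⟨v', hv', h⟩ := Multiset.mem_map.1 h
      rw [Prod.mk.injEq] at h
      obtain ⟨rfl, rfl⟩ := h
      have hsk := isSketch_of_mem_merge hAB (fun v hv => Or.inl (ih (.node β) v hv).2.2.2) hv'
      obtain ⟨h1, h2, h3, -⟩ := hs₀
      refine ⟨by omega, hr, ?_, hsk⟩
      rw [show r + 1 - p.phases - 1 = (r - p.phases - 1) + 1 by omega, pow_succ,
        ← Nat.div_div_eq_div_mul]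
      exact Nat.div_le_div_right h3
    · exact hs₀.elim
    · exact hs₀.elim

end

/-! ### The outcome of the estimation -/

section

variable {S : Type u} [NonUnitalSemiring S] {p : Params} {A B : Matrix (Fin p.q) (Fin p.q) S}
  {ω : Choices p}

theorem vals_succ (r : ℕ) (k' : Key) : vals A B ω (r + 1) k' = ∑ k ∈ keysAt A B ω r,
    values ((algorithm S ω).reduce r k (vals A B ω r k)).1 k' := values_state_succ _ _ _ _

theorem vals_eq_zero {r : ℕ} {k : Key} (h : k ∉ keysAt A B ω r) : vals A B ω r k = 0 :=
  values_eq_zero h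

/-- Only the home reducers and the root of the tree of sketches send values to a home reducer. -/
theorem values_reduce_home_eq_zero {r : ℕ} {k : Key} {c : Bool} {i : ℕ} (V : Multiset (Msg S))
    (hk : ∀ c i, k ≠ .home c i) (hn : (∀ β, k ≠ .node β) ∨ r < p.estRound) :
    values ((algorithm S ω).reduce r k V).1 (.home c i) = 0 := by
  refine values_eq_zero_of_forall fun v hv => ?_
  rcases k with ⟨c, i⟩ | ⟨i, j, l⟩ | β | β | ⟨K, i, j, s⟩ | ⟨K, x, y, s⟩
  · exact hk _ _ rfl
  · have := (mem_pairStep hv).1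
    cases this
  · obtain ⟨v', -, h⟩ := Multiset.mem_map.1 hv
    have := (Prod.ext_iff.1 h).1
    simp only at this
    split_ifs at this
  · rcases hn with hn | hn
    · exact hn _ rfl
    · change _ ∈ nodeStep ω r β _ at hv
      rw [nodeStep, if_pos hn] at hv
      obtain ⟨v', -, h⟩ := Multiset.mem_map.1 hv
      cases (Prod.ext_iff.1 h).1
  · obtain ⟨_, _, _, ⟨-, h⟩ | ⟨-, h⟩, -⟩ := mem_prodStep hv <;> cases h
  · obtain ⟨_, _, _, h⟩ := mem_cellStep hv
    cases h

/-- Only the home reducers send values to a pair of submatrices. -/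
theorem values_reduce_pair_eq_zero {r : ℕ} {k : Key} {i' j' l' : ℕ} (V : Multiset (Msg S))
    (hk : ∀ c i, k ≠ .home c i) : values ((algorithm S ω).reduce r k V).1 (.pair i' j' l') = 0 := by
  refine values_eq_zero_of_forall fun v hv => ?_
  rcases k with ⟨c, i⟩ | ⟨i, j, l⟩ | β | β | ⟨K, i, j, s⟩ | ⟨K, x, y, s⟩
  · exact hk _ _ rfl
  · have := (mem_pairStep hv).1
    cases this
  · obtain ⟨v', -, h⟩ := Multiset.mem_map.1 hv
    have := (Prod.ext_iff.1 h).1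
    simp only at this
    split_ifs at this
  · change _ ∈ nodeStep ω r β _ at hv
    rw [nodeStep] at hv
    split_ifs at hv
    · obtain ⟨v', -, h⟩ := Multiset.mem_map.1 hv
      cases (Prod.ext_iff.1 h).1
    · simp at hv
  · obtain ⟨_, _, _, ⟨-, h⟩ | ⟨-, h⟩, -⟩ := mem_prodStep hv <;> cases h
  · obtain ⟨_, _, _, h⟩ := mem_cellStep hv
    cases h

/-- Up to the round of the estimate, the entries stay where they are. -/
theorem vals_home {r : ℕ} (hr : r ≤ p.estRound) (c : Bool) (i : ℕ) :
    vals A B ω r (.home c i) = values (inputs A B) (.home c i) := by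
  induction r with
  | zero => rfl
  | succ r ih =>
    rw [vals_succ, ← ih (by omega)]
    by_cases hk : Key.home c i ∈ keysAt A B ω r
    · rw [Finset.sum_eq_single_of_mem _ hk]
      · change values (homeStep p r _ _) _ = _
        rw [homeStep, if_pos (by omega), values_add]
        refine (congrArg₂ (· + ·) ((values_map_const _ _ _ _).trans (if_pos rfl)) ?_).trans
          ((add_zero _).trans (Multiset.map_id _))
        split_ifs
        · exact values_copies_eq_zero (by simp)
        · rfl
      · intro k _ hne
        by_cases hkh : ∀ c i, k ≠ .home c i
        · exact values_reduce_home_eq_zero _ hkh (Or.inr (by omega))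
        · simp only [not_forall, not_not] at hkh
          obtain ⟨c', i', rfl⟩ := hkh
          refine values_eq_zero_of_forall fun v hv => ?_
          rcases mem_homeStep (by omega) hv with ⟨h, -⟩ | ⟨_, _, _, h, -⟩
          · exact hne h.symm
          · cases h
    · rw [vals_eq_zero hk]
      refine Finset.sum_eq_zero fun k hk' => ?_
      by_cases hkh : ∀ c i, k ≠ .home c i
      · exact values_reduce_home_eq_zero _ hkh (Or.inr (by omega))
      · simp only [not_forall, not_not] at hkh
        obtain ⟨c', i', rfl⟩ := hkh
        refine values_eq_zero_of_forall fun v hv => ?_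
        rcases mem_homeStep (by omega) hv with ⟨h, -⟩ | ⟨_, _, _, h, -⟩
        · have h : Key.home c i = Key.home c' i' := h
          rw [← h] at hk'
          exact hk hk'
        · cases h

theorem keys_inputs_subset {r : ℕ} (hr : r ≤ p.estRound) :
    keys (inputs A B) ⊆ keysAt A B ω r := by
  intro k hk
  obtain ⟨v, hv⟩ := mem_keys.1 hk
  obtain ⟨c, u, -, rfl, -⟩ := mem_inputs hv
  rw [mem_keys_iff] at hk ⊢
  exact fun h => hk ((vals_home hr _ _).symm.trans h)

/-- In round `r + 1`, all pairs of submatrices of the groups of phase `r` have their entries. -/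
theorem vals_pair {r : ℕ} (hr : r < p.phases) {i j s : ℕ} (hi : i < p.g) (hj : j < p.g)
    (hs : s < p.estGroups) (hl : r * p.estGroups + s < p.g) :
    vals A B ω (r + 1) (.pair i j (r * p.estGroups + s)) =
      blockEntries A B i j (r * p.estGroups + s) := by
  have hR : r ≤ p.estRound := by rw [Params.estRound]; omega
  rw [vals_succ, blockEntries, ← sum_values_inputs (keys_inputs_subset (ω := ω) hR)]
  refine Finset.sum_congr rfl fun k _ => ?_
  by_cases hkh : ∀ c i, k ≠ .home c i
  · rw [values_reduce_pair_eq_zero _ hkh, values_inputs_eq_zero hkh]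
    rfl
  · simp only [not_forall, not_not] at hkh
    obtain ⟨c', i', rfl⟩ := hkh
    change values (homeStep p r _ _) _ = _
    rw [homeStep, if_pos hR, values_add]
    refine (congrArg₂ (· + ·) ((values_map_const _ _ _ _).trans (if_neg (by simp))) ?_).trans
      (zero_add _)
    rw [if_pos hr, values_copies (key := fun i j s => .pair i j (r * p.estGroups + s)) (by simp),
      if_pos ⟨hi, hj, hs, hl⟩, vals_home hR]

/-- The value `v` of list `w` of a sketch is among the values or follows from a pseudosketch. -/
def Carries (ω : Choices p) (V : Multiset (Msg S)) (w v : ℕ) : Prop :=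
  v ∈ sketchValues V w ∪ (pseudoStream p V).image (hash ω w)

/-- Merging preserves the values of the sketch of the whole stream. -/
theorem Carries.mem_merge (hAB : NoCancellation A B) {V : Multiset (Msg S)} {w v : ℕ} (hw : w < p.Δ)
    (hV : ∀ v ∈ V, IsSketch A B ω v ∨ IsPseudoValue A B v)
    (hv : v ∈ smallest p.t ((positions A B).image (hash ω w))) (h : Carries ω V w v) :
    Msg.sketch w v ∈ merge ω V :=
  mem_sketchOf.2 ⟨w, hw, v, mem_smallest_of_subset hv (merge_sets_subset hAB hV w) h, rfl⟩

theorem ne_zero_of_carries {V : Multiset (Msg S)} {w v : ℕ} (h : Carries ω V w v) : V ≠ 0 := by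
  rintro rfl
  simp [Carries, sketchValues, pseudoStream, pseudos] at h

theorem mem_vals_succ {r : ℕ} {k k' : Key} {v : Msg S} (hk : vals A B ω r k ≠ 0)
    (h : (k', v) ∈ ((algorithm S ω).reduce r k (vals A B ω r k)).1) : v ∈ vals A B ω (r + 1) k' :=
  mem_values.2 ((mem_state_succ _ _ _).2 ⟨k, mem_keys_iff.2 hk, h⟩)

/-- Each value of the sketch of the whole stream enters the estimation: the two entries behind a
position of the product meet in one pair of submatrices, which yields a sketch or a pseudosketch. -/
theorem exists_bin_carries (hp : p.Valid) (hAB : NoCancellation A B) {w v : ℕ} (hw : w < p.Δ)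
    (hv : v ∈ smallest p.t ((positions A B).image (hash ω w))) :
    ∃ r, 2 ≤ r ∧ r ≤ p.phases + 1 ∧ ∃ β, Carries ω (vals A B ω r (.bin β)) w v := by
  obtain ⟨z, hz, rfl⟩ := Finset.mem_image.1 (smallest_subset hv)
  obtain ⟨x, k, y, ha, hb, rfl⟩ := exists_of_mem_positions hz
  -- the group in which the two entries meet
  obtain ⟨l, hl, hlk⟩ := exists_shift ((x : ℕ) / p.b + (y : ℕ) / p.b) (hp.div_lt k.2)
  have hr := hp.div_estGroups_lt hl
  set r := l / p.estGroups with hrdef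
  have hi := hp.div_lt x.2
  have hj := hp.div_lt y.2
  set i := (x : ℕ) / p.b with hidef
  set j := (y : ℕ) / p.b with hjdef
  have hV : vals A B ω (r + 1) (.pair i j l) = blockEntries A B i j l := by
    have h1 : r * p.estGroups + l % p.estGroups = l := by
      rw [mul_comm]
      exact Nat.div_add_mod _ _
    have h2 := vals_pair (A := A) (B := B) (ω := ω) hr hi hj
      (Nat.mod_lt l Params.Valid.estGroups_pos) (by rw [h1]; exact hl)
    rwa [h1] at h2
  have h1 : Msg.entry true (x : ℕ) k (A x k) ∈ vals A B ω (r + 1) (.pair i j l) := by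
    rw [hV, entry_mem_blockEntries]
    exact ⟨entry_mem_allEntries.2 ⟨(x, k), ha, rfl, rfl, rfl⟩, Or.inl ⟨rfl, rfl, hlk⟩⟩
  have h2 : Msg.entry false (k : ℕ) y (B k y) ∈ vals A B ω (r + 1) (.pair i j l) := by
    rw [hV, entry_mem_blockEntries]
    exact ⟨entry_mem_allEntries.2 ⟨(k, y), hb, rfl, rfl, rfl⟩, Or.inr ⟨rfl, rfl, hlk⟩⟩
  set V := vals A B ω (r + 1) (.pair i j l) with hVdef
  have hne : vals A B ω (r + 1) (.pair i j l) ≠ 0 := fun h => by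
    rw [← hVdef] at h
    rw [h] at h1
    simp at h1
  have hVe : ∀ v ∈ V, v ∈ allEntries A B := fun v hv => by
    rw [hV] at hv
    exact (Multiset.mem_filter.1 hv).1
  refine ⟨r + 2, Nat.le_add_left 2 r, by omega, coin ω (r + 1) (.pair i j l), ?_⟩
  have hA : (entries true V).card ≠ 0 := fun h => by
    rw [Multiset.card_eq_zero] at h
    have := mem_entries.2 h1
    rw [h] at this
    simp at this
  have hB : (entries false V).card ≠ 0 := fun h => by
    rw [Multiset.card_eq_zero] at h
    have := mem_entries.2 h2
    rw [h] at this
    simp at this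
  have hred : ((algorithm S ω).reduce (r + 1) (.pair i j l) (vals A B ω (r + 1) (.pair i j l))).1 =
      pairStep ω (r + 1) i j l V := rfl
  by_cases hH : p.H < (entries true V).card + (entries false V).card
  · refine Finset.mem_union_left _ (mem_sketchValues.2 (mem_vals_succ hne ?_))
    rw [hred, pairStep, if_neg (by tauto), if_pos hH]
    refine Multiset.mem_map_of_mem _ (mem_sketchOf.2 ⟨w, hw, _, mem_smallest_of_subset hv
      (Finset.image_subset_image (pairStream_subset hAB hVe)) ?_, rfl⟩)
    exact Finset.mem_image_of_mem _ (mem_pairStream.2 ⟨_, _, _, _, _, h1, h2, rfl⟩)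
  · refine Finset.mem_union_right _ (Finset.mem_image_of_mem _ (mem_pseudoStream.2
      ⟨i, j, l, x, y, k, mem_vals_succ hne ?_, mem_vals_succ hne ?_, rfl⟩))
    · rw [hred, pairStep, if_neg (by tauto), if_neg hH]
      exact Multiset.mem_map_of_mem _ (Multiset.mem_add.2 (Or.inl
        (Multiset.mem_map.2 ⟨_, mem_entries.2 h1, rfl⟩)))
    · rw [hred, pairStep, if_neg (by tauto), if_neg hH]
      exact Multiset.mem_map_of_mem _ (Multiset.mem_add.2 (Or.inr
        (Multiset.mem_map.2 ⟨_, mem_entries.2 h2, rfl⟩)))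

/-- A value of the sketch of the whole stream survives all phases, whatever the assignments. -/
theorem exists_bin_carries_last (hp : p.Valid) (hAB : NoCancellation A B) {w v : ℕ} (hw : w < p.Δ)
    (hv : v ∈ smallest p.t ((positions A B).image (hash ω w))) :
    ∃ β, Carries ω (vals A B ω (p.phases + 1) (.bin β)) w v := by
  obtain ⟨r, hr2, hr, h⟩ := exists_bin_carries hp hAB hw hv
  induction hr using Nat.decreasingInduction with
  | self => exact h
  | of_succ r hrp ih =>
    refine ih (by omega) ?_
    obtain ⟨β, h⟩ := h
    have hR : r ≤ p.estRound := by rw [Params.estRound]; omega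
    refine ⟨coin ω r (.bin β), Finset.mem_union_left _ (mem_sketchValues.2
      (mem_vals_succ (ne_zero_of_carries h) ?_))⟩
    refine Multiset.mem_map.2 ⟨_, h.mem_merge hAB hw (fun v hv =>
      (sound hp hAB r hR (.bin β) v hv).2.2.2) hv, ?_⟩
    rw [if_pos (by omega)]

/-- A value of the sketch of the whole stream survives in the tree. -/
theorem exists_node_mem (hp : p.Valid) (hAB : NoCancellation A B) {w v : ℕ} (hw : w < p.Δ)
    (hv : v ∈ smallest p.t ((positions A B).image (hash ω w))) {r : ℕ} (hr : p.phases + 2 ≤ r)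
    (hR : r ≤ p.estRound) : ∃ β, Msg.sketch w v ∈ vals A B ω r (.node β) := by
  induction r, hr using Nat.le_induction with
  | base =>
    obtain ⟨β, h⟩ := exists_bin_carries_last hp hAB hw hv
    refine ⟨β / p.fan, mem_vals_succ (ne_zero_of_carries h) ?_⟩
    refine Multiset.mem_map.2 ⟨_, h.mem_merge hAB hw (fun v hv =>
      (sound hp hAB (p.phases + 1) (by omega) (.bin β) v hv).2.2.2) hv, ?_⟩
    rw [if_neg (by omega)]
  | succ r hr ih =>
    obtain ⟨β, h⟩ := ih (by omega)
    refine ⟨β / p.fan, mem_vals_succ (k := .node β) (fun h0 => ?_) ?_⟩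
    · rw [h0] at h
      simp at h
    · change _ ∈ nodeStep ω r β _
      rw [nodeStep, if_pos (by omega)]
      refine Multiset.mem_map_of_mem _ (Carries.mem_merge hAB hw (fun v hv =>
        Or.inl (sound hp hAB r (by omega) (.node β) v hv).2.2.2) hv ?_)
      exact Finset.mem_union_left _ (mem_sketchValues.2 h)

/-- In the last round of the estimation, the tree is down to its root. -/
theorem root_eq_zero {β : ℕ} (h : β ≤ (p.bins - 1) / p.fan ^ (p.estRound - p.phases - 1)) :
    β = 0 := by
  have h1 : p.estRound - p.phases - 1 = Nat.clog p.fan p.bins + 1 := by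
    rw [Params.estRound]
    omega
  have h2 : p.bins ≤ p.fan ^ Nat.clog p.fan p.bins :=
    Nat.le_pow_clog Params.Valid.two_le_fan _
  have h3 : 0 < p.fan ^ Nat.clog p.fan p.bins :=
    pow_pos (lt_of_lt_of_le Nat.two_pos Params.Valid.two_le_fan) _
  have h4 : p.fan ^ Nat.clog p.fan p.bins ≤ p.fan ^ (Nat.clog p.fan p.bins + 1) :=
    Nat.pow_le_pow_right (lt_of_lt_of_le Nat.two_pos Params.Valid.two_le_fan) (Nat.le_succ _)
  rw [h1, Nat.div_eq_of_lt (by omega)] at h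
  omega

theorem mem_root (hp : p.Valid) (hAB : NoCancellation A B) {w v : ℕ} (hw : w < p.Δ)
    (hv : v ∈ smallest p.t ((positions A B).image (hash ω w))) :
    Msg.sketch w v ∈ vals A B ω p.estRound (.node 0) := by
  obtain ⟨β, h⟩ := exists_node_mem hp hAB hw hv (r := p.estRound) (by rw [Params.estRound]; omega)
    le_rfl
  have := root_eq_zero (sound hp hAB _ le_rfl (.node β) _ h).2.2.1
  rwa [this] at h

/-- The estimate computed at the root is that of the sketch of the whole stream. -/
theorem estimate_root (hp : p.Valid) (hAB : NoCancellation A B) :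
    estimate p (vals A B ω p.estRound (.node 0)) = trueEstimate ω (positions A B) := by
  refine congrArg (fun s : Multiset ℕ => (s.sort (· ≤ ·)).getD (p.Δ / 2) 0)
    (Multiset.map_congr rfl fun w hw => congrArg (listEstimate p) ?_)
  have hw : w < p.Δ := Multiset.mem_range.1 hw
  refine smallest_eq_of_subset (fun v hv => mem_sketchValues.2 (mem_root hp hAB hw hv)) ?_
  intro v hv
  obtain ⟨w', -, z, hz, h⟩ := (sound hp hAB _ le_rfl (.node 0) _ (mem_sketchValues.1 hv)).2.2.2
  rw [Msg.sketch.injEq] at h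
  obtain ⟨rfl, rfl⟩ := h
  exact Finset.mem_image_of_mem _ hz

/-- There is a root if and only if the product does not vanish. Otherwise no sketches are ever sent.
-/
theorem root_mem_keys_iff (hp : p.Valid) (hAB : NoCancellation A B) :
    Key.node 0 ∈ keysAt A B ω p.estRound ↔ (positions A B).Nonempty := by
  rw [mem_keys_iff]
  constructor
  · intro h
    obtain ⟨v, hv⟩ := Multiset.exists_mem_of_ne_zero h
    obtain ⟨w', -, z, hz, -⟩ := (sound hp hAB _ le_rfl (.node 0) _ hv).2.2.2
    exact ⟨z, hz⟩
  · intro h h0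
    obtain ⟨v, hv⟩ := smallest_nonempty (t := p.t) (by norm_num [Params.t]) (h.image (hash ω 0))
    have h1 : Msg.sketch 0 v ∈ vals A B ω p.estRound (.node 0) :=
      mem_root hp hAB (by rw [Params.Δ]; omega) hv
    have h1 := mem_values.1 h1
    rw [← mem_values, h0] at h1
    simp at h1

variable (A B ω) in
/-- The estimate of the number of nonzero entries that the algorithm computes. -/
noncomputable def est : ℕ := trueEstimate ω (positions A B)

/-- After the estimation, the reducers with an index below `nt` have the estimate. If the product
vanishes, there is no estimate. -/
theorem vals_home_after (hp : p.Valid) (hAB : NoCancellation A B) (c : Bool) (i : ℕ) :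
    vals A B ω (p.estRound + 1) (.home c i) = values (inputs A B) (.home c i) +
      if (positions A B).Nonempty ∧ i < p.nt then {Msg.est (est A B ω)} else 0 := by
  have hterm : ∀ k ∈ keysAt A B ω p.estRound,
      values ((algorithm S ω).reduce p.estRound k (vals A B ω p.estRound k)).1 (.home c i) =
        (if k = .home c i then values (inputs A B) (.home c i) else 0) +
        if k = .node 0 then (if i < p.nt then {Msg.est (est A B ω)} else 0) else 0 := by
    intro k hk
    rcases k with ⟨c', i'⟩ | ⟨i', j, l⟩ | β | β | ⟨K, i, j, s⟩ | ⟨K, x, y, s⟩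
    · change values (homeStep p _ _ _) _ = _
      have hph : ¬ p.estRound < p.phases := by rw [Params.estRound]; omega
      rw [homeStep, if_pos le_rfl, values_add, if_neg hph, values_zero, add_zero,
        if_neg (c := Key.home c' i' = .node 0) (by simp), add_zero]
      refine (values_map_const _ _ _ _).trans ?_
      split_ifs with h
      · rw [h]
        exact (Multiset.map_id _).trans (vals_home le_rfl _ _)
      · rfl
    · rw [values_reduce_home_eq_zero _ (by simp) (Or.inl (by simp))]
      simp
    · rw [values_reduce_home_eq_zero _ (by simp) (Or.inl (by simp))]
      simp
    · obtain ⟨v, hv⟩ := Multiset.exists_mem_of_ne_zero (mem_keys_iff.1 hk)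
      obtain rfl : β = 0 := root_eq_zero (sound hp hAB _ le_rfl (.node β) v hv).2.2.1
      change values (nodeStep ω _ _ _) _ = _
      rw [nodeStep, if_neg (lt_irrefl _), estimate_root hp hAB, if_neg (by simp), if_pos rfl,
        zero_add, Multiset.bind, Multiset.join, values_multiset_sum]
      have h1 : ∀ k', values (({(Key.home true k', Msg.est (trueEstimate ω (positions A B))),
          (Key.home false k', Msg.est (trueEstimate ω (positions A B)))} :
            Multiset (Key × Msg S))) (.home c i) = if k' = i then {Msg.est (est A B ω)} else 0 := by
        intro k'
        rw [Multiset.insert_eq_cons, ← Multiset.singleton_add, values_add, values_singleton,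
          values_singleton]
        by_cases hk' : k' = i <;> cases c <;> simp [hk', est]
      simp only [h1]
      rw [map_range_sum]
      simp
    · rw [values_reduce_home_eq_zero _ (by simp) (Or.inl (by simp))]
      simp
    · rw [values_reduce_home_eq_zero _ (by simp) (Or.inl (by simp))]
      simp
  rw [vals_succ, Finset.sum_congr rfl hterm, Finset.sum_add_distrib, Finset.sum_ite_eq',
    Finset.sum_ite_eq']
  congr 1
  · split_ifs with h
    · rfl
    · rw [← vals_home (A := A) (B := B) (ω := ω) le_rfl, vals_eq_zero h]
  · simp only [root_mem_keys_iff hp hAB]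
    split_ifs <;> first | rfl | (exfalso; tauto)

theorem vals_after_eq_zero (hp : p.Valid) (hAB : NoCancellation A B) {k : Key}
    (hk : ∀ c i, k ≠ .home c i) : vals A B ω (p.estRound + 1) k = 0 := by
  rw [vals_succ]
  refine Finset.sum_eq_zero fun k₀ hk₀ => values_eq_zero_of_forall fun v h => ?_
  obtain ⟨v₀, hv₀⟩ := Multiset.exists_mem_of_ne_zero (mem_keys_iff.1 hk₀)
  have hs := sound hp hAB _ le_rfl k₀ v₀ hv₀
  have hph : p.phases + 2 ≤ p.estRound := by rw [Params.estRound]; omega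
  rcases k₀ with ⟨c', i'⟩ | ⟨i', j, l⟩ | β | β | ⟨K, i, j, s⟩ | ⟨K, x, y, s⟩
  · change _ ∈ homeStep p _ _ _ at h
    rw [homeStep, if_pos le_rfl, if_neg (by omega), add_zero] at h
    obtain ⟨_, -, h⟩ := Multiset.mem_map.1 h
    exact hk _ _ (Prod.ext_iff.1 h).1.symm
  · have h1 : l / p.estGroups + 1 = p.estRound := hs.1
    have := hp.div_estGroups_lt hs.2.2.2.1
    generalize l / p.estGroups = d at *
    omega
  · have h1 : p.estRound ≤ p.phases + 1 := hs.2.1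
    omega
  · change _ ∈ nodeStep ω _ _ _ at h
    rw [nodeStep, if_neg (lt_irrefl _), Multiset.mem_bind] at h
    obtain ⟨k', -, h⟩ := h
    simp only [Multiset.insert_eq_cons, Multiset.mem_cons, Multiset.mem_singleton,
      Prod.mk.injEq] at h
    rcases h with h | h <;> exact hk _ _ h.1
  · exact hs
  · exact hs

end

/-! ### Rounds of the multiplication -/

section

variable {S : Type u} [NonUnitalSemiring S]

/-- The summands are replaced by their sum, unless there are none. -/
def collapse (Z : Multiset S) : Multiset S := if Z.card = 0 then 0 else {Z.sum}

theorem collapse_sum (Z : Multiset S) : (collapse Z).sum = Z.sum := by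
  rw [collapse]
  split_ifs with h
  · rw [Multiset.card_eq_zero.1 h]
  · simp

theorem card_collapse_le (Z : Multiset S) : (collapse Z).card ≤ 1 := by
  rw [collapse]
  split_ifs <;> simp

theorem collapse_eq_zero {Z : Multiset S} : collapse Z = 0 ↔ Z = 0 := by
  rw [collapse]
  split_ifs with h
  · simp [Multiset.card_eq_zero.1 h]
  · rw [Multiset.card_eq_zero] at h
    simp [h]

variable {p : Params} (A B : Matrix (Fin p.q) (Fin p.q) S) (ω : Choices p)

/-- The number of groups that are multiplied in a round. -/
noncomputable def width : ℕ := p.mulGroups (est A B ω)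

/-- The number of rounds in which products are computed. -/
noncomputable def steps : ℕ := p.mulPhases (width A B ω)

/-- The partial sum number `s` for the entry `(x, y)` after `c` rounds of multiplication with `K`
groups each: none if no contribution has been made so far, and a single element otherwise. -/
noncomputable def partialSum (K : ℕ) : ℕ → ℕ → ℕ → ℕ → Multiset S
  | 0, _, _, _ => 0
  | c + 1, s, x, y => collapse (partialSum K c s x y +
      if s < K ∧ c * K + s < p.g then groupProducts A B (c * K + s) x y else 0)

/-- The values of a home reducer during the multiplication: an entry, if there is one, and the
estimate. -/
noncomputable def homeVals (c : Bool) (i : ℕ) : Multiset (Msg S) :=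
  values (inputs A B) (.home c i) + if i < p.nt then {Msg.est (est A B ω)} else 0

variable {A B ω}

theorem copies_zero (K c : ℕ) (key : ℕ → ℕ → ℕ → Key) :
    copies p K c key (0 : Multiset (Msg S)) = 0 := by
  rw [copies_eq_sum]
  simp

theorem homeVals_eq_zero (hA : nnz A ≤ p.nt) (hB : nnz B ≤ p.nt) {c : Bool} {i : ℕ}
    (hi : ¬ i < p.nt) : homeVals A B ω c i = 0 := by
  rw [homeVals, if_neg hi, add_zero]
  refine Multiset.eq_zero_iff_forall_notMem.2 fun v hv => hi ?_
  obtain ⟨c', u, hu, h, -⟩ := mem_inputs (mem_values.1 hv)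
  rw [Key.home.injEq] at h
  obtain ⟨rfl, rfl⟩ := h
  refine (progressiveIndex_lt hu).trans_le ?_
  cases c
  · exact hB
  · exact hA

theorem ests_homeVals {c : Bool} {i : ℕ} (hi : i < p.nt) :
    ests (homeVals A B ω c i) = {est A B ω} := by
  rw [homeVals, if_pos hi, ests, Multiset.filterMap_add]
  have : (values (inputs A B) (.home c i)).filterMap (fun v : Msg S => match v with
      | .est e => some e
      | _ => none) = 0 := by
    refine Multiset.eq_zero_iff_forall_notMem.2 fun e he => ?_
    obtain ⟨v, hv, h⟩ := (Multiset.mem_filterMap _ _).1 he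
    obtain ⟨c', u, -, -, rfl⟩ := mem_inputs (mem_values.1 hv)
    cases h
  exact (congrArg₂ (· + ·) this rfl).trans (zero_add _)

theorem homeStep_mul (hA : nnz A ≤ p.nt) (hB : nnz B ≤ p.nt) (c : ℕ) (d : Bool) (i : ℕ) :
    homeStep p (p.estRound + 1 + c) (.home d i) (homeVals A B ω d i) =
      if c < steps A B ω then (homeVals A B ω d i).map (fun v => (Key.home d i, v)) +
        copies p (width A B ω) c (fun i j s => .prod (width A B ω) i j s) (homeVals A B ω d i)
      else 0 := by
  rw [homeStep, if_neg (by omega), show p.estRound + 1 + c - (p.estRound + 1) = c by omega]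
  by_cases hi : i < p.nt
  · rw [ests_homeVals hi, Multiset.singleton_bind]
    rfl
  · rw [homeVals_eq_zero hA hB hi, copies_zero]
    simp [ests]

/-- The content of the home reducers, and the kinds of keys, during the multiplication. -/
theorem multiplication_keys (hp : p.Valid) (hAB : NoCancellation A B) (hA : nnz A ≤ p.nt)
    (hB : nnz B ≤ p.nt) (hF : (positions A B).Nonempty) (c : ℕ) :
    (∀ d i, vals A B ω (p.estRound + 1 + c) (.home d i) =
      if c ≤ steps A B ω then homeVals A B ω d i else 0) ∧
    ∀ k ∈ keysAt A B ω (p.estRound + 1 + c), (∃ d i, k = .home d i ∧ c ≤ steps A B ω) ∨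
      (∃ i j s, k = .prod (width A B ω) i j s ∧ 1 ≤ c ∧ c ≤ steps A B ω) ∨
      ∃ x y s, k = .cell (width A B ω) x y s ∧ steps A B ω + 1 ≤ c := by
  induction c with
  | zero =>
    constructor
    · intro d i
      rw [if_pos (Nat.zero_le _), add_zero, vals_home_after hp hAB, homeVals]
      simp only [hF, true_and]
    · intro k hk
      by_cases hkh : ∀ c i, k ≠ .home c i
      · exact absurd (vals_after_eq_zero hp hAB hkh) (mem_keys_iff.1 hk)
      · simp only [not_forall, not_not] at hkh
        obtain ⟨c', i', rfl⟩ := hkh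
        exact Or.inl ⟨_, _, rfl, Nat.zero_le _⟩
  | succ c ih =>
    obtain ⟨ih1, ih2⟩ := ih
    have hmem : ∀ k v, (k, v) ∈ (algorithm S ω).state (inputs A B) (p.estRound + 1 + (c + 1)) →
        (∃ d i, k = .home d i ∧ c + 1 ≤ steps A B ω) ∨
        (∃ i j s, k = .prod (width A B ω) i j s ∧ 1 ≤ c + 1 ∧ c + 1 ≤ steps A B ω) ∨
        ∃ x y s, k = .cell (width A B ω) x y s ∧ steps A B ω + 1 ≤ c + 1 := by
      intro k v hv
      obtain ⟨k₀, hk₀, h⟩ := (mem_state_succ _ _ (p.estRound + 1 + c)).1 hv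
      rcases ih2 k₀ hk₀ with ⟨d, i, rfl, hc⟩ | ⟨i, j, s, rfl, hc, hc'⟩ | ⟨x, y, s, rfl, hc⟩
      · change _ ∈ homeStep p _ _ (vals A B ω _ _) at h
        rw [ih1, if_pos hc, homeStep_mul hA hB] at h
        split_ifs at h with hc1
        · rw [Multiset.mem_add] at h
          rcases h with h | h
          · obtain ⟨v', -, h⟩ := Multiset.mem_map.1 h
            exact Or.inl ⟨d, i, (Prod.ext_iff.1 h).1.symm, hc1⟩
          · obtain ⟨i', j', s', h⟩ := mem_copies h
            exact Or.inr (Or.inl ⟨i', j', s', h, by omega, hc1⟩)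
        · simp at h
      · obtain ⟨x', y, a, h | h, -⟩ := mem_prodStep h
        · have h1 : p.estRound + 1 + c - (p.estRound + 2) + 1 < steps A B ω := h.1
          exact Or.inr (Or.inl ⟨i, j, s, h.2, by omega, by omega⟩)
        · have h1 : ¬ p.estRound + 1 + c - (p.estRound + 2) + 1 < steps A B ω := h.1
          exact Or.inr (Or.inr ⟨x', y, s / p.m, h.2, by omega⟩)
      · obtain ⟨x', y', s', h⟩ := mem_cellStep h
        exact Or.inr (Or.inr ⟨x', y', s', h, by omega⟩)
    refine ⟨fun d i => ?_, fun k hk => ?_⟩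
    · have hterm : ∀ k ∈ keysAt A B ω (p.estRound + 1 + c), values ((algorithm S ω).reduce
          (p.estRound + 1 + c) k (vals A B ω (p.estRound + 1 + c) k)).1 (.home d i) =
          if k = .home d i then (if c + 1 ≤ steps A B ω then homeVals A B ω d i else 0) else 0 := by
        intro k hk
        rcases ih2 k hk with ⟨d', i', rfl, hc⟩ | ⟨i', j, s, rfl, -⟩ | ⟨x, y, s, rfl, -⟩
        · change values (homeStep p _ _ _) _ = _
          rw [ih1, if_pos hc, homeStep_mul hA hB]
          by_cases hc1 : c < steps A B ω
          · rw [if_pos hc1, values_add, values_copies_eq_zero (by simp), add_zero,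
              if_pos (c := c + 1 ≤ steps A B ω) hc1]
            refine (values_map_const _ _ _ _).trans ?_
            split_ifs with h
            · rw [Key.home.injEq] at h
              obtain ⟨rfl, rfl⟩ := h
              exact Multiset.map_id _
            · rfl
          · rw [if_neg hc1, values_zero, if_neg (c := c + 1 ≤ steps A B ω) hc1, ite_self]
        · rw [values_reduce_home_eq_zero _ (by simp) (Or.inl (by simp)), if_neg (by simp)]
        · rw [values_reduce_home_eq_zero _ (by simp) (Or.inl (by simp)), if_neg (by simp)]
      rw [← add_assoc, vals_succ, Finset.sum_congr rfl hterm, Finset.sum_ite_eq']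
      split_ifs with h1 h2
      · rfl
      · rfl
      · have h3 := ih1 d i
        rw [if_pos (by omega), vals_eq_zero h1] at h3
        exact h3
      · rfl
    · obtain ⟨v, hv⟩ := mem_keys.1 hk
      exact hmem k v hv

variable (A B ω) in
/-- What a reducer sends to a reducer of the multiplication if it is a home reducer. -/
noncomputable def homeSends (r i j s : ℕ) : Key → Multiset (Msg S)
  | .home d i' => values (homeStep p r (.home d i') (vals A B ω r (.home d i')))
      (.prod (width A B ω) i j s)
  | _ => 0

/-- The home reducers send the blocks of the next groups to the reducers that multiply them. -/
theorem sum_homeSends (hp : p.Valid) (hAB : NoCancellation A B) (hA : nnz A ≤ p.nt)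
    (hB : nnz B ≤ p.nt) (hF : (positions A B).Nonempty) {c : ℕ} (hc : c < steps A B ω)
    (i j s : ℕ) : ∑ k ∈ keysAt A B ω (p.estRound + 1 + c),
      homeSends A B ω (p.estRound + 1 + c) i j s k =
          if i < p.g ∧ j < p.g ∧ s < width A B ω ∧ c * width A B ω + s < p.g then
        blockEntries A B i j (c * width A B ω + s) else 0 := by
  have hterm : ∀ k, homeSends A B ω (p.estRound + 1 + c) i j s k =
      if i < p.g ∧ j < p.g ∧ s < width A B ω ∧ c * width A B ω + s < p.g then
        (values (inputs A B) k).filter (AtPlace p i j (c * width A B ω + s)) else 0 := by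
    intro k
    rcases k with ⟨d, i'⟩ | ⟨i', j, l⟩ | β | β | ⟨K, i, j, s⟩ | ⟨K, x, y, s⟩
    · change values _ _ = _
      rw [(multiplication_keys hp hAB hA hB hF c).1, if_pos hc.le, homeStep_mul hA hB, if_pos hc,
        values_add]
      refine (congrArg₂ (· + ·) ((values_map_const _ _ _ _).trans (if_neg (by simp))) ?_).trans
        (zero_add _)
      rw [values_copies (key := fun i j s => .prod (width A B ω) i j s) (by simp)]
      congr 1
      rw [homeVals, Multiset.filter_add]
      refine (congrArg₂ (· + ·) rfl ?_).trans (add_zero _)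
      split_ifs
      · rw [Multiset.filter_singleton, if_neg]
        · rfl
        · rintro ⟨h, -⟩
          simp [Msg.num] at h
      · rfl
    all_goals
      rw [values_inputs_eq_zero (by simp)]
      simp [homeSends]
  rw [Finset.sum_congr rfl fun k _ => hterm k]
  split_ifs
  · rw [blockEntries]
    refine sum_values_inputs (A := A) (B := B) (fun k hk => ?_) _
    obtain ⟨v, hv⟩ := mem_keys.1 hk
    obtain ⟨d, u, -, rfl, -⟩ := mem_inputs hv
    rw [mem_keys_iff] at hk ⊢
    have h1 := (multiplication_keys (A := A) (B := B) (ω := ω) hp hAB hA hB hF c).1 d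
      (progressiveIndex (side A B d) u.1 u.2)
    rw [if_pos hc.le, homeVals] at h1
    intro h2
    have h3 := h1.symm.trans h2
    rw [add_eq_zero] at h3
    exact hk h3.1
  · exact Finset.sum_const_zero

end

/-- A sum over keys that receives contributions only from a family of keys indexed by `s < K`. -/
theorem sum_eq_sum_range {κ X : Type*} [DecidableEq κ] [AddCommMonoid X] {T : Finset κ} {K : ℕ}
    {key : ℕ → κ} {f : κ → X} (hinj : Function.Injective key)
    (h1 : ∀ k ∈ T, (∀ s < K, k ≠ key s) → f k = 0) (h2 : ∀ s < K, key s ∉ T → f (key s) = 0) :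
    ∑ k ∈ T, f k = ∑ s ∈ Finset.range K, f (key s) := by
  rw [← Finset.sum_image (f := f) (s := Finset.range K) (g := key) hinj.injOn]
  have hz : ∀ U : Finset κ, U ⊆ T ∪ (Finset.range K).image key →
      (∀ k ∈ T ∪ (Finset.range K).image key, k ∉ U → f k = 0) →
      ∑ k ∈ U, f k = ∑ k ∈ T ∪ (Finset.range K).image key, f k :=
    fun U hU h => Finset.sum_subset hU h
  rw [hz T Finset.subset_union_left, ← hz _ Finset.subset_union_right]
  · intro k hk hk'
    refine h1 k ((Finset.mem_union.1 hk).resolve_right hk') fun s hs h => hk' ?_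
    exact Finset.mem_image.2 ⟨s, Finset.mem_range.2 hs, h.symm⟩
  · intro k hk hk'
    obtain ⟨s, hs, rfl⟩ := Finset.mem_image.1 ((Finset.mem_union.1 hk).resolve_left hk')
    exact h2 s (Finset.mem_range.1 hs) hk'

section

variable {S : Type u} [NonUnitalSemiring S] {p : Params}

theorem collapse_zero : collapse (0 : Multiset S) = 0 := rfl

theorem contributions_zero (x y : ℕ) : contributions (0 : Multiset (Msg S)) x y = 0 := rfl

/-- The multiplication in terms of `collapse`, entry by entry. -/
theorem prodStep_eq (r K i j s : ℕ) (V : Multiset (Msg S)) : prodStep p r K i j s V =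
    ∑ u ∈ Finset.range p.b ×ˢ Finset.range p.b,
      (collapse (contributions V (i * p.b + u.1) (j * p.b + u.2))).map fun a =>
        (if r - (p.estRound + 2) + 1 < p.mulPhases K then Key.prod K i j s
          else Key.cell K (i * p.b + u.1) (j * p.b + u.2) (s / p.m),
        Msg.part (i * p.b + u.1) (j * p.b + u.2) a) := by
  rw [prodStep, Multiset.bind, Multiset.join, Multiset.map_map]
  change _ = Multiset.sum (Multiset.map _ (Multiset.range p.b ×ˢ Multiset.range p.b))
  congr 1
  refine Multiset.map_congr rfl fun u _ => ?_
  simp only [Function.comp_apply]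
  by_cases h : (contributions V (i * p.b + u.1) (j * p.b + u.2)).card = 0
  · rw [if_pos h, collapse, if_pos h]
    rfl
  · rw [if_neg h, collapse, if_neg h]
    rfl

theorem parts_add (V V' : Multiset (Msg S)) (x y : ℕ) :
    parts (V + V') x y = parts V x y + parts V' x y := Multiset.filterMap_add _ _ _

theorem entries_add (c : Bool) (V V' : Multiset (Msg S)) :
    entries c (V + V') = entries c V + entries c V' := Multiset.filterMap_add _ _ _

theorem parts_map_part (Z : Multiset S) (x' y' x y : ℕ) :
    parts (Z.map (Msg.part x' y')) x y = if x' = x ∧ y' = y then Z else 0 := by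
  rw [parts, Multiset.filterMap_map]
  split_ifs with h
  · refine Eq.trans (congrArg (fun f => Multiset.filterMap f Z) (funext fun a => ?_))
      (Multiset.filterMap_some Z)
    simp [h]
  · refine Multiset.eq_zero_iff_forall_notMem.2 fun a ha => ?_
    obtain ⟨b, -, hb⟩ := (Multiset.mem_filterMap _ _).1 ha
    simp [h] at hb

theorem entries_map_part (c : Bool) (Z : Multiset S) (x' y' : ℕ) :
    entries c (Z.map (Msg.part x' y')) = 0 := by
  rw [entries, Multiset.filterMap_map]
  refine Multiset.eq_zero_iff_forall_notMem.2 fun a ha => ?_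
  obtain ⟨b, -, hb⟩ := (Multiset.mem_filterMap _ _).1 ha
  cases hb

theorem parts_sum_parts (i j : ℕ) (Z : ℕ → ℕ → Multiset S) {x y : ℕ} (hx : x / p.b = i)
    (hy : y / p.b = j) (hb : 0 < p.b) :
    parts (∑ u ∈ Finset.range p.b ×ˢ Finset.range p.b,
      (Z (i * p.b + u.1) (j * p.b + u.2)).map (Msg.part (i * p.b + u.1) (j * p.b + u.2))) x y =
    Z x y := by
  have h := map_sum ({ toFun := fun V : Multiset (Msg S) => parts V x y, map_zero' := rfl,
                       map_add' := fun V V' => parts_add V V' x y } :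
    Multiset (Msg S) →+ Multiset S) (fun u : ℕ × ℕ => (Z (i * p.b + u.1) (j * p.b + u.2)).map
      (Msg.part (i * p.b + u.1) (j * p.b + u.2))) (Finset.range p.b ×ˢ Finset.range p.b)
  refine h.trans ((Finset.sum_congr rfl fun u _ => parts_map_part _ _ _ x y).trans ?_)
  have hx' : i * p.b + x % p.b = x := by rw [← hx, mul_comm]; exact Nat.div_add_mod _ _
  have hy' : j * p.b + y % p.b = y := by rw [← hy, mul_comm]; exact Nat.div_add_mod _ _
  rw [Finset.sum_eq_single_of_mem (x % p.b, y % p.b)]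
  · simp only [hx', hy', and_self, if_true]
  · simp [Nat.mod_lt _ hb]
  · intro u _ hu
    refine if_neg fun h => hu (Prod.ext ?_ ?_)
    · change u.1 = x % p.b
      omega
    · change u.2 = y % p.b
      omega

theorem entries_sum_parts (c : Bool) (i j : ℕ) (Z : ℕ → ℕ → Multiset S) :
    entries c (∑ u ∈ Finset.range p.b ×ˢ Finset.range p.b,
      (Z (i * p.b + u.1) (j * p.b + u.2)).map (Msg.part (i * p.b + u.1) (j * p.b + u.2))) = 0 := by
  have h := map_sum ({ toFun := fun V : Multiset (Msg S) => entries c V, map_zero' := rfl,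
                       map_add' := fun V V' => entries_add c V V' } :
    Multiset (Msg S) →+ Multiset (ℕ × ℕ × S)) (fun u : ℕ × ℕ =>
        (Z (i * p.b + u.1) (j * p.b + u.2)).map
      (Msg.part (i * p.b + u.1) (j * p.b + u.2))) (Finset.range p.b ×ˢ Finset.range p.b)
  refine h.trans (Finset.sum_eq_zero fun u _ => ?_)
  exact entries_map_part _ _ _ _

variable {A B : Matrix (Fin p.q) (Fin p.q) S} {ω : Choices p}

theorem groupProducts_eq_zero (hp : p.Valid) {l x y : ℕ} (h : ¬ (x / p.b < p.g ∧ y / p.b < p.g)) :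
    groupProducts A B l x y = 0 := by
  rw [← Multiset.card_eq_zero]
  by_contra hne
  obtain ⟨x', _, y', rfl, rfl, -⟩ := exists_of_groupProducts hne
  exact h ⟨hp.div_lt x'.2, hp.div_lt y'.2⟩

theorem partialSum_eq_zero {K s : ℕ} (hs : K ≤ s) (c x y : ℕ) : partialSum A B K c s x y = 0 := by
  induction c with
  | zero => rfl
  | succ c ih =>
    rw [partialSum, ih, if_neg (by omega)]
    rfl

/-- What a multiplying reducer holds after one more round: the blocks of the next group, and the
sums that it has sent to itself. -/
theorem vals_prod_succ (hp : p.Valid) (hAB : NoCancellation A B) (hA : nnz A ≤ p.nt)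
    (hB : nnz B ≤ p.nt) (hF : (positions A B).Nonempty) {c : ℕ} (hc : c < steps A B ω)
    (i j s : ℕ) : vals A B ω (p.estRound + 1 + c + 1) (.prod (width A B ω) i j s) =
      (if i < p.g ∧ j < p.g ∧ s < width A B ω ∧ c * width A B ω + s < p.g then
        blockEntries A B i j (c * width A B ω + s) else 0) +
      ∑ u ∈ Finset.range p.b ×ˢ Finset.range p.b,
        (collapse (contributions (vals A B ω (p.estRound + 1 + c) (.prod (width A B ω) i j s))
          (i * p.b + u.1) (j * p.b + u.2))).map (Msg.part (i * p.b + u.1) (j * p.b + u.2)) := by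
  set X := ∑ u ∈ Finset.range p.b ×ˢ Finset.range p.b,
        (collapse (contributions (vals A B ω (p.estRound + 1 + c) (.prod (width A B ω) i j s))
          (i * p.b + u.1) (j * p.b + u.2))).map (Msg.part (i * p.b + u.1) (j * p.b + u.2)) with hX
  have hterm : ∀ k ∈ keysAt A B ω (p.estRound + 1 + c), values ((algorithm S ω).reduce
      (p.estRound + 1 + c) k (vals A B ω (p.estRound + 1 + c) k)).1 (.prod (width A B ω) i j s) =
      homeSends A B ω (p.estRound + 1 + c) i j s k +
        if k = .prod (width A B ω) i j s then X else 0 := by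
    intro k hk
    rcases (multiplication_keys hp hAB hA hB hF c).2 k hk with ⟨d, i', rfl, -⟩ |
      ⟨i', j', s', rfl, h1, -⟩ | ⟨x, y, s', rfl, h1⟩
    · rw [if_neg (by simp), add_zero]
      rfl
    · change values (prodStep p _ _ _ _ _ _) _ = 0 + _
      rw [zero_add, prodStep_eq, values_finset_sum]
      have h2 : p.estRound + 1 + c - (p.estRound + 2) + 1 < p.mulPhases (width A B ω) := by
        have h3 : c < p.mulPhases (width A B ω) := hc
        omega
      simp only [h2, if_true, values_map_const]
      split_ifs with h
      · rw [Key.prod.injEq] at h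
        obtain ⟨-, rfl, rfl, rfl⟩ := h
        rw [hX]
      · exact Finset.sum_const_zero
    · omega
  rw [vals_succ, Finset.sum_congr rfl hterm, Finset.sum_add_distrib,
    sum_homeSends hp hAB hA hB hF hc, Finset.sum_ite_eq']
  congr 1
  split_ifs with h
  · rfl
  · rw [hX, vals_eq_zero h]
    simp [contributions_zero, collapse_zero]

/-- The sum that a multiplying reducer forms for an entry of its submatrix is the partial sum. -/
theorem collapse_contributions (hp : p.Valid) (hAB : NoCancellation A B) (hA : nnz A ≤ p.nt)
    (hB : nnz B ≤ p.nt) (hF : (positions A B).Nonempty) {c : ℕ} (hc : c ≤ steps A B ω)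
    {i j s x y : ℕ} (hx : x / p.b = i) (hy : y / p.b = j) :
    collapse (contributions (vals A B ω (p.estRound + 1 + c) (.prod (width A B ω) i j s)) x y) =
      partialSum A B (width A B ω) c s x y := by
  induction c generalizing x y with
  | zero =>
    rw [add_zero, vals_after_eq_zero hp hAB (by simp)]
    rfl
  | succ c ih =>
    rw [← add_assoc, vals_prod_succ hp hAB hA hB hF hc, partialSum]
    congr 1
    set Z : ℕ → ℕ → Multiset S := fun x y => collapse (contributions
      (vals A B ω (p.estRound + 1 + c) (.prod (width A B ω) i j s)) x y) with hZ
    rw [contributions, parts_add, entries_add, entries_add, parts_sum_parts i j Z hx hy hp.b_pos,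
      entries_sum_parts true i j Z, entries_sum_parts false i j Z, add_zero, add_zero,
          ← ih (by omega) hx hy]
    have hE : ∀ E : Multiset (Msg S), parts E x y = 0 → (parts E x y + Z x y +
        ((entries true E ×ˢ entries false E).filter fun u =>
          u.1.1 = x ∧ u.2.2.1 = y ∧ u.1.2.1 = u.2.1).map fun u => u.1.2.2 * u.2.2.2) =
        Z x y + contributions E x y := by
      intro E hE
      rw [contributions, hE, zero_add, zero_add]
    rw [hE]
    swap
    · split_ifs
      · exact parts_blockEntries _ _ _ _ _
      · rfl
    congr 1
    by_cases hij : i < p.g ∧ j < p.g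
    · simp only [hij.1, hij.2, true_and]
      split_ifs
      · rw [groupProducts, hx, hy]
      · rfl
    · rw [if_neg (fun h => hij ⟨h.1, h.2.1⟩), groupProducts_eq_zero hp (by rwa [hx, hy]), ite_self]
      rfl

/-- The reducers of the multiplication hold the blocks of the current group and the partial sums. -/
theorem vals_prod (hp : p.Valid) (hAB : NoCancellation A B) (hA : nnz A ≤ p.nt)
    (hB : nnz B ≤ p.nt) (hF : (positions A B).Nonempty) {c : ℕ} (hc : c < steps A B ω)
    (i j s : ℕ) : vals A B ω (p.estRound + 1 + c + 1) (.prod (width A B ω) i j s) =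
      (if i < p.g ∧ j < p.g ∧ s < width A B ω ∧ c * width A B ω + s < p.g then
        blockEntries A B i j (c * width A B ω + s) else 0) +
      ∑ u ∈ Finset.range p.b ×ˢ Finset.range p.b,
        (partialSum A B (width A B ω) c s (i * p.b + u.1) (j * p.b + u.2)).map
          (Msg.part (i * p.b + u.1) (j * p.b + u.2)) := by
  rw [vals_prod_succ hp hAB hA hB hF hc]
  congr 1
  refine Finset.sum_congr rfl fun u hu => ?_
  rw [Finset.mem_product, Finset.mem_range, Finset.mem_range] at hu
  rw [collapse_contributions hp hAB hA hB hF hc.le]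
  · rw [mul_comm, Nat.mul_add_div hp.b_pos, Nat.div_eq_of_lt hu.1, add_zero]
  · rw [mul_comm, Nat.mul_add_div hp.b_pos, Nat.div_eq_of_lt hu.2, add_zero]

/-! ### The tree of partial sums -/

variable (A B ω)

/-- The sum for the entry `(x, y)` that node number `s` of level `l` of the tree receives or
computes. -/
noncomputable def nodeSum (x y : ℕ) : ℕ → ℕ → Multiset S
  | 0, s => partialSum A B (width A B ω) (steps A B ω) s x y
  | l + 1, s => collapse (∑ s' ∈ Finset.range (width A B ω), if s' / p.m = s then
      nodeSum x y l s' else 0)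

/-- The summands that node number `s` above level `l` of the tree receives. -/
noncomputable def summands (x y l s : ℕ) : Multiset S :=
  ∑ s' ∈ Finset.range (width A B ω), if s' / p.m = s then nodeSum A B ω x y l s' else 0

variable {A B ω}

theorem nodeSum_succ (x y l s : ℕ) :
    nodeSum A B ω x y (l + 1) s = collapse (summands A B ω x y l s) := rfl

theorem summands_eq_zero {x y l s : ℕ} (hs : width A B ω ≤ s) : summands A B ω x y l s = 0 := by
  refine Finset.sum_eq_zero fun s' hs' => if_neg fun h => ?_
  rw [Finset.mem_range] at hs'
  have := Nat.div_le_self s' p.m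
  omega

theorem steps_pos (hp : p.Valid) : 0 < steps A B ω :=
  hp.mulPhases_pos (Params.Valid.mulGroups_pos _)

theorem values_cell_prodStep {r K i j s : ℕ} {V : Multiset (Msg S)} (hb : 0 < p.b)
    (hr : ¬ r - (p.estRound + 2) + 1 < p.mulPhases K) (x y s' : ℕ) :
    values (prodStep p r K i j s V) (.cell K x y s') =
      if x / p.b = i ∧ y / p.b = j ∧ s / p.m = s' then
        (collapse (contributions V x y)).map (Msg.part x y) else 0 := by
  rw [prodStep_eq, values_finset_sum]
  simp only [hr, if_false, values_map_const, Key.cell.injEq, true_and]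
  split_ifs with h
  · obtain ⟨hx, hy, hs⟩ := h
    have hx' : i * p.b + x % p.b = x := by rw [← hx, mul_comm]; exact Nat.div_add_mod _ _
    have hy' : j * p.b + y % p.b = y := by rw [← hy, mul_comm]; exact Nat.div_add_mod _ _
    rw [Finset.sum_eq_single_of_mem (x % p.b, y % p.b)]
    · simp only [hx', hy', hs, and_self, if_true]
    · simp [Nat.mod_lt _ hb]
    · intro u _ hu
      refine if_neg fun h => hu (Prod.ext ?_ ?_)
      · change u.1 = x % p.b
        omega
      · change u.2 = y % p.b
        omega
  · refine Finset.sum_eq_zero fun u hu => if_neg fun h' => h ?_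
    rw [Finset.mem_product, Finset.mem_range, Finset.mem_range] at hu
    refine ⟨?_, ?_, h'.2.2⟩
    · rw [← h'.1, mul_comm, Nat.mul_add_div hb, Nat.div_eq_of_lt hu.1, add_zero]
    · rw [← h'.2.1, mul_comm, Nat.mul_add_div hb, Nat.div_eq_of_lt hu.2, add_zero]

/-- After the last group, the partial sums are at the leaves of the trees. -/
theorem vals_cell_zero (hp : p.Valid) (hAB : NoCancellation A B) (hA : nnz A ≤ p.nt)
    (hB : nnz B ≤ p.nt) (hF : (positions A B).Nonempty) (x y s' : ℕ) :
    vals A B ω (p.estRound + 1 + steps A B ω + 1) (.cell (width A B ω) x y s') =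
      (summands A B ω x y 0 s').map (Msg.part x y) := by
  have hst : 0 < steps A B ω := steps_pos hp
  have hr : ¬ p.estRound + 1 + steps A B ω - (p.estRound + 2) + 1 < p.mulPhases (width A B ω) := by
    have : steps A B ω = p.mulPhases (width A B ω) := rfl
    omega
  have hk := (multiplication_keys (ω := ω) hp hAB hA hB hF (steps A B ω)).2
  rw [vals_succ, summands, map_finset_sum]
  rw [sum_eq_sum_range (K := width A B ω)
    (key := fun s => Key.prod (width A B ω) (x / p.b) (y / p.b) s) (fun s s' h => by simpa using h)]
  · refine Finset.sum_congr rfl fun s _ => ?_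
    change values (prodStep p _ _ _ _ _ _) _ = _
    rw [values_cell_prodStep hp.b_pos hr, collapse_contributions hp hAB hA hB hF le_rfl rfl rfl]
    simp only [true_and]
    split_ifs
    · rfl
    · rfl
  · intro k hk' hne
    rcases hk k hk' with ⟨d, i', rfl, -⟩ | ⟨i', j', s, rfl, -⟩ | ⟨x', y', s, rfl, h1⟩
    · change values (homeStep p _ _ _) _ = _
      rw [(multiplication_keys hp hAB hA hB hF _).1, if_pos le_rfl, homeStep_mul hA hB,
        if_neg (lt_irrefl _)]
      rfl
    · change values (prodStep p _ _ _ _ _ _) _ = _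
      rw [values_cell_prodStep hp.b_pos hr]
      split_ifs with h
      · obtain ⟨rfl, rfl, -⟩ := h
        rw [collapse_contributions hp hAB hA hB hF le_rfl rfl rfl, partialSum_eq_zero]
        · rfl
        · by_contra h
          exact hne s (not_le.1 h) rfl
      · rfl
    · omega
  · intro s _ hs
    change values (prodStep p _ _ _ _ _ (vals A B ω _ _)) _ = _
    rw [vals_eq_zero hs, values_cell_prodStep hp.b_pos hr, contributions_zero, collapse_zero]
    split_ifs <;> rfl

/-- The content of the nodes of the trees, level by level. There is always a first level, even if
there is a single partial sum for each entry. -/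
theorem vals_cell (hp : p.Valid) (hAB : NoCancellation A B) (hA : nnz A ≤ p.nt)
    (hB : nnz B ≤ p.nt) (hF : (positions A B).Nonempty) {l : ℕ}
    (hl : l = 0 ∨ l < Nat.clog p.m (width A B ω)) (x y s : ℕ) :
    vals A B ω (p.estRound + 1 + (steps A B ω + 1 + l)) (.cell (width A B ω) x y s) =
      (summands A B ω x y l s).map (Msg.part x y) := by
  induction l generalizing s with
  | zero => exact vals_cell_zero hp hAB hA hB hF x y s
  | succ l ih =>
    have hl1 : l + 1 < Nat.clog p.m (width A B ω) := by omega
    have hr : p.estRound + 1 + (steps A B ω + 1 + l) -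
        (p.estRound + p.mulPhases (width A B ω) + 2) + 1 < Nat.clog p.m (width A B ω) := by
      have : steps A B ω = p.mulPhases (width A B ω) := rfl
      omega
    have hk := (multiplication_keys (ω := ω) hp hAB hA hB hF (steps A B ω + 1 + l)).2
    rw [show p.estRound + 1 + (steps A B ω + 1 + (l + 1)) =
      p.estRound + 1 + (steps A B ω + 1 + l) + 1 by ring, vals_succ]
    have hterm : ∀ k ∈ keysAt A B ω (p.estRound + 1 + (steps A B ω + 1 + l)),
        values ((algorithm S ω).reduce (p.estRound + 1 + (steps A B ω + 1 + l)) k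
          (vals A B ω (p.estRound + 1 + (steps A B ω + 1 + l)) k)).1
            (.cell (width A B ω) x y s) =
        (match k with
        | .cell _ x' y' s' => if x' = x ∧ y' = y ∧ s' / p.m = s then
            (nodeSum A B ω x y (l + 1) s').map (Msg.part x y) else 0
        | _ => 0) := by
      intro k hk'
      rcases hk k hk' with ⟨d, i', rfl, h1⟩ | ⟨i', j', s, rfl, -, h1⟩ | ⟨x', y', s', rfl, h1⟩
      · omega
      · omega
      · change values (cellStep p _ _ _ _ _ _).1 _ = _
        rw [cellStep, if_pos hr, values_singleton]
        have hne : vals A B ω (p.estRound + 1 + (steps A B ω + 1 + l))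
          (.cell (width A B ω) x' y' s') ≠ 0 := mem_keys_iff.1 hk'
        by_cases h : x' = x ∧ y' = y ∧ s' / p.m = s
        · obtain ⟨rfl, rfl, rfl⟩ := h
          have hV := ih (by omega) s'
          rw [hV] at hne
          rw [hV, parts_map_part, if_pos rfl, if_pos ⟨rfl, rfl⟩]
          simp only [and_self, if_true]
          rw [nodeSum_succ, collapse, if_neg]
          · rfl
          · rw [Multiset.card_eq_zero]
            exact fun h0 => hne (by rw [h0]; rfl)
        · rw [if_neg (by simpa using h)]
          simp only [h, if_false]
    rw [Finset.sum_congr rfl hterm, summands, map_finset_sum]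
    rw [sum_eq_sum_range (K := width A B ω)
      (key := fun s => Key.cell (width A B ω) x y s) (fun s s' h => by simpa using h)]
    · refine Finset.sum_congr rfl fun s' _ => ?_
      simp only [true_and]
      split_ifs
      · rfl
      · rfl
    · intro k hk' hne
      rcases hk k hk' with ⟨d, i', rfl, h1⟩ | ⟨i', j', s, rfl, -, h1⟩ | ⟨x', y', s', rfl, h1⟩
      · rfl
      · rfl
      · refine ite_eq_right_iff.2 ?_
        rintro ⟨rfl, rfl, -⟩
        rw [nodeSum_succ, summands_eq_zero]
        · rfl
        · by_contra h
          exact hne s' (not_le.1 h) rfl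
    · intro s' _ hs'
      refine ite_eq_right_iff.2 fun _ => ?_
      have hV := ih (by omega) s'
      rw [vals_eq_zero hs'] at hV
      rw [nodeSum_succ, Multiset.map_eq_zero.1 hV.symm]
      rfl

end

/-! ### Termination and output -/

section

variable {S : Type u} [NonUnitalSemiring S] {p : Params}
  {A B : Matrix (Fin p.q) (Fin p.q) S} {ω : Choices p}

variable (A B ω) in
theorem width_pos : 0 < width A B ω := Params.Valid.mulGroups_pos _

/-- All partial sums together amount to the products of the groups handled so far. -/
theorem sum_partialSum {K : ℕ} (c x y : ℕ) :
    ∑ s ∈ Finset.range K, (partialSum A B K c s x y).sum =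
      ∑ l ∈ Finset.range (c * K), if l < p.g then (groupProducts A B l x y).sum else 0 := by
  induction c with
  | zero => simp [partialSum]
  | succ c ih =>
    rw [Nat.succ_mul, Finset.sum_range_add, ← ih, ← Finset.sum_add_distrib]
    refine Finset.sum_congr rfl fun s hs => ?_
    rw [partialSum, collapse_sum, Multiset.sum_add]
    congr 1
    simp only [Finset.mem_range.1 hs, true_and]
    split_ifs <;> simp

theorem sum_summands (l : ℕ) (x y : Fin p.q) :
    ∑ s ∈ Finset.range (width A B ω), (summands A B ω x y l s).sum =
      ∑ s ∈ Finset.range (width A B ω), (nodeSum A B ω x y l s).sum := by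
  have h : ∀ s, (summands A B ω x y l s).sum = ∑ s' ∈ Finset.range (width A B ω),
      if s' / p.m = s then (nodeSum A B ω x y l s').sum else 0 := by
    intro s
    refine (map_sum Multiset.sumAddMonoidHom _ _).trans (Finset.sum_congr rfl fun s' _ => ?_)
    change Multiset.sum _ = _
    split_ifs <;> simp
  simp only [h]
  rw [Finset.sum_comm]
  refine Finset.sum_congr rfl fun s' hs' => ?_
  rw [Finset.sum_ite_eq, if_pos]
  rw [Finset.mem_range] at hs' ⊢
  exact (Nat.div_le_self _ _).trans_lt hs'

/-- Each level of the trees preserves the total, which is the entry of the product. -/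
theorem sum_nodeSum (hp : p.Valid) (l : ℕ) (x y : Fin p.q) :
    ∑ s ∈ Finset.range (width A B ω), (nodeSum A B ω x y l s).sum = (A * B) x y := by
  induction l with
  | zero =>
    have hle : p.g ≤ steps A B ω * width A B ω :=
      Params.Valid.g_le_mulPhases_mul (width_pos A B ω)
    refine (sum_partialSum _ _ _).trans ?_
    rw [← sum_groupProducts hp.b_pos hp.q_le]
    rw [← Finset.sum_subset (Finset.range_mono hle)]
    · exact Finset.sum_congr rfl fun l hl => if_pos (Finset.mem_range.1 hl)
    · exact fun l _ hl => if_neg fun h => hl (Finset.mem_range.2 h)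
  | succ l ih =>
    rw [← ih]
    refine (Finset.sum_congr rfl fun s _ => ?_).trans (sum_summands l x y)
    rw [nodeSum_succ, collapse_sum]

theorem exists_of_partialSum {K c s x y : ℕ} (h : partialSum A B K c s x y ≠ 0) :
    ∃ x' z y' : Fin p.q, x = x' ∧ y = y' ∧ A x' z ≠ 0 ∧ B z y' ≠ 0 := by
  induction c with
  | zero => exact absurd rfl h
  | succ c ih =>
    rw [partialSum, Ne, collapse_eq_zero, add_eq_zero, not_and_or] at h
    rcases h with h | h
    · exact ih h
    · split_ifs at h
      · exact exists_of_groupProducts (mt Multiset.card_eq_zero.1 h)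
      · exact absurd rfl h

theorem exists_nodeSum_ne_zero {l x y s : ℕ} (h : summands A B ω x y l s ≠ 0) :
    ∃ s' < width A B ω, s' / p.m = s ∧ nodeSum A B ω x y l s' ≠ 0 := by
  obtain ⟨s', hs', h⟩ := Finset.exists_ne_zero_of_sum_ne_zero h
  by_cases h1 : s' / p.m = s
  · rw [if_pos h1] at h
    exact ⟨s', Finset.mem_range.1 hs', h1, h⟩
  · exact absurd (if_neg h1) h

/-- A nonempty node lies within the tree, and there is a pair of nonzero entries behind it. So the
nonempty trees belong to nonzero entries of the product. -/
theorem exists_of_nodeSum {l s x y : ℕ} (h : nodeSum A B ω x y l s ≠ 0) :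
    s * p.m ^ l < width A B ω ∧
      ∃ x' z y' : Fin p.q, x = x' ∧ y = y' ∧ A x' z ≠ 0 ∧ B z y' ≠ 0 := by
  induction l generalizing s with
  | zero =>
    refine ⟨?_, exists_of_partialSum h⟩
    rw [pow_zero, mul_one]
    by_contra hs
    exact h (partialSum_eq_zero (not_lt.1 hs) _ _ _)
  | succ l ih =>
    rw [nodeSum_succ, Ne, collapse_eq_zero] at h
    obtain ⟨s', -, rfl, h'⟩ := exists_nodeSum_ne_zero h
    obtain ⟨h1, h2⟩ := ih h'
    refine ⟨lt_of_le_of_lt ?_ h1, h2⟩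
    rw [pow_succ', ← mul_assoc]
    exact Nat.mul_le_mul_right _ (Nat.div_mul_le_self _ _)

theorem exists_of_summands {l s x y : ℕ} (h : summands A B ω x y l s ≠ 0) :
    s * p.m ^ (l + 1) < width A B ω ∧
      ∃ x' z y' : Fin p.q, x = x' ∧ y = y' ∧ A x' z ≠ 0 ∧ B z y' ≠ 0 :=
  exists_of_nodeSum (l := l + 1) (by rwa [nodeSum_succ, Ne, collapse_eq_zero])

variable (A B ω) in
/-- The number of levels of the trees that add up the partial sums; there is always one. -/
noncomputable def depth : ℕ := max 1 (Nat.clog p.m (width A B ω))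

variable (A B ω) in
/-- The number of rounds after which the algorithm stops. If the product vanishes, no estimate
arrives and the entries are dropped in the round after the estimation. -/
noncomputable def rounds : ℕ :=
  if (positions A B).Nonempty then p.estRound + 1 + (steps A B ω + 1 + depth A B ω)
  else p.estRound + 2

theorem width_le_pow (hp : p.Valid) : width A B ω ≤ p.m ^ depth A B ω :=
  (Nat.le_pow_clog hp.two_le_m _).trans
    (Nat.pow_le_pow_right (by have := hp.two_le_m; omega) (le_max_right _ _))

theorem summands_root_sum (hp : p.Valid) (x y : Fin p.q) :
    (summands A B ω x y (depth A B ω - 1) 0).sum = (A * B) x y := by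
  rw [← sum_nodeSum (ω := ω) hp (depth A B ω - 1), ← sum_summands,
    Finset.sum_eq_single_of_mem 0 (Finset.mem_range.2 (width_pos A B ω))]
  intro s _ hs
  by_contra h
  have h0 : summands A B ω x y (depth A B ω - 1) s ≠ 0 := fun h0 => h (by rw [h0]; rfl)
  have h1 := (exists_of_summands h0).1
  rw [show depth A B ω - 1 + 1 = depth A B ω from
    Nat.sub_add_cancel (le_max_left _ _)] at h1
  have h2 := width_le_pow (A := A) (B := B) (ω := ω) hp
  have h3 := Nat.le_mul_of_pos_left (p.m ^ depth A B ω) (Nat.pos_of_ne_zero hs)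
  omega

/-- The roots of the trees in the last round. -/
theorem mem_keys_last_iff (hp : p.Valid) (hAB : NoCancellation A B) (hA : nnz A ≤ p.nt)
    (hB : nnz B ≤ p.nt) (hF : (positions A B).Nonempty) (k : Key) :
    k ∈ keysAt A B ω (p.estRound + 1 + (steps A B ω + 1 + (depth A B ω - 1))) ↔
      k ∈ (support (A * B)).image fun u => Key.cell (width A B ω) u.1 u.2 0 := by
  have hd : 1 ≤ depth A B ω := le_max_left _ _
  have hv := fun x y s => vals_cell (l := depth A B ω - 1) (ω := ω) hp hAB hA hB hF
    (by rw [depth]; omega) x y s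
  rw [Finset.mem_image]
  constructor
  · intro hk
    rcases (multiplication_keys hp hAB hA hB hF _).2 k hk with ⟨d, i, rfl, h⟩ |
      ⟨i, j, s, rfl, -, h⟩ | ⟨x, y, s, rfl, -⟩
    · omega
    · omega
    · rw [mem_keys_iff] at hk
      change vals A B ω _ _ ≠ 0 at hk
      rw [hv] at hk
      have hne : summands A B ω x y (depth A B ω - 1) s ≠ 0 := fun h => hk (by rw [h]; rfl)
      obtain ⟨h1, x', z, y', rfl, rfl, ha, hb⟩ := exists_of_summands hne
      rw [Nat.sub_add_cancel hd] at h1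
      refine ⟨(x', y'), mem_support.2 (hAB _ _ ⟨z, ha, hb⟩), ?_⟩
      rcases Nat.eq_zero_or_pos s with rfl | hs
      · rfl
      · have h2 := width_le_pow (A := A) (B := B) (ω := ω) hp
        have h3 := Nat.le_mul_of_pos_left (p.m ^ depth A B ω) hs
        omega
  · rintro ⟨⟨x, y⟩, hu, rfl⟩
    rw [mem_keys_iff]
    change vals A B ω _ _ ≠ 0
    rw [hv, Ne, Multiset.map_eq_zero]
    intro h
    refine mem_support.1 hu ?_
    rw [← summands_root_sum (ω := ω) hp, h]
    rfl

theorem roundOutput_estimation (hp : p.Valid) (hAB : NoCancellation A B) {r : ℕ}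
    (hr : r ≤ p.estRound) : (algorithm S ω).roundOutput (inputs A B) r = 0 := by
  refine Finset.sum_eq_zero fun k hk => ?_
  rcases k with ⟨c, i⟩ | ⟨i, j, l⟩ | β | β | ⟨K, i, j, s⟩ | ⟨K, x, y, s⟩
  any_goals rfl
  obtain ⟨v, hv⟩ := Multiset.exists_mem_of_ne_zero (mem_keys_iff.1 hk)
  exact (sound hp hAB r hr (.cell K x y s) v hv).elim

theorem roundOutput_multiplication (hp : p.Valid) (hAB : NoCancellation A B) (hA : nnz A ≤ p.nt)
    (hB : nnz B ≤ p.nt) (hF : (positions A B).Nonempty) {c : ℕ}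
    (hc : c < steps A B ω + 1 + (depth A B ω - 1)) :
    (algorithm S ω).roundOutput (inputs A B) (p.estRound + 1 + c) = 0 := by
  refine Finset.sum_eq_zero fun k hk => ?_
  rcases (multiplication_keys hp hAB hA hB hF _).2 k hk with ⟨d, i, rfl, h⟩ |
    ⟨i, j, s, rfl, -, h⟩ | ⟨x, y, s, rfl, h⟩
  · rfl
  · rfl
  · change (cellStep p _ _ _ _ _ _).2 = 0
    rw [cellStep, if_pos]
    have h1 : steps A B ω = p.mulPhases (width A B ω) := rfl
    have h2 : depth A B ω = max 1 (Nat.clog p.m (width A B ω)) := rfl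
    omega

theorem cellStep_last {V : Multiset (Msg S)} {x y s : ℕ} :
    cellStep p (p.estRound + 1 + (steps A B ω + 1 + (depth A B ω - 1))) (width A B ω) x y s V =
      (0, {(x, y, (parts V x y).sum)}) := by
  rw [cellStep, if_neg]
  have h1 : steps A B ω = p.mulPhases (width A B ω) := rfl
  have h2 : depth A B ω = max 1 (Nat.clog p.m (width A B ω)) := rfl
  omega

/-- In the last round, the roots of the trees output the nonzero entries of the product. -/
theorem roundOutput_last (hp : p.Valid) (hAB : NoCancellation A B) (hA : nnz A ≤ p.nt)
    (hB : nnz B ≤ p.nt) (hF : (positions A B).Nonempty) :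
    (algorithm S ω).roundOutput (inputs A B)
      (p.estRound + 1 + (steps A B ω + 1 + (depth A B ω - 1))) = outputItems (A * B) := by
  have hkeys : keysAt A B ω (p.estRound + 1 + (steps A B ω + 1 + (depth A B ω - 1))) =
      (support (A * B)).image fun u => Key.cell (width A B ω) u.1 u.2 0 :=
    Finset.ext (mem_keys_last_iff hp hAB hA hB hF)
  change ∑ k ∈ keysAt A B ω _, _ = _
  rw [hkeys, Finset.sum_image, outputItems, ← sum_singleton_eq_map]
  · refine Finset.sum_congr rfl fun u _ => ?_
    change (cellStep p _ _ _ _ _ (vals A B ω _ _)).2 = _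
    rw [cellStep_last, vals_cell hp hAB hA hB hF (by rw [depth]; omega), parts_map_part,
      if_pos ⟨rfl, rfl⟩, summands_root_sum hp]
  · intro u _ v _ h
    simp only [Key.cell.injEq, true_and, and_true] at h
    exact Prod.ext (Fin.ext h.1) (Fin.ext h.2)

theorem keys_after_of_empty (hp : p.Valid) (hAB : NoCancellation A B) {k : Key}
    (hk : k ∈ keysAt A B ω (p.estRound + 1)) : ∃ d i, k = .home d i := by
  by_contra h
  exact mem_keys_iff.1 hk (vals_after_eq_zero hp hAB fun d i h' => h ⟨d, i, h'⟩)

theorem state_rounds (hp : p.Valid) (hAB : NoCancellation A B) (hA : nnz A ≤ p.nt)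
    (hB : nnz B ≤ p.nt) : (algorithm S ω).state (inputs A B) (rounds A B ω) = 0 := by
  rw [rounds]
  split_ifs with hF
  · have hd : 1 ≤ depth A B ω := le_max_left _ _
    rw [show p.estRound + 1 + (steps A B ω + 1 + depth A B ω) =
      p.estRound + 1 + (steps A B ω + 1 + (depth A B ω - 1)) + 1 by omega]
    rw [state_succ]
    refine Finset.sum_eq_zero fun k hk => ?_
    obtain ⟨u, -, rfl⟩ := Finset.mem_image.1 ((mem_keys_last_iff hp hAB hA hB hF k).1 hk)
    change (cellStep p _ _ _ _ _ _).1 = 0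
    rw [cellStep_last]
  · rw [state_succ _ _ (p.estRound + 1)]
    refine Finset.sum_eq_zero fun k hk => ?_
    obtain ⟨d, i, rfl⟩ := keys_after_of_empty hp hAB hk
    change homeStep p _ _ (vals A B ω _ _) = 0
    rw [homeStep, if_neg (by omega), vals_home_after hp hAB, if_neg (fun h => hF h.1), add_zero]
    have : ests (values (inputs A B) (.home d i)) = 0 := by
      refine Multiset.eq_zero_iff_forall_notMem.2 fun e he => ?_
      obtain ⟨c', u, -, -, h⟩ := mem_inputs (mem_values.1 (mem_ests.1 he))
      cases h
    rw [this]
    rfl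

theorem output_rounds (hp : p.Valid) (hAB : NoCancellation A B) (hA : nnz A ≤ p.nt)
    (hB : nnz B ≤ p.nt) :
    (algorithm S ω).output (inputs A B) (rounds A B ω) = outputItems (A * B) := by
  change ∑ r ∈ Finset.range (rounds A B ω), (algorithm S ω).roundOutput (inputs A B) r = _
  rw [rounds]
  split_ifs with hF
  · have hd : 1 ≤ depth A B ω := le_max_left _ _
    rw [show p.estRound + 1 + (steps A B ω + 1 + depth A B ω) =
      p.estRound + 1 + (steps A B ω + 1 + (depth A B ω - 1)) + 1 by omega, Finset.sum_range_succ,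
      Finset.sum_eq_zero, zero_add, roundOutput_last hp hAB hA hB hF]
    intro r hr
    rw [Finset.mem_range] at hr
    rcases le_or_gt r p.estRound with h | h
    · exact roundOutput_estimation hp hAB h
    · obtain ⟨c, rfl⟩ := Nat.exists_eq_add_of_le (Nat.succ_le_of_lt h)
      exact roundOutput_multiplication hp hAB hA hB hF (by omega)
  · have h0 : support (A * B) = ∅ := by
      rw [← Finset.card_eq_zero]
      change nnz _ = 0
      rw [← card_positions, Finset.card_eq_zero]
      exact Finset.not_nonempty_iff_eq_empty.1 hF
    rw [outputItems, h0]
    refine Finset.sum_eq_zero fun r hr => ?_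
    rw [Finset.mem_range] at hr
    rcases le_or_gt r p.estRound with h | h
    · exact roundOutput_estimation hp hAB h
    · obtain rfl : r = p.estRound + 1 := by omega
      refine Finset.sum_eq_zero fun k hk => ?_
      obtain ⟨d, i, rfl⟩ := keys_after_of_empty hp hAB hk
      rfl

end

/-! ### Sizes during the estimation -/

/-- A sum over keys is bounded by the sum over a family of indices that covers all keys with a
nonzero summand. -/
theorem sum_le_sum_of_cover {κ ι : Type*} [DecidableEq κ] {T : Finset κ} {U : Finset ι} (e : ι → κ)
    (f : κ → ℕ) (h : ∀ k ∈ T, f k ≠ 0 → ∃ a ∈ U, e a = k) : ∑ k ∈ T, f k ≤ ∑ a ∈ U, f (e a) := by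
  calc ∑ k ∈ T, f k ≤ ∑ k ∈ T, ∑ a ∈ U, if e a = k then f k else 0 := by
        refine Finset.sum_le_sum fun k hk => ?_
        rcases Nat.eq_zero_or_pos (f k) with h0 | h0
        · rw [h0]
          exact Nat.zero_le _
        · obtain ⟨a, ha, rfl⟩ := h k hk h0.ne'
          refine le_trans ?_ (Finset.single_le_sum (fun _ _ => Nat.zero_le _) ha)
          rw [if_pos rfl]
    _ = ∑ a ∈ U, ∑ k ∈ T, if e a = k then f k else 0 := Finset.sum_comm
    _ ≤ ∑ a ∈ U, f (e a) := by
        refine Finset.sum_le_sum fun a _ => ?_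
        rw [Finset.sum_ite_eq]
        split_ifs
        · exact le_rfl
        · exact Nat.zero_le _

section

variable {S : Type u} [NonUnitalSemiring S] {p : Params}
  {A B : Matrix (Fin p.q) (Fin p.q) S} {ω : Choices p}

theorem card_entries_add_le (V : Multiset (Msg S)) :
    (entries true V).card + (entries false V).card ≤ V.card := by
  rw [← card_map_sum (entries true V), ← card_map_sum (entries false V), ← card_map_sum V,
    entries_sum, entries_sum, ← Multiset.sum_map_add]
  refine Multiset.sum_map_le_sum_map _ _ fun v _ => ?_
  simp only [flag, if_true, Bool.false_eq_true, if_false]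
  split_ifs <;> omega

theorem card_pairStep_le (r i j l : ℕ) (V : Multiset (Msg S)) :
    (pairStep ω r i j l V).card ≤ min p.H V.card := by
  have h := card_entries_add_le V
  rw [pairStep, Multiset.card_map]
  split_ifs with h1 h2
  · exact Nat.zero_le _
  · exact le_min (card_sketchOf_le _) ((card_sketchOf_le _).trans (h2.le.trans h))
  · rw [Multiset.card_add, Multiset.card_map, Multiset.card_map]
    exact le_min (not_lt.1 h2) h

theorem card_merge_le (V : Multiset (Msg S)) : (merge ω V).card ≤ p.H := card_sketchOf_le _

theorem card_values_le {κ ν : Type*} [DecidableEq κ] (W : Multiset (κ × ν)) (k : κ) :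
    (values W k).card ≤ W.card := by
  rw [values, Multiset.card_map]
  exact Multiset.card_le_card (Multiset.filter_le _ _)

theorem card_vals_pair_le (hp : p.Valid) (hAB : NoCancellation A B) {r : ℕ} (hr : r ≤ p.estRound)
    (i j l : ℕ) : (vals A B ω r (.pair i j l)).card ≤ (blockEntries A B i j l).card := by
  by_cases h : vals A B ω r (.pair i j l) = 0
  · rw [h]
    exact Nat.zero_le _
  · obtain ⟨v, hv⟩ := Multiset.exists_mem_of_ne_zero h
    obtain ⟨rfl, hi, hj, hl, -⟩ := sound hp hAB r hr (.pair i j l) v hv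
    have h1 : l / p.estGroups * p.estGroups + l % p.estGroups = l := Nat.div_add_mod' _ _
    have h2 := vals_pair (A := A) (B := B) (ω := ω) (hp.div_estGroups_lt hl) hi hj
      (Nat.mod_lt l Params.Valid.estGroups_pos) (by rwa [h1])
    rw [h1] at h2
    rw [h2]

variable (A B) in
/-- A bound for the size of the sketch or pseudosketch of a pair of submatrices. -/
noncomputable def pairSize (u : Fin p.g × Fin p.g × Fin p.g) : ℕ :=
  min p.H (blockEntries A B u.1 u.2.1 u.2.2).card

variable (A B ω) in
/-- The number of words that a reducer sends to the reducer `β` that collects sketches. -/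
noncomputable def binSends (r β : ℕ) (k : Key) : ℕ :=
  (values ((algorithm S ω).reduce r k (vals A B ω r k)).1 (.bin β)).card

/-- A reducer that collects sketches receives at most its load. -/
theorem card_vals_bin_le (hp : p.Valid) (hAB : NoCancellation A B) {r : ℕ}
    (hr : r + 1 ≤ p.estRound) (β : Fin p.bins) :
    (vals A B ω (r + 1) (.bin β)).card ≤ load ω (pairSize A B) r β := by
  set e : (Fin p.g × Fin p.g × Fin p.g) ⊕ Fin p.bins → Key :=
    Sum.elim (fun u => .pair u.1 u.2.1 u.2.2) fun v => .bin v
  have hcover : ∀ k ∈ keysAt A B ω r, binSends A B ω r β k ≠ 0 → ∃ a ∈ Finset.univ, e a = k := by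
    intro k hk hne
    obtain ⟨v, hv⟩ := Multiset.exists_mem_of_ne_zero (mt Multiset.card_eq_zero.2 hne)
    have hv := mem_values.1 hv
    obtain ⟨v₀, hv₀⟩ := Multiset.exists_mem_of_ne_zero (mem_keys_iff.1 hk)
    have hs := sound hp hAB r (by omega) k v₀ hv₀
    rcases k with ⟨c, i⟩ | ⟨i, j, l⟩ | β' | β' | ⟨K, i, j, s⟩ | ⟨K, x, y, s⟩
    · rcases mem_homeStep (by omega) hv with ⟨h, -⟩ | ⟨_, _, _, h, -⟩ <;> cases h
    · exact ⟨Sum.inl (⟨i, hs.2.1⟩, ⟨j, hs.2.2.1⟩, ⟨l, hs.2.2.2.1⟩), Finset.mem_univ _, rfl⟩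
    · exact ⟨Sum.inr ⟨β', hs.2.2.1⟩, Finset.mem_univ _, rfl⟩
    · change _ ∈ nodeStep ω r β' _ at hv
      rw [nodeStep, if_pos (by omega)] at hv
      obtain ⟨_, -, h⟩ := Multiset.mem_map.1 hv
      cases (Prod.ext_iff.1 h).1
    · exact hs.elim
    · exact hs.elim
  rw [vals_succ, Multiset.card_sum]
  refine (sum_le_sum_of_cover e (binSends A B ω r β) hcover).trans ?_
  rw [Fintype.sum_sum_type, load]
  refine Nat.add_le_add (Finset.sum_le_sum fun u _ => ?_) ?_
  · change (values (pairStep ω r u.1 u.2.1 u.2.2 (vals A B ω r (.pair u.1 u.2.1 u.2.2))) _).card ≤ _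
    by_cases h : vals A B ω r (.pair u.1 u.2.1 u.2.2) = 0
    · rw [h]
      exact Nat.zero_le _
    · obtain ⟨v, hv⟩ := Multiset.exists_mem_of_ne_zero h
      have h1 := (sound hp hAB r (by omega) (.pair u.1 u.2.1 u.2.2) v hv).1
      have h2 : coin ω r (.pair u.1 u.2.1 u.2.2) = ω.2.1 u := by
        rw [coin, dif_pos ⟨u.1.2, u.2.1.2, u.2.2.2⟩]
      rw [if_pos h1]
      split_ifs with h3
      · refine (card_values_le _ _).trans ((card_pairStep_le _ _ _ _ _).trans ?_)
        exact min_le_min_left _ (card_vals_pair_le hp hAB (by omega) _ _ _)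
      · rw [values_eq_zero_of_forall]
        · exact Nat.zero_le _
        · intro v hv
          have h4 := (mem_pairStep hv).1
          rw [h2, Key.bin.injEq] at h4
          exact h3 (Fin.ext h4.symm)
  · by_cases hph : r ≤ p.phases
    · have h1 : ∀ v : Fin p.bins, binSends A B ω r β (.bin v) ≤
          if ω.2.2 (⟨r, by omega⟩, v) = β then p.H else 0 := by
        intro v
        change (values (binStep ω r v _) _).card ≤ _
        have h2 : coin ω r (.bin v) = ω.2.2 (⟨r, by omega⟩, v) := by
          rw [coin, dif_pos ⟨by omega, v.2⟩]
        rw [binStep, values_map_const, if_pos hph, h2]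
        split_ifs with h3 h4 h4
        · rw [Multiset.map_id']
          exact card_merge_le _
        · exact absurd (Fin.ext (Key.bin.inj h3)) h4
        · exact Nat.zero_le _
        · exact le_rfl
      refine (Finset.sum_le_sum fun v _ => h1 v).trans ?_
      rw [Fintype.sum_prod_type]
      refine le_trans (Finset.sum_le_sum fun v _ => ?_) (Finset.single_le_sum
        (f := fun x : Fin (p.phases + 1) => ∑ y, if ω.2.2 (x, y) = β then
          (if (x : ℕ) = r then p.H else 0) else 0) (fun _ _ => Nat.zero_le _)
        (Finset.mem_univ (⟨r, by omega⟩ : Fin (p.phases + 1))))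
      simp
    · refine le_trans (le_of_eq (Finset.sum_eq_zero fun v _ => ?_)) (Nat.zero_le _)
      change (values (binStep ω r v _) _).card = 0
      rw [binStep, values_map_const, if_neg hph, if_neg (by simp)]
      rfl

/-- A node of the tree receives at most `fan` sketches. -/
theorem card_vals_node_le (hp : p.Valid) (hAB : NoCancellation A B) {r : ℕ}
    (hr : r ≤ p.estRound) (β : ℕ) : (vals A B ω r (.node β)).card ≤ p.fan * p.H := by
  rcases r with _ | r
  · rw [vals, show values ((algorithm S ω).state (inputs A B) 0) (.node β) =
      values (inputs A B) (.node β) from rfl, values_inputs_eq_zero (by simp)]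
    exact Nat.zero_le _
  set e : ℕ → Key := fun β' => if r ≤ p.phases + 1 then .bin β' else .node β' with he
  set f : Key → ℕ := fun k => (values ((algorithm S ω).reduce r k (vals A B ω r k)).1
    (.node β)).card with hf
  have hcover : ∀ k ∈ keysAt A B ω r, f k ≠ 0 →
      ∃ a ∈ Finset.Ico (β * p.fan) (β * p.fan + p.fan), e a = k := by
    intro k hk hne
    have hfan : 0 < p.fan := by have := Params.Valid.two_le_fan (p := p); omega
    have hdiv : ∀ β' v, β' / p.fan = v → β' ∈ Finset.Ico (v * p.fan) (v * p.fan + p.fan) := by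
      rintro β' _ rfl
      have h1 := Nat.div_add_mod' β' p.fan
      have h2 := Nat.mod_lt β' hfan
      rw [Finset.mem_Ico]
      omega
    obtain ⟨v, hv⟩ := Multiset.exists_mem_of_ne_zero (mt Multiset.card_eq_zero.2 hne)
    have hv := mem_values.1 hv
    obtain ⟨v₀, hv₀⟩ := Multiset.exists_mem_of_ne_zero (mem_keys_iff.1 hk)
    have hs := sound hp hAB r (by omega) k v₀ hv₀
    rcases k with ⟨c, i⟩ | ⟨i, j, l⟩ | β' | β' | ⟨K, i, j, s⟩ | ⟨K, x, y, s⟩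
    · rcases mem_homeStep (by omega) hv with ⟨h, -⟩ | ⟨_, _, _, h, -⟩ <;> cases h
    · cases (mem_pairStep hv).1
    · obtain ⟨_, -, h⟩ := Multiset.mem_map.1 hv
      have h := (Prod.ext_iff.1 h).1
      simp only at h
      split_ifs at h with h1
      · refine ⟨β', hdiv _ _ (Key.node.inj h), ?_⟩
        rw [he]
        exact if_pos hs.2.1
    · change _ ∈ nodeStep ω r β' _ at hv
      rw [nodeStep, if_pos (by omega)] at hv
      obtain ⟨_, -, h⟩ := Multiset.mem_map.1 hv
      refine ⟨β', hdiv _ _ (Key.node.inj (Prod.ext_iff.1 h).1), ?_⟩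
      have h1 : p.phases + 2 ≤ r := hs.1
      rw [he]
      exact if_neg (by omega)
    · exact hs.elim
    · exact hs.elim
  rw [vals_succ, Multiset.card_sum]
  refine (sum_le_sum_of_cover e f hcover).trans ((Finset.sum_le_card_nsmul _ _ p.H
    fun a _ => ?_).trans
    (by simp))
  refine (card_values_le _ _).trans ?_
  rw [he]
  split_ifs
  · change (binStep ω r a _).card ≤ _
    rw [binStep, Multiset.card_map]
    exact card_merge_le _
  · change (nodeStep ω r a _).card ≤ _
    rw [nodeStep, if_pos (by omega), Multiset.card_map]
    exact card_merge_le _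

theorem card_filter_div_add_one_le (ρ : ℕ) :
    ((Finset.range p.g).filter fun l => l / p.estGroups + 1 = ρ).card ≤ p.estGroups := by
  have h : ((Finset.range p.g).filter fun l => l / p.estGroups + 1 = ρ) ⊆
      Finset.Ico ((ρ - 1) * p.estGroups) ((ρ - 1) * p.estGroups + p.estGroups) := by
    intro l hl
    obtain rfl := (Finset.mem_filter.1 hl).2
    have h1 := Nat.div_add_mod' l p.estGroups
    have h2 := Nat.mod_lt l (Params.Valid.estGroups_pos (p := p))
    rw [Finset.mem_Ico, Nat.add_sub_cancel]
    omega
  simpa using Finset.card_le_card h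

/-- Every entry is used at most once in a group, so a group is no larger than the input. -/
theorem sum_card_blockEntries_le (l : ℕ) :
    ∑ i ∈ Finset.range p.g, ∑ j ∈ Finset.range p.g, (blockEntries A B i j l).card ≤
      nnz A + nnz B := by
  rw [← card_allEntries]
  exact sum_card_filter_atPlace_le _ _

/-- The total size of the pairs of submatrices of a phase. -/
theorem sum_blocks_le (hp : p.Valid) (hA : nnz A ≤ p.nt) (hB : nnz B ≤ p.nt) (ρ : ℕ) :
    ∑ u : Fin p.g × Fin p.g × Fin p.g, (if (u.2.2 : ℕ) / p.estGroups + 1 = ρ then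
      (blockEntries A B u.1 u.2.1 u.2.2).card else 0) ≤ 2 * p.mem := by
  have h1 : ∑ u : Fin p.g × Fin p.g × Fin p.g, (if (u.2.2 : ℕ) / p.estGroups + 1 = ρ then
      (blockEntries A B u.1 u.2.1 u.2.2).card else 0) =
      ∑ l ∈ (Finset.range p.g).filter fun l => l / p.estGroups + 1 = ρ,
        ∑ i ∈ Finset.range p.g, ∑ j ∈ Finset.range p.g, (blockEntries A B i j l).card := by
    rw [Finset.sum_filter, Finset.sum_range, Fintype.sum_prod_type]
    simp only [Fintype.sum_prod_type]
    rw [Finset.sum_congr rfl fun i _ => Finset.sum_comm, Finset.sum_comm]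
    refine Finset.sum_congr rfl fun l _ => ?_
    split_ifs with h
    · simp only [Finset.sum_range]
    · simp
  rw [h1]
  refine (Finset.sum_le_card_nsmul _ _ (2 * p.nt) fun l _ =>
    (sum_card_blockEntries_le l).trans (by omega)).trans ?_
  have h2 := card_filter_div_add_one_le (p := p) ρ
  have h3 := hp.nt_mul_estGroups_le
  rw [smul_eq_mul]
  nlinarith

theorem sum_pairSize_le (hp : p.Valid) (hA : nnz A ≤ p.nt) (hB : nnz B ≤ p.nt) (ρ : ℕ) :
    ∑ u, (if (u.2.2 : ℕ) / p.estGroups + 1 = ρ then pairSize A B u else 0) ≤ 2 * p.mem := by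
  refine le_trans (Finset.sum_le_sum fun u _ => ?_) (sum_blocks_le hp hA hB ρ)
  split_ifs
  · exact min_le_right _ _
  · exact le_rfl

theorem sum_load_le (hp : p.Valid) (hA : nnz A ≤ p.nt) (hB : nnz B ≤ p.nt) (ρ : ℕ) :
    ∑ β, load ω (pairSize A B) ρ β ≤ 2 * p.mem + p.bins * p.H := by
  simp only [load, Finset.sum_add_distrib]
  refine Nat.add_le_add ?_ ?_ <;> rw [Finset.sum_comm] <;>
    simp only [Finset.sum_ite_eq, Finset.mem_univ, if_true]
  · exact sum_pairSize_le hp hA hB ρ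
  rw [Fintype.sum_prod_type, Finset.sum_comm]
  refine (Finset.sum_le_card_nsmul _ _ p.H fun y _ => ?_).trans (by simp)
  rw [← Finset.sum_filter, Finset.sum_const, smul_eq_mul]
  have : (Finset.univ.filter fun i : Fin (p.phases + 1) => (i : ℕ) = ρ).card ≤ 1 :=
    Finset.card_le_one.2 fun i hi j hj => Fin.ext (by simp_all)
  exact (Nat.mul_le_mul_right _ this).trans (by simp)

/-- The total number of values in a round of the estimation, which does not depend on luck: the
entries, the pairs of submatrices of a phase, and the sketches of the random reducers or of the
tree. -/
theorem sum_card_estimation_le (hp : p.Valid) (hAB : NoCancellation A B) (hA : nnz A ≤ p.nt)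
    (hB : nnz B ≤ p.nt) {r : ℕ} (hr : r ≤ p.estRound) :
    ∑ k ∈ keysAt A B ω r, (vals A B ω r k).card ≤
      2 * p.nt + 4 * p.mem + 2 * (p.bins * p.H) + p.fan * p.H := by
  set E : (Bool × Fin p.nt) ⊕ (Fin p.g × Fin p.g × Fin p.g) ⊕ Fin p.bins ⊕
      Fin ((p.bins - 1) / p.fan + 1) → Key :=
    Sum.elim (fun u => .home u.1 u.2) (Sum.elim (fun u => .pair u.1 u.2.1 u.2.2)
      (Sum.elim (fun u => .bin u) fun u => .node u)) with hE
  have hcover : ∀ k ∈ keysAt A B ω r, (vals A B ω r k).card ≠ 0 →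
      ∃ a ∈ Finset.univ, E a = k := by
    intro k hk _
    obtain ⟨v₀, hv₀⟩ := Multiset.exists_mem_of_ne_zero (mem_keys_iff.1 hk)
    have hs := sound hp hAB r hr k v₀ hv₀
    rcases k with ⟨c, i⟩ | ⟨i, j, l⟩ | β' | β' | ⟨K, i, j, s⟩ | ⟨K, x, y, s⟩
    · have hi : i < p.nt := by
        obtain ⟨d, u, hu, h, -⟩ := mem_inputs hs
        rw [Key.home.injEq] at h
        obtain ⟨rfl, rfl⟩ := h
        refine (progressiveIndex_lt hu).trans_le ?_
        cases c
        · exact hB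
        · exact hA
      exact ⟨Sum.inl (c, ⟨i, hi⟩), Finset.mem_univ _, rfl⟩
    · exact ⟨Sum.inr (Sum.inl (⟨i, hs.2.1⟩, ⟨j, hs.2.2.1⟩, ⟨l, hs.2.2.2.1⟩)), Finset.mem_univ _,
          rfl⟩
    · exact ⟨Sum.inr (Sum.inr (Sum.inl ⟨β', hs.2.2.1⟩)), Finset.mem_univ _, rfl⟩
    · have h1 : β' ≤ (p.bins - 1) / p.fan := by
        refine hs.2.2.1.trans (Nat.div_le_div_left ?_
            (by have := Params.Valid.two_le_fan (p := p); omega))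
        refine Nat.le_self_pow ?_ _
        have := hs.1
        omega
      exact ⟨Sum.inr (Sum.inr (Sum.inr ⟨β', by omega⟩)), Finset.mem_univ _, rfl⟩
    · exact hs.elim
    · exact hs.elim
  refine (sum_le_sum_of_cover E _ hcover).trans ?_
  rw [Fintype.sum_sum_type, Fintype.sum_sum_type, Fintype.sum_sum_type]
  have hhome : ∑ a, (vals A B ω r (E (Sum.inl a))).card ≤ 2 * p.nt := by
    refine (Finset.sum_le_card_nsmul _ _ 1 fun u _ => ?_).trans (by simp)
    change (vals A B ω r (.home _ _)).card ≤ 1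
    rw [vals_home hr]
    exact card_values_inputs_le _
  have hpair : ∑ a, (vals A B ω r (E (Sum.inr (Sum.inl a)))).card ≤ 2 * p.mem := by
    refine le_trans (Finset.sum_le_sum fun u _ => ?_) (sum_blocks_le hp hA hB r)
    split_ifs with h
    · exact card_vals_pair_le hp hAB hr _ _ _
    · rw [Nat.le_zero, Multiset.card_eq_zero]
      by_contra hne
      obtain ⟨v, hv⟩ := Multiset.exists_mem_of_ne_zero hne
      exact h (sound hp hAB r hr (.pair u.1 u.2.1 u.2.2) v hv).1
  have hbin : ∑ a, (vals A B ω r (E (Sum.inr (Sum.inr (Sum.inl a))))).card ≤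
      2 * p.mem + p.bins * p.H := by
    rcases r with _ | r
    · refine le_trans (le_of_eq (Finset.sum_eq_zero fun u _ => ?_)) (Nat.zero_le _)
      rw [Multiset.card_eq_zero]
      exact values_inputs_eq_zero (by simp [hE])
    · exact (Finset.sum_le_sum fun u _ => card_vals_bin_le hp hAB hr u).trans
        (sum_load_le hp hA hB r)
  have hnode : ∑ a, (vals A B ω r (E (Sum.inr (Sum.inr (Sum.inr a))))).card ≤
      p.bins * p.H + p.fan * p.H := by
    have h : ∀ u ∈ Finset.univ, (vals A B ω r (E (Sum.inr (Sum.inr (Sum.inr u))))).card ≤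
        p.fan * p.H := fun u _ => card_vals_node_le hp hAB hr u
    refine (Finset.sum_le_card_nsmul _ _ _ h).trans ?_
    rw [Finset.card_univ, Fintype.card_fin, smul_eq_mul, ← mul_assoc, ← add_mul]
    refine Nat.mul_le_mul_right _ ?_
    have := Nat.div_mul_le_self (p.bins - 1) p.fan
    rw [add_mul]
    omega
  omega

end

/-! ### Sizes during the multiplication -/

section

variable {S : Type u} [NonUnitalSemiring S] {p : Params}
  {A B : Matrix (Fin p.q) (Fin p.q) S} {ω : Choices p}

theorem card_partialSum_le (K c s x y : ℕ) : (partialSum A B K c s x y).card ≤ 1 := by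
  cases c with
  | zero => exact Nat.zero_le _
  | succ c => exact card_collapse_le _

theorem card_nodeSum_le (x y l s : ℕ) : (nodeSum A B ω x y l s).card ≤ 1 := by
  cases l with
  | zero => exact card_partialSum_le _ _ _ _ _
  | succ c => exact card_collapse_le _

theorem card_summands_le_sum (x y l s : ℕ) : (summands A B ω x y l s).card ≤
    ∑ s' ∈ Finset.range (width A B ω), if s' / p.m = s then 1 else 0 := by
  rw [summands, Multiset.card_sum]
  refine Finset.sum_le_sum fun s' _ => ?_
  split_ifs
  · exact card_nodeSum_le _ _ _ _
  · exact le_rfl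

/-- A node of a tree has at most `m` children. -/
theorem card_summands_le (hp : p.Valid) (x y l s : ℕ) :
    (summands A B ω x y l s).card ≤ p.m := by
  refine (card_summands_le_sum _ _ _ _).trans ?_
  rw [← Finset.card_filter]
  have hm : 0 < p.m := by have := hp.two_le_m; omega
  have h : ((Finset.range (width A B ω)).filter fun s' => s' / p.m = s) ⊆
      Finset.Ico (s * p.m) (s * p.m + p.m) := by
    intro l hl
    obtain rfl := (Finset.mem_filter.1 hl).2
    have h1 := Nat.div_add_mod' l p.m
    have h2 := Nat.mod_lt l hm
    rw [Finset.mem_Ico]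
    omega
  simpa using Finset.card_le_card h

theorem sum_card_summands_le (x y l : ℕ) :
    ∑ s : Fin (width A B ω), (summands A B ω x y l s).card ≤ width A B ω := by
  have h : ∀ s ∈ (Finset.univ : Finset (Fin (width A B ω))), (summands A B ω x y l s).card ≤
      ∑ s' ∈ Finset.range (width A B ω), if s' / p.m = s then 1 else 0 :=
    fun s _ => card_summands_le_sum x y l s
  refine (Finset.sum_le_sum h).trans ?_
  rw [Finset.sum_comm]
  refine (Finset.sum_le_card_nsmul _ _ 1 fun s' _ => ?_).trans (by simp)
  rw [← Finset.card_filter]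
  exact Finset.card_le_one.2 fun i hi j hj => Fin.ext (by simp_all)

theorem card_homeVals_le (c : Bool) (i : ℕ) : (homeVals A B ω c i).card ≤ 2 := by
  rw [homeVals, Multiset.card_add]
  have h : (if i < p.nt then {Msg.est (est A B ω)} else 0 : Multiset (Msg S)).card ≤ 1 := by
    split_ifs <;> simp
  exact Nat.add_le_add (card_values_inputs_le _) h

theorem card_vals_prod_le (hp : p.Valid) (hAB : NoCancellation A B) (hA : nnz A ≤ p.nt)
    (hB : nnz B ≤ p.nt) (hF : (positions A B).Nonempty) (c i j s : ℕ) :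
    (vals A B ω (p.estRound + 1 + c) (.prod (width A B ω) i j s)).card ≤
      (blockEntries A B i j ((c - 1) * width A B ω + s)).card +
      ∑ u ∈ Finset.range p.b ×ˢ Finset.range p.b,
        (partialSum A B (width A B ω) (c - 1) s (i * p.b + u.1) (j * p.b + u.2)).card := by
  by_cases h : vals A B ω (p.estRound + 1 + c) (.prod (width A B ω) i j s) = 0
  · rw [h]
    exact Nat.zero_le _
  · rcases (multiplication_keys hp hAB hA hB hF c).2 _ (mem_keys_iff.2 h) with ⟨d, i, h, -⟩ |
      ⟨i, j, s, -, hc, hc'⟩ | ⟨x, y, s, h, -⟩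
    · cases h
    · obtain ⟨c, rfl⟩ := Nat.exists_eq_add_of_le' hc
      rw [← add_assoc, vals_prod hp hAB hA hB hF hc', Multiset.card_add, Multiset.card_sum]
      simp only [Multiset.card_map, Nat.add_sub_cancel]
      refine Nat.add_le_add_right ?_ _
      split_ifs
      · exact le_rfl
      · exact Nat.zero_le _
    · cases h

/-- The content of the trees that add up partial sums, in all rounds. -/
theorem exists_vals_cell_eq (hp : p.Valid) (hAB : NoCancellation A B) (hA : nnz A ≤ p.nt)
    (hB : nnz B ≤ p.nt) (hF : (positions A B).Nonempty) {c : ℕ}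
    (hc : c < steps A B ω + 1 + depth A B ω) : ∃ l, ∀ x y s,
      vals A B ω (p.estRound + 1 + c) (.cell (width A B ω) x y s) ≠ 0 →
        vals A B ω (p.estRound + 1 + c) (.cell (width A B ω) x y s) =
          (summands A B ω x y l s).map (Msg.part x y) := by
  refine ⟨c - (steps A B ω + 1), fun x y s h => ?_⟩
  rcases (multiplication_keys hp hAB hA hB hF c).2 _ (mem_keys_iff.2 h) with ⟨d, i, h, -⟩ |
      ⟨i, j, s, h, -⟩ | ⟨_, _, _, -, h1⟩
  · cases h
  · cases h
  · have h2 := vals_cell (ω := ω) (l := c - (steps A B ω + 1)) hp hAB hA hB hF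
      (by rw [depth] at hc; omega) x y s
    rwa [show steps A B ω + 1 + (c - (steps A B ω + 1)) = c by omega] at h2

/-- The number of values of a single reducer in the multiplication. A product involves two
submatrices of at most `b² ≤ m` entries each and `b²` partial sums. -/
theorem card_multiplication_le (hp : p.Valid) (hAB : NoCancellation A B) (hA : nnz A ≤ p.nt)
    (hB : nnz B ≤ p.nt) (hF : (positions A B).Nonempty) {c : ℕ}
    (hc : c < steps A B ω + 1 + depth A B ω) {k : Key}
    (hk : k ∈ keysAt A B ω (p.estRound + 1 + c)) :
    (vals A B ω (p.estRound + 1 + c) k).card ≤ 3 * p.m := by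
  have hm := hp.two_le_m
  have hbm : p.b ^ 2 ≤ p.m := Nat.sqrt_le' _
  rcases (multiplication_keys hp hAB hA hB hF c).2 k hk with ⟨d, i, rfl, h⟩ |
      ⟨i, j, s, rfl, -⟩ | ⟨x, y, s, rfl, -⟩
  · rw [(multiplication_keys hp hAB hA hB hF c).1, if_pos h]
    exact (card_homeVals_le _ _).trans (by omega)
  · refine (card_vals_prod_le hp hAB hA hB hF _ _ _ _).trans ?_
    have h1 := card_blockEntries_le (A := A) (B := B) hp.b_pos i j ((c - 1) * width A B ω + s)
    have h2 : ∑ u ∈ Finset.range p.b ×ˢ Finset.range p.b,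
        (partialSum A B (width A B ω) (c - 1) s (i * p.b + u.1) (j * p.b + u.2)).card ≤ p.b ^ 2 :=
      (Finset.sum_le_card_nsmul _ _ 1 fun u _ => card_partialSum_le _ _ _ _ _).trans
        (by simp [sq])
    omega
  · obtain ⟨l, hl⟩ := exists_vals_cell_eq (ω := ω) hp hAB hA hB hF hc
    rw [hl x y s (mem_keys_iff.1 hk), Multiset.card_map]
    exact (card_summands_le hp _ _ _ _).trans (by omega)

/-- Only nonzero entries of the product have partial sums. -/
theorem sum_card_partialSum_le (hp : p.Valid) (hAB : NoCancellation A B) (K c s : ℕ) :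
    ∑ i : Fin p.g, ∑ j : Fin p.g, ∑ u ∈ Finset.range p.b ×ˢ Finset.range p.b,
      (partialSum A B K c s (i * p.b + u.1) (j * p.b + u.2)).card ≤ (positions A B).card := by
  have hinj : Set.InjOn (fun a : (ℕ × ℕ) × (ℕ × ℕ) =>
      (a.1.1 * p.b + a.2.1, a.1.2 * p.b + a.2.2))
      ((Finset.range p.g ×ˢ Finset.range p.g) ×ˢ (Finset.range p.b ×ˢ Finset.range p.b) :
        Finset ((ℕ × ℕ) × (ℕ × ℕ))) := by
    have hdm : ∀ {i i' x x' : ℕ}, x < p.b → x' < p.b → i * p.b + x = i' * p.b + x' →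
        i = i' ∧ x = x' := by
      intro i i' x x' hx hx' h
      have h1 := congrArg (· / p.b) h
      simp only [mul_comm _ p.b, Nat.mul_add_div hp.b_pos, Nat.div_eq_of_lt hx,
        Nat.div_eq_of_lt hx', add_zero] at h1
      subst h1
      exact ⟨rfl, by omega⟩
    rintro ⟨⟨i, j⟩, x, y⟩ h1 ⟨⟨i', j'⟩, x', y'⟩ h2 h
    simp only [Finset.coe_product, Finset.coe_range, Set.mem_prod, Set.mem_Iio] at h1 h2
    rw [Prod.mk.injEq] at h
    obtain ⟨rfl, rfl⟩ := hdm h1.2.1 h2.2.1 h.1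
    obtain ⟨rfl, rfl⟩ := hdm h1.2.2 h2.2.2 h.2
    rfl
  have h1 : ∑ i : Fin p.g, ∑ j : Fin p.g, ∑ u ∈ Finset.range p.b ×ˢ Finset.range p.b,
      (partialSum A B K c s (i * p.b + u.1) (j * p.b + u.2)).card =
      ∑ a ∈ (Finset.range p.g ×ˢ Finset.range p.g) ×ˢ (Finset.range p.b ×ˢ Finset.range p.b),
        (partialSum A B K c s (a.1.1 * p.b + a.2.1) (a.1.2 * p.b + a.2.2)).card := by
    rw [Finset.sum_product, Finset.sum_product, Finset.sum_range]
    simp only [Finset.sum_range]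
  rw [h1, ← Finset.sum_image (f := fun z : ℕ × ℕ => (partialSum A B K c s z.1 z.2).card) hinj]
  refine (sum_le_sum_of_cover (U := support (A * B)) (fun u => ((u.1 : ℕ), (u.2 : ℕ)))
    (fun z : ℕ × ℕ => (partialSum A B K c s z.1 z.2).card) ?_).trans ?_
  · rintro ⟨x, y⟩ - h
    obtain ⟨x', z, y', h1, h2, ha, hb⟩ := exists_of_partialSum (mt Multiset.card_eq_zero.2 h)
    exact ⟨(x', y'), mem_support.2 (hAB _ _ ⟨z, ha, hb⟩), Prod.ext h1.symm h2.symm⟩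
  · rw [card_positions]
    exact (Finset.sum_le_card_nsmul _ _ 1 fun u _ => card_partialSum_le _ _ _ _ _).trans
      (by simp [nnz])

theorem sum_card_partialSums_le (hp : p.Valid) (hAB : NoCancellation A B) (K c : ℕ) :
    ∑ u : Fin K × Fin p.g × Fin p.g, ∑ v ∈ Finset.range p.b ×ˢ Finset.range p.b,
      (partialSum A B K c u.1 (u.2.1 * p.b + v.1) (u.2.2 * p.b + v.2)).card ≤
      K * (positions A B).card := by
  simp only [Fintype.sum_prod_type]
  have h : ∀ s ∈ (Finset.univ : Finset (Fin K)), _ ≤ (positions A B).card := fun s _ =>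
    sum_card_partialSum_le hp hAB K c s
  refine (Finset.sum_le_card_nsmul _ _ _ h).trans (le_of_eq ?_)
  rw [Finset.card_univ, Fintype.card_fin, smul_eq_mul]

theorem sum_card_blocks_le (hA : nnz A ≤ p.nt) (hB : nnz B ≤ p.nt) (K a : ℕ) :
    ∑ u : Fin K × Fin p.g × Fin p.g, (blockEntries A B u.2.1 u.2.2 (a + u.1)).card ≤
      K * (2 * p.nt) := by
  rw [Fintype.sum_prod_type]
  refine (Finset.sum_le_card_nsmul _ _ (2 * p.nt) fun s _ => ?_).trans (by simp)
  rw [Fintype.sum_prod_type]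
  refine le_trans (le_of_eq ?_) ((sum_card_blockEntries_le (A := A) (B := B) (a + s)).trans
    (by omega))
  simp only [Finset.sum_range]

/-- The products in use belong to submatrices and to the current groups. -/
theorem prod_key_lt (hp : p.Valid) (hAB : NoCancellation A B) (hA : nnz A ≤ p.nt)
    (hB : nnz B ≤ p.nt) (hF : (positions A B).Nonempty) {c i j s : ℕ} (hc : 1 ≤ c)
    (hc' : c ≤ steps A B ω) {v : Msg S}
    (hv : v ∈ vals A B ω (p.estRound + 1 + c) (.prod (width A B ω) i j s)) :
    i < p.g ∧ j < p.g ∧ s < width A B ω := by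
  obtain ⟨c, rfl⟩ := Nat.exists_eq_add_of_le' hc
  by_contra hijs
  rw [← add_assoc, vals_prod hp hAB hA hB hF hc', if_neg (fun h => hijs ⟨h.1, h.2.1, h.2.2.1⟩),
    zero_add, Multiset.mem_sum] at hv
  obtain ⟨u, hu, hv⟩ := hv
  rw [Finset.mem_product, Finset.mem_range, Finset.mem_range] at hu
  have hne : partialSum A B (width A B ω) c s (i * p.b + u.1) (j * p.b + u.2) ≠ 0 :=
    fun h => by rw [h] at hv; simp at hv
  obtain ⟨x', z, y', hx, hy, -⟩ := exists_of_partialSum hne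
  refine hijs ⟨?_, ?_, ?_⟩
  · have := hp.div_lt x'.2
    rwa [← hx, mul_comm, Nat.mul_add_div hp.b_pos, Nat.div_eq_of_lt hu.1, add_zero] at this
  · have := hp.div_lt y'.2
    rwa [← hy, mul_comm, Nat.mul_add_div hp.b_pos, Nat.div_eq_of_lt hu.2, add_zero] at this
  · by_contra hs
    exact hne (partialSum_eq_zero (not_lt.1 hs) _ _ _)

/-- The total number of values in a round of the multiplication: the entries with the estimate, the
blocks of `width` groups, and `width` partial sums for each nonzero entry of the product. -/
theorem sum_card_multiplication_le (hp : p.Valid) (hAB : NoCancellation A B) (hA : nnz A ≤ p.nt)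
    (hB : nnz B ≤ p.nt) (hF : (positions A B).Nonempty) {c : ℕ}
    (hc : c < steps A B ω + 1 + depth A B ω) :
    ∑ k ∈ keysAt A B ω (p.estRound + 1 + c), (vals A B ω (p.estRound + 1 + c) k).card ≤
      4 * p.nt + width A B ω * (2 * p.nt) + 2 * (width A B ω * (positions A B).card) := by
  set E : (Bool × Fin p.nt) ⊕ (Fin (width A B ω) × Fin p.g × Fin p.g) ⊕
      (support (A * B) × Fin (width A B ω)) → Key :=
    Sum.elim (fun u => .home u.1 u.2) (Sum.elim
      (fun u => .prod (width A B ω) u.2.1 u.2.2 u.1)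
      (fun u => .cell (width A B ω) u.1.1.1 u.1.1.2 u.2)) with hE
  obtain ⟨l, hl⟩ := exists_vals_cell_eq (ω := ω) hp hAB hA hB hF hc
  have hcover : ∀ k ∈ keysAt A B ω (p.estRound + 1 + c),
      (vals A B ω (p.estRound + 1 + c) k).card ≠ 0 → ∃ a ∈ Finset.univ, E a = k := by
    intro k hk hne
    have hne := mt Multiset.card_eq_zero.2 hne
    rcases (multiplication_keys hp hAB hA hB hF c).2 k hk with ⟨d, i, rfl, h⟩ |
      ⟨i, j, s, rfl, hc, hc'⟩ | ⟨x, y, s, rfl, -⟩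
    · have hi : i < p.nt := by
        by_contra hi
        rw [(multiplication_keys hp hAB hA hB hF c).1, if_pos h, homeVals_eq_zero hA hB hi] at hne
        exact hne rfl
      exact ⟨Sum.inl (d, ⟨i, hi⟩), Finset.mem_univ _, rfl⟩
    · obtain ⟨v, hv⟩ := Multiset.exists_mem_of_ne_zero hne
      have h1 := prod_key_lt hp hAB hA hB hF hc hc' hv
      exact ⟨Sum.inr (Sum.inl (⟨s, h1.2.2⟩, ⟨i, h1.1⟩, ⟨j, h1.2.1⟩)), Finset.mem_univ _, rfl⟩
    · rw [hl x y s hne] at hne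
      have hne : summands A B ω x y l s ≠ 0 := fun h => hne (by rw [h]; rfl)
      obtain ⟨-, x', z, y', rfl, rfl, ha, hb⟩ := exists_of_summands hne
      have hs : s < width A B ω := by
        by_contra hs
        exact hne (summands_eq_zero (not_lt.1 hs))
      exact ⟨Sum.inr (Sum.inr (⟨(x', y'), mem_support.2 (hAB _ _ ⟨z, ha, hb⟩)⟩, ⟨s, hs⟩)),
        Finset.mem_univ _, rfl⟩
  refine (sum_le_sum_of_cover E _ hcover).trans ?_
  rw [Fintype.sum_sum_type, Fintype.sum_sum_type, add_assoc (4 * p.nt)]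
  refine Nat.add_le_add ?_ ?_
  · have h : ∀ u ∈ Finset.univ, (vals A B ω (p.estRound + 1 + c) (E (Sum.inl u))).card ≤ 2 := by
      intro u _
      change (vals A B ω (p.estRound + 1 + c) (.home u.1 u.2)).card ≤ 2
      rw [(multiplication_keys hp hAB hA hB hF c).1]
      split_ifs
      · exact card_homeVals_le _ _
      · exact Nat.zero_le _
    refine (Finset.sum_le_card_nsmul _ _ _ h).trans (le_of_eq ?_)
    rw [Finset.card_univ, Fintype.card_prod, Fintype.card_fin, Fintype.card_bool, smul_eq_mul]
    ring
  rw [two_mul (_ * (positions A B).card), ← add_assoc]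
  refine Nat.add_le_add ?_ ?_
  · have h : ∀ u ∈ Finset.univ, (vals A B ω (p.estRound + 1 + c) (E (Sum.inr (Sum.inl u)))).card ≤
        (blockEntries A B u.2.1 u.2.2 ((c - 1) * width A B ω + u.1)).card +
          ∑ v ∈ Finset.range p.b ×ˢ Finset.range p.b, (partialSum A B (width A B ω) (c - 1) u.1
            (u.2.1 * p.b + v.1) (u.2.2 * p.b + v.2)).card :=
      fun u _ => card_vals_prod_le hp hAB hA hB hF _ _ _ _
    refine (Finset.sum_le_sum h).trans ?_
    rw [Finset.sum_add_distrib]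
    exact Nat.add_le_add (sum_card_blocks_le hA hB _ _) (sum_card_partialSums_le hp hAB _ _)
  · rw [Fintype.sum_prod_type]
    refine (Finset.sum_le_card_nsmul _ _ (width A B ω) fun u _ => ?_).trans (le_of_eq ?_)
    · refine (Finset.sum_le_sum fun s _ => ?_).trans (sum_card_summands_le u.1.1 u.1.2 l)
      by_cases hne : vals A B ω (p.estRound + 1 + c) (.cell (width A B ω) u.1.1 u.1.2 s) = 0
      · change (vals A B ω (p.estRound + 1 + c) (.cell (width A B ω) u.1.1 u.1.2 s)).card ≤ _
        rw [hne]
        exact Nat.zero_le _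
      · change (vals A B ω (p.estRound + 1 + c) (.cell (width A B ω) u.1.1 u.1.2 s)).card ≤ _
        rw [hl _ _ _ hne, Multiset.card_map]
    · rw [Finset.card_univ, Fintype.card_coe, smul_eq_mul, card_positions, nnz, mul_comm]

end

/-! ### All rounds together -/

section

variable {S : Type u} [NonUnitalSemiring S] {p : Params}
  {A B : Matrix (Fin p.q) (Fin p.q) S} {ω : Choices p}

variable (A B ω) in
/-- The random choices are favourable: the estimate is right up to a constant factor, and no reducer
that collects sketches receives more than `X` words. -/
structure Favourable (X : ℕ) : Prop where
  est_good : (positions A B).Nonempty → (positions A B).card ≤ 768 * est A B ω ∧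
    est A B ω ≤ 16 * (positions A B).card
  load_le : ∀ r ≤ p.phases, ∀ β, load ω (pairSize A B) r β ≤ X

/-- A round belongs to the estimation, or it is the round in which the entries of matrices with a
vanishing product are dropped, or it belongs to the multiplication. -/
theorem round_cases {r : ℕ} (hr : r < rounds A B ω) : r ≤ p.estRound ∨
    (r = p.estRound + 1 ∧ ¬ (positions A B).Nonempty) ∨
    ∃ c < steps A B ω + 1 + depth A B ω, (positions A B).Nonempty ∧ r = p.estRound + 1 + c := by
  rcases le_or_gt r p.estRound with h | h
  · exact Or.inl h
  · right
    rw [rounds] at hr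
    obtain ⟨c, rfl⟩ := Nat.exists_eq_add_of_le (Nat.succ_le_of_lt h)
    split_ifs at hr with hF
    · exact Or.inr ⟨c, by omega, hF, rfl⟩
    · exact Or.inl ⟨by omega, hF⟩

theorem vals_of_empty (hp : p.Valid) (hAB : NoCancellation A B) (hF : ¬ (positions A B).Nonempty)
    (k : Key) : vals A B ω (p.estRound + 1) k = values (inputs A B) k := by
  by_cases hk : ∀ c i, k ≠ .home c i
  · rw [vals_after_eq_zero hp hAB hk, values_inputs_eq_zero hk]
  · simp only [not_forall, not_not] at hk
    obtain ⟨c, i, rfl⟩ := hk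
    rw [vals_home_after hp hAB, if_neg fun h => hF h.1, add_zero]

/-- The number of values of a single reducer, in all rounds. -/
theorem card_vals_le {X : ℕ} (hp : p.Valid) (hAB : NoCancellation A B) (hA : nnz A ≤ p.nt)
    (hB : nnz B ≤ p.nt) (hω : Favourable A B ω X) {r : ℕ} (hr : r < rounds A B ω) {k : Key}
    (hk : k ∈ keysAt A B ω r) : (vals A B ω r k).card ≤ X + p.fan * p.H + 3 * p.m := by
  have hm := hp.two_le_m
  have hbm : p.b ^ 2 ≤ p.m := Nat.sqrt_le' _
  rcases round_cases hr with hr | ⟨rfl, hF⟩ | ⟨c, hc, hF, rfl⟩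
  · obtain ⟨v, hv⟩ := Multiset.exists_mem_of_ne_zero (mem_keys_iff.1 hk)
    have hs := sound hp hAB r hr k v hv
    rcases k with ⟨c, i⟩ | ⟨i, j, l⟩ | β | β | ⟨K, i, j, s⟩ | ⟨K, x, y, s⟩
    · rw [vals_home hr]
      exact (card_values_inputs_le _).trans (by omega)
    · have h1 := card_vals_pair_le (ω := ω) hp hAB hr i j l
      have h2 := card_blockEntries_le (A := A) (B := B) hp.b_pos i j l
      omega
    · obtain ⟨h1, h2, h3, -⟩ := hs
      obtain ⟨r, rfl⟩ := Nat.exists_eq_add_of_le' (show 1 ≤ r by omega)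
      have h4 := card_vals_bin_le (ω := ω) hp hAB hr ⟨β, h3⟩
      have h5 := hω.load_le r (by omega) ⟨β, h3⟩
      simp only at h4
      omega
    · have := card_vals_node_le (ω := ω) hp hAB hr β
      omega
    · exact hs.elim
    · exact hs.elim
  · rw [vals_of_empty hp hAB hF]
    exact (card_values_inputs_le _).trans (by omega)
  · exact (card_multiplication_le hp hAB hA hB hF hc hk).trans (by omega)

/-- The total number of values, in all rounds. -/
theorem sum_card_vals_le (hp : p.Valid) (hAB : NoCancellation A B) (hA : nnz A ≤ p.nt)
    (hB : nnz B ≤ p.nt) {r : ℕ} (hr : r < rounds A B ω) :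
    ∑ k ∈ keysAt A B ω r, (vals A B ω r k).card ≤ 4 * p.nt + 4 * p.mem + 2 * (p.bins * p.H) +
      p.fan * p.H + 2 * (width A B ω * (positions A B).card) := by
  rcases round_cases hr with hr | ⟨rfl, hF⟩ | ⟨c, hc, hF, rfl⟩
  · exact (sum_card_estimation_le hp hAB hA hB hr).trans (by omega)
  · simp only [vals_of_empty hp hAB hF]
    refine le_trans (Finset.sum_le_sum_of_subset (t := keys (inputs A B)) fun k hk => ?_) ?_
    · rw [mem_keys_iff] at hk ⊢
      rwa [← vals_of_empty (ω := ω) hp hAB hF]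
    · rw [sum_card_values, card_inputs]
      omega
  · refine (sum_card_multiplication_le hp hAB hA hB hF hc).trans ?_
    have h1 : p.nt * width A B ω ≤ p.mem := hp.nt_mul_mulGroups_le _
    have h2 : width A B ω * (2 * p.nt) = 2 * (p.nt * width A B ω) := by ring
    omega

/-! ### Sizes of numbers -/

/-- The quantities from which all parameters, keys and numbers of values are formed are at most `Λ`.
-/
structure Params.BoundedBy (p : Params) (Λ : ℕ) : Prop where
  five_le : 5 ≤ Λ
  q_le : p.q ≤ Λ
  m_le : p.m ≤ Λ
  nt_le : p.nt ≤ Λ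
  mem_le : p.mem ≤ Λ
  prime_le : p.prime ≤ Λ
  hashes_le : p.Δ ≤ Λ

theorem getD_le_of_forall {l : List ℕ} {Λ : ℕ} (h : ∀ a ∈ l, a ≤ Λ) (f : ℕ) : l.getD f 0 ≤ Λ := by
  rcases lt_or_ge f l.length with hf | hf
  · rw [List.getD_eq_getElem _ _ hf]
    exact h _ (List.getElem_mem hf)
  · rw [List.getD_eq_default _ _ hf]
    exact Nat.zero_le _

variable {Λ : ℕ}

theorem flag_le (c : Bool) : flag c ≤ 1 := by cases c <;> simp [flag]

theorem num_entry_le (hΛ : p.BoundedBy Λ) {v : Msg S} (h : v ∈ allEntries A B) (f : ℕ) :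
    v.num f ≤ Λ := by
  obtain ⟨c, u, -, rfl⟩ := mem_allEntries.1 h
  have h1 := flag_le c
  have h2 := u.1.2
  have h3 := u.2.2
  have := hΛ.five_le
  have := hΛ.q_le
  refine getD_le_of_forall ?_ f
  simp only [List.mem_cons, List.not_mem_nil, or_false]
  rintro a (rfl | rfl | rfl | rfl) <;> omega

theorem num_part_le (hΛ : p.BoundedBy Λ) {x y : Fin p.q} {a : S} (f : ℕ) :
    (Msg.part x y a).num f ≤ Λ := by
  have h2 := x.2
  have h3 := y.2
  have := hΛ.five_le
  have := hΛ.q_le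
  refine getD_le_of_forall ?_ f
  simp only [List.mem_cons, List.not_mem_nil, or_false]
  rintro a (rfl | rfl | rfl) <;> omega

theorem num_sketch_le (hΛ : p.BoundedBy Λ) {v : Msg S} (h : IsSketch A B ω v) (f : ℕ) :
    v.num f ≤ Λ := by
  obtain ⟨w, hw, z, -, rfl⟩ := h
  have := hΛ.five_le
  have := hΛ.hashes_le
  have := hΛ.prime_le
  have := hash_le ω w z
  refine getD_le_of_forall ?_ f
  simp only [List.mem_cons, List.not_mem_nil, or_false]
  rintro a (rfl | rfl | rfl) <;> omega

theorem num_pseudo_le (hp : p.Valid) (hΛ : p.BoundedBy Λ) {v : Msg S} (h : IsPseudoValue A B v)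
    (f : ℕ) : v.num f ≤ Λ := by
  obtain ⟨i, j, l, c, u, hi, hj, hl, -, rfl⟩ := h
  have := hp.g_le
  have h1 := flag_le c
  have h2 := u.1.2
  have h3 := u.2.2
  have := hΛ.five_le
  have := hΛ.q_le
  refine getD_le_of_forall ?_ f
  simp only [List.mem_cons, List.not_mem_nil, or_false]
  rintro a (rfl | rfl | rfl | rfl | rfl | rfl | rfl) <;> omega

/-- All numbers in the values are at most `Λ`. -/
theorem num_vals_le (hp : p.Valid) (hAB : NoCancellation A B) (hA : nnz A ≤ p.nt)
    (hB : nnz B ≤ p.nt) (hΛ : p.BoundedBy Λ) (hest : (positions A B).Nonempty → est A B ω ≤ Λ)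
    {r : ℕ} (hr : r < rounds A B ω) {k : Key} {v : Msg S} (hv : v ∈ vals A B ω r k) (f : ℕ) :
    v.num f ≤ Λ := by
  rcases round_cases hr with hr | ⟨rfl, hF⟩ | ⟨c, hc, hF, rfl⟩
  · have hs := sound hp hAB r hr k v hv
    rcases k with ⟨c, i⟩ | ⟨i, j, l⟩ | β | β | ⟨K, i, j, s⟩ | ⟨K, x, y, s⟩
    · exact num_entry_le hΛ (mem_allEntries_of_mem_inputs hs) f
    · exact num_entry_le hΛ (Multiset.mem_filter.1 hs.2.2.2.2).1 f
    · rcases hs.2.2.2 with h | h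
      · exact num_sketch_le hΛ h f
      · exact num_pseudo_le hp hΛ h f
    · exact num_sketch_le hΛ hs.2.2.2 f
    · exact hs.elim
    · exact hs.elim
  · rw [vals_of_empty hp hAB hF] at hv
    exact num_entry_le hΛ (mem_allEntries_of_mem_inputs (mem_values.1 hv)) f
  · rcases (multiplication_keys hp hAB hA hB hF c).2 k (mem_keys.2 ⟨v, mem_values.1 hv⟩) with
      ⟨d, i, rfl, h⟩ | ⟨i, j, s, rfl, hc1, hc'⟩ | ⟨x, y, s, rfl, h1⟩
    · rw [(multiplication_keys hp hAB hA hB hF c).1, if_pos h, homeVals, Multiset.mem_add] at hv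
      rcases hv with hv | hv
      · exact num_entry_le hΛ (mem_allEntries_of_mem_inputs (mem_values.1 hv)) f
      · split_ifs at hv
        · rw [Multiset.mem_singleton] at hv
          subst hv
          have := hΛ.five_le
          have := hest hF
          refine getD_le_of_forall ?_ f
          simp only [List.mem_cons, List.not_mem_nil, or_false]
          rintro a (rfl | rfl) <;> omega
        · simp at hv
    · obtain ⟨c, rfl⟩ := Nat.exists_eq_add_of_le' hc1
      rw [← add_assoc, vals_prod hp hAB hA hB hF hc', Multiset.mem_add, Multiset.mem_sum] at hv
      rcases hv with hv | ⟨u, -, hv⟩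
      · split_ifs at hv
        · exact num_entry_le hΛ (Multiset.mem_filter.1 hv).1 f
        · simp at hv
      · obtain ⟨a, ha, rfl⟩ := Multiset.mem_map.1 hv
        obtain ⟨x', z, y', hx, hy, -⟩ := exists_of_partialSum
          (fun h => by rw [h] at ha; simp at ha :
            partialSum A B (width A B ω) c s (i * p.b + u.1) (j * p.b + u.2) ≠ 0)
        rw [hx, hy]
        exact num_part_le hΛ f
    · obtain ⟨l, hl⟩ := exists_vals_cell_eq (ω := ω) hp hAB hA hB hF hc
      rw [hl x y s fun h => by rw [h] at hv; simp at hv] at hv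
      obtain ⟨a, ha, rfl⟩ := Multiset.mem_map.1 hv
      obtain ⟨-, x', z, y', rfl, rfl, -⟩ := exists_of_summands
        (fun h => by rw [h] at ha; simp at ha : summands A B ω x y l s ≠ 0)
      exact num_part_le hΛ f

theorem home_lt_of_mem_inputs (hA : nnz A ≤ p.nt) (hB : nnz B ≤ p.nt) {c : Bool} {i : ℕ} {v : Msg S}
    (h : (Key.home c i, v) ∈ inputs A B) : i < p.nt := by
  obtain ⟨d, u, hu, h, -⟩ := mem_inputs h
  rw [Key.home.injEq] at h
  obtain ⟨rfl, rfl⟩ := h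
  refine (progressiveIndex_lt hu).trans_le ?_
  cases c
  · exact hB
  · exact hA

/-- All numbers in the keys are at most `Λ`. -/
theorem code_le (hp : p.Valid) (hAB : NoCancellation A B) (hA : nnz A ≤ p.nt)
    (hB : nnz B ≤ p.nt) (hΛ : p.BoundedBy Λ)
    {r : ℕ} (hr : r < rounds A B ω) {k : Key} (hk : k ∈ keysAt A B ω r) : ∀ a ∈ k.code, a ≤ Λ := by
  have h5 := hΛ.five_le
  have hq := hΛ.q_le
  have hg := hp.g_le
  have hnt := hΛ.nt_le
  have hbins := hp.bins_le.trans hΛ.mem_le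
  obtain ⟨v, hv⟩ : ∃ v, v ∈ vals A B ω r k :=
    Multiset.exists_mem_of_ne_zero (mem_keys_iff.1 hk)
  have hhome : ∀ c i, i < p.nt → ∀ a ∈ (Key.home c i).code, a ≤ Λ := by
    intro c i hi
    have h1 := flag_le c
    simp only [Key.code, List.mem_cons, List.not_mem_nil, or_false]
    rintro a (rfl | rfl | rfl | rfl | rfl) <;> omega
  have hbin : ∀ β ≤ p.bins, ∀ t ≤ 5, ∀ a ∈ [t, β, 0, 0, 0], a ≤ Λ := by
    intro β hβ t ht
    simp only [List.mem_cons, List.not_mem_nil, or_false]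
    rintro a (rfl | rfl | rfl | rfl | rfl) <;> omega
  have hfive : ∀ t x y z w, t ≤ 5 → x ≤ p.q → y ≤ p.q → z ≤ p.q → w ≤ p.q →
      ∀ a ∈ [t, x, y, z, w], a ≤ Λ := by
    intro t x y z w ht hx hy hz hw
    simp only [List.mem_cons, List.not_mem_nil, or_false]
    rintro a (rfl | rfl | rfl | rfl | rfl) <;> omega
  rcases round_cases hr with hr | ⟨rfl, hF⟩ | ⟨c, hc, hF, rfl⟩
  · have hs := sound hp hAB r hr k v hv
    rcases k with ⟨c, i⟩ | ⟨i, j, l⟩ | β | β | ⟨K, i, j, s⟩ | ⟨K, x, y, s⟩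
    · exact hhome _ _ (home_lt_of_mem_inputs hA hB hs)
    · obtain ⟨-, hi, hj, hl, -⟩ := hs
      exact hfive _ _ _ _ _ (by omega) (by omega) (by omega) (by omega) (by omega)
    · exact hbin _ hs.2.2.1.le _ (by omega)
    · exact hbin _ (hs.2.2.1.trans ((Nat.div_le_self _ _).trans (Nat.sub_le _ _))) _ (by omega)
    · exact hs.elim
    · exact hs.elim
  · obtain ⟨d, i, rfl⟩ := keys_after_of_empty hp hAB hk
    rw [vals_of_empty hp hAB hF] at hv
    exact hhome _ _ (home_lt_of_mem_inputs hA hB (mem_values.1 hv))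
  · have hK : width A B ω ≤ p.g := hp.mulGroups_le _
    rcases (multiplication_keys hp hAB hA hB hF c).2 k hk with
      ⟨d, i, rfl, h⟩ | ⟨i, j, s, rfl, hc1, hc'⟩ | ⟨x, y, s, rfl, h1⟩
    · refine hhome _ _ ?_
      by_contra hi
      rw [(multiplication_keys hp hAB hA hB hF c).1, if_pos h, homeVals_eq_zero hA hB hi] at hv
      simp at hv
    · obtain ⟨hi, hj, hs⟩ := prod_key_lt hp hAB hA hB hF hc1 hc' hv
      exact hfive _ _ _ _ _ (by omega) (by omega) (by omega) (by omega) (by omega)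
    · obtain ⟨l, hl⟩ := exists_vals_cell_eq (ω := ω) hp hAB hA hB hF hc
      rw [hl x y s fun h => by rw [h] at hv; simp at hv] at hv
      obtain ⟨a, ha, rfl⟩ := Multiset.mem_map.1 hv
      have hne : summands A B ω x y l s ≠ 0 := fun h => by rw [h] at ha; simp at ha
      obtain ⟨-, x', z, y', rfl, rfl, -⟩ := exists_of_summands hne
      have hs : s < width A B ω := by
        by_contra hs
        exact hne (summands_eq_zero (not_lt.1 hs))
      have h2 := x'.2
      have h3 := y'.2
      exact hfive _ _ _ _ _ (by omega) (by omega) (by omega) (by omega) (by omega)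

theorem coin_le (r : ℕ) (k : Key) : coin ω r k ≤ p.bins := by
  cases k
  case pair i j l =>
    rw [coin]
    split_ifs
    · exact (Fin.is_lt _).le
    · exact Nat.zero_le _
  case bin β =>
    rw [coin]
    split_ifs
    · exact (Fin.is_lt _).le
    · exact Nat.zero_le _
  all_goals exact Nat.zero_le _

/-- All read-only parameters of the reducers are at most `Λ`. -/
theorem rom_le (hp : p.Valid) (hAB : NoCancellation A B) (hA : nnz A ≤ p.nt)
    (hB : nnz B ≤ p.nt) (hΛ : p.BoundedBy Λ) (hrΛ : rounds A B ω ≤ Λ)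
    {r : ℕ} (hr : r < rounds A B ω) {k : Key} (hk : k ∈ keysAt A B ω r)
    (hc : (vals A B ω r k).card ≤ Λ) (i : ℕ) :
    (encoding S ω).rom r k (vals A B ω r k) i ≤ Λ := by
  refine getD_le_of_forall (fun a ha => ?_) i
  have hbins := hp.bins_le.trans hΛ.mem_le
  rw [List.mem_append, List.mem_append] at ha
  rcases ha with (ha | ha) | ha
  · have := hΛ.q_le
    have := hΛ.m_le
    have := hΛ.nt_le
    have := hΛ.mem_le
    have := coin_le (ω := ω) r k
    simp only [List.mem_cons, List.not_mem_nil, or_false] at ha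
    rcases ha with rfl | rfl | rfl | rfl | rfl | rfl | rfl <;> omega
  · exact code_le hp hAB hA hB hΛ hr hk a ha
  · obtain ⟨w, -, ha⟩ := List.mem_flatMap.1 ha
    have h1 : (seed ω w).1 ≤ p.prime ∧ (seed ω w).2 ≤ p.prime := by
      rw [seed]
      split_ifs
      · exact ⟨(Fin.is_lt _).le, (Fin.is_lt _).le⟩
      · exact ⟨Nat.zero_le _, Nat.zero_le _⟩
    have := hΛ.prime_le
    simp only [List.mem_cons, List.not_mem_nil, or_false] at ha
    rcases ha with rfl | rfl <;> omega

end

/-! ### The probability of favourable random choices -/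

section

variable {p : Params}

theorem one_le_log_n (hp : p.Valid) : 1 ≤ Real.log p.n := by
  have h : Real.log 4 ≤ Real.log p.n := Real.log_le_log (by norm_num)
      (by exact_mod_cast hp.four_le_n)
  have h4 : Real.log 4 = 2 * Real.log 2 := by
    rw [show (4 : ℝ) = 2 ^ 2 by norm_num, Real.log_pow]
    norm_num
  have := Real.log_two_gt_d9
  linarith

/-- A sketch has `O(log n)` words; the constant is not optimized. -/
theorem H_le_log (hp : p.Valid) : (p.H : ℝ) ≤ 30000 * Real.log p.n := by
  have hn : (0 : ℝ) < p.n := by have := hp.four_le_n; positivity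
  have h1 : (Nat.clog 2 (2 * p.n) : ℝ) < Real.logb 2 (2 * p.n) + 1 := by
    have h := Real.natCeil_logb_natCast 2 (2 * p.n)
    rw [← h]
    push_cast
    refine Nat.ceil_lt_add_one (Real.logb_nonneg (by norm_num) ?_)
    have : (1 : ℝ) ≤ p.n := by exact_mod_cast (by have := hp.four_le_n; omega : 1 ≤ p.n)
    linarith
  have h2 : Real.logb 2 (2 * p.n) = 1 + Real.log p.n / Real.log 2 := by
    rw [Real.logb_mul (by norm_num) hn.ne', Real.logb_self_eq_one (by norm_num)]
    rfl
  have h3 := one_le_log_n hp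
  have h4 : Real.log p.n / Real.log 2 ≤ 2 * Real.log p.n := by
    rw [div_le_iff₀ (Real.log_pos (by norm_num))]
    have := Real.log_two_gt_d9
    nlinarith
  have h5 : (p.H : ℝ) = 384 * (12 * Nat.clog 2 (2 * p.n) + 1) := by
    rw [Params.H, Params.t, Params.Δ]
    push_cast
    ring
  rw [h5]
  linarith

/-- A sketch is much smaller than the local memory: this is all that `m = Ω(log² n)` is used for.
The first inequality makes the deviation of a load from its mean logarithmically unlikely, and the
second one makes the degree of the tree of sketches a power of `m`. -/
structure Params.SmallSketches (p : Params) (κ : ℕ) : Prop where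
  mul_log_le : (p.H : ℝ) * Real.log p.n ≤ κ * p.m
  sq_le : p.H ^ 2 ≤ κ * p.m

/-- Since `H = O(log n)`, local memory `m = Ω(log² n)` has room for sketches. -/
theorem exists_smallSketches {c : ℝ} (hc : 0 < c) : ∃ κ : ℕ, ∀ p : Params, p.Valid →
    c * Real.log p.n ^ 2 ≤ p.m → p.SmallSketches κ := by
  refine ⟨⌈30000 ^ 2 / c⌉₊, fun p hp h => ?_⟩
  have h1 := H_le_log hp
  have h2 := one_le_log_n hp
  have h0 : (0 : ℝ) ≤ p.H := Nat.cast_nonneg _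
  have h3 : 30000 ^ 2 * Real.log p.n ^ 2 ≤ (⌈30000 ^ 2 / c⌉₊ : ℝ) * p.m := by
    refine le_trans ?_ (mul_le_mul_of_nonneg_right (Nat.le_ceil _) (Nat.cast_nonneg _))
    rw [div_mul_eq_mul_div, le_div_iff₀ hc]
    nlinarith
  constructor
  · refine le_trans ?_ h3
    nlinarith
  · have h4 : (p.H : ℝ) ^ 2 ≤ (⌈30000 ^ 2 / c⌉₊ : ℝ) * p.m := by
      refine le_trans ?_ h3
      rw [← mul_pow]
      exact pow_le_pow_left₀ h0 h1 2
    exact_mod_cast h4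

theorem Params.SmallSketches.H_le {κ : ℕ} (hκ : p.SmallSketches κ) : p.H ≤ κ * p.m :=
  (Nat.le_self_pow (by norm_num) _).trans hκ.sq_le

variable {S : Type u} [NonUnitalSemiring S] {A B : Matrix (Fin p.q) (Fin p.q) S} {κ : ℕ}

/-- A reducer receives more than `O(m)` words with probability `O(n⁻⁴)`. Twice the mean load due to
the pairs of submatrices is at most `4 m`, and the excess `7 κ m` is worth at least `7 log n`
sketches. -/
theorem pr_load_favourable_le (hp : p.Valid) (hA : nnz A ≤ p.nt) (hB : nnz B ≤ p.nt)
    (hκ : p.SmallSketches κ) (r : ℕ) (β : Fin p.bins) :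
    pr (fun ω : Choices p => (((4 + 7 * κ) * p.m : ℕ) : ℝ) ≤ load ω (pairSize A B) r β) ≤
      1 / (2 * p.n ^ 4) := by
  have : Nonempty (Fin p.prime) := ⟨⟨0, p.prime_spec.2.pos⟩⟩
  have hH : (0 : ℝ) < p.H := by exact_mod_cast p.H_pos
  have hb : (0 : ℝ) < p.bins := by exact_mod_cast hp.bins_pos
  have hn : (0 : ℝ) < p.n := by have := hp.four_le_n; positivity
  have hl := one_le_log_n hp
  refine (pr_load_le (fun u => min_le_left _ _) r β _ (2 * p.mem)
    (by exact_mod_cast sum_pairSize_le hp hA hB r)).trans ?_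
  have h1 : (p.mem : ℝ) ≤ p.bins * p.m := by exact_mod_cast hp.mem_le_bins_mul
  have h2 : 2 * (2 * (p.mem : ℝ)) / (p.H * p.bins) ≤ 4 * p.m / p.H := by
    rw [div_le_div_iff₀ (by positivity) hH]
    nlinarith
  have h3 : 7 * Real.log p.n ≤ 7 * κ * p.m / p.H := by
    rw [le_div_iff₀ hH]
    have := hκ.mul_log_le
    linarith
  have h4 : (((4 + 7 * κ) * p.m : ℕ) : ℝ) / p.H = 4 * p.m / p.H + 7 * κ * p.m / p.H := by
    push_cast
    ring
  rw [h4, one_div, ← Real.exp_log (show (0 : ℝ) < (2 * (p.n : ℝ) ^ 4)⁻¹ by positivity),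
      Real.exp_le_exp,
    Real.log_inv, Real.log_mul (by norm_num) (by positivity), Real.log_pow]
  have := Real.log_two_lt_d9
  push_cast
  linarith

/-- The random choices are favourable with high probability. Half of the failure probability `1 / n`
is spent on the median, the other half on a union bound over at most `n³` loads. -/
theorem le_pr_favourable (hp : p.Valid) (hA : nnz A ≤ p.nt) (hB : nnz B ≤ p.nt)
    (hκ : p.SmallSketches κ) :
    1 - 1 / (p.n : ℝ) ≤ pr (fun ω : Choices p => Favourable A B ω ((4 + 7 * κ) * p.m)) := by
  classical
  have : Nonempty (Fin p.prime) := ⟨⟨0, p.prime_spec.2.pos⟩⟩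
  have : Nonempty (Fin p.bins) := ⟨⟨0, hp.bins_pos⟩⟩
  have hn : (0 : ℝ) < p.n := by have := hp.four_le_n; positivity
  set P : Choices p → Prop := fun ω => Favourable A B ω ((4 + 7 * κ) * p.m)
  -- `Q₁`: the median fails; `Q₂`: some load is too large
  set Q₁ : Choices p → Prop := fun ω => (positions A B).Nonempty ∧
    p.Δ ≤ 2 * badLists (positions A B) ω.1 with hQ₁
  set Q₂ : Choices p → Prop := fun ω => ∃ u ∈ Finset.range (p.phases + 1) ×ˢ
    (Finset.univ : Finset (Fin p.bins)),
      (((4 + 7 * κ) * p.m : ℕ) : ℝ) ≤ load ω (pairSize A B) u.1 u.2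
  have h1 : pr (fun ω => ¬ P ω) ≤ pr (fun ω => Q₁ ω ∨ Q₂ ω) := by
    refine pr_mono fun ω hω => ?_
    by_contra h
    rw [not_or] at h
    refine hω ⟨fun hF => trueEstimate_good ?_, fun r hr β => ?_⟩
    · by_contra h'
      exact h.1 ⟨hF, not_lt.1 h'⟩
    · by_contra h'
      exact h.2 ⟨(r, β), by simp; omega, by exact_mod_cast (not_le.1 h').le⟩
  have h2 : pr Q₁ ≤ 1 / (2 * p.n) := by
    by_cases hF : (positions A B).Nonempty
    · have h3 := pr_badLists_le hF fun x hx => positions_lt hx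
      have h4 : pr Q₁ = pr (fun f : Fin p.Δ → Fin p.prime × Fin p.prime =>
          p.Δ ≤ 2 * badLists (positions A B) f) := by
        simp only [hQ₁, hF, true_and]
        exact pr_fst fun f => p.Δ ≤ 2 * badLists (positions A B) f
      rw [h4]
      exact h3.trans (two_thirds_pow_le (by have := hp.four_le_n; omega))
    · have h4 : pr Q₁ = 0 := by
        simp only [hQ₁, hF, false_and]
        exact pr_false
      rw [h4]
      positivity
  have h3 : pr Q₂ ≤ 1 / (2 * p.n) := by
    refine (pr_exists _ fun (u : ℕ × Fin p.bins) (ω : Choices p) =>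
      (((4 + 7 * κ) * p.m : ℕ) : ℝ) ≤ load ω (pairSize A B) u.1 u.2).trans ?_
    refine (Finset.sum_le_card_nsmul _ _ _ fun u _ =>
      pr_load_favourable_le hp hA hB hκ u.1 u.2).trans ?_
    rw [Finset.card_product, Finset.card_range, Finset.card_univ, Fintype.card_fin, nsmul_eq_mul]
    have h4 : (p.phases + 1) * p.bins ≤ p.n ^ 3 := by
      have h5 : p.phases + 1 ≤ p.n := by
        have := hp.phases_le
        have := hp.g_le
        have := hp.two_le_q
        rw [Params.n]
        nlinarith
      have h6 : p.bins ≤ p.n ^ 2 := hp.bins_le.trans (min_le_right _ _)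
      calc (p.phases + 1) * p.bins ≤ p.n * p.n ^ 2 := Nat.mul_le_mul h5 h6
        _ = p.n ^ 3 := by ring
    have h4 : (((p.phases + 1) * p.bins : ℕ) : ℝ) ≤ (p.n : ℝ) ^ 3 := by exact_mod_cast h4
    refine (mul_le_mul_of_nonneg_right h4 (by positivity)).trans (le_of_eq ?_)
    field_simp
  have h4 := pr_or Q₁ Q₂
  rw [pr_not] at h1
  have h5 : 1 / (2 * (p.n : ℝ)) + 1 / (2 * p.n) = 1 / p.n := by field_simp; norm_num
  linarith

end

/-! ### The number of rounds -/

section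

variable {p : Params}

/-- If as many of the `g` groups are handled at a time as `M / d` allows, then the number of phases
is `O(g d / M + 1)`. -/
theorem ceilDiv_groups_mul_le {g mem d : ℕ} (hg : 0 < g) (hd : 0 < d) :
    ((g + max 1 (min (mem / d) g) - 1) / max 1 (min (mem / d) g)) * mem ≤ 2 * (g * d) + mem := by
  set E := max 1 (min (mem / d) g) with hE
  have hE0 : 0 < E := lt_of_lt_of_le Nat.one_pos (le_max_left _ _)
  have hE1 : (g + E - 1) / E ≤ (g - 1) / E + 1 := by
    rw [show g + E - 1 = g - 1 + E by omega, Nat.add_div_right _ hE0]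
  have key : (g - 1) / E * mem ≤ 2 * (g * d) := by
    rcases Nat.eq_zero_or_pos (mem / d) with h0 | h0
    · have hE2 : E = 1 := by rw [hE, h0]; simp
      have h1 : mem < d := (Nat.div_eq_zero_iff.1 h0).resolve_left hd.ne'
      have h2 : (g - 1) * mem ≤ g * d := Nat.mul_le_mul (Nat.sub_le _ _) h1.le
      rw [hE2, Nat.div_one]
      omega
    · rcases le_or_gt g (mem / d) with h1 | h1
      · have hE2 : E = g := by rw [hE, min_eq_right h1, max_eq_right hg]
        rw [hE2, Nat.div_eq_of_lt (by omega), zero_mul]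
        exact Nat.zero_le _
      · have hE2 : E = mem / d := by rw [hE, min_eq_left h1.le, max_eq_right h0]
        have h2 : mem ≤ 2 * (E * d) := by
          have h3 := Nat.div_add_mod' mem d
          have h4 := Nat.mod_lt mem hd
          rw [← hE2] at h3
          nlinarith
        calc (g - 1) / E * mem ≤ (g - 1) / E * (2 * (E * d)) := Nat.mul_le_mul_left _ h2
          _ = 2 * ((g - 1) / E * E * d) := by ring
          _ ≤ 2 * (g * d) := by
            have := (Nat.div_mul_le_self (g - 1) E).trans (Nat.sub_le _ _)
            gcongr
  calc (g + E - 1) / E * mem ≤ ((g - 1) / E + 1) * mem := Nat.mul_le_mul_right _ hE1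
    _ ≤ _ := by rw [add_mul, one_mul]; omega

theorem sqrt_m_pos (hp : p.Valid) : 0 < √(p.m : ℝ) :=
  Real.sqrt_pos.2 (by have := hp.two_le_m; positivity)

/-- There are `O(√n / √m)` groups. The bound needs `m = O(n)`, or else a single group would be too
many. -/
theorem g_mul_sqrt_le (hp : p.Valid) : (p.g : ℝ) * √(p.m : ℝ) ≤ 4 * p.q := by
  have hs := sqrt_m_pos hp
  have hsq := Real.sq_sqrt (Nat.cast_nonneg (α := ℝ) p.m)
  have hq : (2 : ℝ) ≤ p.q := by exact_mod_cast hp.two_le_q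
  have hb1 : (1 : ℝ) ≤ p.b := by exact_mod_cast hp.b_pos
  have h1 : √(p.m : ℝ) ≤ 2 * p.b := by
    have h2 : (p.m : ℝ) < (p.b + 1) ^ 2 := by
      have := Nat.lt_succ_sqrt' p.m
      exact_mod_cast this
    rw [Real.sqrt_le_left (by positivity)]
    nlinarith
  have h2 : √(p.m : ℝ) ≤ 2 * p.q := by
    rw [Real.sqrt_le_left (by positivity)]
    have h3 : p.m ≤ 2 * p.q ^ 2 := by
      have := hp.m_lt
      have := hp.nt_le
      rw [Params.n] at this
      omega
    have h3 : (p.m : ℝ) ≤ 2 * p.q ^ 2 := by exact_mod_cast h3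
    nlinarith
  have h3 : p.g * p.b ≤ p.q + p.b := by
    have := Nat.div_mul_le_self (p.q + p.b - 1) p.b
    rw [Params.g]
    omega
  have h3 : (p.g : ℝ) * p.b ≤ p.q + p.b := by exact_mod_cast h3
  by_contra h
  push Not at h
  have h4 : (p.g : ℝ) * √(p.m : ℝ) * p.b ≤ (p.q + p.b) * √(p.m : ℝ) := by nlinarith
  nlinarith

/-- The number of groups, in proportion to the number that fit into the memory. If the memory is cut
off at `n²`, this number is bounded by a constant. -/
theorem g_mul_div_mem_le (hp : p.Valid) {d o : ℕ} (ho : o ≤ p.n) (hd : d ≤ p.nt + 32 * o) :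
    (p.g * d : ℝ) / p.mem ≤ 128 * ((p.nt + o) * p.q / (p.M * √(p.m : ℝ))) + 33 := by
  have hs := sqrt_m_pos hp
  have hg := g_mul_sqrt_le hp
  have hdr : (d : ℝ) ≤ 32 * (p.nt + o) := by
    have h : (d : ℝ) ≤ p.nt + 32 * o := by exact_mod_cast hd
    have : (0 : ℝ) ≤ p.nt := Nat.cast_nonneg _
    linarith
  have hmem : (0 : ℝ) < p.mem := by
    exact_mod_cast (by have := hp.nt_le_mem; have := hp.two_le_nt; omega : 0 < p.mem)
  have hQ : 0 ≤ (p.nt + o) * p.q / (p.M * √(p.m : ℝ)) := by positivity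
  rcases le_total p.M (p.n ^ 2) with h | h
  · have hm : p.mem = p.M := min_eq_left h
    rw [hm] at hmem ⊢
    have h1 : (p.g * d : ℝ) / p.M ≤ 128 * ((p.nt + o) * p.q / (p.M * √(p.m : ℝ))) := by
      rw [div_le_iff₀ hmem]
      have h2 : 128 * ((p.nt + o) * p.q / (p.M * √(p.m : ℝ))) * p.M =
          4 * p.q * (32 * (p.nt + o)) / √(p.m : ℝ) := by
        field_simp
        ring
      rw [h2, le_div_iff₀ hs]
      calc (p.g * d : ℝ) * √(p.m : ℝ) = (p.g * √(p.m : ℝ)) * d := by ring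
        _ ≤ 4 * p.q * (32 * (p.nt + o)) := by gcongr
    linarith
  · have hm : p.mem = p.n ^ 2 := min_eq_right h
    have h1 : (p.g * d : ℝ) / p.mem ≤ 33 := by
      rw [div_le_iff₀ hmem]
      have h2 : p.g * d ≤ 33 * p.mem := by
        have h3 := hp.g_le
        have h4 := hp.nt_le
        have h5 : d ≤ 33 * p.n := by omega
        have h6 : p.q ≤ p.n := Nat.le_self_pow (by norm_num) _
        calc p.g * d ≤ p.n * (33 * p.n) := Nat.mul_le_mul (h3.trans h6) h5
          _ = 33 * p.mem := by rw [hm]; ring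
      exact_mod_cast h2
    linarith

theorem ceilDiv_groups_le (hp : p.Valid) {d o : ℕ} (hd0 : 0 < d) (ho : o ≤ p.n)
    (hd : d ≤ p.nt + 32 * o) :
    (((p.g + max 1 (min (p.mem / d) p.g) - 1) / max 1 (min (p.mem / d) p.g) : ℕ) : ℝ) ≤
      256 * ((p.nt + o) * p.q / (p.M * √(p.m : ℝ))) + 67 := by
  have h1 := ceilDiv_groups_mul_le (mem := p.mem) (d := d) hp.g_pos hd0
  set N := (p.g + max 1 (min (p.mem / d) p.g) - 1) / max 1 (min (p.mem / d) p.g)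
  have h2 := g_mul_div_mem_le hp ho hd
  have hmem : (0 : ℝ) < p.mem := by
    exact_mod_cast (by have := hp.nt_le_mem; have := hp.two_le_nt; omega : 0 < p.mem)
  have h1 : (N : ℝ) * p.mem ≤ 2 * (p.g * d) + p.mem := by exact_mod_cast h1
  have h3 : (N : ℝ) ≤ 2 * (p.g * d / p.mem) + 1 := by
    rw [← mul_le_mul_iff_left₀ hmem]
    refine h1.trans (le_of_eq ?_)
    field_simp
  linarith

/-- A constant number of rounds is `O(log_m M)`, since `m ≤ M²`. -/
theorem half_le_logb (hp : p.Valid) : 1 / 2 ≤ Real.logb p.m p.M := by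
  have hm : (1 : ℝ) < p.m := by exact_mod_cast hp.two_le_m
  have hM : 2 ≤ p.M := hp.two_le_nt.trans hp.nt_le_M
  have h1 : p.m ≤ p.M ^ 2 := by
    have := hp.m_lt
    have := hp.nt_le_M
    nlinarith
  have h2 := Real.log_le_log (by linarith) (show (p.m : ℝ) ≤ (p.M : ℝ) ^ 2 by exact_mod_cast h1)
  rw [Real.log_pow] at h2
  rw [Real.logb, le_div_iff₀ (Real.log_pos hm)]
  push_cast at h2
  linarith

theorem clog_le_logb (hp : p.Valid) : (Nat.clog p.m p.M : ℝ) ≤ 3 * Real.logb p.m p.M := by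
  have h := half_le_logb hp
  rw [← Real.natCeil_logb_natCast]
  have := Nat.ceil_lt_add_one (show 0 ≤ Real.logb p.m p.M by linarith)
  linarith

/-- The trees that merge the sketches have degree `m ^ Ω(1)`, for `H² = O(m)` and the degree is
about `m / H`. -/
theorem m_le_fan_pow {κ : ℕ} (hκ : p.SmallSketches κ) : p.m ≤ p.fan ^ (κ + 4) := by
  have hfan : 2 ≤ p.fan := Params.Valid.two_le_fan
  have hH := p.H_pos
  have h1 : p.m ≤ 2 * p.fan * p.H := by
    have h2 := Nat.div_add_mod' p.m p.H
    have h3 := Nat.mod_lt p.m hH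
    have h4 : p.m / p.H ≤ p.fan := le_max_right _ _
    nlinarith
  have h2 : p.m ≤ 4 * κ * p.fan ^ 2 := by
    rcases Nat.eq_zero_or_pos p.m with h0 | h0
    · omega
    · have h3 : p.m * p.m ≤ 4 * κ * p.fan ^ 2 * p.m :=
        calc p.m * p.m ≤ (2 * p.fan * p.H) * (2 * p.fan * p.H) := Nat.mul_le_mul h1 h1
          _ = 4 * p.fan ^ 2 * p.H ^ 2 := by ring
          _ ≤ 4 * p.fan ^ 2 * (κ * p.m) := Nat.mul_le_mul_left _ hκ.sq_le
          _ = _ := by ring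
      exact Nat.le_of_mul_le_mul_right h3 h0
  calc p.m ≤ 2 ^ 2 * 2 ^ κ * p.fan ^ 2 := h2.trans (by
        gcongr
        · norm_num
        · exact Nat.lt_two_pow_self.le)
    _ ≤ p.fan ^ 2 * p.fan ^ κ * p.fan ^ 2 := by gcongr
    _ = _ := by ring

theorem clog_fan_le (hp : p.Valid) {κ : ℕ} (hκ : p.SmallSketches κ) :
    Nat.clog p.fan p.bins ≤ (κ + 4) * Nat.clog p.m p.M := by
  refine Nat.clog_le_of_le_pow ?_
  calc p.bins ≤ p.M := hp.bins_le.trans (min_le_left _ _)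
    _ ≤ p.m ^ Nat.clog p.m p.M := Nat.le_pow_clog hp.two_le_m _
    _ ≤ (p.fan ^ (κ + 4)) ^ Nat.clog p.m p.M := Nat.pow_le_pow_left (m_le_fan_pow hκ) _
    _ = _ := (pow_mul _ _ _).symm

variable {S : Type u} [NonUnitalSemiring S] {A B : Matrix (Fin p.q) (Fin p.q) S} {ω : Choices p}
  {κ X : ℕ}

theorem card_positions_le : (positions A B).card ≤ p.n := by
  have : positions A B ⊆ Finset.range p.n := fun x hx => Finset.mem_range.2 (positions_lt hx)
  simpa using Finset.card_le_card this

theorem width_le (hp : p.Valid) : width A B ω ≤ p.M := by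
  have h1 : p.nt * width A B ω ≤ p.mem := hp.nt_mul_mulGroups_le _
  have h2 : p.mem ≤ p.M := min_le_left _ _
  have h3 := hp.two_le_nt
  nlinarith

/-- The number of rounds. An overestimate by at most the factor `16` bounds the number of rounds of
multiplication. -/
theorem rounds_le (hp : p.Valid) (hω : Favourable A B ω X) (hκ : p.SmallSketches κ) :
    (rounds A B ω : ℝ) ≤ (512 + 3 * (κ + 105)) *
      ((p.nt + nnz (A * B)) * p.q / (p.M * √(p.m : ℝ)) + Real.logb p.m p.M) := by
  rw [← card_positions]
  set o := (positions A B).card with ho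
  have hon : o ≤ p.n := card_positions_le
  set Q := (p.nt + o) * p.q / (p.M * √(p.m : ℝ)) with hQ
  have hQ0 : 0 ≤ Q := by positivity
  have hl := half_le_logb hp
  have hc := clog_le_logb hp
  have hnt := hp.two_le_nt
  have h1 : (p.phases : ℝ) ≤ 256 * Q + 67 := ceilDiv_groups_le hp (by omega) hon (by omega)
  have h2 : (Nat.clog p.fan p.bins : ℝ) ≤ (κ + 4) * Nat.clog p.m p.M := by
    exact_mod_cast clog_fan_le hp hκ
  have hκ0 : (0 : ℝ) ≤ κ := Nat.cast_nonneg _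
  have h3 : ((κ : ℝ) + 4) * Nat.clog p.m p.M ≤ (κ + 4) * (3 * Real.logb p.m p.M) := by gcongr
  have h4 : (rounds A B ω : ℝ) ≤
      p.phases + Nat.clog p.fan p.bins + (256 * Q + 67) + (1 + Nat.clog p.m p.M) + 4 := by
    rw [rounds]
    split_ifs with hF
    · have h5 : (steps A B ω : ℝ) ≤ 256 * Q + 67 :=
        ceilDiv_groups_le hp (by omega) hon (by have := (hω.est_good hF).2; omega)
      have h6 : depth A B ω ≤ 1 + Nat.clog p.m p.M :=
        max_le (Nat.le_add_right _ _) ((Nat.clog_mono_right _ (width_le hp)).trans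
          (Nat.le_add_left _ _))
      have h6 : (depth A B ω : ℝ) ≤ 1 + Nat.clog p.m p.M := by exact_mod_cast h6
      rw [Params.estRound]
      push_cast
      linarith
    · rw [Params.estRound]
      push_cast
      have : (0 : ℝ) ≤ Nat.clog p.m p.M := Nat.cast_nonneg _
      linarith
  have h5 : 0 ≤ (κ : ℝ) * Real.logb p.m p.M := mul_nonneg hκ0 (by linarith)
  have h6 : 0 ≤ (κ : ℝ) * Q := mul_nonneg hκ0 hQ0
  nlinarith

/-! ### Memory -/

theorem bins_mul_le (hp : p.Valid) : p.bins * p.m ≤ 3 * p.mem := by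
  have h1 := Nat.div_mul_le_self (p.mem + p.m - 1) p.m
  have h2 := hp.m_lt
  have h3 := hp.nt_le_mem
  rw [Params.bins]
  omega

theorem bins_mul_H_le (hp : p.Valid) (hκ : p.SmallSketches κ) : p.bins * p.H ≤ 3 * κ * p.mem :=
  calc p.bins * p.H ≤ p.bins * (κ * p.m) := Nat.mul_le_mul_left _ hκ.H_le
    _ = κ * (p.bins * p.m) := by ring
    _ ≤ κ * (3 * p.mem) := Nat.mul_le_mul_left _ (bins_mul_le hp)
    _ = _ := by ring

theorem fan_mul_H_le (hκ : p.SmallSketches κ) : p.fan * p.H ≤ (2 * κ + 1) * p.m := by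
  have h1 := hκ.H_le
  have h2 := Nat.div_mul_le_self p.m p.H
  rw [Params.fan]
  rcases max_cases 2 (p.m / p.H) with ⟨h, -⟩ | ⟨h, -⟩ <;> rw [h] <;> nlinarith

/-- The partial sums fit into the memory, since the estimate is not too small:
`width ≤ max 1 (M / (2 e))` and `o ≤ 768 e`. -/
theorem width_mul_card_le (hω : Favourable A B ω X) (ho : nnz (A * B) ≤ p.M) :
    width A B ω * (positions A B).card ≤ 385 * p.M := by
  rw [← card_positions] at ho
  by_cases hF : (positions A B).Nonempty
  · have h1 := (hω.est_good hF).1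
    have h2 : p.mem ≤ p.M := min_le_left _ _
    have h3 := Nat.div_mul_le_self p.mem (p.nt + 2 * est A B ω)
    rw [width, Params.mulGroups]
    rcases max_cases 1 (min (p.mem / (p.nt + 2 * est A B ω)) p.g) with ⟨h, -⟩ | ⟨h, -⟩ <;> rw [h]
    · omega
    · have h4 := min_le_left (p.mem / (p.nt + 2 * est A B ω)) p.g
      set K := min (p.mem / (p.nt + 2 * est A B ω)) p.g
      have h5 := Nat.mul_le_mul_right (p.nt + 2 * est A B ω) h4
      nlinarith
  · rw [Finset.not_nonempty_iff_eq_empty.1 hF]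
    simp

/-- Each reducer has `O(m)` values. -/
theorem card_vals_le_mul (hp : p.Valid) (hAB : NoCancellation A B) (hA : nnz A ≤ p.nt)
    (hB : nnz B ≤ p.nt) (hκ : p.SmallSketches κ) (hω : Favourable A B ω ((4 + 7 * κ) * p.m)) {r : ℕ}
    (hr : r < rounds A B ω) {k : Key} (hk : k ∈ keysAt A B ω r) :
    (vals A B ω r k).card ≤ (8 + 9 * κ) * p.m := by
  have h1 := card_vals_le hp hAB hA hB hω hr hk
  have h2 := fan_mul_H_le hκ
  nlinarith

/-- All reducers of a round together have `O(M)` values. -/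
theorem sum_card_vals_le_mul (hp : p.Valid) (hAB : NoCancellation A B) (hA : nnz A ≤ p.nt)
    (hB : nnz B ≤ p.nt) (ho : nnz (A * B) ≤ p.M) (hκ : p.SmallSketches κ)
    (hω : Favourable A B ω ((4 + 7 * κ) * p.m)) {r : ℕ} (hr : r < rounds A B ω) :
    ∑ k ∈ keysAt A B ω r, (vals A B ω r k).card ≤ (780 + 10 * κ) * p.M := by
  have h1 := sum_card_vals_le (ω := ω) hp hAB hA hB hr
  have h2 := fan_mul_H_le hκ
  have h3 := bins_mul_H_le hp hκ
  have h4 := width_mul_card_le hω ho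
  have h5 : p.mem ≤ p.M := min_le_left _ _
  have h6 := hp.nt_le_mem
  have h7 := hp.m_lt
  have h8 : κ * p.m ≤ κ * (2 * p.M) := Nat.mul_le_mul_left _ (by omega)
  have h9 : κ * p.mem ≤ κ * p.M := Nat.mul_le_mul_left _ h5
  nlinarith

end

/-! ### Correctness and the constraints of the model -/

section

variable {p : Params} {S : Type u} [NonUnitalSemiring S] {A B : Matrix (Fin p.q) (Fin p.q) S}
  {ω : Choices p} {κ : ℕ}

/-- A crude bound for the number of rounds, which has to fit into a word. -/
theorem rounds_le_mul_sq (hp : p.Valid) : rounds A B ω ≤ 4 * p.n ^ 2 := by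
  have hq : p.q ≤ p.n := Nat.le_self_pow (by norm_num) _
  have hg := hp.g_le
  have h1 := hp.phases_le
  have h2 : Nat.clog p.fan p.bins ≤ p.n ^ 2 := by
    refine le_trans (Nat.clog_le_of_le_pow ?_) (hp.bins_le.trans (min_le_right _ _))
    exact (Nat.lt_pow_self Params.Valid.two_le_fan).le
  have h3 : steps A B ω ≤ p.g := Params.ceilDiv_le hp.g_pos (width_pos A B ω)
  have h4 : depth A B ω ≤ 1 + p.g := by
    refine max_le (by omega) ((Nat.clog_le_of_le_pow ?_).trans (Nat.le_add_left _ _))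
    exact (hp.mulGroups_le _).trans (Nat.lt_pow_self hp.two_le_m).le
  have h5 := hp.four_le_n
  rw [rounds, Params.estRound]
  split_ifs <;> nlinarith

/-- The range of the hash functions is polynomial, by Bertrand. -/
theorem prime_le (hp : p.Valid) : p.prime ≤ 2 * p.n ^ 3 := by
  have hn := hp.four_le_n
  obtain ⟨P, hP, h1, h2⟩ := Nat.exists_prime_lt_and_le_two_mul (p.n ^ 3) (by positivity)
  exact (Nat.find_min' _ ⟨h1.le, hP⟩).trans h2

/-- All numbers are polynomially bounded. -/
theorem boundedBy (hp : p.Valid) (hκ : p.SmallSketches κ) {E : ℕ} (hE : 16 + 2 * κ ≤ E) :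
    p.BoundedBy (E * p.n ^ 3) := by
  have hn := hp.four_le_n
  have hq : p.q ≤ p.n := Nat.le_self_pow (by norm_num) _
  have hn2 : p.n ^ 2 ≤ p.n ^ 3 := Nat.pow_le_pow_right (by omega) (by norm_num)
  have hn1 : p.n ≤ p.n ^ 3 := Nat.le_self_pow (by norm_num) _
  have hE' : (16 + 2 * κ) * p.n ^ 3 ≤ E * p.n ^ 3 := Nat.mul_le_mul_right _ hE
  have h1 := hp.nt_le
  have h2 := hp.m_lt
  have h3 : κ * p.m ≤ κ * (2 * p.n ^ 3) := Nat.mul_le_mul_left _ (by omega)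
  have h4 : p.mem ≤ p.n ^ 2 := min_le_right _ _
  have h5 := prime_le hp
  have h6 := hκ.H_le
  have h7 : p.Δ ≤ p.H := Nat.le_mul_of_pos_left _ (by norm_num [Params.t])
  have h8 : 0 ≤ κ * p.n ^ 3 := Nat.zero_le _
  constructor <;> nlinarith

/-- With favourable choices, the algorithm is correct and respects the model. All numbers in sight
are at most `Λ = E n³`, so that `Λ ^ D < n ^ C` bounds the time and all numbers that the reducers
produce; the space of a reducer is eight words for each value and a constant number of registers. A
reducer with a key that occurs has at least one value, and so the registers of all reducers together
cost no more than the values. -/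
theorem multiplies {prog : Ram.Cmd} {D : ℕ} (hprog : ComputesReducers.{u} prog D)
    (hp : p.Valid) (hAB : NoCancellation A B) (hA : nnz A ≤ p.nt) (hB : nnz B ≤ p.nt)
    (ho : nnz (A * B) ≤ p.M) (hκ : p.SmallSketches κ)
    (hω : Favourable A B ω ((4 + 7 * κ) * p.m)) {E C : ℕ} (hE : 16 + 18 * κ ≤ E)
    (hC1 : (E + 3) * D < C) (hC2 : (8 + prog.width) * (780 + 10 * κ) ≤ C)
    (hC3 : 512 + 3 * (κ + 105) ≤ C) :
    Multiplies prog C (C * (((p.nt : ℝ) + nnz (A * B)) * p.q / (p.M * √(p.m : ℝ)) +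
      Real.logb p.m p.M)) A B ω := by
  have hn := hp.four_le_n
  set Λ := E * p.n ^ 3 with hΛdef
  have hΛ : p.BoundedBy Λ := boundedBy hp hκ (by omega)
  have hn3 : p.n ^ 2 ≤ p.n ^ 3 := Nat.pow_le_pow_right (by omega) (by norm_num)
  have hn1 : p.n ≤ p.n ^ 3 := Nat.le_self_pow (by norm_num) _
  have h16 : 16 * p.n ^ 3 + 18 * κ * p.n ^ 3 ≤ Λ := by
    rw [← add_mul]
    exact Nat.mul_le_mul_right _ hE
  have hrΛ : rounds A B ω ≤ Λ := (rounds_le_mul_sq hp).trans (by omega)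
  have hest : (positions A B).Nonempty → est A B ω ≤ Λ := fun hF => by
    have h1 := (hω.est_good hF).2
    have h2 := card_positions_le (A := A) (B := B)
    omega
  have hΛpow : Λ ≤ p.n ^ (E + 3) := by
    rw [pow_add]
    exact Nat.mul_le_mul_right _ ((Nat.lt_pow_self (by omega)).le)
  have hΛD : Λ ^ D < p.n ^ C :=
    calc Λ ^ D ≤ (p.n ^ (E + 3)) ^ D := Nat.pow_le_pow_left hΛpow _
      _ = p.n ^ ((E + 3) * D) := (pow_mul _ _ _).symm
      _ < p.n ^ C := Nat.pow_lt_pow_right (by omega) hC1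
  have hcardΛ : ∀ r < rounds A B ω, ∀ k ∈ keysAt A B ω r, (vals A B ω r k).card ≤ Λ := by
    intro r hr k hk
    refine (card_vals_le_mul hp hAB hA hB hκ hω hr hk).trans ?_
    have h1 := hp.nt_le
    have h2 := hp.m_lt
    have h3 : κ * p.m ≤ κ * (2 * p.n ^ 3) := Nat.mul_le_mul_left _ (by omega)
    nlinarith
  refine ⟨rounds A B ω, ?_, state_rounds hp hAB hA hB, output_rounds hp hAB hA hB,
    ⟨fun r k => 8 * (vals A B ω r k).card + prog.width, fun r hr => ⟨fun k hk => ⟨?_, ?_⟩, ?_⟩⟩, ?_⟩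
  · refine (rounds_le hp hω hκ).trans (mul_le_mul_of_nonneg_right (by exact_mod_cast hC3) ?_)
    have := half_le_logb hp
    have : 0 ≤ ((p.nt : ℝ) + nnz (A * B)) * p.q / (p.M * √(p.m : ℝ)) := by positivity
    linarith
  · intro l hl
    change (l : Multiset (Msg S)) = vals A B ω r k at hl
    change Ram.Computes _ _ _ _ ((encoding S ω).rom r k (vals A B ω r k)) _
      ((algorithm S ω).records (encoding S ω) r k (vals A B ω r k))
    have hlen : l.length = (vals A B ω r k).card := by rw [← hl, Multiset.coe_card]
    have hrom := rom_le hp hAB hA hB hΛ hrΛ hr hk (hcardΛ r hr k hk)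
    rw [← hl] at hrom ⊢
    refine hprog S ω r k l Λ _ _ _ (by have := hΛ.five_le; omega) hrom ?_ ?_ ?_ hΛD hΛD.le
    · rw [hlen]
      exact hcardΛ r hr k hk
    · intro v hv f
      exact num_vals_le hp hAB hA hB hΛ hest hr (k := k) (by rw [← hl]; exact hv) f
    · exact le_of_eq (by rw [hlen])
  · have h1 := card_vals_le_mul hp hAB hA hB hκ hω hr hk
    have h2 := hp.two_le_m
    calc 8 * (vals A B ω r k).card + prog.width
        ≤ 8 * ((8 + 9 * κ) * p.m) + prog.width * p.m :=
          Nat.add_le_add (Nat.mul_le_mul_left _ h1) (Nat.le_mul_of_pos_right _ (by omega))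
      _ = (8 * (8 + 9 * κ) + prog.width) * p.m := by ring
      _ ≤ C * p.m := Nat.mul_le_mul_right _ (by nlinarith)
  · have h1 : ∀ k ∈ keysAt A B ω r, 8 * (vals A B ω r k).card + prog.width ≤
        (8 + prog.width) * (vals A B ω r k).card := by
      intro k hk
      have h2 : 1 ≤ (vals A B ω r k).card := Multiset.card_pos.2 (mem_keys_iff.1 hk)
      have := Nat.le_mul_of_pos_right prog.width h2
      rw [add_mul]
      omega
    refine (Finset.sum_le_sum h1).trans ?_
    rw [← Finset.mul_sum]
    calc (8 + prog.width) * ∑ k ∈ keysAt A B ω r, (vals A B ω r k).card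
        ≤ (8 + prog.width) * ((780 + 10 * κ) * p.M) :=
          Nat.mul_le_mul_left _ (sum_card_vals_le_mul hp hAB hA hB ho hκ hω hr)
      _ = ((8 + prog.width) * (780 + 10 * κ)) * p.M := (mul_assoc _ _ _).symm
      _ ≤ C * p.M := Nat.mul_le_mul_right _ hC2
  · change Multiset.sum (Multiset.map _ ((algorithm S ω).output (inputs A B) (rounds A B ω))) ≤ _
    rw [output_rounds hp hAB hA hB, outputItems, Multiset.map_map]
    have h1 : (Multiset.map ((fun y => ((encoding S ω).out y).length) ∘
        fun u : Fin p.q × Fin p.q => ((u.1 : ℕ), (u.2 : ℕ), (A * B) u.1 u.2))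
        (support (A * B)).val).sum = nnz (A * B) * 3 := by
      change Multiset.sum (Multiset.map (fun _ => 3) _) = _
      rw [Multiset.map_const', Multiset.sum_replicate, smul_eq_mul]
      rfl
    rw [h1, mul_comm]
    exact Nat.mul_le_mul (by omega) ho

end

end R1

theorem mainTheorem5 :
    ∃ prog : Ram.Cmd, ∀ c : ℝ, 0 < c → ∃ C : ℕ, ∀ q m M nt : ℕ,
      2 ≤ m → c * (Real.log ((q : ℝ) ^ 2)) ^ 2 ≤ m → m < 2 * nt → nt ≤ q ^ 2 → nt ≤ M →
      ∀ (S : Type*) [NonUnitalSemiring S] (A B : Matrix (Fin q) (Fin q) S),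
        R1.nnz A ≤ nt → R1.nnz B ≤ nt → R1.nnz (A * B) ≤ M → R1.NoCancellation A B →
        ENNReal.ofReal (1 - 1 / (q : ℝ) ^ 2) ≤
          ProbabilityTheory.uniformOn (Set.univ : Set (R1.Choices ⟨q, m, M, nt⟩))
            {ω | R1.Multiplies prog C
              (C * (((nt : ℝ) + R1.nnz (A * B)) * q / (M * √(m : ℝ)) + Real.logb m M)) A B ω} := by
  obtain ⟨prog, D, hprog⟩ := R1.exists_program
  refine ⟨prog, fun c hc => ?_⟩
  obtain ⟨κ, hκ⟩ := R1.exists_smallSketches hc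
  refine ⟨(16 + 18 * κ + 3) * D + (8 + prog.width) * (780 + 10 * κ) + (512 + 3 * (κ + 105)) + 1,
    fun q m M nt hm hcm hmnt hnt hntM S _ A B hA hB ho hAB => ?_⟩
  set p : R1.Params := ⟨q, m, M, nt⟩
  have hp : p.Valid := ⟨hm, hmnt, hnt, hntM⟩
  have hn : (p.n : ℝ) = (q : ℝ) ^ 2 := by
    change ((q ^ 2 : ℕ) : ℝ) = _
    push_cast
    rfl
  have hκ := hκ p hp (by rw [hn]; exact hcm)
  have : Nonempty (Fin p.prime) := ⟨⟨0, p.prime_spec.2.pos⟩⟩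
  have : Nonempty (Fin p.bins) := ⟨⟨0, hp.bins_pos⟩⟩
  rw [R1.uniformOn_univ_eq_pr, ← hn]
  refine ENNReal.ofReal_le_ofReal ((R1.le_pr_favourable hp hA hB hκ).trans
      (R1.pr_mono fun ω hω => ?_))
  exact R1.multiplies (p := p) hprog hp hAB hA hB ho hκ hω le_rfl (by omega) (by omega) (by omega)
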